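/- Let $(X,\omega)$ be a compact symplectic manifold of dimension $2n$, let $G$ be a compact Lie group whose Lie algebra $\mathfrak g$ is semisimple, with a fixed $\operatorname{Ad}$-invariant positive definite inner product, and let $E\to X$ be a smooth principal $G$-bundle. Let $\mathcal J$ be the space of almost complex structures on $X$ compatible with $\omega$, put $g_J=\omega(\cdot,J\cdot)$ for $J\in\mathcal J$, and let $\mathcal J^i\subset\mathcal J$ be the subset of integrable ones. Let $\mathcal A$ be the space of connections on $E$; for $A\in\mathcal A$ let $F_A$ be its curvature. Let $\Lambda_\omega$ be the adjoint of $\alpha\mapsto\alpha\wedge\omega$, and let $(F_A\wedge F_A)$ be the real 4-form obtained from the inner product on $\mathfrak g$. Pointwise norms of 2-forms are normalized so that $|e^1\wedge e^2|=1$ for orthonormal $e^1,e^2$. For $J\in\mathcal J$ let $S_J$ be the Hermitian scalar curvature, $S_J\,\omega^n=n\,\rho_J\wedge\omega^{n-1}$, where $\rho_J$ is $-i$ times the curvature of the canonical line bundle with respect to the canonical Hermitian connection of $(\omega,J)$. Given real numbers $\alpha_0,\alpha_1>0$ and a scalar curvature function $S$, consider for $J\in\mathcal J$, $A\in\mathcal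 A$ the functional $$CYM(g_J,A)=\int_X(\alpha_0S-2\alpha_1|F_A|^2)^2\,\mathrm{vol}_{g_J}+2\alpha_1\|F_A\|^2,\qquad \|F_A\|^2=\int_X|F_A|^2\,\mathrm{vol}_{g_J},$$ and the coupled equations $$\Lambda_\omega F_A=z,\qquad \alpha_0S+\alpha_1\Lambda_\omega^2(F_A\wedge F_A)=c,$$ with $z$ in the centre of $\mathfrak g$ and $c\in\mathbb R$ constant. Suppose that $2c<1$. (1) Take $S=S_J$. If $(J,A)\in\mathcal J\times\mathcal A$ satisfies the coupled equations and $F_A^{0,2}=0$, then $CYM(g_J,A)\le CYM(g_{J'},A')$ for all $(J',A')\in\mathcal J\times\mathcal A$. (2) Take $S=S_{g_J}$, the Riemannian scalar curvature of $g_J$. If $J\in\mathcal J^i$, $A\in\mathcal A$, and $(J,A)$ satisfies the coupled equations and $F_A^{0,2}=0$, then $CYM(g_J,A)\le CYM(g_{J'},A')$ for all $(J',A')\in\mathcal J^i\times\mathcal A$. -/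

import Mathlib

open scoped Manifold ContDiff Topology Matrix TensorProduct
open Set

noncomputable section

namespace CoupledYM

/-! ### Multilinear algebra -/

/-- Wedge product of alternating maps with values in `M` and `N`, the coefficients being multiplied
by a bilinear map `B`. It is the sum over shuffles, without numerical factor; for 1-forms,
`(a ∧ b)(u, v) = B (a u) (b v) - B (a v) (b u)`. -/
def wedge {V M N K : Type*} [AddCommGroup V] [Module ℝ V] [AddCommGroup M] [Module ℝ M]
    [AddCommGroup N] [Module ℝ N] [AddCommGroup K] [Module ℝ K] {k l : ℕ}
    (B : M →ₗ[ℝ] N →ₗ[ℝ] K) (a : V [⋀^Fin k]→ₗ[ℝ] M) (b : V [⋀^Fin l]→ₗ[ℝ] N) :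
    V [⋀^Fin (k + l)]→ₗ[ℝ] K :=
  ((TensorProduct.lift B).compAlternatingMap (a.domCoprod b)).domDomCongr finSumFinEquiv

/-! ### Differential forms on manifolds without boundary -/

section Forms

variable {V : Type*} [NormedAddCommGroup V] [NormedSpace ℝ V]
  {M : Type*} [TopologicalSpace M] [ChartedSpace V M]
  {W : Type*} [NormedAddCommGroup W] [NormedSpace ℝ W] {k : ℕ}

variable (V M) in
/-- Differential `k`-forms on `M` with values in `W`; smoothness is `DForm.IsSmooth`. -/
abbrev DForm (k : ℕ) (W : Type*) [NormedAddCommGroup W] [NormedSpace ℝ W] :=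
  ∀ x : M, TangentSpace 𝓘(ℝ, V) x [⋀^Fin k]→L[ℝ] W

/-- The local expression of a form in the chart at `x₀`, i.e. its pullback under the inverse
chart. -/
def DForm.inChart (η : DForm V M k W) (x₀ : M) (y : V) : V [⋀^Fin k]→L[ℝ] W :=
  (η ((chartAt V x₀).symm y)).compContinuousLinearMap
    (mfderiv 𝓘(ℝ, V) 𝓘(ℝ, V) (chartAt V x₀).symm y)

def DForm.IsSmooth (η : DForm V M k W) : Prop :=
  ∀ x₀ : M, ContDiffOn ℝ ∞ (DForm.inChart η x₀) (chartAt V x₀).target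

/-- Exterior derivative, computed at `x` in the chart at `x`. For 1-forms the normalization is
`dη(X, Y) = X η(Y) - Y η(X) - η([X, Y])`. -/
def DForm.d (η : DForm V M k W) : DForm V M (k + 1) W := fun x =>
  (extDeriv (DForm.inChart η x) (chartAt V x x)).compContinuousLinearMap
    (mfderiv 𝓘(ℝ, V) 𝓘(ℝ, V) (chartAt V x) x)

variable (V M) in
/-- Fields of endomorphisms of the tangent bundle. -/
abbrev EndField := ∀ x : M, TangentSpace 𝓘(ℝ, V) x →L[ℝ] TangentSpace 𝓘(ℝ, V) x

/-- The local expression of an endomorphism field in the chart at `x₀`. -/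
def EndField.inChart (J : EndField V M) (x₀ : M) (y : V) : V →L[ℝ] V :=
  (mfderiv 𝓘(ℝ, V) 𝓘(ℝ, V) (chartAt V x₀) ((chartAt V x₀).symm y)).comp
    ((J ((chartAt V x₀).symm y)).comp (mfderiv 𝓘(ℝ, V) 𝓘(ℝ, V) (chartAt V x₀).symm y))

def EndField.IsSmooth (J : EndField V M) : Prop :=
  ∀ x₀ : M, ContDiffOn ℝ ∞ (EndField.inChart J x₀) (chartAt V x₀).target

end Forms

/-! ### Symplectic manifolds of dimension `2n`, compatible almost complex structures -/

/-- The model space of manifolds of dimension `2n`. -/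
abbrev R2 (n : ℕ) := EuclideanSpace ℝ (Fin (2 * n))

/-- The standard basis vectors of `ℝ²ⁿ`. -/
def stdVec {n : ℕ} (a : Fin (2 * n)) : R2 n := EuclideanSpace.single a 1

structure SymplecticForm (n : ℕ) (X : Type*) [TopologicalSpace X] [ChartedSpace (R2 n) X] where
  form : DForm (R2 n) X 2 ℝ
  smooth : DForm.IsSmooth form
  closed : ∀ x, DForm.d form x = 0
  nondegenerate : ∀ x u, (∀ v, form x ![u, v] = 0) → u = 0

section Base

variable {n : ℕ} {X : Type*} [TopologicalSpace X] [ChartedSpace (R2 n) X]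

/-- Almost complex structures compatible with the symplectic form `Ω`. -/
structure CompatibleACS (Ω : SymplecticForm n X) where
  J : EndField (R2 n) X
  smooth : EndField.IsSmooth J
  sq : ∀ x u, J x (J x u) = -u
  compat : ∀ x u v, Ω.form x ![J x u, J x v] = Ω.form x ![u, v]
  pos : ∀ x u, u ≠ 0 → 0 < Ω.form x ![u, J x u]

variable (n X) in
/-- Fields of bilinear forms on the tangent spaces, such as Riemannian metrics. -/
abbrev TwoTensor := ∀ x : X, TangentSpace 𝓘(ℝ, R2 n) x → TangentSpace 𝓘(ℝ, R2 n) x → ℝ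

/-- The Riemannian metric `g_J = Ω(·, J·)`. -/
def CompatibleACS.metric {Ω : SymplecticForm n X} (j : CompatibleACS Ω) : TwoTensor n X :=
  fun x u v => Ω.form x ![u, j.J x v]

/-! ### Local coordinate expressions -/

/-- The matrix `g(∂_a, ∂_b)` in the chart at `x₀`, at the point with coordinates `y`. -/
def metricMatrix (g : TwoTensor n X) (x₀ : X) (y : R2 n) :
    Matrix (Fin (2 * n)) (Fin (2 * n)) ℝ :=
  Matrix.of fun a b =>
    g ((chartAt (R2 n) x₀).symm y)
      (mfderiv 𝓘(ℝ, R2 n) 𝓘(ℝ, R2 n) (chartAt (R2 n) x₀).symm y (stdVec a))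
      (mfderiv 𝓘(ℝ, R2 n) 𝓘(ℝ, R2 n) (chartAt (R2 n) x₀).symm y (stdVec b))

/-- The matrix of an endomorphism field in the chart at `x₀`: `J ∂_b = ∑ a, J a b ∂_a`. -/
def endMatrix (J : EndField (R2 n) X) (x₀ : X) (y : R2 n) :
    Matrix (Fin (2 * n)) (Fin (2 * n)) ℝ :=
  Matrix.of fun a b => EndField.inChart J x₀ y (stdVec b) a

/-- Entrywise partial derivative `∂f/∂y_i` of a matrix valued function. -/
def pderivMatrix (i : Fin (2 * n)) (f : R2 n → Matrix (Fin (2 * n)) (Fin (2 * n)) ℝ) (y : R2 n) :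
    Matrix (Fin (2 * n)) (Fin (2 * n)) ℝ :=
  Matrix.of fun a b => fderiv ℝ (fun z => f z a b) y (stdVec i)

/-- The connection matrices of the Levi-Civita connection in the chart at `x₀`: the entry `k j` of
the `i`-th matrix is the Christoffel symbol `Γ^k_{ij}`. -/
def leviCivita (g : TwoTensor n X) (x₀ : X) (y : R2 n) (i : Fin (2 * n)) :
    Matrix (Fin (2 * n)) (Fin (2 * n)) ℝ :=
  Matrix.of fun k j => (1 / 2) * ∑ l, (metricMatrix g x₀ y)⁻¹ k l *
    (pderivMatrix i (metricMatrix g x₀) y j l + pderivMatrix j (metricMatrix g x₀) y i l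
      - pderivMatrix l (metricMatrix g x₀) y i j)

/-- The curvature `R(∂_i, ∂_j) = ∂_i C_j - ∂_j C_i + [C_i, C_j]` of the linear connection with
connection matrices `C`. -/
def linearCurvature (C : R2 n → Fin (2 * n) → Matrix (Fin (2 * n)) (Fin (2 * n)) ℝ)
    (y : R2 n) (i j : Fin (2 * n)) : Matrix (Fin (2 * n)) (Fin (2 * n)) ℝ :=
  pderivMatrix i (fun z => C z j) y - pderivMatrix j (fun z => C z i) y
    + (C y i * C y j - C y j * C y i)

/-- The Riemannian scalar curvature, i.e. the `g`-trace of the Ricci tensor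
`Ric(Y, Z) = tr (X ↦ R(X, Y) Z)`. -/
def riemScalar (g : TwoTensor n X) (x : X) : ℝ :=
  ∑ j, ∑ k, (metricMatrix g x (chartAt (R2 n) x x))⁻¹ j k *
    ∑ i, linearCurvature (leviCivita g x) (chartAt (R2 n) x x) i j i k

variable {Ω : SymplecticForm n X}

/-- The connection matrices of the canonical Hermitian connection `∇ - ½ J ∇J`, where `∇` is the
Levi-Civita connection of `g_J`. This is the unique connection with `∇g = 0`, `∇J = 0` whose
torsion has no `(1,1)` part; equivalently, the unitary connection that it induces on the bundle of
`(1,0)`-forms has the operator `∂̄_J : Ω^{1,0} → Ω^{1,1}` as its `(0,1)` part. -/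
def hermitianConnection (j : CompatibleACS Ω) (x₀ : X) (y : R2 n) (i : Fin (2 * n)) :
    Matrix (Fin (2 * n)) (Fin (2 * n)) ℝ :=
  leviCivita j.metric x₀ y i - (1 / 2 : ℝ) • (endMatrix j.J x₀ y *
    (pderivMatrix i (endMatrix j.J x₀) y
      + leviCivita j.metric x₀ y i * endMatrix j.J x₀ y
      - endMatrix j.J x₀ y * leviCivita j.metric x₀ y i))

/-- The components at `x` of the real 2-form `ρ_J`, which is `-i` times the curvature of the
canonical line bundle `K_X = Λⁿ(T*X)^{1,0}`, i.e. `i` times the complex trace of the curvature `R`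
of the canonical Hermitian connection on `(TX, J)`. As `R` is skew-symmetric and commutes with `J`,
its complex trace is `-(i/2) tr (J R)`. -/
def ricciForm (j : CompatibleACS Ω) (x : X) (a b : Fin (2 * n)) : ℝ :=
  (1 / 2) * (endMatrix j.J x (chartAt (R2 n) x x) *
    linearCurvature (hermitianConnection j x) (chartAt (R2 n) x x) a b).trace

/-- The Hermitian scalar curvature `S_J = Λ_ω ρ_J`, i.e. `S_J ωⁿ = n ρ_J ∧ ωⁿ⁻¹`. -/
def hermScalar (j : CompatibleACS Ω) (x : X) : ℝ :=
  (1 / 2) * ∑ a, ∑ b, ∑ c, (metricMatrix j.metric x (chartAt (R2 n) x x))⁻¹ a b *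
    endMatrix j.J x (chartAt (R2 n) x x) c b * ricciForm j x a c

/-- Integrability of an almost complex structure: the Nijenhuis tensor
`[J∂_i, J∂_j] - J[J∂_i, ∂_j] - J[∂_i, J∂_j] - [∂_i, ∂_j]` vanishes. -/
def CompatibleACS.Integrable (j : CompatibleACS Ω) : Prop :=
  ∀ (x : X) (a b c : Fin (2 * n)),
    let y := chartAt (R2 n) x x
    let J := endMatrix j.J x
    ∑ l, (J y l a * pderivMatrix l J y c b - J y l b * pderivMatrix l J y c a
      - J y c l * (pderivMatrix a J y l b - pderivMatrix b J y l a)) = 0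

/-! ### Integration -/

variable (n X) in
/-- A smooth partition of unity, indexed by `X`, whose `i`-th function is supported in the domain
of the chart at `i`. -/
def chartPartition [T2Space X] [SigmaCompactSpace X] [IsManifold 𝓘(ℝ, R2 n) ∞ X] :
    SmoothPartitionOfUnity X 𝓘(ℝ, R2 n) X univ :=
  Classical.choose
    (SmoothPartitionOfUnity.exists_isSubordinate_chartAt_source 𝓘(ℝ, R2 n) X)

/-- The integral `∫_X f vol_g`, where `vol_g` is the Riemannian volume `√(det g_ab) dy` of `g`. -/
def volIntegral [T2Space X] [SigmaCompactSpace X] [IsManifold 𝓘(ℝ, R2 n) ∞ X]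
    (g : TwoTensor n X) (f : X → ℝ) : ℝ :=
  ∑ᶠ i : X, ∫ y in (chartAt (R2 n) i).target,
    chartPartition n X i ((chartAt (R2 n) i).symm y) * f ((chartAt (R2 n) i).symm y) *
      √(metricMatrix g i y).det

/-! ### Pointwise operations determined by a metric and an almost complex structure -/

/-- The standard basis of `T_xX = ℝ²ⁿ` (the coordinate basis of the chart at `x`). -/
def frame (x : X) (a : Fin (2 * n)) : TangentSpace 𝓘(ℝ, R2 n) x := stdVec a

/-- The inverse `g^{ab}` of the matrix of `g` in the basis `frame x`. -/
def invGram (g : TwoTensor n X) (x : X) : Matrix (Fin (2 * n)) (Fin (2 * n)) ℝ :=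
  (Matrix.of fun a b => g x (frame x a) (frame x b))⁻¹

/-- The adjoint `Λ` of the Lefschetz operator `α ↦ α ∧ ω`. For a `g_J`-orthonormal basis `(e_i)`,
`Λ α = ½ ∑ i, α(e_i, J e_i, ·, …, ·)`; in particular `Λ ω = n`. -/
def lefschetzAdjoint (j : CompatibleACS Ω) (x : X) {k : ℕ} {M : Type*} [AddCommGroup M]
    [Module ℝ M] (α : TangentSpace 𝓘(ℝ, R2 n) x [⋀^Fin (k + 2)]→ₗ[ℝ] M) :
    TangentSpace 𝓘(ℝ, R2 n) x [⋀^Fin k]→ₗ[ℝ] M :=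
  (1 / 2 : ℝ) • ∑ a, ∑ b, invGram j.metric x a b •
    (α.curryLeft (frame x a)).curryLeft (j.J x (frame x b))

/-- The squared pointwise norm of a 2-form with coefficients in a space with inner product `B`,
normalized such that `|e¹ ∧ e²| = 1` for orthonormal `e¹, e²`. -/
def normSqTwoForm (g : TwoTensor n X) (x : X) {M : Type*} [AddCommGroup M] [Module ℝ M]
    (B : M →ₗ[ℝ] M →ₗ[ℝ] ℝ) (α : TangentSpace 𝓘(ℝ, R2 n) x [⋀^Fin 2]→ₗ[ℝ] M) : ℝ :=
  (1 / 2) * ∑ a, ∑ b, ∑ c, ∑ d, invGram g x a b * invGram g x c d *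
    B (α ![frame x a, frame x c]) (α ![frame x b, frame x d])

/-- The `(0,2)` part of a 2-form with coefficients in a real vector space `M`, as a function of
real tangent vectors with values in `M ⊗ ℂ`. It is the value of the complex bilinear extension of
`α` on the `(0,1)` components `½ (u + i J u)` and `½ (v + i J v)`. -/
def part02 (j : CompatibleACS Ω) (x : X) {M : Type*} [AddCommGroup M] [Module ℝ M]
    (α : TangentSpace 𝓘(ℝ, R2 n) x [⋀^Fin 2]→ₗ[ℝ] M) (u v : TangentSpace 𝓘(ℝ, R2 n) x) :
    ℂ ⊗[ℝ] M :=
  (1 / 4 : ℂ) ⊗ₜ[ℝ] (α ![u, v] - α ![j.J x u, j.J x v])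
    + (Complex.I / 4) ⊗ₜ[ℝ] (α ![j.J x u, v] + α ![u, j.J x v])

end Base

/-! ### Lie groups, principal bundles, connections -/

section Bundle

variable {EG : Type*} [NormedAddCommGroup EG] [NormedSpace ℝ EG]
  {G : Type*} [TopologicalSpace G] [ChartedSpace EG G] [Group G]

instance lieGroup_minSmoothness [LieGroup 𝓘(ℝ, EG) ∞ G] :
    LieGroup 𝓘(ℝ, EG) (minSmoothness ℝ 3) G := by
  rw [minSmoothness_of_isRCLikeNormedField]
  exact LieGroup.of_le (m := 3) (n := ∞) ENat.LEInfty.out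

/-- The Lie bracket of the Lie algebra `𝔤 = T_1 G`, which is `EG` as a vector space. -/
def bracketMap (EG : Type*) [NormedAddCommGroup EG] [NormedSpace ℝ EG] [CompleteSpace EG]
    (G : Type*) [TopologicalSpace G] [ChartedSpace EG G] [Group G] [LieGroup 𝓘(ℝ, EG) ∞ G] :
    EG →ₗ[ℝ] EG →ₗ[ℝ] EG :=
  LinearMap.mk₂ ℝ
    (fun u v => Bracket.bracket (L := GroupLieAlgebra 𝓘(ℝ, EG) G)
      (M := GroupLieAlgebra 𝓘(ℝ, EG) G) u v)
    (fun u u' v => add_lie (L := GroupLieAlgebra 𝓘(ℝ, EG) G)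
      (M := GroupLieAlgebra 𝓘(ℝ, EG) G) u u' v)
    (fun c u v => smul_lie (R := ℝ) (L := GroupLieAlgebra 𝓘(ℝ, EG) G)
      (M := GroupLieAlgebra 𝓘(ℝ, EG) G) c u v)
    (fun u v v' => lie_add (L := GroupLieAlgebra 𝓘(ℝ, EG) G)
      (M := GroupLieAlgebra 𝓘(ℝ, EG) G) u v v')
    (fun c u v => lie_smul (R := ℝ) (L := GroupLieAlgebra 𝓘(ℝ, EG) G)
      (M := GroupLieAlgebra 𝓘(ℝ, EG) G) c u v)

/-- The adjoint representation: `Ad a` is the derivative at `1` of `h ↦ a h a⁻¹`. -/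
def Ad (a : G) : EG → EG := fun ξ =>
  mfderiv 𝓘(ℝ, EG) 𝓘(ℝ, EG) (fun h : G => a * h * a⁻¹) 1 ξ

variable (EG G) in
/-- Positive definite inner products on `𝔤` that are invariant under the adjoint representation. -/
structure InvariantInner where
  form : EG →ₗ[ℝ] EG →ₗ[ℝ] ℝ
  symm : ∀ ξ η, form ξ η = form η ξ
  pos : ∀ ξ, ξ ≠ 0 → 0 < form ξ ξ
  invariant : ∀ (a : G) (ξ η : EG), form (Ad a ξ) (Ad a η) = form ξ η

variable {n : ℕ} {X : Type*} [TopologicalSpace X] [ChartedSpace (R2 n) X]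
  {EP : Type*} [NormedAddCommGroup EP] [NormedSpace ℝ EP]
  {P : Type*} [TopologicalSpace P] [ChartedSpace EP P]

variable (n X EG G EP P) in
/-- Smooth principal `G`-bundles over `X` with total space `P`: a projection `P → X`, a smooth right
action of `G` on `P`, and `G`-equivariant smooth local trivializations. -/
structure PrincipalBundle where
  proj : P → X
  act : P → G → P
  act_one : ∀ p, act p 1 = p
  act_mul : ∀ p a b, act p (a * b) = act (act p a) b
  smooth_act : ContMDiff (𝓘(ℝ, EP).prod 𝓘(ℝ, EG)) 𝓘(ℝ, EP) ∞ (fun q : P × G => act q.1 q.2)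
  locallyTrivial : ∀ x : X, ∃ e : Bundle.Trivialization G proj, x ∈ e.baseSet ∧
    (∀ p ∈ e.source, ∀ a : G, act p a ∈ e.source ∧ e (act p a) = ((e p).1, (e p).2 * a)) ∧
    ContMDiffOn 𝓘(ℝ, EP) (𝓘(ℝ, R2 n).prod 𝓘(ℝ, EG)) ∞ e e.source ∧
    ContMDiffOn (𝓘(ℝ, R2 n).prod 𝓘(ℝ, EG)) 𝓘(ℝ, EP) ∞ e.toOpenPartialHomeomorph.symm e.target

theorem PrincipalBundle.proj_surjective (E : PrincipalBundle EG G n X EP P) :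
    Function.Surjective E.proj := by
  intro x
  obtain ⟨e, hx, -⟩ := E.locallyTrivial x
  exact ⟨e.toOpenPartialHomeomorph.symm (x, 1), e.proj_symm_apply' hx⟩

/-- Principal connections on `E`, given by their connection 1-forms: a connection form reproduces
the generators of the fundamental vector fields, and is equivariant. The kernel of the form is the
horizontal space, and `form` composed with `𝔤 ≅ V_pE` is the `G`-equivariant projection
`TE → VE`. -/
structure Connection (E : PrincipalBundle EG G n X EP P) where
  form : DForm EP P 1 EG
  smooth : DForm.IsSmooth form
  vertical : ∀ (p : P) (ξ : EG),
    form p ![(mfderiv 𝓘(ℝ, EG) 𝓘(ℝ, EP) (fun a : G => E.act p a) 1 ξ : EP)] = ξ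
  equivariant : ∀ (p : P) (a : G) (v : TangentSpace 𝓘(ℝ, EP) p),
    form (E.act p a) ![mfderiv 𝓘(ℝ, EP) 𝓘(ℝ, EP) (fun q : P => E.act q a) p v]
      = Ad a⁻¹ (form p ![v])

variable {E : PrincipalBundle EG G n X EP P}

/-- The curvature 2-form `dθ + ½ [θ ∧ θ]` on the total space, i.e.
`F(u, v) = dθ(u, v) + [θ u, θ v]`. -/
def Connection.curvatureTotal [CompleteSpace EG] [LieGroup 𝓘(ℝ, EG) ∞ G] (A : Connection E)
    (p : P) : TangentSpace 𝓘(ℝ, EP) p [⋀^Fin 2]→ₗ[ℝ] EG :=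
  (DForm.d A.form p).toAlternatingMap + (1 / 2 : ℝ) •
    wedge (bracketMap EG G) (A.form p).toAlternatingMap (A.form p).toAlternatingMap

/-- The horizontal lift `T_{π p}X → T_pP`: `u` is sent to the unique vector `w` with `dπ w = u` and
`θ w = 0`. -/
def Connection.horizontalLift (A : Connection E) (p : P) :
    TangentSpace 𝓘(ℝ, R2 n) (E.proj p) →L[ℝ] TangentSpace 𝓘(ℝ, EP) p :=
  (ContinuousLinearMap.inverse
    ((mfderiv 𝓘(ℝ, EP) 𝓘(ℝ, R2 n) E.proj p).prod
      ((ContinuousAlternatingMap.ofSubsingleton ℝ (TangentSpace 𝓘(ℝ, EP) p) EG (0 : Fin 1)).symm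
        (A.form p)))).comp
    (ContinuousLinearMap.inl ℝ (TangentSpace 𝓘(ℝ, R2 n) (E.proj p)) EG)

/-- The curvature `F_A ∈ Ω²(ad E)` at `π p`, where the fibre of `ad E = E ×_G 𝔤` at `π p` is
identified with `𝔤` by means of `p`. -/
def Connection.curvature [CompleteSpace EG] [LieGroup 𝓘(ℝ, EG) ∞ G] (A : Connection E)
    (p : P) : TangentSpace 𝓘(ℝ, R2 n) (E.proj p) [⋀^Fin 2]→ₗ[ℝ] EG :=
  (A.curvatureTotal p).compLinearMap (A.horizontalLift p).toLinearMap

variable [CompleteSpace EG] [LieGroup 𝓘(ℝ, EG) ∞ G] {Ω : SymplecticForm n X}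

/-- The function `|F_A|²` on `X`. By invariance of `B` it does not matter which point of the fibre
is used. -/
def curvNormSq (B : InvariantInner EG G) (g : TwoTensor n X) (A : Connection E) (x : X) : ℝ :=
  normSqTwoForm g (E.proj (Function.surjInv E.proj_surjective x)) B.form
    (A.curvature (Function.surjInv E.proj_surjective x))

/-- `Λ_ω F_A` at `π p`, as an element of `𝔤`. -/
def lambdaF (j : CompatibleACS Ω) (A : Connection E) (p : P) : EG :=
  lefschetzAdjoint (k := 0) j (E.proj p) (A.curvature p) ![]

/-- `Λ_ω² (F_A ∧ F_A)` at `π p`. -/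
def lambdaSqFF (B : InvariantInner EG G) (j : CompatibleACS Ω) (A : Connection E) (p : P) : ℝ :=
  lefschetzAdjoint (k := 0) j (E.proj p) (lefschetzAdjoint (k := 2) j (E.proj p)
    (wedge B.form (A.curvature p) (A.curvature p))) ![]

/-- `F_A^{0,2} = 0`. -/
def CurvatureType11 (j : CompatibleACS Ω) (A : Connection E) : Prop :=
  ∀ p u v, part02 j (E.proj p) (A.curvature p) u v = 0

/-- The coupled equations `Λ_ω F_A = z`, `α₀ S + α₁ Λ_ω² (F_A ∧ F_A) = c`, where `S` is the scalar
curvature function. -/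
def CoupledEquations (B : InvariantInner EG G) (α₀ α₁ : ℝ) (z : EG) (c : ℝ)
    (j : CompatibleACS Ω) (S : X → ℝ) (A : Connection E) : Prop :=
  (∀ p, lambdaF j A p = z) ∧ ∀ p, α₀ * S (E.proj p) + α₁ * lambdaSqFF B j A p = c

/-- The functional `CYM(g, A) = ∫ (α₀ S - 2 α₁ |F_A|²)² vol_g + 2 α₁ ‖F_A‖²`, where `S` is the scalar
curvature function of `g` and `‖F_A‖² = ∫ |F_A|² vol_g`. -/
def CYM [T2Space X] [SigmaCompactSpace X] [IsManifold 𝓘(ℝ, R2 n) ∞ X]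
    (B : InvariantInner EG G) (α₀ α₁ : ℝ) (g : TwoTensor n X) (S : X → ℝ)
    (A : Connection E) : ℝ :=
  volIntegral g (fun x => (α₀ * S x - 2 * α₁ * curvNormSq B g A x) ^ 2)
    + 2 * α₁ * volIntegral g (curvNormSq B g A)

end Bundle

end CoupledYM

end

/-! The proof completes a square with the constant c of the coupled equations. For every pair (J,
A), expanding (α₀S − 2α₁|F|² − c)² gives CYM = ∫ [(α₀S − 2α₁|F|² − c)² + α₁(1 − 2c)(2|F|² +
Λ²(F∧F))] + K, K = 2cα₀∫S − c²∫1 − α₁(1 − 2c)∫Λ²(F∧F), which is `CYM_eq`. The coefficient α₁(1 − 2c)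
is positive. So the theorem follows if K is the same for all pairs, the density 2|F|² + Λ²(F∧F) is
nonnegative, and the whole integrand vanishes for a solution.

The density equals 2|ΛF|² + |F − F(J·,J·)|² pointwise. This is linear algebra in a symplectic vector
space (`IsCompatiblePair.pairing_sub_twist`, `lefschetzAdjoint_wedge`), and it gives
`neg_topDensity_le`. For a solution, semisimplicity forces z = 0, so ΛF = 0. As F also has no (0,2)
part, the density vanishes, and the second coupled equation then says that the square vanishes too.
Hence a solution attains the value K (`CYM_le`).

The constant K does not depend on the pair, for the following reasons. The volume density √det g_J
equals √|det ω|, since |det J| = 1. The operator Λ depends on ω only, because J g_J⁻¹ = ω⁻¹. The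
integrals of Λ²(F∧F) and of S_J are invariants of the bundle and of ω. In both cases the difference
of two integrands is a divergence ω^{ab}∂_aη_b of a global 1-form η, and such a divergence
integrates to zero (`CovectorField.IsDiv.integral_eq_zero`). That divergence theorem rests on
∂_a(√|det ω| ω^{ab}) = 0, a consequence of dω = 0.

For Λ²(F∧F), the form η is the ω-contraction of the relative Chern-Simons 3-form of the two
connections (`Connection.isDiv_csField`). Its construction needs the connection form in local
sections and the infinitesimal Ad-invariance of the inner product. The latter comes from identifying
the derivative of Ad with the Lie bracket (`fderiv_adInv`).

For S_J, twice the Ricci form is dτ − ½ tr(J dJ dJ) in each chart, with τ = tr(JΓ) formed from the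
Christoffel symbols Γ. For two structures J and J', the endomorphism h = J + J' is invertible and
satisfies hJ = J'h. The curl of tr(J h⁻¹dh) is the difference of the two quadratic terms
(`pd_gaugeTrace_sub`). Hence τ − τ' − tr(J h⁻¹dh) is a global 1-form η
(`CompatibleACS.isDiv_ricciField`).

On Kähler metrics the canonical Hermitian connection is the Levi-Civita connection, and the Bianchi
identity gives S_g = 2S_J (`CompatibleACS.Integrable.riemScalar_eq`). So the second statement
follows from the same inequality. -/

noncomputable section

namespace CoupledYM

/-! ### Pullback of differential forms from manifolds to normed spaces -/

section Pullback

variable {V : Type*} [NormedAddCommGroup V] [NormedSpace ℝ V]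
  {M : Type*} [TopologicalSpace M] [ChartedSpace V M]
  {W : Type*} [NormedAddCommGroup W] [NormedSpace ℝ W] {k : ℕ}
  {U : Type*} [NormedAddCommGroup U] [NormedSpace ℝ U]

/-- The pullback of a differential form under a map from a normed space. -/
def DForm.pullback (η : DForm V M k W) (f : U → M) (y : U) : U [⋀^Fin k]→L[ℝ] W :=
  (η (f y)).compContinuousLinearMap (mfderiv 𝓘(ℝ, U) 𝓘(ℝ, V) f y)

theorem contMDiffOn_chart_comp [IsManifold 𝓘(ℝ, V) ∞ M] {f : U → M} {s : Set U}
    (hf : ContMDiffOn 𝓘(ℝ, U) 𝓘(ℝ, V) ∞ f s) (x₀ : M) :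
    ContDiffOn ℝ ∞ (fun y => chartAt V x₀ (f y)) (s ∩ f ⁻¹' (chartAt V x₀).source) := by
  rw [← contMDiffOn_iff_contDiffOn]
  exact (contMDiffOn_chart (I := 𝓘(ℝ, V)) (n := ∞)).comp (hf.mono inter_subset_left)
    (fun y hy => hy.2)

theorem mdifferentiableAt_chart [IsManifold 𝓘(ℝ, V) ∞ M] (x₀ : M) {x : M}
    (hx : x ∈ (chartAt V x₀).source) :
    MDifferentiableAt 𝓘(ℝ, V) 𝓘(ℝ, V) (chartAt V x₀) x :=
  mdifferentiableAt_atlas (I := 𝓘(ℝ, V)) (chart_mem_atlas V x₀) hx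

theorem mdifferentiableAt_chart_symm [IsManifold 𝓘(ℝ, V) ∞ M] (x₀ : M) {y : V}
    (hy : y ∈ (chartAt V x₀).target) :
    MDifferentiableAt 𝓘(ℝ, V) 𝓘(ℝ, V) (chartAt V x₀).symm y :=
  mdifferentiableAt_atlas_symm (I := 𝓘(ℝ, V)) (chart_mem_atlas V x₀) hy

theorem mdifferentiableAt_of_contMDiffOn {f : U → M} {s : Set U} (hs : IsOpen s)
    (hf : ContMDiffOn 𝓘(ℝ, U) 𝓘(ℝ, V) ∞ f s) {y : U} (hy : y ∈ s) :
    MDifferentiableAt 𝓘(ℝ, U) 𝓘(ℝ, V) f y :=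
  (hf.contMDiffAt (hs.mem_nhds hy)).mdifferentiableAt (by simp)

theorem isOpen_inter_preimage_chart {f : U → M} {s : Set U} (hs : IsOpen s)
    (hf : ContMDiffOn 𝓘(ℝ, U) 𝓘(ℝ, V) ∞ f s) (x₀ : M) :
    IsOpen (s ∩ f ⁻¹' (chartAt V x₀).source) :=
  hf.continuousOn.isOpen_inter_preimage hs (chartAt V x₀).open_source

theorem fderiv_chart_comp [IsManifold 𝓘(ℝ, V) ∞ M] {f : U → M} {s : Set U} (hs : IsOpen s)
    (hf : ContMDiffOn 𝓘(ℝ, U) 𝓘(ℝ, V) ∞ f s) (x₀ : M) {y : U} (hy : y ∈ s)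
    (hx : f y ∈ (chartAt V x₀).source) :
    fderiv ℝ (fun y => chartAt V x₀ (f y)) y =
      (mfderiv 𝓘(ℝ, V) 𝓘(ℝ, V) (chartAt V x₀) (f y)).comp (mfderiv 𝓘(ℝ, U) 𝓘(ℝ, V) f y) := by
  rw [← mfderiv_eq_fderiv]
  exact mfderiv_comp (I' := 𝓘(ℝ, V)) y (mdifferentiableAt_chart x₀ hx)
    (mdifferentiableAt_of_contMDiffOn hs hf hy)

theorem mfderiv_chart_symm_comp_mfderiv_chart [IsManifold 𝓘(ℝ, V) ∞ M] (x₀ : M) {x : M}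
    (hx : x ∈ (chartAt V x₀).source) :
    (mfderiv 𝓘(ℝ, V) 𝓘(ℝ, V) (chartAt V x₀).symm (chartAt V x₀ x)).comp
      (mfderiv 𝓘(ℝ, V) 𝓘(ℝ, V) (chartAt V x₀) x) =
      ContinuousLinearMap.id ℝ (TangentSpace 𝓘(ℝ, V) x) := by
  have h := (mdifferentiable_chart (I := 𝓘(ℝ, V)) x₀).symm_comp_deriv hx
  exact h

theorem mfderiv_chart_comp_mfderiv_chart_symm [IsManifold 𝓘(ℝ, V) ∞ M] (x₀ : M) {y : V}
    (hy : y ∈ (chartAt V x₀).target) :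
    (mfderiv 𝓘(ℝ, V) 𝓘(ℝ, V) (chartAt V x₀) ((chartAt V x₀).symm y)).comp
      (mfderiv 𝓘(ℝ, V) 𝓘(ℝ, V) (chartAt V x₀).symm y) =
      ContinuousLinearMap.id ℝ V :=
  (mdifferentiable_chart (I := 𝓘(ℝ, V)) x₀).comp_symm_deriv hy

/-- Reading the pullback in one fixed chart removes the moving base point from the types, so that
calculus in normed spaces applies. -/
theorem DForm.pullback_eq_inChart [IsManifold 𝓘(ℝ, V) ∞ M] (η : DForm V M k W) {f : U → M}
    {s : Set U} (hs : IsOpen s) (hf : ContMDiffOn 𝓘(ℝ, U) 𝓘(ℝ, V) ∞ f s) (x₀ : M) {y : U}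
    (hy : y ∈ s) (hx : f y ∈ (chartAt V x₀).source) :
    η.pullback f y = (η.inChart x₀ (chartAt V x₀ (f y))).compContinuousLinearMap
      (fderiv ℝ (fun y => chartAt V x₀ (f y)) y) := by
  -- `inChart` evaluates the form at the image of `f y` under the chart and back. This equals `f y`
  -- only propositionally, while the tangent space depends on it, so the base point is generalized.
  have key : ∀ (z : M) (hz : z = f y),
      (η (f y)).compContinuousLinearMap (mfderiv 𝓘(ℝ, U) 𝓘(ℝ, V) f y) =
      ((η z).compContinuousLinearMap
        (mfderiv 𝓘(ℝ, V) 𝓘(ℝ, V) (chartAt V x₀).symm (chartAt V x₀ (f y)))).compContinuousLinearMap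
      (fderiv ℝ (fun y => chartAt V x₀ (f y)) y) := by
    rintro z rfl
    refine ContinuousAlternatingMap.ext fun v => ?_
    refine congrArg (η (f y)) (funext fun i => ?_)
    have h1 := DFunLike.congr_fun (fderiv_chart_comp hs hf x₀ hy hx) (v i)
    have h2 := DFunLike.congr_fun (mfderiv_chart_symm_comp_mfderiv_chart x₀ hx)
      (mfderiv 𝓘(ℝ, U) 𝓘(ℝ, V) f y (v i))
    exact (h2.symm.trans (congrArg (mfderiv 𝓘(ℝ, V) 𝓘(ℝ, V) (chartAt V x₀).symm
      (chartAt V x₀ (f y))) h1.symm))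
  exact key _ ((chartAt V x₀).left_inv hx)

/-- For multilinear maps, composition is analytic jointly in the multilinear map and in the linear
maps inserted; alternating maps are treated as multilinear ones. -/
theorem contDiffAt_compContinuousLinearMap_apply [CompleteSpace W] {a : U → V [⋀^Fin k]→L[ℝ] W} {L : U → U →L[ℝ] V}
    {y : U} (ha : ContDiffAt ℝ ∞ a y) (hL : ContDiffAt ℝ ∞ L y) (v : Fin k → U) :
    ContDiffAt ℝ ∞ (fun y => (a y).compContinuousLinearMap (L y) v) y := by
  have h1 : ContDiffAt ℝ ∞ (fun y => ((fun _ : Fin k => L y), (a y).toContinuousMultilinearMap)) y :=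
    (contDiffAt_pi.2 fun _ => hL).prodMk
      (ContDiffAt.comp y (g := ContinuousAlternatingMap.toContinuousMultilinearMapCLM (𝕜 := ℝ)
        (E := V) (F := W) (ι := Fin k) ℝ) (ContinuousLinearMap.contDiff _).contDiffAt ha)
  have h2 := (ContinuousMultilinearMap.analyticAt_uncurry_compContinuousLinearMap
    (q := ((fun _ : Fin k => L y), (a y).toContinuousMultilinearMap))).contDiffAt (n := ∞)
  have h3 := h2.comp y h1
  exact (ContinuousMultilinearMap.apply ℝ (fun _ : Fin k => U) W v).contDiff.contDiffAt.comp y h3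

theorem DForm.IsSmooth.pullback_aux [IsManifold 𝓘(ℝ, V) ∞ M] {η : DForm V M k W}
    (hη : η.IsSmooth) {f : U → M} {s : Set U} (hs : IsOpen s)
    (hf : ContMDiffOn 𝓘(ℝ, U) 𝓘(ℝ, V) ∞ f s) {y : U} (hy : y ∈ s) :
    ∃ (a : U → V [⋀^Fin k]→L[ℝ] W) (L : U → U →L[ℝ] V), ContDiffAt ℝ ∞ a y ∧ ContDiffAt ℝ ∞ L y ∧
      η.pullback f =ᶠ[𝓝 y] fun y => (a y).compContinuousLinearMap (L y) := by
  set x₀ := f y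
  have hy' : y ∈ s ∩ f ⁻¹' (chartAt V x₀).source := ⟨hy, mem_chart_source V x₀⟩
  have ho := isOpen_inter_preimage_chart hs hf x₀
  have hc : ContDiffAt ℝ ∞ (fun y => chartAt V x₀ (f y)) y :=
    (contMDiffOn_chart_comp hf x₀).contDiffAt (ho.mem_nhds hy')
  refine ⟨fun y => η.inChart x₀ (chartAt V x₀ (f y)), fderiv ℝ (fun y => chartAt V x₀ (f y)),
    ?_, hc.fderiv_right (m := ∞) (by simp), ?_⟩
  · refine ContDiffAt.comp y (g := η.inChart x₀) ?_ hc
    exact (hη x₀).contDiffAt ((chartAt V x₀).open_target.mem_nhds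
      ((chartAt V x₀).map_source (mem_chart_source V x₀)))
  · filter_upwards [ho.mem_nhds hy'] with z hz
    exact η.pullback_eq_inChart hs hf x₀ hz.1 hz.2

theorem DForm.IsSmooth.contDiffAt_pullback_apply [CompleteSpace W] [IsManifold 𝓘(ℝ, V) ∞ M] {η : DForm V M k W}
    (hη : η.IsSmooth) {f : U → M} {s : Set U} (hs : IsOpen s)
    (hf : ContMDiffOn 𝓘(ℝ, U) 𝓘(ℝ, V) ∞ f s) {y : U} (hy : y ∈ s) (v : Fin k → U) :
    ContDiffAt ℝ ∞ (fun y => η.pullback f y v) y := by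
  obtain ⟨a, L, ha, hL, h⟩ := hη.pullback_aux hs hf hy
  refine (contDiffAt_compContinuousLinearMap_apply ha hL v).congr_of_eventuallyEq ?_
  filter_upwards [h] with z hz
  rw [hz]

theorem DForm.IsSmooth.differentiableAt_pullback [IsManifold 𝓘(ℝ, V) ∞ M] {η : DForm V M k W}
    (hη : η.IsSmooth) {f : U → M} {s : Set U} (hs : IsOpen s)
    (hf : ContMDiffOn 𝓘(ℝ, U) 𝓘(ℝ, V) ∞ f s) {y : U} (hy : y ∈ s) :
    DifferentiableAt ℝ (η.pullback f) y := by
  obtain ⟨a, L, ha, hL, h⟩ := hη.pullback_aux hs hf hy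
  exact ((ha.differentiableAt (by simp)).continuousAlternatingMapCompContinuousLinearMap
    (hL.differentiableAt (by simp))).congr_of_eventuallyEq h

/-- `DForm.d` at `f y` is computed in the chart at `f y`, so reading `f` in that chart reduces the
claim to naturality of `extDeriv` between normed spaces. With `f` an inverse chart, this is the
independence of `DForm.d` of the chart. -/
theorem DForm.IsSmooth.extDeriv_pullback [IsManifold 𝓘(ℝ, V) ∞ M] {η : DForm V M k W}
    (hη : η.IsSmooth) {f : U → M} {s : Set U} (hs : IsOpen s)
    (hf : ContMDiffOn 𝓘(ℝ, U) 𝓘(ℝ, V) ∞ f s) {y : U} (hy : y ∈ s) :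
    extDeriv (η.pullback f) y =
      (DForm.d η (f y)).compContinuousLinearMap (mfderiv 𝓘(ℝ, U) 𝓘(ℝ, V) f y) := by
  set x₀ := f y with hx₀
  have hy' : y ∈ s ∩ f ⁻¹' (chartAt V x₀).source := ⟨hy, mem_chart_source V x₀⟩
  have ho := isOpen_inter_preimage_chart hs hf x₀
  have hev : η.pullback f =ᶠ[𝓝 y] fun y => (η.inChart x₀ (chartAt V x₀ (f y))).compContinuousLinearMap
      (fderiv ℝ (fun y => chartAt V x₀ (f y)) y) := by
    filter_upwards [ho.mem_nhds hy'] with z hz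
    exact η.pullback_eq_inChart hs hf x₀ hz.1 hz.2
  rw [hev.extDeriv_eq]
  have hc : ContDiffAt ℝ ∞ (fun y => chartAt V x₀ (f y)) y :=
    (contMDiffOn_chart_comp hf x₀).contDiffAt (ho.mem_nhds hy')
  have h1 : DifferentiableAt ℝ (η.inChart x₀) (chartAt V x₀ (f y)) :=
    ((hη x₀).contDiffAt ((chartAt V x₀).open_target.mem_nhds
      ((chartAt V x₀).map_source (mem_chart_source V x₀)))).differentiableAt (by simp)
  rw [_root_.extDeriv_pullback (f := fun y => chartAt V x₀ (f y)) (x := y) h1 hc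
    (by rw [minSmoothness_of_isRCLikeNormedField]; exact ENat.LEInfty.out)]
  rw [fderiv_chart_comp hs hf x₀ hy (mem_chart_source V x₀)]
  rfl

end Pullback

/-! ### Matrices of a symplectic form and a compatible complex structure -/

section CompatibleMatrices

set_option linter.unusedSectionVars false

variable {ι : Type*} [Fintype ι] [DecidableEq ι]

/-- `w` is the matrix of a symplectic form and `J` that of a compatible complex structure. -/
structure IsCompatiblePair (w J : Matrix ι ι ℝ) : Prop where
  skew : wᵀ = -w
  sq : J * J = -1
  compat : Jᵀ * w * J = w
  pos : (w * J).PosDef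

namespace IsCompatiblePair

variable {w J J' : Matrix ι ι ℝ}

theorem isUnit_det (h : IsCompatiblePair w J) : IsUnit w.det := by
  have h1 : (w * J).det ≠ 0 := h.pos.det_pos.ne'
  rw [Matrix.det_mul] at h1
  exact isUnit_iff_ne_zero.2 (left_ne_zero_of_mul h1)

theorem inv_mul (h : IsCompatiblePair w J) : w⁻¹ * w = 1 := Matrix.nonsing_inv_mul _ h.isUnit_det

theorem mul_inv (h : IsCompatiblePair w J) : w * w⁻¹ = 1 := Matrix.mul_nonsing_inv _ h.isUnit_det

theorem inv_skew (h : IsCompatiblePair w J) : (w⁻¹)ᵀ = -w⁻¹ := by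
  rw [Matrix.transpose_nonsing_inv, h.skew]
  refine Matrix.inv_eq_left_inv ?_
  rw [neg_mul_neg, h.inv_mul]

theorem inv_skew_apply (h : IsCompatiblePair w J) (a b : ι) : w⁻¹ a b = -w⁻¹ b a := by
  have := congrFun (congrFun h.inv_skew b) a
  simpa using this

theorem transpose_mul (h : IsCompatiblePair w J) : Jᵀ * w = -(w * J) := by
  have h1 : Jᵀ * w * (J * J) = w * J := by rw [← mul_assoc, h.compat]
  rw [h.sq, mul_neg, mul_one] at h1
  rw [← h1, neg_neg]

theorem metric_inv (h : IsCompatiblePair w J) : (w * J)⁻¹ = -(J * w⁻¹) := by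
  refine Matrix.inv_eq_left_inv ?_
  calc -(J * w⁻¹) * (w * J) = -(J * (w⁻¹ * w) * J) := by noncomm_ring
    _ = 1 := by rw [h.inv_mul, mul_one, h.sq, neg_neg]

/-- With g = wJ this reads J g⁻¹ = w⁻¹. It is what replaces metric contractions by contractions that
do not see J. -/
theorem mul_metric_inv (h : IsCompatiblePair w J) : J * (w * J)⁻¹ = w⁻¹ := by
  rw [h.metric_inv, mul_neg, ← mul_assoc, h.sq, neg_mul, one_mul, neg_neg]

theorem metric_inv_mul_transpose (h : IsCompatiblePair w J) : (w * J)⁻¹ * Jᵀ = -w⁻¹ := by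
  have h1 : w⁻¹ * Jᵀ = -(J * w⁻¹) := by
    have h2 : w⁻¹ * (Jᵀ * w) * w⁻¹ = w⁻¹ * (-(w * J)) * w⁻¹ := by rw [h.transpose_mul]
    calc w⁻¹ * Jᵀ = w⁻¹ * (Jᵀ * w) * w⁻¹ := by rw [mul_assoc, mul_assoc, h.mul_inv, mul_one]
      _ = w⁻¹ * (-(w * J)) * w⁻¹ := h2
      _ = -((w⁻¹ * w) * J * w⁻¹) := by noncomm_ring
      _ = -(J * w⁻¹) := by rw [h.inv_mul, one_mul]
  rw [h.metric_inv, neg_mul, mul_assoc, h1, mul_neg, neg_neg, ← mul_assoc, h.sq, neg_mul, one_mul]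

theorem conj_metric_inv (h : IsCompatiblePair w J) : J * (w * J)⁻¹ * Jᵀ = (w * J)⁻¹ := by
  rw [mul_assoc, h.metric_inv_mul_transpose, h.metric_inv, mul_neg]

theorem metric_inv_symm (h : IsCompatiblePair w J) : ((w * J)⁻¹)ᵀ = (w * J)⁻¹ := by
  have := h.pos.isHermitian.inv
  rwa [Matrix.IsHermitian, Matrix.conjTranspose_eq_transpose_of_trivial] at this

/-- J² = −1 forces |det J| = 1, so the Riemannian volume density is the Liouville density. -/
theorem sqrt_det (h : IsCompatiblePair w J) : √(w * J).det = √|w.det| := by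
  have h1 : J.det * J.det = (-1 : Matrix ι ι ℝ).det := by rw [← Matrix.det_mul, h.sq]
  have h2 : |J.det| = 1 := by
    have h3 : |J.det| * |J.det| = 1 := by
      rw [← abs_mul, h1, Matrix.det_neg, Matrix.det_one, mul_one, abs_pow]; simp
    nlinarith [abs_nonneg J.det]
  rw [← abs_of_pos h.pos.det_pos, Matrix.det_mul, abs_mul, h2, mul_one]

/-- w(J + J') is a sum of two positive definite matrices. -/
theorem isUnit_det_add (h : IsCompatiblePair w J) (h' : IsCompatiblePair w J') :
    IsUnit (J + J').det := by
  have h1 : (w * (J + J')).det ≠ 0 := by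
    rw [mul_add]; exact (h.pos.add h'.pos).det_pos.ne'
  rw [Matrix.det_mul] at h1
  exact isUnit_iff_ne_zero.2 (right_ne_zero_of_mul h1)

end IsCompatiblePair

variable {M : Type*} [AddCommGroup M] [Module ℝ M]

/-- Contractions with a contravariant 2-tensor do not depend on the frame. -/
theorem sum_smul_transform {q q' P : Matrix ι ι ℝ} (hq : P * q' * Pᵀ = q) (β : ι → ι → M) :
    ∑ a, ∑ b, q' a b • ∑ c, ∑ d, (P c a * P d b) • β c d = ∑ c, ∑ d, q c d • β c d := by
  have h : ∀ c d, q c d = ∑ a, ∑ b, q' a b * (P c a * P d b) := by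
    intro c d
    rw [← hq, Matrix.mul_apply, Finset.sum_comm]
    refine Finset.sum_congr rfl fun b _ => ?_
    rw [Matrix.mul_apply, Finset.sum_mul]
    refine Finset.sum_congr rfl fun a _ => ?_
    rw [Matrix.transpose_apply]; ring
  simp_rw [h, Finset.sum_smul, Finset.smul_sum, smul_smul]
  calc _ = ∑ a, ∑ c, ∑ b, ∑ d, (q' a b * (P c a * P d b)) • β c d :=
        Finset.sum_congr rfl fun a _ => Finset.sum_comm
    _ = ∑ c, ∑ a, ∑ b, ∑ d, (q' a b * (P c a * P d b)) • β c d := Finset.sum_comm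
    _ = ∑ c, ∑ a, ∑ d, ∑ b, (q' a b * (P c a * P d b)) • β c d :=
        Finset.sum_congr rfl fun c _ => Finset.sum_congr rfl fun a _ => Finset.sum_comm
    _ = _ := Finset.sum_congr rfl fun c _ => Finset.sum_comm

/-- The inverse of the matrix of a bilinear form is a contravariant 2-tensor. -/
theorem mul_inv_mul_transpose {w w' P : Matrix ι ι ℝ} (hw : Pᵀ * w * P = w') (hP : IsUnit P.det) :
    P * w'⁻¹ * Pᵀ = w⁻¹ := by
  rw [← hw, Matrix.mul_inv_rev, Matrix.mul_inv_rev, ← mul_assoc, ← mul_assoc,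
    Matrix.mul_nonsing_inv _ hP, one_mul, mul_assoc, Matrix.nonsing_inv_mul, mul_one]
  rwa [Matrix.det_transpose]

variable (B : M →ₗ[ℝ] M →ₗ[ℝ] ℝ)

/-- The contraction of two families of vectors indexed by pairs with two contravariant tensors. -/
def pairing (p q : Matrix ι ι ℝ) (F F' : ι → ι → M) : ℝ :=
  ∑ a, ∑ b, p a b * ∑ c, ∑ d, q c d * B (F a c) (F' b d)

theorem pairing_add_left (p q : Matrix ι ι ℝ) (F₁ F₂ F' : ι → ι → M) :
    pairing B p q (fun a b => F₁ a b + F₂ a b) F' = pairing B p q F₁ F' + pairing B p q F₂ F' := by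
  simp only [pairing, map_add, LinearMap.add_apply, mul_add, Finset.sum_add_distrib]

theorem pairing_smul_left (p q : Matrix ι ι ℝ) (r : ℝ) (F₁ F' : ι → ι → M) :
    pairing B p q (fun a b => r • F₁ a b) F' = r * pairing B p q F₁ F' := by
  simp only [pairing, map_smul, LinearMap.smul_apply, smul_eq_mul, Finset.mul_sum]
  refine Finset.sum_congr rfl fun a _ => Finset.sum_congr rfl fun b _ =>
    Finset.sum_congr rfl fun c _ => Finset.sum_congr rfl fun d _ => ?_
  ring

theorem pairing_add_right (p q : Matrix ι ι ℝ) (F F₁ F₂ : ι → ι → M) :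
    pairing B p q F (fun a b => F₁ a b + F₂ a b) = pairing B p q F F₁ + pairing B p q F F₂ := by
  simp only [pairing, map_add, mul_add, Finset.sum_add_distrib]

theorem pairing_smul_right (p q : Matrix ι ι ℝ) (r : ℝ) (F₁ F' : ι → ι → M) :
    pairing B p q F₁ (fun a b => r • F' a b) = r * pairing B p q F₁ F' := by
  simp only [pairing, map_smul, smul_eq_mul, Finset.mul_sum]
  refine Finset.sum_congr rfl fun a _ => Finset.sum_congr rfl fun b _ =>
    Finset.sum_congr rfl fun c _ => Finset.sum_congr rfl fun d _ => ?_
  ring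

theorem sum₄_comm (f : ι → ι → ι → ι → ℝ) :
    ∑ a, ∑ b, ∑ c, ∑ d, f a b c d = ∑ c, ∑ d, ∑ a, ∑ b, f a b c d := by
  calc _ = ∑ a, ∑ c, ∑ b, ∑ d, f a b c d := Finset.sum_congr rfl fun a _ => Finset.sum_comm
    _ = ∑ c, ∑ a, ∑ b, ∑ d, f a b c d := Finset.sum_comm
    _ = ∑ c, ∑ a, ∑ d, ∑ b, f a b c d :=
        Finset.sum_congr rfl fun c _ => Finset.sum_congr rfl fun a _ => Finset.sum_comm
    _ = _ := Finset.sum_congr rfl fun c _ => Finset.sum_comm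

theorem bilin_sum_smul (p p' : ι → ℝ) (u v : ι → M) :
    B (∑ s, p s • u s) (∑ t, p' t • v t) = ∑ s, ∑ t, p s * p' t * B (u s) (v t) := by
  rw [Finset.sum_comm]
  simp only [map_sum, LinearMap.sum_apply, map_smul, LinearMap.smul_apply, smul_eq_mul,
    Finset.mul_sum]
  refine Finset.sum_congr rfl fun _ _ => Finset.sum_congr rfl fun _ _ => ?_
  ring

/-- The effect of a change of frame on `pairing`. -/
theorem pairing_transform {p p' q q' P Q : Matrix ι ι ℝ} (hp : P * p' * Pᵀ = p)
    (hq : Q * q' * Qᵀ = q) (F F' : ι → ι → M) :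
    pairing B p' q' (fun a c => ∑ s, ∑ t, (P s a * Q t c) • F s t)
      (fun a c => ∑ s, ∑ t, (P s a * Q t c) • F' s t) = pairing B p q F F' := by
  have e : ∀ (G : ι → ι → M) (a c : ι), ∑ s, ∑ t, (P s a * Q t c) • G s t
      = ∑ t, Q t c • ∑ s, P s a • G s t := by
    intro G a c
    rw [Finset.sum_comm]
    refine Finset.sum_congr rfl fun t _ => ?_
    rw [Finset.smul_sum]
    refine Finset.sum_congr rfl fun s _ => ?_
    rw [smul_smul, mul_comm]
  have h1 : ∀ a b, ∑ c, ∑ d, q' c d * B (∑ s, ∑ t, (P s a * Q t c) • F s t)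
      (∑ s, ∑ t, (P s b * Q t d) • F' s t) =
      ∑ c, ∑ d, q c d * B (∑ s, P s a • F s c) (∑ s, P s b • F' s d) := by
    intro a b
    have := sum_smul_transform hq (fun c d => B (∑ s, P s a • F s c) (∑ s, P s b • F' s d))
    simp only [smul_eq_mul] at this
    rw [← this]
    refine Finset.sum_congr rfl fun c _ => Finset.sum_congr rfl fun d _ => ?_
    rw [e, e, bilin_sum_smul]
  unfold pairing
  simp_rw [h1]
  have := sum_smul_transform hp (fun a b => ∑ c, ∑ d, q c d * B (F a c) (F' b d))
  simp only [smul_eq_mul] at this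
  rw [← this]
  refine Finset.sum_congr rfl fun a _ => Finset.sum_congr rfl fun b _ => ?_
  simp only [bilin_sum_smul, Finset.mul_sum]
  rw [sum₄_comm]
  refine Finset.sum_congr rfl fun c _ => Finset.sum_congr rfl fun d _ =>
    Finset.sum_congr rfl fun _ _ => Finset.sum_congr rfl fun _ _ => ?_
  ring

open scoped MatrixOrder in
theorem posSemidef_factor {p : Matrix ι ι ℝ} (hp : p.PosSemidef) :
    ∃ P : Matrix ι ι ℝ, p = Pᴴ * P :=
  CStarAlgebra.nonneg_iff_eq_star_mul_self.mp hp.nonneg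

/-- Factoring p = PPᵀ and q = QQᵀ amounts to a change of frame after which both tensors are the
identity; the pairing is then a sum of values B(v, v). -/
theorem pairing_self_nonneg {p q : Matrix ι ι ℝ} (hp : p.PosDef) (hq : q.PosDef)
    (hB : ∀ u, 0 ≤ B u u) (F : ι → ι → M) : 0 ≤ pairing B p q F F := by
  obtain ⟨P, rfl⟩ : ∃ P : Matrix ι ι ℝ, P * 1 * Pᵀ = p := by
    obtain ⟨P, h⟩ := posSemidef_factor hp.posSemidef
    exact ⟨Pᵀ, by rw [h, mul_one, Matrix.transpose_transpose,
      Matrix.conjTranspose_eq_transpose_of_trivial]⟩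
  obtain ⟨Q, rfl⟩ : ∃ P : Matrix ι ι ℝ, P * 1 * Pᵀ = q := by
    obtain ⟨P, h⟩ := posSemidef_factor hq.posSemidef
    exact ⟨Pᵀ, by rw [h, mul_one, Matrix.transpose_transpose,
      Matrix.conjTranspose_eq_transpose_of_trivial]⟩
  rw [← pairing_transform B rfl rfl]
  simp only [pairing, Matrix.one_apply, ite_mul, one_mul, zero_mul, Finset.sum_ite_eq,
    Finset.mem_univ, if_true]
  exact Finset.sum_nonneg fun a _ => Finset.sum_nonneg fun b _ => hB _

/-- The family `F (J e_a) (J e_b)`. -/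
def twist (J : Matrix ι ι ℝ) (F : ι → ι → M) (a b : ι) : M := ∑ s, ∑ t, (J s a * J t b) • F s t

variable {w J : Matrix ι ι ℝ}

theorem IsCompatiblePair.pairing_twist_twist (h : IsCompatiblePair w J) (F F' : ι → ι → M) :
    pairing B (w * J)⁻¹ (w * J)⁻¹ (twist J F) (twist J F') =
      pairing B (w * J)⁻¹ (w * J)⁻¹ F F' :=
  pairing_transform B h.conj_metric_inv h.conj_metric_inv F F'

theorem sum_left_transform (P p : Matrix ι ι ℝ) (f : ι → ι → ℝ) :
    ∑ a, ∑ b, p a b * ∑ s, P s a * f s b = ∑ s, ∑ b, (P * p) s b * f s b := by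
  simp only [Matrix.mul_apply, Finset.mul_sum, Finset.sum_mul]
  calc _ = ∑ a, ∑ s, ∑ b, p a b * (P s a * f s b) :=
        Finset.sum_congr rfl fun a _ => Finset.sum_comm
    _ = ∑ s, ∑ a, ∑ b, p a b * (P s a * f s b) := Finset.sum_comm
    _ = ∑ s, ∑ b, ∑ a, p a b * (P s a * f s b) :=
        Finset.sum_congr rfl fun a _ => Finset.sum_comm
    _ = _ := by
        refine Finset.sum_congr rfl fun _ _ => Finset.sum_congr rfl fun _ _ =>
          Finset.sum_congr rfl fun _ _ => ?_
        ring

theorem pairing_transform_left (p' q' P Q : Matrix ι ι ℝ) (F F' : ι → ι → M) :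
    pairing B p' q' (fun a c => ∑ s, ∑ t, (P s a * Q t c) • F s t) F' =
      pairing B (P * p') (Q * q') F F' := by
  have h1 : ∀ a b, ∑ c, ∑ d, q' c d * B (∑ s, ∑ t, (P s a * Q t c) • F s t) (F' b d) =
      ∑ s, P s a * ∑ t, ∑ d, (Q * q') t d * B (F s t) (F' b d) := by
    intro a b
    have h2 : ∀ c d, B (∑ s, ∑ t, (P s a * Q t c) • F s t) (F' b d) =
        ∑ t, Q t c * ∑ s, P s a * B (F s t) (F' b d) := by
      intro c d
      rw [Finset.sum_comm]
      simp only [map_sum, LinearMap.sum_apply, map_smul, LinearMap.smul_apply, smul_eq_mul,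
        Finset.mul_sum]
      refine Finset.sum_congr rfl fun _ _ => Finset.sum_congr rfl fun _ _ => ?_
      ring
    simp_rw [h2]
    rw [sum_left_transform Q q' (fun t d => ∑ s, P s a * B (F s t) (F' b d))]
    simp only [Finset.mul_sum]
    calc _ = ∑ t, ∑ s, ∑ d, (Q * q') t d * (P s a * B (F s t) (F' b d)) :=
          Finset.sum_congr rfl fun a _ => Finset.sum_comm
      _ = ∑ s, ∑ t, ∑ d, (Q * q') t d * (P s a * B (F s t) (F' b d)) := Finset.sum_comm
      _ = _ := by
          refine Finset.sum_congr rfl fun _ _ => Finset.sum_congr rfl fun _ _ =>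
            Finset.sum_congr rfl fun _ _ => ?_
          ring
  unfold pairing
  simp_rw [h1]
  exact sum_left_transform P p' (fun s b => ∑ t, ∑ d, (Q * q') t d * B (F s t) (F' b d))

/-- As J g⁻¹ = w⁻¹, contracting with w⁻¹ twice is contracting F(J·,J·) with g⁻¹ twice. -/
theorem IsCompatiblePair.pairing_inv (h : IsCompatiblePair w J) (F F' : ι → ι → M) :
    pairing B w⁻¹ w⁻¹ F F' = pairing B (w * J)⁻¹ (w * J)⁻¹ (twist J F) F' := by
  have := pairing_transform_left B (w * J)⁻¹ (w * J)⁻¹ J J F F'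
  rw [h.mul_metric_inv] at this
  exact this.symm

theorem pairing_comm {p q : Matrix ι ι ℝ} (hp : pᵀ = p) (hq : qᵀ = q) (hB : ∀ u v, B u v = B v u)
    (F F' : ι → ι → M) : pairing B p q F F' = pairing B p q F' F := by
  have hp' : ∀ a b, p a b = p b a := fun a b => congrFun (congrFun hp b) a
  have hq' : ∀ a b, q a b = q b a := fun a b => congrFun (congrFun hq b) a
  unfold pairing
  rw [Finset.sum_comm]
  refine Finset.sum_congr rfl fun a _ => Finset.sum_congr rfl fun b _ => ?_
  rw [Finset.sum_comm, hp' b a]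
  congr 1
  refine Finset.sum_congr rfl fun c _ => Finset.sum_congr rfl fun d _ => ?_
  rw [hq' d c, hB]

/-- The map F ↦ F(J·,J·) is a g-isometry, and the inner product of F(J·,J·) with F is the
w-contraction, so the square expands to the right-hand side. For a 2-form, F − F(J·,J·) is twice the
part of type (2,0) + (0,2). -/
theorem IsCompatiblePair.pairing_sub_twist (h : IsCompatiblePair w J) (hB : ∀ u v, B u v = B v u)
    (F : ι → ι → M) :
    pairing B (w * J)⁻¹ (w * J)⁻¹ (fun a b => F a b - twist J F a b)
      (fun a b => F a b - twist J F a b) =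
      2 * (pairing B (w * J)⁻¹ (w * J)⁻¹ F F - pairing B w⁻¹ w⁻¹ F F) := by
  have e : (fun a b => F a b - twist J F a b) = fun a b => F a b + (-1 : ℝ) • twist J F a b := by
    funext a b; rw [neg_one_smul, sub_eq_add_neg]
  rw [e, pairing_add_left, pairing_add_right, pairing_add_right,
    pairing_smul_left B _ _ (-1) (fun a b => twist J F a b),
    pairing_smul_left B _ _ (-1) (fun a b => twist J F a b),
    pairing_smul_right B _ _ (-1) _ (fun a b => twist J F a b),
    pairing_smul_right B _ _ (-1) _ (fun a b => twist J F a b), h.pairing_inv]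
  have h1 := h.pairing_twist_twist B F F
  have h2 := pairing_comm B h.metric_inv_symm h.metric_inv_symm hB F (twist J F)
  change _ + (-1 : ℝ) * pairing B _ _ F (twist J F) + ((-1 : ℝ) * pairing B _ _ (twist J F) F
    + (-1 : ℝ) * ((-1 : ℝ) * pairing B _ _ (twist J F) (twist J F))) = _
  rw [h1, h2]
  ring

/-- The difference of the two sides is half the squared length of F − F(J·,J·). This is the
pointwise inequality behind the lower bound for the functional. -/
theorem IsCompatiblePair.pairing_le (h : IsCompatiblePair w J) (hB : ∀ u v, B u v = B v u)
    (hB' : ∀ u, 0 ≤ B u u) (F : ι → ι → M) :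
    pairing B w⁻¹ w⁻¹ F F ≤ pairing B (w * J)⁻¹ (w * J)⁻¹ F F := by
  have h1 := h.pairing_sub_twist B hB F
  have h2 := pairing_self_nonneg B h.pos.inv h.pos.inv hB' (fun a b => F a b - twist J F a b)
  linarith

theorem IsCompatiblePair.pairing_eq (h : IsCompatiblePair w J) (F : ι → ι → M)
    (hF : ∀ a b, twist J F a b = F a b) :
    pairing B w⁻¹ w⁻¹ F F = pairing B (w * J)⁻¹ (w * J)⁻¹ F F := by
  rw [h.pairing_inv, show twist J F = F from funext fun a => funext fun b => hF a b]

end CompatibleMatrices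

/-! ### Wedge products of forms of low degree -/

section Wedge

variable {V M N K : Type*} [AddCommGroup V] [Module ℝ V] [AddCommGroup M] [Module ℝ M]
    [AddCommGroup N] [Module ℝ N] [AddCommGroup K] [Module ℝ K]

/-- Each shuffle class contains k! l! permutations with the same summand. Trading shuffles for all
permutations makes low degrees computable by enumeration. -/
theorem factorial_smul_wedge_apply {k l : ℕ} (B : M →ₗ[ℝ] N →ₗ[ℝ] K) (a : V [⋀^Fin k]→ₗ[ℝ] M)
    (b : V [⋀^Fin l]→ₗ[ℝ] N) (v : Fin (k + l) → V) :
    (k.factorial * l.factorial) • wedge B a b v = ∑ σ : Equiv.Perm (Fin (k + l)),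
      Equiv.Perm.sign σ • B (a fun i => v (σ (Fin.castAdd l i))) (b fun i => v (σ (Fin.natAdd k i))) := by
  have h := MultilinearMap.domCoprod_alternization_eq a b
  have h2 := congrArg (fun F : V [⋀^Fin k ⊕ Fin l]→ₗ[ℝ] _ =>
    TensorProduct.lift B (F fun i => v (finSumFinEquiv i))) h
  simp only [Fintype.card_fin] at h2
  rw [AlternatingMap.smul_apply, map_nsmul] at h2
  have h3 : TensorProduct.lift B ((a.domCoprod b) fun i => v (finSumFinEquiv i)) = wedge B a b v := rfl
  rw [h3] at h2
  rw [← h2, MultilinearMap.alternatization_apply, map_sum]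
  refine (Fintype.sum_equiv finSumFinEquiv.permCongr _ _ fun σ => ?_)
  rw [Equiv.Perm.sign_permCongr]
  rw [Units.smul_def, Units.smul_def, map_zsmul]
  congr 1
  simp [MultilinearMap.domDomCongr_apply, MultilinearMap.domCoprod_apply, Equiv.permCongr_apply]

theorem wedge_one_one_apply (B : M →ₗ[ℝ] N →ₗ[ℝ] K) (a : V [⋀^Fin 1]→ₗ[ℝ] M)
    (b : V [⋀^Fin 1]→ₗ[ℝ] N) (u v : V) :
    wedge B a b ![u, v] = B (a ![u]) (b ![v]) - B (a ![v]) (b ![u]) := by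
  have h := factorial_smul_wedge_apply B a b ![u, v]
  rw [← Equiv.sum_comp (Equiv.Perm.decomposeFin (n := 1)).symm, Fintype.sum_prod_type] at h
  simp only [Fin.sum_univ_succ, Finset.univ_unique, Finset.sum_singleton,
    Equiv.Perm.decomposeFin.symm_sign] at h
  simp only [Nat.factorial, mul_one, Fin.default_eq_zero] at h
  have e0 : (Equiv.Perm.decomposeFin.symm ((0 : Fin 2), (default : Equiv.Perm (Fin 1)))) = 1 := by
    decide
  have e1 : (Equiv.Perm.decomposeFin.symm (Fin.succ (0 : Fin 1), (default : Equiv.Perm (Fin 1)))) =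
    Equiv.swap 0 1 := by decide
  rw [e0, e1] at h
  have s1 : Equiv.Perm.sign (default : Equiv.Perm (Fin 1)) = 1 := by decide
  rw [s1] at h
  have k0 : ∀ i : Fin 1, Fin.castAdd 1 i = 0 := by decide
  have k1 : ∀ i : Fin 1, Fin.natAdd 1 i = 1 := by decide
  simp only [k0, k1] at h
  have c : ∀ x : V, (fun _ : Fin 1 => x) = ![x] := fun x => by ext i; fin_cases i; rfl
  simp [c] at h
  rw [h, sub_eq_add_neg]

/-- The 24 permutations fall into three classes, one for each splitting of four indices into two
pairs. Within a class the eight signed terms agree by the two symmetries. -/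
theorem sum_sign_smul_fin_four (Φ : Fin 4 → Fin 4 → Fin 4 → Fin 4 → ℝ)
    (h₁ : ∀ a b c d, Φ b a c d = -Φ a b c d) (h₂ : ∀ a b c d, Φ c d a b = Φ a b c d) :
    ∑ σ : Equiv.Perm (Fin 4), Equiv.Perm.sign σ • Φ (σ 0) (σ 1) (σ 2) (σ 3) =
      8 * (Φ 0 1 2 3 - Φ 0 2 1 3 + Φ 0 3 1 2) := by
  rw [← Equiv.sum_comp (Equiv.Perm.decomposeFin (n := 3)).symm, Fintype.sum_prod_type]
  simp_rw [← Equiv.sum_comp (Equiv.Perm.decomposeFin (n := 2)).symm, Fintype.sum_prod_type]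
  simp_rw [← Equiv.sum_comp (Equiv.Perm.decomposeFin (n := 1)).symm, Fintype.sum_prod_type]
  simp only [Fin.sum_univ_succ, Finset.univ_unique, Finset.sum_singleton,
    Equiv.Perm.decomposeFin.symm_sign]
  have e1 : (1 : Fin 4) = Fin.succ 0 := rfl
  have e2 : (2 : Fin 4) = Fin.succ (Fin.succ 0) := rfl
  have e3 : (3 : Fin 4) = Fin.succ (Fin.succ (Fin.succ 0)) := rfl
  rw [e1, e2, e3]
  simp only [Equiv.Perm.decomposeFin_symm_apply_zero, Equiv.Perm.decomposeFin_symm_apply_succ]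
  have s1 : Equiv.Perm.sign (default : Equiv.Perm (Fin 1)) = 1 := by decide
  simp only [s1, Equiv.swap_self, Equiv.refl_apply, Subsingleton.elim _ (0 : Fin 1)]
  have z : ∀ {m : ℕ} (x : Fin m), (0 = x.succ) = False := fun x => by
    simp [(Fin.succ_ne_zero x).symm]
  simp only [Equiv.swap_apply_def, Fin.succ_ne_zero, Fin.succ_inj, z, if_true, if_false,
    mul_one, neg_neg, mul_neg, one_smul, Units.neg_smul]
  rw [← e3, ← e2, ← e1]
  linarith [
    h₁ 0 1 2 3, h₁ 0 1 3 2, h₁ 2 3 0 1, h₁ 2 3 1 0, h₂ 0 1 2 3, h₂ 0 1 3 2, h₂ 1 0 2 3, h₂ 1 0 3 2,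
    h₁ 0 2 1 3, h₁ 0 2 3 1, h₁ 1 3 0 2, h₁ 1 3 2 0, h₂ 0 2 1 3, h₂ 0 2 3 1, h₂ 2 0 1 3, h₂ 2 0 3 1,
    h₁ 0 3 1 2, h₁ 0 3 2 1, h₁ 1 2 0 3, h₁ 1 2 3 0, h₂ 0 3 1 2, h₂ 0 3 2 1, h₂ 3 0 1 2, h₂ 3 0 2 1]

/-- The factor 2 is 8 / (2! 2!): eight equal terms for each splitting, divided by the overcount of
shuffles. -/
theorem wedge_two_two_apply (B : M →ₗ[ℝ] M →ₗ[ℝ] ℝ) (hB : ∀ u v, B u v = B v u)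
    (a : V [⋀^Fin 2]→ₗ[ℝ] M) (u v w z : V) :
    wedge B a a ![u, v, w, z] = 2 * (B (a ![u, v]) (a ![w, z]) - B (a ![u, w]) (a ![v, z])
      + B (a ![u, z]) (a ![v, w])) := by
  have h := factorial_smul_wedge_apply B a a ![u, v, w, z]
  have e : ∀ f : Fin 2 → V, f = ![f 0, f 1] := fun f => by ext i; fin_cases i <;> rfl
  have h2 := sum_sign_smul_fin_four (fun x y s t => B (a ![![u, v, w, z] x, ![u, v, w, z] y])
    (a ![![u, v, w, z] s, ![u, v, w, z] t])) (by
      intro x y s t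
      have := a.map_swap ![![u, v, w, z] x, ![u, v, w, z] y] (i := 0) (j := 1) (by decide)
      have e2 : (![![u, v, w, z] x, ![u, v, w, z] y] ∘ ⇑(Equiv.swap (0 : Fin 2) 1)) =
          ![![u, v, w, z] y, ![u, v, w, z] x] := by ext i; fin_cases i <;> rfl
      rw [e2] at this
      rw [this]; simp) (fun x y s t => hB _ _)
  have h3 := h.trans (Eq.trans (Finset.sum_congr rfl fun σ _ => by
    rw [e (fun i => ![u, v, w, z] (σ (Fin.castAdd 2 i))),
      e (fun i => ![u, v, w, z] (σ (Fin.natAdd 2 i)))]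
    rfl) h2)
  simp [Nat.factorial] at h3
  linarith

end Wedge

/-! ### Matrices of linear maps and 2-forms on `ℝ²ⁿ` -/

section Mat

variable {n : ℕ}

theorem sum_smul_stdVec (v : R2 n) : ∑ a, v a • stdVec a = v := by
  ext i
  simp [stdVec, Finset.sum_apply, Pi.single_apply]

theorem stdVec_apply (a b : Fin (2 * n)) : (stdVec a : R2 n) b = (1 : Matrix _ _ ℝ) b a := by
  simp [stdVec, Matrix.one_apply]

/-- The matrix of a linear endomorphism of `ℝ²ⁿ`. -/
def clmMat (L : R2 n →L[ℝ] R2 n) : Matrix (Fin (2 * n)) (Fin (2 * n)) ℝ :=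
  Matrix.of fun a b => L (stdVec b) a

theorem apply_stdVec (L : R2 n →L[ℝ] R2 n) (b : Fin (2 * n)) :
    L (stdVec b) = ∑ a, clmMat L a b • stdVec a :=
  (sum_smul_stdVec (L (stdVec b))).symm

theorem clmMat_comp (L K : R2 n →L[ℝ] R2 n) : clmMat (L.comp K) = clmMat L * clmMat K := by
  ext a b
  rw [Matrix.mul_apply]
  change L (K (stdVec b)) a = _
  rw [apply_stdVec K, map_sum]
  simp [clmMat, mul_comm]

theorem clmMat_id : clmMat (ContinuousLinearMap.id ℝ (R2 n)) = 1 := by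
  ext a b
  exact stdVec_apply b a

theorem clmMat_neg (L : R2 n →L[ℝ] R2 n) : clmMat (-L) = -clmMat L := by
  ext a b
  simp [clmMat]

theorem clmMat_det (L : R2 n →L[ℝ] R2 n) : (clmMat L).det = L.det := by
  have : clmMat L = LinearMap.toMatrix (EuclideanSpace.basisFun _ ℝ).toBasis
      (EuclideanSpace.basisFun _ ℝ).toBasis (L : R2 n →ₗ[ℝ] R2 n) := by
    ext a b
    simp [clmMat, LinearMap.toMatrix_apply, stdVec]
  rw [this, LinearMap.det_toMatrix]

variable {M : Type*} [AddCommGroup M] [Module ℝ M]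

theorem bilin_apply_apply (β : R2 n →ₗ[ℝ] R2 n →ₗ[ℝ] M) (L K : R2 n →L[ℝ] R2 n)
    (a b : Fin (2 * n)) :
    β (L (stdVec a)) (K (stdVec b)) =
      ∑ c, ∑ d, (clmMat L c a * clmMat K d b) • β (stdVec c) (stdVec d) := by
  rw [apply_stdVec L, apply_stdVec K]
  simp only [map_sum, LinearMap.sum_apply, map_smul, LinearMap.smul_apply, Finset.smul_sum,
    smul_smul]
  rw [Finset.sum_comm]
  exact Finset.sum_congr rfl fun _ _ => Finset.sum_congr rfl fun _ _ => by rw [mul_comm]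

theorem twoForm_swap {V : Type*} [AddCommGroup V] [Module ℝ V]
    (α : V [⋀^Fin 2]→ₗ[ℝ] M) (u v : V) : α ![u, v] = -α ![v, u] := by
  have := α.map_swap ![v, u] (i := 0) (j := 1) (by decide)
  have e : (![v, u] ∘ ⇑(Equiv.swap (0 : Fin 2) 1)) = ![u, v] := by
    ext i : 1; fin_cases i <;> rfl
  rwa [e] at this

theorem twoForm_cons_add {V : Type*} [AddCommGroup V] [Module ℝ V]
    (α : V [⋀^Fin 2]→ₗ[ℝ] M) (u u' v : V) :
    α ![u + u', v] = α ![u, v] + α ![u', v] := by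
  have h : ∀ x : V, Function.update ![(0 : V), v] 0 x = ![x, v] := fun x => by
    ext i : 1; fin_cases i <;> rfl
  have := α.map_update_add ![(0 : V), v] 0 u u'
  rwa [h, h, h] at this

theorem twoForm_cons_smul {V : Type*} [AddCommGroup V] [Module ℝ V]
    (α : V [⋀^Fin 2]→ₗ[ℝ] M) (c : ℝ) (u v : V) :
    α ![c • u, v] = c • α ![u, v] := by
  have h : ∀ x : V, Function.update ![(0 : V), v] 0 x = ![x, v] := fun x => by
    ext i : 1; fin_cases i <;> rfl
  have := α.map_update_smul ![(0 : V), v] 0 c u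
  rwa [h, h] at this

/-- An alternating bilinear map as a bilinear map. -/
def twoFormBilin (α : R2 n [⋀^Fin 2]→ₗ[ℝ] M) : R2 n →ₗ[ℝ] R2 n →ₗ[ℝ] M :=
  LinearMap.mk₂ ℝ (fun u v => α ![u, v])
    (fun u u' v => by simp only [twoForm_cons_add])
    (fun c u v => by simp only [twoForm_cons_smul])
    (fun u v v' => by
      rw [twoForm_swap α u, twoForm_swap α u v, twoForm_swap α u v', twoForm_cons_add, neg_add])
    (fun c u v => by rw [twoForm_swap α u, twoForm_swap α u v, twoForm_cons_smul, smul_neg])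

theorem twoFormBilin_apply (α : R2 n [⋀^Fin 2]→ₗ[ℝ] M) (u v : R2 n) :
    twoFormBilin α u v = α ![u, v] := rfl

theorem twoForm_apply_apply (α : R2 n [⋀^Fin 2]→ₗ[ℝ] M) (L K : R2 n →L[ℝ] R2 n)
    (a b : Fin (2 * n)) :
    α ![L (stdVec a), K (stdVec b)] =
      ∑ c, ∑ d, (clmMat L c a * clmMat K d b) • α ![stdVec c, stdVec d] :=
  bilin_apply_apply (twoFormBilin α) L K a b

/-- The matrix of a scalar 2-form. -/
def formMat (α : R2 n [⋀^Fin 2]→ₗ[ℝ] ℝ) : Matrix (Fin (2 * n)) (Fin (2 * n)) ℝ :=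
  Matrix.of fun a b => α ![stdVec a, stdVec b]

theorem of_twoForm_apply_apply (α : R2 n [⋀^Fin 2]→ₗ[ℝ] ℝ) (L K : R2 n →L[ℝ] R2 n) :
    (Matrix.of fun a b => α ![L (stdVec a), K (stdVec b)]) =
      (clmMat L)ᵀ * formMat α * clmMat K := by
  ext a b
  rw [Matrix.of_apply, twoForm_apply_apply, Matrix.mul_apply, Finset.sum_comm]
  refine Finset.sum_congr rfl fun d _ => ?_
  rw [Matrix.mul_apply, Finset.sum_mul]
  refine Finset.sum_congr rfl fun c _ => ?_
  simp only [formMat, Matrix.of_apply, Matrix.transpose_apply, smul_eq_mul]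
  ring

theorem posDef_of_quadratic {p : Matrix (Fin (2 * n)) (Fin (2 * n)) ℝ} (hp : pᵀ = p)
    (h : ∀ v : R2 n, v ≠ 0 → 0 < ∑ a, ∑ b, v a * p a b * v b) : p.PosDef := by
  refine Matrix.PosDef.of_dotProduct_mulVec_pos ?_ fun v hv => ?_
  · rw [Matrix.IsHermitian, Matrix.conjTranspose_eq_transpose_of_trivial, hp]
  · have := h (WithLp.toLp 2 v) (by simpa using hv)
    simpa [dotProduct, Matrix.mulVec, Finset.mul_sum, mul_assoc] using this

end Mat

/-! ### Pointwise contractions: the operator Λ, norms of 2-forms and the (0,2) part. -/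

section Points

variable {n : ℕ} {X : Type*} [TopologicalSpace X] [ChartedSpace (R2 n) X] {Ω : SymplecticForm n X}

/-- The value of a symplectic form at a point. -/
def SymplecticForm.at (Ω : SymplecticForm n X) (x : X) : R2 n [⋀^Fin 2]→ₗ[ℝ] ℝ :=
  (Ω.form x).toAlternatingMap

/-- The value of an almost complex structure at a point. -/
def CompatibleACS.at (j : CompatibleACS Ω) (x : X) : R2 n →L[ℝ] R2 n := j.J x

theorem SymplecticForm.mul_clmMat (Ω : SymplecticForm n X) (x : X) (K : R2 n →L[ℝ] R2 n) :
    formMat (Ω.at x) * clmMat K = Matrix.of fun a b => Ω.at x ![stdVec a, K (stdVec b)] := by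
  have := of_twoForm_apply_apply (Ω.at x) (ContinuousLinearMap.id ℝ (R2 n)) K
  rw [clmMat_id, Matrix.transpose_one, one_mul] at this
  exact this.symm

theorem CompatibleACS.isCompatiblePair (j : CompatibleACS Ω) (x : X) :
    IsCompatiblePair (formMat (Ω.at x)) (clmMat (j.at x)) := by
  have sq : clmMat (j.at x) * clmMat (j.at x) = -1 := by
    have h2 : (j.at x).comp (j.at x) = -ContinuousLinearMap.id ℝ (R2 n) := by
      ext1 u; exact j.sq x u
    rw [← clmMat_comp, h2, clmMat_neg, clmMat_id]
  have hc : (clmMat (j.at x))ᵀ * formMat (Ω.at x) * clmMat (j.at x) = formMat (Ω.at x) := by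
    rw [← of_twoForm_apply_apply]
    ext a b
    exact j.compat x (stdVec a) (stdVec b)
  have hs : (formMat (Ω.at x))ᵀ = -formMat (Ω.at x) := by
    ext a b
    exact twoForm_swap (Ω.at x) (stdVec b) (stdVec a)
  refine ⟨hs, sq, hc, posDef_of_quadratic ?_ fun v hv => ?_⟩
  · have h4 : (clmMat (j.at x))ᵀ * formMat (Ω.at x) = -(formMat (Ω.at x) * clmMat (j.at x)) := by
      have h5 : (clmMat (j.at x))ᵀ * formMat (Ω.at x) * (clmMat (j.at x) * clmMat (j.at x)) =
          formMat (Ω.at x) * clmMat (j.at x) := by rw [← mul_assoc, hc]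
      rw [sq, mul_neg, mul_one] at h5
      rw [← h5, neg_neg]
    rw [Matrix.transpose_mul, hs, mul_neg, h4, neg_neg]
  · have h5 : 0 < twoFormBilin (Ω.at x) v (j.at x v) := j.pos x v hv
    have h6 : twoFormBilin (Ω.at x) v (j.at x v) =
        ∑ a, ∑ b, v a * Ω.at x ![stdVec a, j.at x (stdVec b)] * v b := by
      have e : v = ∑ a, v a • stdVec a := (sum_smul_stdVec v).symm
      have e' : j.at x v = ∑ b, v b • j.at x (stdVec b) := by
        conv_lhs => rw [e]
        rw [map_sum]
        simp only [map_smul]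
      rw [e']
      conv_lhs => rw [e]
      rw [bilin_sum_smul]
      refine Finset.sum_congr rfl fun a _ => Finset.sum_congr rfl fun b _ => ?_
      rw [twoFormBilin_apply]
      simp only [sum_smul_stdVec]
      ring
    rw [Ω.mul_clmMat]
    rw [h6] at h5
    exact h5

theorem alternatingMap_sum_apply {V M : Type*} [AddCommGroup V] [Module ℝ V] [AddCommGroup M]
    [Module ℝ M] {ι : Type*} {k : ℕ} (s : Finset ι) (f : ι → V [⋀^Fin k]→ₗ[ℝ] M) (v : Fin k → V) :
    (∑ i ∈ s, f i) v = ∑ i ∈ s, f i v := by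
  classical
  induction s using Finset.induction_on with
  | empty => simp
  | insert a s ha ih => rw [Finset.sum_insert ha, Finset.sum_insert ha, AlternatingMap.add_apply, ih]

/-- The inverse matrix of the symplectic form at a point. -/
def SymplecticForm.inv (Ω : SymplecticForm n X) (x : X) : Matrix (Fin (2 * n)) (Fin (2 * n)) ℝ :=
  (formMat (Ω.at x))⁻¹

theorem CompatibleACS.invGram_eq (j : CompatibleACS Ω) (x : X) :
    invGram j.metric x = (formMat (Ω.at x) * clmMat (j.at x))⁻¹ := by
  rw [Ω.mul_clmMat]
  rfl

variable {M : Type*} [AddCommGroup M] [Module ℝ M]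

/-- The metric and J enter Λ only through g⁻¹Jᵀ = −ω⁻¹, so Λ depends on the symplectic form alone.
-/
theorem lefschetzAdjoint_apply (j : CompatibleACS Ω) (x : X) {k : ℕ}
    (α : R2 n [⋀^Fin (k + 2)]→ₗ[ℝ] M) (v : Fin k → R2 n) :
    lefschetzAdjoint j x (k := k) α v = -(1 / 2 : ℝ) • ∑ a, ∑ b, Ω.inv x a b •
      α (Matrix.vecCons (stdVec a) (Matrix.vecCons (stdVec b) v)) := by
  have h1 : ∀ a b, ((α.curryLeft (stdVec a)).curryLeft (j.at x (stdVec b))) v =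
      ∑ c, clmMat (j.at x) c b • α (Matrix.vecCons (stdVec a) (Matrix.vecCons (stdVec c) v)) := by
    intro a b
    rw [apply_stdVec, map_sum, alternatingMap_sum_apply]
    refine Finset.sum_congr rfl fun c _ => ?_
    rw [map_smul, AlternatingMap.smul_apply]
    rfl
  have h2 : lefschetzAdjoint j x (k := k) α v = (1 / 2 : ℝ) • ∑ a, ∑ b, invGram j.metric x a b •
      ((α.curryLeft (stdVec a)).curryLeft (j.at x (stdVec b))) v := by
    change ((1 / 2 : ℝ) • ∑ a, ∑ b, invGram j.metric x a b •
      (α.curryLeft (stdVec a)).curryLeft (j.at x (stdVec b))) v = _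
    rw [AlternatingMap.smul_apply, alternatingMap_sum_apply]
    congr 1
    refine Finset.sum_congr rfl fun a _ => ?_
    rw [alternatingMap_sum_apply]
    rfl
  rw [h2]
  simp_rw [h1]
  have h3 : ∀ a c, Ω.inv x a c = -∑ b, invGram j.metric x a b * clmMat (j.at x) c b := by
    intro a c
    have h4 := (j.isCompatiblePair x).metric_inv_mul_transpose
    rw [← j.invGram_eq] at h4
    have h5 := congrFun (congrFun h4 a) c
    rw [Matrix.mul_apply] at h5
    simp only [Matrix.transpose_apply] at h5
    rw [h5]
    simp [SymplecticForm.inv]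
  simp_rw [h3]
  rw [neg_smul, ← smul_neg, ← Finset.sum_neg_distrib]
  congr 1
  refine Finset.sum_congr rfl fun a _ => ?_
  rw [← Finset.sum_neg_distrib]
  simp only [neg_smul, neg_neg, Finset.sum_smul, Finset.smul_sum, smul_smul]
  rw [Finset.sum_comm]

/-- The components of a 2-form at a point. -/
def comps (α : R2 n [⋀^Fin 2]→ₗ[ℝ] M) (a b : Fin (2 * n)) : M := α ![stdVec a, stdVec b]

/-- The contraction of a family of vectors with a contravariant 2-tensor. -/
def contract {ι : Type*} [Fintype ι] (p : Matrix ι ι ℝ) (F : ι → ι → M) : M :=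
  -(1 / 2 : ℝ) • ∑ a, ∑ b, p a b • F a b

theorem lefschetzAdjoint_two (j : CompatibleACS Ω) (x : X) (α : R2 n [⋀^Fin 2]→ₗ[ℝ] M) :
    lefschetzAdjoint j x (k := 0) α ![] = contract (Ω.inv x) (comps α) :=
  lefschetzAdjoint_apply j x (k := 0) α ![]

/-- The full contraction of the square of a family of vectors with a contravariant 2-tensor. -/
def topo {ι : Type*} [Fintype ι] (B : M →ₗ[ℝ] M →ₗ[ℝ] ℝ) (q : Matrix ι ι ℝ) (F : ι → ι → M) : ℝ :=
  2 * B (contract q F) (contract q F) - pairing B q q F F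

/-- The splitting ab|cd gives four times the square of the trace `contract q F`. By skewness of q,
each of the other two splittings gives −`pairing B q q F F`. -/
theorem sum_mul_wedge_eq_topo {ι : Type*} [Fintype ι] [DecidableEq ι] (B : M →ₗ[ℝ] M →ₗ[ℝ] ℝ) {q : Matrix ι ι ℝ}
    (hskew : ∀ a b, q a b = -q b a) (F : ι → ι → M) :
    ∑ c, ∑ d, ∑ a, ∑ b, q c d * q a b * (B (F a b) (F c d) - B (F a c) (F b d) + B (F a d) (F b c)) =
      2 * topo B q F := by
  have h5 : B (contract q F) (contract q F) =
      (1 / 4) * ∑ c, ∑ d, ∑ a, ∑ b, q c d * q a b * B (F a b) (F c d) := by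
    simp only [contract, map_smul, LinearMap.smul_apply, map_sum, LinearMap.sum_apply, smul_eq_mul,
      Finset.mul_sum]
    refine Finset.sum_congr rfl fun _ _ => Finset.sum_congr rfl fun _ _ =>
      Finset.sum_congr rfl fun _ _ => Finset.sum_congr rfl fun _ _ => ?_
    ring
  have h6 : pairing B q q F F = ∑ c, ∑ d, ∑ a, ∑ b, q c d * q a b * B (F a c) (F b d) := by
    simp only [pairing, Finset.mul_sum]
    rw [sum₄_comm]
    refine Finset.sum_congr rfl fun _ _ => Finset.sum_congr rfl fun _ _ =>
      Finset.sum_congr rfl fun _ _ => Finset.sum_congr rfl fun _ _ => ?_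
    ring
  have h7 : pairing B q q F F = -∑ c, ∑ d, ∑ a, ∑ b, q c d * q a b * B (F a d) (F b c) := by
    rw [h6, Finset.sum_comm, ← Finset.sum_neg_distrib]
    refine Finset.sum_congr rfl fun c _ => ?_
    rw [← Finset.sum_neg_distrib]
    refine Finset.sum_congr rfl fun d _ => ?_
    rw [← Finset.sum_neg_distrib]
    refine Finset.sum_congr rfl fun a _ => ?_
    rw [← Finset.sum_neg_distrib]
    refine Finset.sum_congr rfl fun b _ => ?_
    rw [hskew d c]; ring
  simp only [mul_add, mul_sub, Finset.sum_add_distrib, Finset.sum_sub_distrib]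
  rw [topo]
  linarith

/-- In invariant terms, Λ²(F∧F) = 2|ΛF|² − ω^{ab}ω^{cd}B(F_{ac}, F_{bd}). No J appears on the right.
-/
theorem lefschetzAdjoint_wedge (j : CompatibleACS Ω) (x : X) (B : M →ₗ[ℝ] M →ₗ[ℝ] ℝ)
    (hB : ∀ u v, B u v = B v u) (α : R2 n [⋀^Fin 2]→ₗ[ℝ] M) :
    lefschetzAdjoint j x (k := 0) (lefschetzAdjoint j x (k := 2) (wedge B α α)) ![] =
      topo B (Ω.inv x) (comps α) := by
  set q := Ω.inv x with hq
  have h1 := lefschetzAdjoint_apply j x (k := 0) (lefschetzAdjoint j x (k := 2) (wedge B α α)) ![]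
  have h2 : ∀ c d, lefschetzAdjoint j x (k := 2) (wedge B α α) ![stdVec c, stdVec d] =
      -(1 / 2 : ℝ) • ∑ a, ∑ b, q a b • (2 * (B (comps α a b) (comps α c d)
        - B (comps α a c) (comps α b d) + B (comps α a d) (comps α b c))) := by
    intro c d
    have h3 := lefschetzAdjoint_apply j x (k := 2) (wedge B α α) ![stdVec c, stdVec d]
    refine h3.trans ?_
    congr 1
    refine Finset.sum_congr rfl fun a _ => Finset.sum_congr rfl fun b _ => ?_
    congr 1
    exact wedge_two_two_apply B hB α _ _ _ _
  have h4 : lefschetzAdjoint j x (k := 0) (lefschetzAdjoint j x (k := 2) (wedge B α α)) ![] =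
      -(1 / 2 : ℝ) • ∑ c, ∑ d, q c d •
        lefschetzAdjoint j x (k := 2) (wedge B α α) ![stdVec c, stdVec d] := h1
  rw [h4]
  simp_rw [h2]
  have h5 := sum_mul_wedge_eq_topo B (j.isCompatiblePair x).inv_skew_apply (comps α)
  -- The two factors −1/2 of Λ and the factor 2 of the wedge product leave 1/2 in front of the sum,
  -- which `h5` evaluates as 2 · `topo`.
  rw [← mul_right_inj' (two_ne_zero' ℝ)]
  refine Eq.trans ?_ h5
  simp only [smul_eq_mul, Finset.mul_sum]
  refine Finset.sum_congr rfl fun _ _ => Finset.sum_congr rfl fun _ _ =>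
      Finset.sum_congr rfl fun _ _ => Finset.sum_congr rfl fun _ _ => ?_
  rw [hq, SymplecticForm.inv]
  ring

theorem normSqTwoForm_eq (j : CompatibleACS Ω) (x : X) (B : M →ₗ[ℝ] M →ₗ[ℝ] ℝ)
    (α : R2 n [⋀^Fin 2]→ₗ[ℝ] M) :
    normSqTwoForm j.metric x B α = (1 / 2) * pairing B (invGram j.metric x) (invGram j.metric x)
      (comps α) (comps α) := by
  simp only [normSqTwoForm, pairing, Finset.mul_sum]
  refine Finset.sum_congr rfl fun _ _ => Finset.sum_congr rfl fun _ _ =>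
      Finset.sum_congr rfl fun _ _ => Finset.sum_congr rfl fun _ _ => ?_
  rw [mul_assoc]
  rfl

/-- The real part of F^{0,2} is ¼(F − F(J·,J·)); the condition F^{0,2} = 0 is needed only through
this. -/
theorem twist_comps (j : CompatibleACS Ω) (x : X) (α : R2 n [⋀^Fin 2]→ₗ[ℝ] M)
    (h : ∀ u v, part02 j x α u v = 0) (a b : Fin (2 * n)) :
    twist (clmMat (j.at x)) (comps α) a b = comps α a b := by
  have h1 : twist (clmMat (j.at x)) (comps α) a b = α ![j.at x (stdVec a), j.at x (stdVec b)] :=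
    (twoForm_apply_apply α _ _ a b).symm
  rw [h1]
  -- Taking real parts of the complex coefficients, as a map from ℂ ⊗ M to M.
  let φ : TensorProduct ℝ ℂ M →ₗ[ℝ] M :=
    TensorProduct.lift ((LinearMap.lsmul ℝ M).comp Complex.reLm)
  have h2 : part02 j x α (stdVec a) (stdVec b) = 0 := h _ _
  have h3 : part02 j x α (stdVec a) (stdVec b) =
      (1 / 4 : ℂ) ⊗ₜ[ℝ] (comps α a b - α ![j.at x (stdVec a), j.at x (stdVec b)])
      + (Complex.I / 4) ⊗ₜ[ℝ] (α ![j.at x (stdVec a), stdVec b] + α ![stdVec a, j.at x (stdVec b)]) :=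
    rfl
  have h4 := congrArg φ (h3.symm.trans h2)
  have e1 : (1 / 4 : ℂ).re = 1 / 4 := by norm_num
  have e2 : (Complex.I / 4 : ℂ).re = 0 := by norm_num
  simp only [φ, map_add, TensorProduct.lift.tmul, LinearMap.comp_apply, Complex.reLm_coe, e1, e2,
    map_zero, LinearMap.zero_apply, add_zero] at h4
  have h5 : (1 / 4 : ℝ) • (comps α a b - α ![j.at x (stdVec a), j.at x (stdVec b)]) = 0 := h4
  rw [smul_eq_zero_iff_right (by norm_num), sub_eq_zero] at h5
  exact h5.symm

end Points

/-! ### Tensors in charts -/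

section Charts

set_option linter.unusedSectionVars false

variable {n : ℕ} {X : Type*} [TopologicalSpace X] [ChartedSpace (R2 n) X] {Ω : SymplecticForm n X}

/-- Partial derivatives. -/
def pd {W : Type*} [NormedAddCommGroup W] [NormedSpace ℝ W] (a : Fin (2 * n)) (f : R2 n → W)
    (y : R2 n) : W := fderiv ℝ f y (stdVec a)

/-- The derivative of the inverse of the chart at `x₀`. -/
def chartD (x₀ : X) (y : R2 n) : R2 n →L[ℝ] R2 n :=
  mfderiv 𝓘(ℝ, R2 n) 𝓘(ℝ, R2 n) (chartAt (R2 n) x₀).symm y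

/-- The matrix of the derivative of the inverse of the chart at `x₀`. -/
def jac (x₀ : X) (y : R2 n) : Matrix (Fin (2 * n)) (Fin (2 * n)) ℝ := clmMat (chartD x₀ y)

/-- The matrix of the symplectic form in the chart at `x₀`. -/
def SymplecticForm.mat (Ω : SymplecticForm n X) (x₀ : X) (y : R2 n) :
    Matrix (Fin (2 * n)) (Fin (2 * n)) ℝ :=
  Matrix.of fun a b => Ω.form.inChart x₀ y ![stdVec a, stdVec b]

theorem SymplecticForm.mat_eq (Ω : SymplecticForm n X) (x₀ : X) (y : R2 n) :
    Ω.mat x₀ y = (jac x₀ y)ᵀ * formMat (Ω.at ((chartAt (R2 n) x₀).symm y)) * jac x₀ y := by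
  rw [jac, ← of_twoForm_apply_apply]
  ext a b
  have : ∀ L : R2 n → R2 n, (fun i => L (![stdVec a, stdVec b] i)) = ![L (stdVec a), L (stdVec b)] := by
    intro L; ext i : 1; fin_cases i <;> rfl
  exact congrArg (Ω.at ((chartAt (R2 n) x₀).symm y)) (this (chartD x₀ y))

variable [IsManifold 𝓘(ℝ, R2 n) ∞ X]

theorem isUnit_det_jac (x₀ : X) {y : R2 n} (hy : y ∈ (chartAt (R2 n) x₀).target) :
    IsUnit (jac x₀ y).det := by
  let L : R2 n →L[ℝ] R2 n :=
    mfderiv 𝓘(ℝ, R2 n) 𝓘(ℝ, R2 n) (chartAt (R2 n) x₀) ((chartAt (R2 n) x₀).symm y)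
  have h : L.comp (chartD x₀ y) = ContinuousLinearMap.id ℝ (R2 n) :=
    mfderiv_chart_comp_mfderiv_chart_symm x₀ hy
  have h2 := congrArg clmMat h
  rw [clmMat_comp, clmMat_id] at h2
  exact Matrix.isUnit_det_of_left_inverse h2

theorem jac_mul_endMatrix (j : CompatibleACS Ω) (x₀ : X) {y : R2 n}
    (hy : y ∈ (chartAt (R2 n) x₀).target) :
    jac x₀ y * endMatrix j.J x₀ y = clmMat (j.at ((chartAt (R2 n) x₀).symm y)) * jac x₀ y := by
  let L : R2 n →L[ℝ] R2 n :=
    mfderiv 𝓘(ℝ, R2 n) 𝓘(ℝ, R2 n) (chartAt (R2 n) x₀) ((chartAt (R2 n) x₀).symm y)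
  have h : L.comp (chartD x₀ y) = ContinuousLinearMap.id ℝ (R2 n) :=
    mfderiv_chart_comp_mfderiv_chart_symm x₀ hy
  have h2 := congrArg clmMat h
  rw [clmMat_comp, clmMat_id] at h2
  have h3 : endMatrix j.J x₀ y =
      clmMat (L.comp ((j.at ((chartAt (R2 n) x₀).symm y)).comp (chartD x₀ y))) := rfl
  rw [h3, clmMat_comp, clmMat_comp]
  change jac x₀ y * _ = _
  rw [← mul_assoc]
  have h4 : jac x₀ y * clmMat L = 1 := mul_eq_one_comm.1 h2
  rw [h4, one_mul]
  rfl

theorem endMatrix_eq (j : CompatibleACS Ω) (x₀ : X) {y : R2 n}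
    (hy : y ∈ (chartAt (R2 n) x₀).target) :
    endMatrix j.J x₀ y =
      (jac x₀ y)⁻¹ * clmMat (j.at ((chartAt (R2 n) x₀).symm y)) * jac x₀ y := by
  rw [mul_assoc, ← jac_mul_endMatrix j x₀ hy, ← mul_assoc,
    Matrix.nonsing_inv_mul _ (isUnit_det_jac x₀ hy), one_mul]

theorem metricMatrix_eq (j : CompatibleACS Ω) (x₀ : X) (y : R2 n) :
    metricMatrix j.metric x₀ y = (jac x₀ y)ᵀ * (formMat (Ω.at ((chartAt (R2 n) x₀).symm y)) *
      clmMat (j.at ((chartAt (R2 n) x₀).symm y))) * jac x₀ y := by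
  have h := of_twoForm_apply_apply (Ω.at ((chartAt (R2 n) x₀).symm y)) (chartD x₀ y)
    ((j.at ((chartAt (R2 n) x₀).symm y)).comp (chartD x₀ y))
  rw [clmMat_comp] at h
  rw [← mul_assoc, mul_assoc]
  exact h

theorem metricMatrix_eq_mul (j : CompatibleACS Ω) (x₀ : X) {y : R2 n}
    (hy : y ∈ (chartAt (R2 n) x₀).target) :
    metricMatrix j.metric x₀ y = Ω.mat x₀ y * endMatrix j.J x₀ y := by
  rw [Ω.mat_eq, mul_assoc, jac_mul_endMatrix j x₀ hy, metricMatrix_eq]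
  simp only [mul_assoc]

theorem IsCompatiblePair.conj {ι : Type*} [Fintype ι] [DecidableEq ι] {w J P : Matrix ι ι ℝ}
    (h : IsCompatiblePair w J) (hP : IsUnit P.det) :
    IsCompatiblePair (Pᵀ * w * P) (P⁻¹ * J * P) := by
  have h1 : P * P⁻¹ = 1 := Matrix.mul_nonsing_inv _ hP
  have h2 : P⁻¹ * P = 1 := Matrix.nonsing_inv_mul _ hP
  have h1' : (P⁻¹)ᵀ * Pᵀ = 1 := by rw [← Matrix.transpose_mul, h1, Matrix.transpose_one]
  have e : ∀ A B : Matrix ι ι ℝ, A * P * (P⁻¹ * B) = A * B := fun A B => by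
    rw [mul_assoc, ← mul_assoc P, h1, one_mul]
  refine ⟨?_, ?_, ?_, ?_⟩
  · rw [Matrix.transpose_mul, Matrix.transpose_mul, h.skew, Matrix.transpose_transpose]
    noncomm_ring
  · calc P⁻¹ * J * P * (P⁻¹ * J * P) = P⁻¹ * J * P * (P⁻¹ * (J * P)) := by simp only [mul_assoc]
      _ = P⁻¹ * (J * J) * P := by rw [e]; simp only [mul_assoc]
      _ = -1 := by rw [h.sq, mul_neg, mul_one, neg_mul, h2]
  · rw [Matrix.transpose_mul, Matrix.transpose_mul]
    calc Pᵀ * (Jᵀ * (P⁻¹)ᵀ) * (Pᵀ * w * P) * (P⁻¹ * J * P)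
        = Pᵀ * Jᵀ * ((P⁻¹)ᵀ * Pᵀ) * (w * P * (P⁻¹ * (J * P))) := by simp only [mul_assoc]
      _ = Pᵀ * (Jᵀ * w * J) * P := by rw [h1', e]; simp only [mul_one, mul_assoc]
      _ = _ := by rw [h.compat]
  · have : Pᵀ * w * P * (P⁻¹ * J * P) = Pᴴ * (w * J) * P := by
      rw [mul_assoc P⁻¹, e, Matrix.conjTranspose_eq_transpose_of_trivial]; simp only [mul_assoc]
    rw [this]
    refine h.pos.conjTranspose_mul_mul_same ?_
    exact Matrix.mulVec_injective_of_isUnit ((Matrix.isUnit_iff_isUnit_det _).2 hP)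

theorem CompatibleACS.isCompatiblePair_mat (j : CompatibleACS Ω) (x₀ : X) {y : R2 n}
    (hy : y ∈ (chartAt (R2 n) x₀).target) :
    IsCompatiblePair (Ω.mat x₀ y) (endMatrix j.J x₀ y) := by
  rw [endMatrix_eq j x₀ hy, Ω.mat_eq]
  exact (j.isCompatiblePair _).conj (isUnit_det_jac x₀ hy)

theorem jac_mul_mat_inv (Ω : SymplecticForm n X) (x₀ : X) {y : R2 n}
    (hy : y ∈ (chartAt (R2 n) x₀).target) :
    jac x₀ y * (Ω.mat x₀ y)⁻¹ * (jac x₀ y)ᵀ = Ω.inv ((chartAt (R2 n) x₀).symm y) :=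
  mul_inv_mul_transpose (Ω.mat_eq x₀ y).symm (isUnit_det_jac x₀ hy)

theorem jac_mul_metric_inv (j : CompatibleACS Ω) (x₀ : X) {y : R2 n}
    (hy : y ∈ (chartAt (R2 n) x₀).target) :
    jac x₀ y * (metricMatrix j.metric x₀ y)⁻¹ * (jac x₀ y)ᵀ =
      invGram j.metric ((chartAt (R2 n) x₀).symm y) := by
  rw [j.invGram_eq]
  exact mul_inv_mul_transpose (metricMatrix_eq j x₀ y).symm (isUnit_det_jac x₀ hy)

/-! #### Smoothness -/

theorem contMDiffOn_chart_symm' (x₀ : X) :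
    ContMDiffOn 𝓘(ℝ, R2 n) 𝓘(ℝ, R2 n) ∞ (chartAt (R2 n) x₀).symm (chartAt (R2 n) x₀).target :=
  contMDiffOn_chart_symm

theorem SymplecticForm.contDiffAt_mat (Ω : SymplecticForm n X) (x₀ : X) {y : R2 n}
    (hy : y ∈ (chartAt (R2 n) x₀).target) (a b : Fin (2 * n)) :
    ContDiffAt ℝ ∞ (fun z => Ω.mat x₀ z a b) y :=
  Ω.smooth.contDiffAt_pullback_apply (chartAt (R2 n) x₀).open_target (contMDiffOn_chart_symm' x₀) hy
    ![stdVec a, stdVec b]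

theorem CompatibleACS.contDiffAt_endMatrix (j : CompatibleACS Ω) (x₀ : X) {y : R2 n}
    (hy : y ∈ (chartAt (R2 n) x₀).target) (a b : Fin (2 * n)) :
    ContDiffAt ℝ ∞ (fun z => endMatrix j.J x₀ z a b) y := by
  have h1 : ContDiffAt ℝ ∞ (EndField.inChart j.J x₀) y :=
    (j.smooth x₀).contDiffAt ((chartAt (R2 n) x₀).open_target.mem_nhds hy)
  have h2 := h1.clm_apply (contDiffAt_const (c := (stdVec b : R2 n)))
  exact (EuclideanSpace.proj (𝕜 := ℝ) a).contDiff.contDiffAt.comp y h2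

/-- Closedness is assumed at each x in the chart at x only. Naturality of the exterior derivative
under the inverse of the chart at `x₀` carries it to all points of that chart. -/
theorem SymplecticForm.pd_mat_cyclic (Ω : SymplecticForm n X) (x₀ : X) {y : R2 n}
    (hy : y ∈ (chartAt (R2 n) x₀).target) (a b c : Fin (2 * n)) :
    pd a (fun z => Ω.mat x₀ z b c) y + pd b (fun z => Ω.mat x₀ z c a) y
      + pd c (fun z => Ω.mat x₀ z a b) y = 0 := by
  have h1 := Ω.smooth.extDeriv_pullback (chartAt (R2 n) x₀).open_target
    (contMDiffOn_chart_symm' x₀) hy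
  rw [Ω.closed] at h1
  have h2 := congrArg (fun F : R2 n [⋀^Fin 3]→L[ℝ] ℝ => F ![stdVec a, stdVec b, stdVec c]) h1
  have h3 : extDeriv (Ω.form.pullback (chartAt (R2 n) x₀).symm) y ![stdVec a, stdVec b, stdVec c] = 0 :=
    h2
  rw [extDeriv_apply (Ω.smooth.differentiableAt_pullback (chartAt (R2 n) x₀).open_target
    (contMDiffOn_chart_symm' x₀) hy)] at h3
  rw [Fin.sum_univ_three] at h3
  have e0 : (0 : Fin 3).removeNth ![(stdVec a : R2 n), stdVec b, stdVec c] = ![stdVec b, stdVec c] := by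
    ext i : 1; fin_cases i <;> rfl
  have e1 : (1 : Fin 3).removeNth ![(stdVec a : R2 n), stdVec b, stdVec c] = ![stdVec a, stdVec c] := by
    ext i : 1; fin_cases i <;> rfl
  have e2 : (2 : Fin 3).removeNth ![(stdVec a : R2 n), stdVec b, stdVec c] = ![stdVec a, stdVec b] := by
    ext i : 1; fin_cases i <;> rfl
  rw [e0, e1, e2] at h3
  have e4 : (fun z => Ω.mat x₀ z c a) = fun z => -Ω.mat x₀ z a c := by
    funext z
    exact twoForm_swap (Ω.form.inChart x₀ z).toAlternatingMap (stdVec c) (stdVec a)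
  have e5 : pd b (fun z => Ω.mat x₀ z c a) y = -pd b (fun z => Ω.mat x₀ z a c) y := by
    rw [e4, pd, fderiv_fun_neg]; rfl
  rw [e5]
  simp only [Fin.val_zero, pow_zero, one_smul, Fin.val_one, pow_one, neg_smul, Fin.val_two,
    even_two, Even.neg_pow, one_pow] at h3
  exact h3

/-! #### Transition functions -/

/-- The transition function from the chart at `x₀` to the chart at `x₁`. -/
def transition (x₀ x₁ : X) : OpenPartialHomeomorph (R2 n) (R2 n) :=
  (chartAt (R2 n) x₀).symm.trans (chartAt (R2 n) x₁)

theorem transition_source (x₀ x₁ : X) : (transition x₀ x₁).source =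
    (chartAt (R2 n) x₀).target ∩ (chartAt (R2 n) x₀).symm ⁻¹' (chartAt (R2 n) x₁).source := by
  rw [transition, OpenPartialHomeomorph.trans_source]
  rfl

theorem mem_transition_source (x₀ x₁ : X) {y : R2 n} : y ∈ (transition x₀ x₁).source ↔
    y ∈ (chartAt (R2 n) x₀).target ∧ (chartAt (R2 n) x₀).symm y ∈ (chartAt (R2 n) x₁).source := by
  rw [transition_source]; rfl

theorem transition_apply (x₀ x₁ : X) (y : R2 n) :
    transition x₀ x₁ y = chartAt (R2 n) x₁ ((chartAt (R2 n) x₀).symm y) := rfl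

theorem transition_target (x₀ x₁ : X) :
    (transition (n := n) x₀ x₁).target = (transition x₁ x₀).source := by
  ext y
  simp only [transition, OpenPartialHomeomorph.trans_target, OpenPartialHomeomorph.trans_source]
  rfl

theorem transition_mem_target (x₀ x₁ : X) {y : R2 n} (hy : y ∈ (transition x₀ x₁).source) :
    transition x₀ x₁ y ∈ (chartAt (R2 n) x₁).target :=
  (chartAt (R2 n) x₁).map_source ((mem_transition_source x₀ x₁).1 hy).2

theorem symm_transition (x₀ x₁ : X) {y : R2 n} (hy : y ∈ (transition x₀ x₁).source) :
    (chartAt (R2 n) x₁).symm (transition x₀ x₁ y) = (chartAt (R2 n) x₀).symm y :=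
  (chartAt (R2 n) x₁).left_inv ((mem_transition_source x₀ x₁).1 hy).2

theorem contDiffOn_transition (x₀ x₁ : X) :
    ContDiffOn ℝ ∞ (transition (n := n) x₀ x₁) (transition x₀ x₁).source := by
  rw [transition_source]
  exact contMDiffOn_chart_comp (contMDiffOn_chart_symm' x₀) x₁

theorem contDiffAt_transition (x₀ x₁ : X) {y : R2 n} (hy : y ∈ (transition x₀ x₁).source) :
    ContDiffAt ℝ ∞ (transition x₀ x₁) y :=
  (contDiffOn_transition x₀ x₁).contDiffAt ((transition x₀ x₁).open_source.mem_nhds hy)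

theorem chartD_transition (x₀ x₁ : X) {y : R2 n} (hy : y ∈ (transition x₀ x₁).source) :
    chartD x₀ y = (chartD x₁ (transition x₀ x₁ y)).comp (fderiv ℝ (transition x₀ x₁) y) := by
  obtain ⟨h0, h1⟩ := (mem_transition_source x₀ x₁).1 hy
  have h2 := fderiv_chart_comp (chartAt (R2 n) x₀).open_target (contMDiffOn_chart_symm' x₀) x₁ h0 h1
  have h3 := mfderiv_chart_symm_comp_mfderiv_chart x₁ h1
  have h4 : fderiv ℝ (transition x₀ x₁) y = (show R2 n →L[ℝ] R2 n from
    mfderiv 𝓘(ℝ, R2 n) 𝓘(ℝ, R2 n) (chartAt (R2 n) x₁) ((chartAt (R2 n) x₀).symm y)).comp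
      (chartD x₀ y) := h2
  have h5 : (chartD x₁ (transition x₀ x₁ y)).comp (show R2 n →L[ℝ] R2 n from
    mfderiv 𝓘(ℝ, R2 n) 𝓘(ℝ, R2 n) (chartAt (R2 n) x₁) ((chartAt (R2 n) x₀).symm y)) =
    ContinuousLinearMap.id ℝ (R2 n) := h3
  rw [h4, ← ContinuousLinearMap.comp_assoc, h5, ContinuousLinearMap.id_comp]

/-- The Jacobian matrix of a transition function. -/
def transJac (x₀ x₁ : X) (y : R2 n) : Matrix (Fin (2 * n)) (Fin (2 * n)) ℝ :=
  clmMat (fderiv ℝ (transition x₀ x₁) y)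

theorem jac_eq_jac_mul (x₀ x₁ : X) {y : R2 n} (hy : y ∈ (transition x₀ x₁).source) :
    jac x₀ y = jac x₁ (transition x₀ x₁ y) * transJac x₀ x₁ y := by
  rw [jac, chartD_transition x₀ x₁ hy, clmMat_comp]
  rfl

theorem isUnit_det_transJac (x₀ x₁ : X) {y : R2 n} (hy : y ∈ (transition x₀ x₁).source) :
    IsUnit (transJac x₀ x₁ y).det := by
  have h := isUnit_det_jac x₀ ((mem_transition_source x₀ x₁).1 hy).1
  rw [jac_eq_jac_mul x₀ x₁ hy, Matrix.det_mul] at h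
  exact isUnit_of_mul_isUnit_right h

theorem mat_transition (Ω : SymplecticForm n X) (x₀ x₁ : X) {y : R2 n}
    (hy : y ∈ (transition x₀ x₁).source) :
    Ω.mat x₀ y = (transJac x₀ x₁ y)ᵀ * Ω.mat x₁ (transition x₀ x₁ y) * transJac x₀ x₁ y := by
  rw [Ω.mat_eq, Ω.mat_eq, symm_transition x₀ x₁ hy, jac_eq_jac_mul x₀ x₁ hy, Matrix.transpose_mul]
  simp only [mul_assoc]

theorem metricMatrix_transition (j : CompatibleACS Ω) (x₀ x₁ : X) {y : R2 n}
    (hy : y ∈ (transition x₀ x₁).source) :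
    metricMatrix j.metric x₀ y = (transJac x₀ x₁ y)ᵀ *
      metricMatrix j.metric x₁ (transition x₀ x₁ y) * transJac x₀ x₁ y := by
  rw [metricMatrix_eq, metricMatrix_eq, symm_transition x₀ x₁ hy, jac_eq_jac_mul x₀ x₁ hy,
    Matrix.transpose_mul]
  simp only [mul_assoc]

theorem transJac_mul_endMatrix (j : CompatibleACS Ω) (x₀ x₁ : X) {y : R2 n}
    (hy : y ∈ (transition x₀ x₁).source) :
    transJac x₀ x₁ y * endMatrix j.J x₀ y =
      endMatrix j.J x₁ (transition x₀ x₁ y) * transJac x₀ x₁ y := by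
  have h0 := jac_mul_endMatrix j x₀ ((mem_transition_source x₀ x₁).1 hy).1
  have h1 := jac_mul_endMatrix j x₁ (transition_mem_target x₀ x₁ hy)
  rw [symm_transition x₀ x₁ hy] at h1
  rw [jac_eq_jac_mul x₀ x₁ hy, ← mul_assoc, ← h1] at h0
  have h2 := Matrix.nonsing_inv_mul _ (isUnit_det_jac x₁ (transition_mem_target x₀ x₁ hy))
  have h3 := congrArg (fun A => (jac x₁ (transition x₀ x₁ y))⁻¹ * A) h0
  simp only [← mul_assoc, h2, one_mul] at h3
  exact h3

theorem contDiffAt_transJac (x₀ x₁ : X) {y : R2 n} (hy : y ∈ (transition x₀ x₁).source)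
    (a b : Fin (2 * n)) : ContDiffAt ℝ ∞ (fun z => transJac x₀ x₁ z a b) y := by
  have h1 : ContDiffAt ℝ ∞ (fderiv ℝ (transition x₀ x₁)) y :=
    (contDiffAt_transition x₀ x₁ hy).fderiv_right (m := ∞) (by simp)
  have h2 := h1.clm_apply (contDiffAt_const (c := (stdVec b : R2 n)))
  exact (EuclideanSpace.proj (𝕜 := ℝ) a).contDiff.contDiffAt.comp y h2

end Charts

/-! ### Calculus of matrix valued functions -/

section MatrixCalculus

set_option linter.unusedSectionVars false

variable {n : ℕ}

section Smooth

variable {ι : Type*} [Fintype ι] [DecidableEq ι] {E : Type*} [NormedAddCommGroup E]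
  [NormedSpace ℝ E]

/-- Smoothness of all entries of a matrix valued function at a point. -/
def SmoothMat (f : E → Matrix ι ι ℝ) (y : E) : Prop :=
  ∀ a b, ContDiffAt ℝ ∞ (fun z => f z a b) y

variable {f g : E → Matrix ι ι ℝ} {y : E}

theorem SmoothMat.mul (hf : SmoothMat f y) (hg : SmoothMat g y) :
    SmoothMat (fun z => f z * g z) y := by
  intro a b
  simp only [Matrix.mul_apply]
  exact ContDiffAt.sum fun c _ => (hf a c).mul (hg c b)

theorem SmoothMat.add (hf : SmoothMat f y) (hg : SmoothMat g y) :
    SmoothMat (fun z => f z + g z) y :=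
  fun a b => (hf a b).add (hg a b)

theorem SmoothMat.trace (hf : SmoothMat f y) : ContDiffAt ℝ ∞ (fun z => (f z).trace) y := by
  simp only [Matrix.trace]
  exact ContDiffAt.sum fun c _ => hf c c

theorem SmoothMat.det (hf : SmoothMat f y) : ContDiffAt ℝ ∞ (fun z => (f z).det) y := by
  simp only [Matrix.det_apply, Units.smul_def, zsmul_eq_mul]
  exact ContDiffAt.sum fun σ _ => contDiffAt_const.mul (contDiffAt_prod fun i _ => hf _ _)

/-- Cramer's rule: the entries of the inverse are minors divided by a determinant that does not
vanish. -/
theorem SmoothMat.inv (hf : SmoothMat f y) (h : IsUnit (f y).det) :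
    SmoothMat (fun z => (f z)⁻¹) y := by
  intro a b
  simp only [Matrix.inv_def, Ring.inverse_eq_inv', Matrix.smul_apply, smul_eq_mul,
    Matrix.adjugate_apply]
  refine (hf.det.inv h.ne_zero).mul (SmoothMat.det fun c d => ?_)
  by_cases hc : c = b
  · subst hc
    simp only [Matrix.updateRow_self]
    exact contDiffAt_const
  · simp only [Matrix.updateRow_ne hc]
    exact hf c d

theorem SmoothMat.diff (hf : SmoothMat f y) (a b : ι) : DifferentiableAt ℝ (fun z => f z a b) y :=
  (hf a b).differentiableAt (by simp)

theorem SmoothMat.congr (hf : SmoothMat f y) (h : g =ᶠ[𝓝 y] f) : SmoothMat g y :=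
  fun a b => (hf a b).congr_of_eventuallyEq (h.mono fun _ hz => congrFun (congrFun hz a) b)

theorem SmoothMat.eventually_isUnit (hf : SmoothMat f y) (h : IsUnit (f y).det) :
    ∀ᶠ z in 𝓝 y, IsUnit (f z).det := by
  filter_upwards [hf.det.continuousAt.eventually_ne h.ne_zero] with z hz
  exact isUnit_iff_ne_zero.2 hz

end Smooth

variable {W : Type*} [NormedAddCommGroup W] [NormedSpace ℝ W]

theorem ContDiffAt.pd {f : R2 n → W} {y : R2 n} (hf : ContDiffAt ℝ ∞ f y) (a : Fin (2 * n)) :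
    ContDiffAt ℝ ∞ (pd a f) y :=
  (hf.fderiv_right (m := ∞) (by simp)).clm_apply contDiffAt_const

theorem pd_congr {f g : R2 n → W} {y : R2 n} (h : f =ᶠ[𝓝 y] g) (a : Fin (2 * n)) :
    pd a f y = pd a g y := by
  rw [pd, pd, h.fderiv_eq]

theorem pd_add {f g : R2 n → W} {y : R2 n} (hf : DifferentiableAt ℝ f y)
    (hg : DifferentiableAt ℝ g y) (a : Fin (2 * n)) :
    pd a (fun z => f z + g z) y = pd a f y + pd a g y := by
  rw [pd, fderiv_fun_add hf hg]; rfl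

theorem pd_sub {f g : R2 n → W} {y : R2 n} (hf : DifferentiableAt ℝ f y)
    (hg : DifferentiableAt ℝ g y) (a : Fin (2 * n)) :
    pd a (fun z => f z - g z) y = pd a f y - pd a g y := by
  rw [pd, fderiv_fun_sub hf hg]; rfl

theorem pd_neg {f : R2 n → W} {y : R2 n} (a : Fin (2 * n)) :
    pd a (fun z => -f z) y = -pd a f y := by
  rw [pd, fderiv_fun_neg]; rfl

theorem pd_const (c : W) (y : R2 n) (a : Fin (2 * n)) : pd a (fun _ => c) y = 0 := by
  rw [pd, fderiv_fun_const]; rfl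

theorem pd_mul {f g : R2 n → ℝ} {y : R2 n} (hf : DifferentiableAt ℝ f y)
    (hg : DifferentiableAt ℝ g y) (a : Fin (2 * n)) :
    pd a (fun z => f z * g z) y = pd a f y * g y + f y * pd a g y := by
  rw [pd, fderiv_fun_mul hf hg]
  simp [pd]; ring

theorem pd_const_mul {f : R2 n → ℝ} {y : R2 n} (c : ℝ) (hf : DifferentiableAt ℝ f y)
    (a : Fin (2 * n)) : pd a (fun z => c * f z) y = c * pd a f y := by
  rw [pd_mul (differentiableAt_const c) hf, pd_const, zero_mul, zero_add]

theorem pd_sum {κ : Type*} {s : Finset κ} {f : κ → R2 n → W} {y : R2 n}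
    (hf : ∀ i ∈ s, DifferentiableAt ℝ (f i) y) (a : Fin (2 * n)) :
    pd a (fun z => ∑ i ∈ s, f i z) y = ∑ i ∈ s, pd a (f i) y := by
  rw [pd, fderiv_fun_sum hf]; simp [pd]

theorem pd_comm {f : R2 n → W} {y : R2 n} (hf : ContDiffAt ℝ ∞ f y) (a b : Fin (2 * n)) :
    pd a (pd b f) y = pd b (pd a f) y := by
  have h1 : DifferentiableAt ℝ (fderiv ℝ f) y :=
    (hf.fderiv_right (m := ∞) (by simp)).differentiableAt (by simp)
  have h2 : ∀ c d, pd c (pd d f) y = fderiv ℝ (fderiv ℝ f) y (stdVec c) (stdVec d) := by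
    intro c d
    have : pd d f = fun z => fderiv ℝ f z (stdVec d) := rfl
    rw [pd, this, fderiv_clm_apply h1 (differentiableAt_const _)]
    simp
  rw [h2, h2]
  exact (hf.isSymmSndFDerivAt (by rw [minSmoothness_of_isRCLikeNormedField]; exact ENat.LEInfty.out)) _ _

variable {f g : R2 n → Matrix (Fin (2 * n)) (Fin (2 * n)) ℝ} {y : R2 n}

theorem pderivMatrix_apply (i : Fin (2 * n)) (a b : Fin (2 * n)) :
    pderivMatrix i f y a b = pd i (fun z => f z a b) y := rfl

theorem SmoothMat.pderivMatrix (hf : SmoothMat f y) (i : Fin (2 * n)) :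
    SmoothMat (pderivMatrix i f) y := fun a b => ContDiffAt.pd (hf a b) i

theorem pderivMatrix_congr (h : f =ᶠ[𝓝 y] g) (i : Fin (2 * n)) :
    pderivMatrix i f y = pderivMatrix i g y := by
  ext a b
  exact pd_congr (h.mono fun _ hz => congrFun (congrFun hz a) b) i

theorem pderivMatrix_const (A : Matrix (Fin (2 * n)) (Fin (2 * n)) ℝ) (i : Fin (2 * n)) :
    pderivMatrix i (fun _ => A) y = 0 := by
  ext a b
  exact pd_const _ _ _

theorem pderivMatrix_mul (hf : SmoothMat f y) (hg : SmoothMat g y) (i : Fin (2 * n)) :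
    pderivMatrix i (fun z => f z * g z) y = pderivMatrix i f y * g y + f y * pderivMatrix i g y := by
  ext a b
  rw [pderivMatrix_apply, Matrix.add_apply, Matrix.mul_apply, Matrix.mul_apply,
    ← Finset.sum_add_distrib]
  simp only [Matrix.mul_apply]
  rw [pd_sum (f := fun c z => f z a c * g z c b) fun c _ => (hf.diff a c).fun_mul (hg.diff c b)]
  exact Finset.sum_congr rfl fun c _ => pd_mul (hf.diff a c) (hg.diff c b) i

theorem pderivMatrix_inv (hf : SmoothMat f y) (h : IsUnit (f y).det) (i : Fin (2 * n)) :
    pderivMatrix i (fun z => (f z)⁻¹) y = -((f y)⁻¹ * pderivMatrix i f y * (f y)⁻¹) := by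
  have h1 : (fun z => (f z)⁻¹ * f z) =ᶠ[𝓝 y] fun _ => 1 := by
    filter_upwards [hf.eventually_isUnit h] with z hz
    exact Matrix.nonsing_inv_mul _ hz
  have h2 := pderivMatrix_congr h1 i
  rw [pderivMatrix_const, pderivMatrix_mul (hf.inv h) hf] at h2
  have h3 : f y * (f y)⁻¹ = 1 := Matrix.mul_nonsing_inv _ h
  calc pderivMatrix i (fun z => (f z)⁻¹) y
      = (pderivMatrix i (fun z => (f z)⁻¹) y * f y + (f y)⁻¹ * pderivMatrix i f y) * (f y)⁻¹
        - (f y)⁻¹ * pderivMatrix i f y * (f y)⁻¹ := by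
        rw [add_mul, mul_assoc, h3, mul_one]; abel
    _ = _ := by rw [h2, zero_mul, zero_sub]

theorem pd_trace (hf : SmoothMat f y) (i : Fin (2 * n)) :
    pd i (fun z => (f z).trace) y = (pderivMatrix i f y).trace := by
  simp only [Matrix.trace, Matrix.diag_apply]
  exact pd_sum (f := fun c z => f z c c) (fun c _ => hf.diff c c) i

/-- Jacobi's formula. -/
theorem pd_det (hf : SmoothMat f y) (i : Fin (2 * n)) :
    pd i (fun z => (f z).det) y = ((f y).adjugate * pderivMatrix i f y).trace := by
  -- By Cramer's rule, the k-th diagonal entry of adj(f) ∂f is the determinant of f with its k-th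
  -- column differentiated.
  have h1 : ((f y).adjugate * pderivMatrix i f y).trace =
      ∑ k, ((f y).updateCol k fun a => pderivMatrix i f y a k).det := by
    rw [Matrix.trace]
    refine Finset.sum_congr rfl fun k _ => ?_
    rw [← Matrix.cramer_apply, Matrix.cramer_eq_adjugate_mulVec]
    rfl
  rw [h1]
  simp only [Matrix.det_apply, Units.smul_def, zsmul_eq_mul]
  have hp : ∀ σ : Equiv.Perm (Fin (2 * n)), DifferentiableAt ℝ (fun z => ∏ k, f z (σ k) k) y :=
    fun σ => (contDiffAt_prod (f := fun k z => f z (σ k) k)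
      fun k _ => hf (σ k) k).differentiableAt (by simp)
  rw [pd_sum (f := fun (σ : Equiv.Perm (Fin (2 * n))) z =>
    (((Equiv.Perm.sign σ : ℤˣ) : ℤ) : ℝ) * ∏ k, f z (σ k) k)
    fun σ _ => (differentiableAt_const _).fun_mul (hp σ), Finset.sum_comm]
  refine Finset.sum_congr rfl fun σ _ => ?_
  rw [pd_const_mul _ (hp σ), ← Finset.mul_sum]
  congr 1
  rw [pd, fderiv_finsetProd (g := fun k z => f z (σ k) k) fun k _ => hf.diff _ _]
  simp only [sum_apply, smul_apply, smul_eq_mul]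
  refine Finset.sum_congr rfl fun k _ => ?_
  rw [← Finset.mul_prod_erase _ _ (Finset.mem_univ k), Matrix.updateCol_self, mul_comm]
  congr 1
  refine Finset.prod_congr rfl fun l hl => ?_
  rw [Matrix.updateCol_ne (Finset.ne_of_mem_erase hl)]

theorem pd_sqrt_abs_det (hf : SmoothMat f y) (h : IsUnit (f y).det) (i : Fin (2 * n)) :
    pd i (fun z => √|(f z).det|) y =
      (1 / 2) * √|(f y).det| * ((f y)⁻¹ * pderivMatrix i f y).trace := by
  have h0 := h.ne_zero
  have hd : DifferentiableAt ℝ (fun z => (f z).det) y := hf.det.differentiableAt (by simp)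
  have h2 : pd i (fun z => (f z).det) y = (f y).det * ((f y)⁻¹ * pderivMatrix i f y).trace := by
    rw [pd_det hf, Matrix.inv_def, Ring.inverse_eq_inv', smul_mul_assoc, Matrix.trace_smul,
      smul_eq_mul, ← mul_assoc, mul_inv_cancel₀ h0, one_mul]
  -- s is the sign of the determinant, which is locally constant; it replaces the absolute value by
  -- a differentiable expression.
  have key : ∀ s : ℝ, 0 < s * (f y).det → |s| = 1 → pd i (fun z => √|(f z).det|) y =
      (1 / 2) * √|(f y).det| * ((f y)⁻¹ * pderivMatrix i f y).trace := by
    intro s hs hs1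
    have h3 : (fun z => √|(f z).det|) =ᶠ[𝓝 y] fun z => √(s * (f z).det) := by
      have : ContinuousAt (fun z => s * (f z).det) y := continuousAt_const.mul hd.continuousAt
      filter_upwards [this.eventually (lt_mem_nhds hs)] with z hz
      rw [← abs_of_pos hz, abs_mul, hs1, one_mul]
    have h4 : |(f y).det| = s * (f y).det := by rw [← abs_of_pos hs, abs_mul, hs1, one_mul]
    rw [pd_congr h3, pd, fderiv_sqrt ((differentiableAt_const s).fun_mul hd) hs.ne',
      smul_apply]
    have h5 : fderiv ℝ (fun z => s * (f z).det) y (stdVec i) = s * pd i (fun z => (f z).det) y :=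
      pd_const_mul s hd i
    rw [h5, h2, h4, smul_eq_mul, ← mul_assoc s, ← mul_assoc]
    congr 1
    have h6 : 0 < √(s * (f y).det) := Real.sqrt_pos.2 hs
    have h7 := Real.mul_self_sqrt hs.le
    nth_rw 2 [← h7]
    field_simp
  rcases lt_or_gt_of_ne h0 with h3 | h3
  · exact key (-1) (by linarith) (by simp)
  · exact key 1 (by linarith) (by simp)

end MatrixCalculus

/-! ### Identities for the inverse of a closed 2-form -/

section Poisson

set_option linter.unusedSectionVars false

variable {ι : Type*} [Fintype ι] [DecidableEq ι]

/-- By skewness, the contractions of q with the two terms `D a c d` and `D c d a` of the cyclic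
identity agree, so each is minus half the contraction with the third. -/
theorem sum_skew_mul_cyclic {q : Matrix ι ι ℝ} (hq : ∀ a b, q a b = -q b a) {D : ι → ι → ι → ℝ}
    (hs : ∀ a b c, D a b c = -D a c b)
    (hD : ∀ a b c, D a b c + D b c a + D c a b = 0) (d : ι) :
    ∑ a, ∑ c, q a c * D a c d = -(1 / 2) * ∑ a, ∑ c, q a c * D d a c := by
  have h1 : ∑ a, ∑ c, q a c * D a c d = ∑ a, ∑ c, q a c * D c d a := by
    rw [Finset.sum_comm]
    refine Finset.sum_congr rfl fun a _ => Finset.sum_congr rfl fun c _ => ?_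
    rw [hq c a, hs c a d]; ring
  have h2 : ∑ a, ∑ c, q a c * D a c d + ∑ a, ∑ c, q a c * D c d a
      = -∑ a, ∑ c, q a c * D d a c := by
    simp only [← Finset.sum_add_distrib, ← Finset.sum_neg_distrib]
    refine Finset.sum_congr rfl fun a _ => Finset.sum_congr rfl fun c _ => ?_
    linear_combination q a c * hD a c d
  linarith

/-- Cyclic relabelling fixes τ, so three times the sum is the sum of τ against the cyclic sums of D.
-/
theorem sum_mul_cyclic_eq_zero {D τ : ι → ι → ι → ℝ} (hτ : ∀ a b c, τ a b c = τ b c a)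
    (hD : ∀ a b c, D a b c + D b c a + D c a b = 0) :
    ∑ a, ∑ b, ∑ c, τ a b c * D a b c = 0 := by
  have h1 : ∀ f : ι → ι → ι → ℝ, ∑ a, ∑ b, ∑ c, f a b c = ∑ a, ∑ b, ∑ c, f b c a := by
    intro f
    calc _ = ∑ b, ∑ a, ∑ c, f a b c := Finset.sum_comm
      _ = ∑ b, ∑ c, ∑ a, f a b c := Finset.sum_congr rfl fun b _ => Finset.sum_comm
      _ = ∑ c, ∑ b, ∑ a, f a b c := Finset.sum_comm
      _ = ∑ c, ∑ a, ∑ b, f a b c := Finset.sum_congr rfl fun b _ => Finset.sum_comm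
  have h2 := h1 fun a b c => τ a b c * D a b c
  have h3 := h1 fun a b c => τ b c a * D b c a
  have h4 : ∑ a, ∑ b, ∑ c, τ a b c * D a b c + ∑ a, ∑ b, ∑ c, τ b c a * D b c a
      + ∑ a, ∑ b, ∑ c, τ c a b * D c a b = 0 := by
    simp only [← Finset.sum_add_distrib]
    refine Finset.sum_eq_zero fun a _ => Finset.sum_eq_zero fun b _ => Finset.sum_eq_zero fun c _ => ?_
    rw [← hτ a b c, hτ c a b]
    linear_combination τ a b c * hD a b c
  linarith

/-- The three factors q join the three indices of D to those of σ, so the coefficient of `D a e f`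
is invariant under rotation and the cyclic identity applies. With D = ∂w, the inner sum is minus the
derivative of w⁻¹. -/
theorem sum_skew_mul_cyclic_mul_alternating {q : Matrix ι ι ℝ} (hq : ∀ a b, q a b = -q b a)
    {D σ : ι → ι → ι → ℝ} (hσ : ∀ a b c, σ a b c = σ b c a)
    (hD : ∀ a b c, D a b c + D b c a + D c a b = 0) :
    ∑ a, ∑ b, ∑ c, ∑ d, q a b * (∑ e, ∑ f, q c e * D a e f * q f d) * σ b c d = 0 := by
  have h := sum_mul_cyclic_eq_zero (D := D)
    (τ := fun a e f => ∑ b, ∑ c, ∑ d, q a b * q c e * q f d * σ b c d) ?_ hD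
  · refine Eq.trans ?_ h
    refine Finset.sum_congr rfl fun a _ => ?_
    simp only [Finset.mul_sum, Finset.sum_mul]
    calc _ = ∑ b, ∑ c, ∑ e, ∑ d, ∑ f, q a b * (q c e * D a e f * q f d) * σ b c d :=
          Finset.sum_congr rfl fun b _ => Finset.sum_congr rfl fun c _ => Finset.sum_comm
      _ = ∑ b, ∑ e, ∑ c, ∑ d, ∑ f, q a b * (q c e * D a e f * q f d) * σ b c d :=
          Finset.sum_congr rfl fun b _ => Finset.sum_comm
      _ = ∑ e, ∑ b, ∑ c, ∑ d, ∑ f, q a b * (q c e * D a e f * q f d) * σ b c d :=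
          Finset.sum_comm
      _ = ∑ e, ∑ b, ∑ c, ∑ f, ∑ d, q a b * (q c e * D a e f * q f d) * σ b c d :=
          Finset.sum_congr rfl fun b _ => Finset.sum_congr rfl fun c _ =>
            Finset.sum_congr rfl fun c _ => Finset.sum_comm
      _ = ∑ e, ∑ b, ∑ f, ∑ c, ∑ d, q a b * (q c e * D a e f * q f d) * σ b c d :=
          Finset.sum_congr rfl fun b _ => Finset.sum_congr rfl fun c _ => Finset.sum_comm
      _ = ∑ e, ∑ f, ∑ b, ∑ c, ∑ d, q a b * (q c e * D a e f * q f d) * σ b c d :=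
          Finset.sum_congr rfl fun b _ => Finset.sum_comm
      _ = _ := Finset.sum_congr rfl fun e _ => Finset.sum_congr rfl fun f _ =>
          Finset.sum_congr rfl fun b _ => Finset.sum_congr rfl fun c _ =>
            Finset.sum_congr rfl fun d _ => by ring
  · intro a e f
    calc ∑ b, ∑ c, ∑ d, q a b * q c e * q f d * σ b c d
        = ∑ c, ∑ b, ∑ d, q a b * q c e * q f d * σ b c d := Finset.sum_comm
      _ = ∑ c, ∑ d, ∑ b, q a b * q c e * q f d * σ b c d :=
          Finset.sum_congr rfl fun b _ => Finset.sum_comm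
      _ = _ := Finset.sum_congr rfl fun b _ => Finset.sum_congr rfl fun c _ =>
            Finset.sum_congr rfl fun d _ => by rw [hσ d b c, hq b e, hq f c]; ring

variable {n : ℕ} {w : R2 n → Matrix (Fin (2 * n)) (Fin (2 * n)) ℝ} {y : R2 n}

/-- The Liouville density is invariant under Hamiltonian vector fields. -/
theorem sum_pd_sqrt_abs_det_mul_inv (hw : SmoothMat w y) (hu : IsUnit (w y).det)
    (hs : ∀ z, (w z)ᵀ = -w z)
    (hD : ∀ a b c, pd a (fun z => w z b c) y + pd b (fun z => w z c a) y
      + pd c (fun z => w z a b) y = 0) (b : Fin (2 * n)) :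
    ∑ a, pd a (fun z => √|(w z).det| * (w z)⁻¹ a b) y = 0 := by
  have hsq : ((w y)⁻¹)ᵀ = -(w y)⁻¹ := by
    rw [Matrix.transpose_nonsing_inv, hs]
    exact Matrix.inv_eq_left_inv (by rw [neg_mul_neg, Matrix.nonsing_inv_mul _ hu])
  have hq : ∀ a b, (w y)⁻¹ a b = -(w y)⁻¹ b a := fun a b => by
    simpa using congrFun (congrFun hsq b) a
  have hs' : ∀ a b c, pd a (fun z => w z b c) y = -pd a (fun z => w z c b) y := by
    intro a b c
    rw [← pd_neg]
    refine congrArg (fun f => pd a f y) (funext fun z => ?_)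
    simpa using congrFun (congrFun (hs z) c) b
  have hdiff : DifferentiableAt ℝ (fun z => √|(w z).det|) y := by
    have := hw.det.differentiableAt (by simp)
    rcases lt_or_gt_of_ne hu.ne_zero with h | h
    · refine ((this.fun_neg).sqrt (by linarith)).congr_of_eventuallyEq ?_
      filter_upwards [this.continuousAt.eventually (gt_mem_nhds h)] with z hz
      rw [abs_of_neg hz]
    · refine ((this).sqrt (by linarith)).congr_of_eventuallyEq ?_
      filter_upwards [this.continuousAt.eventually (lt_mem_nhds h)] with z hz
      rw [abs_of_pos hz]
  have key := sum_skew_mul_cyclic hq (D := fun a b c => pd a (fun z => w z b c) y) hs' hD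
  -- The density contributes ½ tr(w⁻¹∂_a w) and the inverse contributes −w⁻¹(∂_a w)w⁻¹; after
  -- summation over a, `key` makes the two cancel.
  have h1 : ∀ a, pd a (fun z => √|(w z).det| * (w z)⁻¹ a b) y =
      √|(w y).det| * ((1 / 2) * ((w y)⁻¹ * pderivMatrix a w y).trace * (w y)⁻¹ a b
        - ∑ d, (∑ c, (w y)⁻¹ a c * pd a (fun z => w z c d) y) * (w y)⁻¹ d b) := by
    intro a
    rw [pd_mul hdiff ((hw.inv hu).diff a b), pd_sqrt_abs_det hw hu]
    have := congrFun (congrFun (pderivMatrix_inv hw hu a) a) b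
    rw [pderivMatrix_apply] at this
    rw [this, Matrix.neg_apply, Matrix.mul_apply]
    simp only [Matrix.mul_apply, pderivMatrix_apply]
    ring
  have h2 : ∀ d, ((w y)⁻¹ * pderivMatrix d w y).trace =
      -∑ a, ∑ c, (w y)⁻¹ a c * pd d (fun z => w z a c) y := by
    intro d
    simp only [Matrix.trace, Matrix.diag_apply, Matrix.mul_apply, pderivMatrix_apply,
      ← Finset.sum_neg_distrib]
    exact Finset.sum_congr rfl fun a _ => Finset.sum_congr rfl fun c _ => by rw [hs' d c a]; ring
  simp only [h1, ← Finset.mul_sum, Finset.sum_sub_distrib]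
  rw [Finset.sum_comm (f := fun a d => (∑ c, (w y)⁻¹ a c * pd a (fun z => w z c d) y) * (w y)⁻¹ d b)]
  simp only [← Finset.sum_mul]
  simp only [key, h2]
  rw [← Finset.sum_sub_distrib, Finset.sum_eq_zero, mul_zero]
  intro d _
  ring

/-- For a 3-form `σ`, contraction with the inverse of a closed 2-form commutes with the exterior
derivative after full contraction. -/
theorem sum_inv_mul_pd_inv_mul_alternating (hw : SmoothMat w y) (hu : IsUnit (w y).det)
    (hs : ∀ z, (w z)ᵀ = -w z)
    (hD : ∀ a b c, pd a (fun z => w z b c) y + pd b (fun z => w z c a) y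
      + pd c (fun z => w z a b) y = 0) {σ : Fin (2 * n) → Fin (2 * n) → Fin (2 * n) → ℝ}
    (hσ : ∀ a b c, σ a b c = σ b c a) :
    ∑ a, ∑ b, ∑ c, ∑ d, (w y)⁻¹ a b * pd a (fun z => (w z)⁻¹ c d) y * σ b c d = 0 := by
  have hsq : ((w y)⁻¹)ᵀ = -(w y)⁻¹ := by
    rw [Matrix.transpose_nonsing_inv, hs]
    exact Matrix.inv_eq_left_inv (by rw [neg_mul_neg, Matrix.nonsing_inv_mul _ hu])
  have hq : ∀ a b, (w y)⁻¹ a b = -(w y)⁻¹ b a := fun a b => by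
    simpa using congrFun (congrFun hsq b) a
  have key := sum_skew_mul_cyclic_mul_alternating hq (D := fun a b c => pd a (fun z => w z b c) y)
    hσ hD
  rw [← neg_eq_zero, ← key]
  simp only [← Finset.sum_neg_distrib]
  refine Finset.sum_congr rfl fun a _ => Finset.sum_congr rfl fun b _ =>
    Finset.sum_congr rfl fun c _ => Finset.sum_congr rfl fun d _ => ?_
  have := congrFun (congrFun (pderivMatrix_inv hw hu a) c) d
  rw [pderivMatrix_apply] at this
  rw [this, Matrix.neg_apply, Matrix.mul_apply]
  simp only [Matrix.mul_apply, pderivMatrix_apply, Finset.sum_mul]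
  rw [Finset.sum_comm]
  ring

end Poisson

/-! ### Integrals of derivatives -/

section Integral

variable {n : ℕ}

open MeasureTheory

theorem integral_pd_eq_zero {f : R2 n → ℝ} (hf : ContDiff ℝ 1 f) (hc : HasCompactSupport f)
    (a : Fin (2 * n)) : ∫ y, pd a f y = 0 := by
  have h1 : Continuous fun y => fderiv ℝ f y (stdVec a) :=
    (hf.continuous_fderiv one_ne_zero).clm_apply continuous_const
  have h2 : HasCompactSupport fun y => fderiv ℝ f y (stdVec a) := hc.fderiv_apply ℝ _
  -- Integration by parts against the constant function 1.
  have := integral_mul_fderiv_eq_neg_fderiv_mul_of_integrable (μ := volume)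
    (f := fun _ : R2 n => (1 : ℝ)) (g := f) (v := stdVec a) (by simp)
    (by simpa using h1.integrable_of_hasCompactSupport h2)
    (by simpa using hf.continuous.integrable_of_hasCompactSupport hc)
    (fun x _ => differentiableAt_const _) (fun x _ => hf.differentiable one_ne_zero x)
  simpa [pd] using this

/-- A function that is smooth on an open set and vanishes off a compact subset of it extends to a
smooth function by zero. -/
theorem contDiff_indicator {U K : Set (R2 n)} (hU : IsOpen U) (hK : IsCompact K) (hKU : K ⊆ U)
    {f : R2 n → ℝ} (hf : ∀ y ∈ U, ContDiffAt ℝ 1 f y) (h0 : ∀ y ∈ U, y ∉ K → f y = 0) :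
    ContDiff ℝ 1 (U.indicator f) ∧ HasCompactSupport (U.indicator f) := by
  have h1 : ∀ y, y ∉ K → U.indicator f y = 0 := by
    intro y hy
    by_cases h : y ∈ U
    · rw [indicator_of_mem h, h0 y h hy]
    · exact indicator_of_notMem h _
  refine ⟨contDiff_iff_contDiffAt.2 fun y => ?_, HasCompactSupport.intro hK h1⟩
  by_cases hy : y ∈ U
  · refine (hf y hy).congr_of_eventuallyEq ?_
    filter_upwards [hU.mem_nhds hy] with z hz
    exact indicator_of_mem hz _
  · refine (contDiffAt_const (c := (0 : ℝ))).congr_of_eventuallyEq ?_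
    filter_upwards [hK.isClosed.isOpen_compl.mem_nhds fun h => hy (hKU h)] with z hz
    exact h1 z hz

theorem integral_pd_eq_zero_of_compact {U K : Set (R2 n)} (hU : IsOpen U) (hK : IsCompact K)
    (hKU : K ⊆ U) {f : R2 n → ℝ} (hf : ∀ y ∈ U, ContDiffAt ℝ 1 f y)
    (h0 : ∀ y ∈ U, y ∉ K → f y = 0) (a : Fin (2 * n)) :
    IntegrableOn (pd a f) U ∧ ∫ y in U, pd a f y = 0 := by
  obtain ⟨h1, h2⟩ := contDiff_indicator hU hK hKU hf h0
  have h3 : EqOn (pd a (U.indicator f)) (pd a f) U := by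
    intro y hy
    have : U.indicator f =ᶠ[𝓝 y] f := by
      filter_upwards [hU.mem_nhds hy] with z hz
      exact indicator_of_mem hz _
    rw [pd, pd, this.fderiv_eq]
  have h4 : ∀ y, y ∉ U → pd a (U.indicator f) y = 0 := by
    intro y hy
    have : U.indicator f =ᶠ[𝓝 y] fun _ => 0 := by
      filter_upwards [hK.isClosed.isOpen_compl.mem_nhds fun h => hy (hKU h)] with z hz
      by_cases h : z ∈ U
      · rw [indicator_of_mem h, h0 z h hz]
      · exact indicator_of_notMem h _
    rw [pd, this.fderiv_eq, fderiv_fun_const]; rfl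
  have h5 : Integrable (pd a (U.indicator f)) := by
    refine Continuous.integrable_of_hasCompactSupport ?_ ?_
    · exact (h1.continuous_fderiv one_ne_zero).clm_apply continuous_const
    · exact h2.fderiv_apply ℝ _
  constructor
  · exact h5.integrableOn.congr_fun h3 hU.measurableSet
  · rw [← setIntegral_congr_fun hU.measurableSet h3, setIntegral_eq_integral_of_forall_compl_eq_zero h4,
      integral_pd_eq_zero h1 h2]

end Integral

/-! ### Integration on a compact symplectic manifold -/

section Stokes

set_option linter.unusedSectionVars false

open MeasureTheory

variable {n : ℕ} {X : Type*} [TopologicalSpace X] [ChartedSpace (R2 n) X] {Ω : SymplecticForm n X}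

theorem SymplecticForm.mat_skew (Ω : SymplecticForm n X) (i : X) (y : R2 n) :
    (Ω.mat i y)ᵀ = -Ω.mat i y := by
  ext a b
  exact twoForm_swap (Ω.form.inChart i y).toAlternatingMap (stdVec b) (stdVec a)

/-- The density of the Liouville volume in the chart at `i`. -/
def SymplecticForm.density (Ω : SymplecticForm n X) (i : X) (y : R2 n) : ℝ := √|(Ω.mat i y).det|

/-- The integral over the chart domain at `i` against the Liouville volume. -/
def SymplecticForm.chartIntegral (Ω : SymplecticForm n X) (i : X) (h : X → ℝ) : ℝ :=
  ∫ y in (chartAt (R2 n) i).target, h ((chartAt (R2 n) i).symm y) * Ω.density i y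

/-- Smoothness of functions in all charts. -/
def SmoothFun (n : ℕ) {X : Type*} [TopologicalSpace X] [ChartedSpace (R2 n) X] (f : X → ℝ) : Prop :=
  ∀ i : X, ∀ y ∈ (chartAt (R2 n) i).target,
    ContDiffAt ℝ ∞ (fun z => f ((chartAt (R2 n) i).symm z)) y

theorem SmoothFun.add {f g : X → ℝ} (hf : SmoothFun n f) (hg : SmoothFun n g) :
    SmoothFun n fun x => f x + g x := fun i y hy => (hf i y hy).add (hg i y hy)

theorem SmoothFun.mul {f g : X → ℝ} (hf : SmoothFun n f) (hg : SmoothFun n g) :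
    SmoothFun n fun x => f x * g x := fun i y hy => (hf i y hy).mul (hg i y hy)

theorem smoothFun_const (c : ℝ) : SmoothFun n fun _ : X => c :=
  fun _ _ _ => contDiffAt_const

variable [IsManifold 𝓘(ℝ, R2 n) ∞ X]

/-- Only nondegeneracy enters: a kernel vector of the matrix would be a tangent vector in the
radical of ω. No compatible J has to be given. -/
theorem SymplecticForm.isUnit_det_mat (Ω : SymplecticForm n X) (i : X) {y : R2 n}
    (hy : y ∈ (chartAt (R2 n) i).target) : IsUnit (Ω.mat i y).det := by
  have h1 : IsUnit (formMat (Ω.at ((chartAt (R2 n) i).symm y))).det := by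
    rw [isUnit_iff_ne_zero]
    intro h0
    obtain ⟨v, hv, hv0⟩ := Matrix.exists_mulVec_eq_zero_iff.2 h0
    refine hv ?_
    have h2 : WithLp.toLp 2 v = (0 : R2 n) := by
      have h3 : ∀ u : R2 n, Ω.at ((chartAt (R2 n) i).symm y) ![WithLp.toLp 2 v, u] = 0 := by
        intro u
        rw [twoForm_swap, ← twoFormBilin_apply, ← sum_smul_stdVec u,
          ← sum_smul_stdVec (WithLp.toLp 2 v : R2 n)]
        simp only [map_sum, LinearMap.sum_apply, map_smul, LinearMap.smul_apply]
        simp only [Finset.smul_sum]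
        rw [neg_eq_zero, Finset.sum_comm]
        refine Finset.sum_eq_zero fun a _ => ?_
        have := congrFun hv0 a
        simp only [Matrix.mulVec, dotProduct, formMat, Matrix.of_apply, Pi.zero_apply] at this
        rw [← mul_zero (u a), ← this, Finset.mul_sum]
        refine Finset.sum_congr rfl fun b _ => ?_
        simp only [twoFormBilin_apply, smul_eq_mul]
        ring
      exact Ω.nondegenerate ((chartAt (R2 n) i).symm y) _ h3
    funext a
    exact congrArg (fun w : R2 n => w a) h2
  rw [Ω.mat_eq, Matrix.det_mul, Matrix.det_mul, Matrix.det_transpose]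
  exact ((isUnit_det_jac i hy).mul h1).mul (isUnit_det_jac i hy)

theorem SymplecticForm.smoothMat_mat (Ω : SymplecticForm n X) (i : X) {y : R2 n}
    (hy : y ∈ (chartAt (R2 n) i).target) : SmoothMat (Ω.mat i) y :=
  Ω.contDiffAt_mat i hy

theorem SymplecticForm.contDiffAt_density (Ω : SymplecticForm n X) (i : X) {y : R2 n}
    (hy : y ∈ (chartAt (R2 n) i).target) : ContDiffAt ℝ ∞ (Ω.density i) y := by
  have h0 := (Ω.isUnit_det_mat i hy).ne_zero
  have h1 := (Ω.smoothMat_mat i hy).det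
  have h2 : ContDiffAt ℝ ∞ (fun z => |(Ω.mat i z).det|) y := h1.abs h0
  exact h2.sqrt (abs_ne_zero.2 h0)

theorem SymplecticForm.density_transition (Ω : SymplecticForm n X) (i k : X) {y : R2 n}
    (hy : y ∈ (transition i k).source) :
    Ω.density i y = |(transJac i k y).det| * Ω.density k (transition i k y) := by
  rw [density, density, mat_transition Ω i k hy, Matrix.det_mul, Matrix.det_mul,
    Matrix.det_transpose, ← Real.sqrt_sq (abs_nonneg (transJac i k y).det),
    ← Real.sqrt_mul (sq_nonneg _), sq, abs_mul, abs_mul]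
  congr 1
  ring

/-- Change of charts in integrals. -/
theorem SymplecticForm.chartIntegral_eq (Ω : SymplecticForm n X) (i k : X) {h : X → ℝ}
    (hi : ∀ x, x ∉ (chartAt (R2 n) i).source → h x = 0)
    (hk : ∀ x, x ∉ (chartAt (R2 n) k).source → h x = 0) :
    Ω.chartIntegral i h = Ω.chartIntegral k h := by
  have h1 : ∀ i k : X, (∀ x, x ∉ (chartAt (R2 n) k).source → h x = 0) →
      ∫ y in (transition i k).source, h ((chartAt (R2 n) i).symm y) * Ω.density i y =
        Ω.chartIntegral i h := by
    intro i k hk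
    symm
    refine setIntegral_eq_of_subset_of_forall_sdiff_eq_zero
      (chartAt (R2 n) i).open_target.measurableSet
      (fun y hy => ((mem_transition_source i k).1 hy).1) fun y hy => ?_
    rw [hk, zero_mul]
    exact fun hm => hy.2 ((mem_transition_source i k).2 ⟨hy.1, hm⟩)
  rw [← h1 i k hk, ← h1 k i hi, ← transition_target i k,
    integral_target_eq_integral_abs_det_fderiv_smul (μ := volume)
      (f' := fun y => fderiv ℝ (transition i k) y)
      (fun y hy => ((contDiffAt_transition i k hy).differentiableAt (by simp)).hasFDerivAt)]
  refine setIntegral_congr_fun (transition i k).open_source.measurableSet fun y hy => ?_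
  simp only [smul_eq_mul]
  rw [symm_transition i k hy, Ω.density_transition i k hy, ← clmMat_det]
  change _ = |(transJac i k y).det| * _
  ring

variable [T2Space X] [CompactSpace X]

theorem chart_image_tsupport {i : X} {h : X → ℝ} (hs : tsupport h ⊆ (chartAt (R2 n) i).source) :
    IsCompact (chartAt (R2 n) i '' tsupport h) ∧
      chartAt (R2 n) i '' tsupport h ⊆ (chartAt (R2 n) i).target ∧
      ∀ y ∈ (chartAt (R2 n) i).target, y ∉ chartAt (R2 n) i '' tsupport h →
        h ((chartAt (R2 n) i).symm y) = 0 := by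
  refine ⟨(isClosed_tsupport h).isCompact.image_of_continuousOn
    ((chartAt (R2 n) i).continuousOn.mono hs), ?_, fun y hy hn => ?_⟩
  · rintro _ ⟨x, hx, rfl⟩
    exact (chartAt (R2 n) i).map_source (hs hx)
  · by_contra h0
    exact hn ⟨_, subset_tsupport h h0, (chartAt (R2 n) i).right_inv hy⟩

theorem SymplecticForm.integrableOn_chart (Ω : SymplecticForm n X) {i : X} {h : X → ℝ}
    (hh : SmoothFun n h) (hs : tsupport h ⊆ (chartAt (R2 n) i).source) :
    IntegrableOn (fun y => h ((chartAt (R2 n) i).symm y) * Ω.density i y)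
      (chartAt (R2 n) i).target := by
  obtain ⟨h1, h2, h3⟩ := chart_image_tsupport hs
  refine IntegrableOn.of_forall_sdiff_eq_zero (s := chartAt (R2 n) i '' tsupport h)
    (ContinuousOn.integrableOn_compact h1 fun y hy => ?_)
    (chartAt (R2 n) i).open_target.measurableSet fun y hy => ?_
  · exact ((hh i y (h2 hy)).mul (Ω.contDiffAt_density i (h2 hy))).continuousAt.continuousWithinAt
  · rw [h3 y hy.1 hy.2, zero_mul]

theorem SymplecticForm.chartIntegral_add (Ω : SymplecticForm n X) {i : X} {h h' : X → ℝ}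
    (hh : SmoothFun n h) (hs : tsupport h ⊆ (chartAt (R2 n) i).source)
    (hh' : SmoothFun n h') (hs' : tsupport h' ⊆ (chartAt (R2 n) i).source) :
    Ω.chartIntegral i (fun x => h x + h' x) = Ω.chartIntegral i h + Ω.chartIntegral i h' := by
  rw [chartIntegral, chartIntegral, chartIntegral,
    ← integral_add (Ω.integrableOn_chart hh hs) (Ω.integrableOn_chart hh' hs')]
  simp only [add_mul]

theorem SymplecticForm.chartIntegral_const_mul (Ω : SymplecticForm n X) (i : X) (c : ℝ)
    (h : X → ℝ) : Ω.chartIntegral i (fun x => c * h x) = c * Ω.chartIntegral i h := by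
  rw [chartIntegral, chartIntegral, ← integral_const_mul]
  simp only [mul_assoc]

/-! #### Covector fields -/

variable (n X) in
/-- Smooth covector fields, given by their components in the charts. -/
structure CovectorField where
  comp : X → R2 n → Fin (2 * n) → ℝ
  transform : ∀ i k : X, ∀ y ∈ (transition i k).source, ∀ a,
    comp i y a = ∑ c, comp k (transition i k y) c * transJac i k y c a
  smooth : ∀ i : X, ∀ y ∈ (chartAt (R2 n) i).target, ∀ a, ContDiffAt ℝ ∞ (fun z => comp i z a) y

theorem pd_comp_transition {i k : X} {y : R2 n} (hy : y ∈ (transition i k).source)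
    {F : R2 n → ℝ} (hF : DifferentiableAt ℝ F (transition i k y)) (a : Fin (2 * n)) :
    pd a (fun z => F (transition i k z)) y =
      ∑ c, pd c F (transition i k y) * transJac i k y c a := by
  have h1 := (contDiffAt_transition i k hy).differentiableAt (by simp)
  have h2 : fderiv ℝ (fun z => F (transition i k z)) y =
      (fderiv ℝ F (transition i k y)).comp (fderiv ℝ (transition i k) y) :=
    fderiv_comp (g := F) y hF h1
  rw [pd, h2, ContinuousLinearMap.comp_apply, apply_stdVec, map_sum]
  refine Finset.sum_congr rfl fun c _ => ?_
  rw [map_smul, smul_eq_mul, mul_comm]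
  rfl

theorem eventually_symm_transition {i k : X} {y : R2 n} (hy : y ∈ (transition i k).source) :
    ∀ᶠ z in 𝓝 y, (chartAt (R2 n) k).symm (transition i k z) = (chartAt (R2 n) i).symm z := by
  filter_upwards [(transition i k).open_source.mem_nhds hy] with z hz
  exact symm_transition i k hz

/-- The differential of a function. -/
def CovectorField.grad (r : X → ℝ) (hr : SmoothFun n r) : CovectorField n X where
  comp i y a := pd a (fun z => r ((chartAt (R2 n) i).symm z)) y
  transform i k y hy a := by
    rw [← pd_comp_transition hy (F := fun z => r ((chartAt (R2 n) k).symm z))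
      ((hr k _ (transition_mem_target i k hy)).differentiableAt (by simp))]
    refine pd_congr ?_ a
    filter_upwards [eventually_symm_transition hy] with z hz
    rw [hz]
  smooth i y hy a := ContDiffAt.pd (hr i y hy) a

/-- The Poisson pairing of two covector fields. -/
def CovectorField.bracket (Ω : SymplecticForm n X) (ξ η : CovectorField n X) (x : X) : ℝ :=
  ∑ a, ∑ b, (Ω.mat x (chartAt (R2 n) x x))⁻¹ a b * ξ.comp x (chartAt (R2 n) x x) a *
    η.comp x (chartAt (R2 n) x x) b

theorem mem_transition_symm (i : X) {y : R2 n} (hy : y ∈ (chartAt (R2 n) i).target) :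
    y ∈ (transition i ((chartAt (R2 n) i).symm y)).source :=
  (mem_transition_source i _).2 ⟨hy, mem_chart_source (R2 n) _⟩

theorem mat_inv_transition (Ω : SymplecticForm n X) (i k : X) {y : R2 n}
    (hy : y ∈ (transition i k).source) :
    transJac i k y * (Ω.mat i y)⁻¹ * (transJac i k y)ᵀ = (Ω.mat k (transition i k y))⁻¹ :=
  mul_inv_mul_transpose (mat_transition Ω i k hy).symm (isUnit_det_transJac i k hy)

/-- `bracket` is defined at x in the chart at x; tensoriality allows any chart around x. -/
theorem CovectorField.bracket_symm (Ω : SymplecticForm n X) (ξ η : CovectorField n X) (i : X)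
    {y : R2 n} (hy : y ∈ (chartAt (R2 n) i).target) :
    ξ.bracket Ω η ((chartAt (R2 n) i).symm y) =
      ∑ a, ∑ b, (Ω.mat i y)⁻¹ a b * ξ.comp i y a * η.comp i y b := by
  have hy' := mem_transition_symm i hy
  rw [bracket, ← transition_apply]
  have h := sum_smul_transform (mat_inv_transition Ω i _ hy')
    fun a b => ξ.comp ((chartAt (R2 n) i).symm y) (transition i ((chartAt (R2 n) i).symm y) y) a *
      η.comp ((chartAt (R2 n) i).symm y) (transition i ((chartAt (R2 n) i).symm y) y) b
  simp only [smul_eq_mul] at h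
  simp only [mul_assoc]
  rw [← h]
  refine Finset.sum_congr rfl fun a _ => Finset.sum_congr rfl fun b _ => ?_
  rw [ξ.transform i _ y hy', η.transform i _ y hy', Finset.sum_mul_sum]
  congr 1
  exact Finset.sum_congr rfl fun c _ => Finset.sum_congr rfl fun d _ => by ring

theorem CovectorField.smoothFun_bracket (Ω : SymplecticForm n X) (ξ η : CovectorField n X) :
    SmoothFun n (ξ.bracket Ω η) := by
  intro i y hy
  have h : ContDiffAt ℝ ∞ (fun z => ∑ a, ∑ b, (Ω.mat i z)⁻¹ a b * ξ.comp i z a * η.comp i z b) y :=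
    ContDiffAt.sum fun a _ => ContDiffAt.sum fun b _ =>
      ((((Ω.smoothMat_mat i hy).inv (Ω.isUnit_det_mat i hy)) a b).mul (ξ.smooth i y hy a)).mul
        (η.smooth i y hy b)
  refine h.congr_of_eventuallyEq ?_
  filter_upwards [(chartAt (R2 n) i).open_target.mem_nhds hy] with z hz
  exact ξ.bracket_symm Ω η i hz

theorem CovectorField.tsupport_bracket_grad (Ω : SymplecticForm n X) (η : CovectorField n X)
    {r : X → ℝ} (hr : SmoothFun n r) :
    tsupport ((CovectorField.grad r hr).bracket Ω η) ⊆ tsupport r := by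
  refine closure_minimal (fun x hx => ?_) (isClosed_tsupport r)
  by_contra h0
  refine hx ?_
  have h1 : (fun z => r ((chartAt (R2 n) x).symm z)) =ᶠ[𝓝 (chartAt (R2 n) x x)] fun _ => 0 := by
    have h2 : r =ᶠ[𝓝 ((chartAt (R2 n) x).symm (chartAt (R2 n) x x))] 0 := by
      rw [(chartAt (R2 n) x).left_inv (mem_chart_source (R2 n) x)]
      exact notMem_tsupport_iff_eventuallyEq.1 h0
    exact ((chartAt (R2 n) x).continuousAt_symm (mem_chart_target (R2 n) x)).eventually h2
  refine Finset.sum_eq_zero fun a _ => Finset.sum_eq_zero fun b _ => ?_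
  have h3 : (CovectorField.grad r hr).comp x (chartAt (R2 n) x x) a = 0 := by
    change pd a _ _ = 0
    rw [pd_congr h1, pd_const]
  rw [h3, mul_zero, zero_mul]

/-- `f` is the divergence of the vector field dual to `η`. -/
def CovectorField.IsDiv (Ω : SymplecticForm n X) (η : CovectorField n X) (f : X → ℝ) : Prop :=
  ∀ i : X, ∀ y ∈ (chartAt (R2 n) i).target, f ((chartAt (R2 n) i).symm y) =
    ∑ a, ∑ b, (Ω.mat i y)⁻¹ a b * pd a (fun z => η.comp i z b) y

theorem CovectorField.IsDiv.smoothFun {η : CovectorField n X} {f : X → ℝ} (h : η.IsDiv Ω f) :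
    SmoothFun n f := by
  intro i y hy
  have h' : ContDiffAt ℝ ∞ (fun z => ∑ a, ∑ b, (Ω.mat i z)⁻¹ a b *
      pd a (fun z => η.comp i z b) z) y :=
    ContDiffAt.sum fun a _ => ContDiffAt.sum fun b _ =>
      (((Ω.smoothMat_mat i hy).inv (Ω.isUnit_det_mat i hy)) a b).mul
        (ContDiffAt.pd (η.smooth i y hy b) a)
  refine h'.congr_of_eventuallyEq ?_
  filter_upwards [(chartAt (R2 n) i).open_target.mem_nhds hy] with z hz
  exact h i z hz

theorem tsupport_mul_subset {r f : X → ℝ} {s : Set X} (hs : tsupport r ⊆ s) :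
    tsupport (fun x => r x * f x) ⊆ s :=
  (closure_mono fun _ hx => left_ne_zero_of_mul hx).trans hs

/-- Integration by parts in a chart. -/
theorem CovectorField.IsDiv.chartIntegral_mul {η : CovectorField n X} {f : X → ℝ}
    (h : η.IsDiv Ω f) {i : X} {r : X → ℝ} (hr : SmoothFun n r)
    (hs : tsupport r ⊆ (chartAt (R2 n) i).source) :
    Ω.chartIntegral i (fun x => r x * f x) =
      -Ω.chartIntegral i ((CovectorField.grad r hr).bracket Ω η) := by
  obtain ⟨hK, hKU, h0⟩ := chart_image_tsupport hs
  set φ := chartAt (R2 n) i with hφ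
  rw [eq_neg_iff_add_eq_zero, ← Ω.chartIntegral_add (hr.mul h.smoothFun) (tsupport_mul_subset hs)
    (CovectorField.smoothFun_bracket Ω _ η) ((η.tsupport_bracket_grad Ω hr).trans hs)]
  -- The vector density √|det ω| ω^{ab} r η_b. It is compactly supported in the chart because r is,
  -- and its coordinate divergence will be the integrand.
  let F : Fin (2 * n) → R2 n → ℝ := fun a y =>
    ∑ b, (Ω.density i y * (Ω.mat i y)⁻¹ a b) * (r (φ.symm y) * η.comp i y b)
  have hd : ∀ y ∈ φ.target, ∀ a b,
      ContDiffAt ℝ ∞ (fun z => Ω.density i z * (Ω.mat i z)⁻¹ a b) y := fun y hy a b =>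
    (Ω.contDiffAt_density i hy).mul (((Ω.smoothMat_mat i hy).inv (Ω.isUnit_det_mat i hy)) a b)
  have he : ∀ y ∈ φ.target, ∀ b, ContDiffAt ℝ ∞ (fun z => r (φ.symm z) * η.comp i z b) y :=
    fun y hy b => (hr i y hy).mul (η.smooth i y hy b)
  have hF : ∀ y ∈ φ.target, ∀ a, ContDiffAt ℝ ∞ (F a) y := fun y hy a =>
    ContDiffAt.sum fun b _ => (hd y hy a b).mul (he y hy b)
  have hF0 : ∀ a, ∀ y ∈ φ.target, y ∉ φ '' tsupport r → F a y = 0 := by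
    intro a y hy hn
    refine Finset.sum_eq_zero fun b _ => ?_
    rw [h0 y hy hn, zero_mul, mul_zero]
  have h1 := fun a => integral_pd_eq_zero_of_compact φ.open_target hK hKU
    (fun y hy => (hF y hy a).of_le (by simp)) (hF0 a) a
  have h2 : ∫ y in φ.target, ∑ a, pd a (F a) y = 0 := by
    rw [integral_finsetSum _ fun a _ => (h1 a).1]
    exact Finset.sum_eq_zero fun a _ => (h1 a).2
  rw [← h2, SymplecticForm.chartIntegral]
  refine setIntegral_congr_fun φ.open_target.measurableSet fun y hy => ?_
  rw [h i y hy, CovectorField.bracket_symm Ω _ η i hy]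
  have h3 : ∀ a, pd a (F a) y = ∑ b, (pd a (fun z => Ω.density i z * (Ω.mat i z)⁻¹ a b) y *
      (r (φ.symm y) * η.comp i y b) + (Ω.density i y * (Ω.mat i y)⁻¹ a b) *
        (pd a (fun z => r (φ.symm z)) y * η.comp i y b + r (φ.symm y) *
          pd a (fun z => η.comp i z b) y)) := by
    intro a
    have hd' := fun b => (hd y hy a b).differentiableAt (by simp)
    have he' := fun b => (he y hy b).differentiableAt (by simp)
    rw [pd_sum (f := fun b z => (Ω.density i z * (Ω.mat i z)⁻¹ a b) *
      (r (φ.symm z) * η.comp i z b)) fun b _ => (hd' b).fun_mul (he' b)]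
    refine Finset.sum_congr rfl fun b _ => ?_
    rw [pd_mul (hd' b) (he' b), pd_mul ((hr i y hy).differentiableAt (by simp))
      ((η.smooth i y hy b).differentiableAt (by simp))]
  -- The product-rule term in which √|det ω| ω^{ab} is differentiated sums to zero; the other two
  -- terms are the two integrands in the goal.
  have h4 := sum_pd_sqrt_abs_det_mul_inv (Ω.smoothMat_mat i hy) (Ω.isUnit_det_mat i hy)
    (Ω.mat_skew i) (Ω.pd_mat_cyclic i hy)
  simp only [h3, Finset.sum_add_distrib]
  rw [Finset.sum_comm (f := fun a b => pd a (fun z => Ω.density i z * (Ω.mat i z)⁻¹ a b) y *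
      (r (φ.symm y) * η.comp i y b))]
  simp only [← Finset.sum_mul]
  have h5 : ∀ b, ∑ a, pd a (fun z => Ω.density i z * (Ω.mat i z)⁻¹ a b) y = 0 := h4
  simp only [h5, zero_mul, Finset.sum_const_zero, zero_add, add_mul, Finset.mul_sum, Finset.sum_mul,
    ← Finset.sum_add_distrib]
  refine Finset.sum_congr rfl fun a _ => Finset.sum_congr rfl fun b _ => ?_
  change _ + _ * pd a (fun z => r (φ.symm z)) y * _ * _ = _
  ring

/-! #### The integral over the manifold -/

theorem smoothFun_chartPartition (i : X) : SmoothFun n (chartPartition n X i) := by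
  intro k y hy
  have h1 : ContMDiff 𝓘(ℝ, R2 n) 𝓘(ℝ, ℝ) ∞ (chartPartition n X i) :=
    (chartPartition n X i).contMDiff
  have h2 := (h1.contMDiffAt (x := (chartAt (R2 n) k).symm y)).comp y
    ((contMDiffOn_chart_symm' k).contMDiffAt ((chartAt (R2 n) k).open_target.mem_nhds hy))
  exact contMDiffAt_iff_contDiffAt.1 h2

theorem tsupport_chartPartition (i : X) :
    tsupport (chartPartition n X i) ⊆ (chartAt (R2 n) i).source :=
  Classical.choose_spec (SmoothPartitionOfUnity.exists_isSubordinate_chartAt_source 𝓘(ℝ, R2 n) X) i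

variable (n X) in
/-- The indices of the nonzero members of the partition of unity. -/
def partitionIndex : Finset X :=
  ((chartPartition n X).locallyFinite.finite_nonempty_of_compact).toFinset

theorem chartPartition_eq_zero {i : X} (hi : i ∉ partitionIndex n X) (x : X) :
    chartPartition n X i x = 0 := by
  by_contra h
  exact hi (by simpa [partitionIndex] using fun h0 => h (congrFun h0 x))

theorem sum_chartPartition (x : X) : ∑ i ∈ partitionIndex n X, chartPartition n X i x = 1 := by
  rw [← (chartPartition n X).sum_eq_one (mem_univ x)]
  refine (finsum_eq_sum_of_support_subset _ fun i hi => ?_).symm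
  by_contra h
  exact hi (chartPartition_eq_zero h x)

/-- The integral against the Liouville volume. -/
def SymplecticForm.integral (Ω : SymplecticForm n X) (f : X → ℝ) : ℝ :=
  ∑ i ∈ partitionIndex n X, Ω.chartIntegral i fun x => chartPartition n X i x * f x

/-- The Riemannian volume is the Liouville volume, so J disappears from the measure. By compactness,
finitely many members of the partition of unity suffice. -/
theorem CompatibleACS.volIntegral_eq (j : CompatibleACS Ω) (f : X → ℝ) :
    volIntegral j.metric f = Ω.integral f := by
  have h1 : ∀ i : X, ∫ y in (chartAt (R2 n) i).target,
      chartPartition n X i ((chartAt (R2 n) i).symm y) * f ((chartAt (R2 n) i).symm y) *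
        √(metricMatrix j.metric i y).det =
      Ω.chartIntegral i fun x => chartPartition n X i x * f x := by
    intro i
    refine setIntegral_congr_fun (chartAt (R2 n) i).open_target.measurableSet fun y hy => ?_
    simp only
    rw [metricMatrix_eq_mul j i hy, (j.isCompatiblePair_mat i hy).sqrt_det]
    rfl
  rw [volIntegral]
  simp only [h1]
  refine finsum_eq_sum_of_support_subset _ fun i hi => ?_
  by_contra h
  refine hi ?_
  simp [SymplecticForm.chartIntegral, chartPartition_eq_zero h]

theorem SymplecticForm.integral_add (Ω : SymplecticForm n X) {f g : X → ℝ} (hf : SmoothFun n f)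
    (hg : SmoothFun n g) : Ω.integral (fun x => f x + g x) = Ω.integral f + Ω.integral g := by
  rw [integral, integral, integral, ← Finset.sum_add_distrib]
  refine Finset.sum_congr rfl fun i _ => ?_
  rw [← Ω.chartIntegral_add ((smoothFun_chartPartition i).mul hf)
    (tsupport_mul_subset (tsupport_chartPartition i)) ((smoothFun_chartPartition i).mul hg)
    (tsupport_mul_subset (tsupport_chartPartition i))]
  simp only [mul_add]

theorem SymplecticForm.integral_const_mul (Ω : SymplecticForm n X) (c : ℝ) (f : X → ℝ) :
    Ω.integral (fun x => c * f x) = c * Ω.integral f := by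
  rw [integral, integral, Finset.mul_sum]
  refine Finset.sum_congr rfl fun i _ => ?_
  rw [← Ω.chartIntegral_const_mul]
  congr 1
  funext x
  ring

theorem SymplecticForm.integral_nonneg (Ω : SymplecticForm n X) {f : X → ℝ} (hf : ∀ x, 0 ≤ f x) :
    0 ≤ Ω.integral f :=
  Finset.sum_nonneg fun i _ => setIntegral_nonneg (chartAt (R2 n) i).open_target.measurableSet
    fun _ _ => mul_nonneg (mul_nonneg ((chartPartition n X).nonneg i _) (hf _)) (Real.sqrt_nonneg _)

/-- The gradients of a partition of unity add up to d1 = 0. -/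
theorem CovectorField.bracket_sum_grad (Ω : SymplecticForm n X) (η : CovectorField n X) (x : X) :
    ∑ i ∈ partitionIndex n X,
      (CovectorField.grad (chartPartition n X i) (smoothFun_chartPartition i)).bracket Ω η x = 0 := by
  have h1 : ∀ a, ∑ i ∈ partitionIndex n X,
      pd a (fun z => chartPartition n X i ((chartAt (R2 n) x).symm z)) (chartAt (R2 n) x x) = 0 := by
    intro a
    rw [← pd_sum (f := fun i z => chartPartition n X i ((chartAt (R2 n) x).symm z))
      fun i _ => (smoothFun_chartPartition i x _ (mem_chart_target (R2 n) x)).differentiableAt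
        (by simp)]
    simp only [sum_chartPartition, pd_const]
  simp only [CovectorField.bracket]
  rw [Finset.sum_comm]
  refine Finset.sum_eq_zero fun a _ => ?_
  rw [Finset.sum_comm]
  refine Finset.sum_eq_zero fun b _ => ?_
  rw [← Finset.sum_mul, ← Finset.mul_sum]
  have h2 := h1 a
  change (_ * ∑ i ∈ partitionIndex n X,
      pd a (fun z => chartPartition n X i ((chartAt (R2 n) x).symm z)) (chartAt (R2 n) x x)) * _ = 0
  rw [h2, mul_zero, zero_mul]

theorem SymplecticForm.chartIntegral_sum {κ : Type*} (Ω : SymplecticForm n X) {i : X}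
    (s : Finset κ) {h : κ → X → ℝ} (hh : ∀ k ∈ s, SmoothFun n (h k))
    (hs : ∀ k ∈ s, tsupport (h k) ⊆ (chartAt (R2 n) i).source) :
    Ω.chartIntegral i (fun x => ∑ k ∈ s, h k x) = ∑ k ∈ s, Ω.chartIntegral i (h k) := by
  simp only [chartIntegral]
  rw [← integral_finsetSum _ fun k hk => Ω.integrableOn_chart (hh k hk) (hs k hk)]
  simp only [Finset.sum_mul]

/-- The divergence theorem. -/
theorem CovectorField.IsDiv.integral_eq_zero {η : CovectorField n X} {f : X → ℝ}
    (h : η.IsDiv Ω f) : Ω.integral f = 0 := by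
  set ρ := chartPartition n X
  set I := partitionIndex n X
  let β : X → X → ℝ := fun i =>
    (CovectorField.grad (ρ i) (smoothFun_chartPartition i)).bracket Ω η
  have hβ : ∀ i, SmoothFun n (β i) := fun i => CovectorField.smoothFun_bracket Ω _ η
  have hβs : ∀ i, tsupport (β i) ⊆ (chartAt (R2 n) i).source := fun i =>
    (η.tsupport_bracket_grad Ω _).trans (tsupport_chartPartition i)
  -- Integration by parts puts the derivative on ρ_i. Inserting 1 = Σ ρ_k splits the result into
  -- pieces supported in both chart domains, which are moved from the chart at i to the chart at k.
  have h1 : ∀ i, Ω.chartIntegral i (fun x => ρ i x * f x) =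
      -∑ k ∈ I, Ω.chartIntegral k (fun x => ρ k x * β i x) := by
    intro i
    rw [h.chartIntegral_mul (smoothFun_chartPartition i) (tsupport_chartPartition i)]
    congr 1
    have h2 : β i = fun x => ∑ k ∈ I, ρ k x * β i x := by
      funext x
      rw [← Finset.sum_mul, sum_chartPartition, one_mul]
    have hs : ∀ k, tsupport (fun x => ρ k x * β i x) ⊆ (chartAt (R2 n) i).source := fun k =>
      (closure_mono fun x hx => right_ne_zero_of_mul hx).trans (hβs i)
    change Ω.chartIntegral i (β i) = _
    rw [h2, Ω.chartIntegral_sum I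
      (fun k _ => (smoothFun_chartPartition k).mul (hβ i)) (fun k _ => hs k)]
    refine Finset.sum_congr rfl fun k _ => ?_
    simp only [← Finset.sum_mul, ρ, I, sum_chartPartition, one_mul]
    refine Ω.chartIntegral_eq i k (fun x hx => ?_) (fun x hx => ?_)
    · by_contra h0
      exact hx (hs k (subset_tsupport (fun x => ρ k x * β i x) h0))
    · by_contra h0
      exact hx (tsupport_chartPartition k (subset_tsupport _ (left_ne_zero_of_mul h0)))
  rw [SymplecticForm.integral, Finset.sum_congr rfl fun i _ => h1 i, Finset.sum_neg_distrib,
    neg_eq_zero, Finset.sum_comm]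
  refine Finset.sum_eq_zero fun k _ => ?_
  rw [← Ω.chartIntegral_sum I
      (fun i _ => (smoothFun_chartPartition k).mul (hβ i))
      (fun i _ => tsupport_mul_subset (tsupport_chartPartition k))]
  -- After the exchange of sums all pieces with index k live in one chart, where the derivatives of
  -- the ρ_i cancel.
  have h3 : (fun x => ∑ i ∈ I, ρ k x * β i x) = fun _ => 0 := by
    funext x
    rw [← Finset.mul_sum, η.bracket_sum_grad Ω x, mul_zero]
  rw [h3]
  simp [SymplecticForm.chartIntegral]

end Stokes

/-! ### The adjoint representation and the Lie bracket -/

section LieGroupCalculus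

set_option linter.unusedSectionVars false

/-! ### Derivatives of maps between manifolds, as maps of the model spaces. -/

section ChartDeriv

variable {V : Type*} [NormedAddCommGroup V] [NormedSpace ℝ V]
  {M : Type*} [TopologicalSpace M] [ChartedSpace V M] [IsManifold 𝓘(ℝ, V) ∞ M]
  {V' : Type*} [NormedAddCommGroup V'] [NormedSpace ℝ V']
  {M' : Type*} [TopologicalSpace M'] [ChartedSpace V' M'] [IsManifold 𝓘(ℝ, V') ∞ M']

variable (V V') in
/-- The derivative of a map between manifolds, as a map between the model spaces. -/
def mfd (f : M → M') (x : M) : V →L[ℝ] V' := mfderiv 𝓘(ℝ, V) 𝓘(ℝ, V') f x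

/-- The equation `f x = z` is kept as a hypothesis so that the chart at a convenient name for the
image point can be used. -/
theorem mfd_eq_fderiv {f : M → M'} {x : M} {z : M'} (hf : MDifferentiableAt 𝓘(ℝ, V) 𝓘(ℝ, V') f x)
    (hz : f x = z) : mfd V V' f x =
      fderiv ℝ (fun y => chartAt V' z (f ((chartAt V x).symm y))) (chartAt V x x) := by
  subst hz
  have h3 : fderivWithin ℝ (writtenInExtChartAt 𝓘(ℝ, V) 𝓘(ℝ, V') x f) (range 𝓘(ℝ, V))
      (extChartAt 𝓘(ℝ, V) x x) =
      fderiv ℝ (fun y => chartAt V' (f x) (f ((chartAt V x).symm y))) (chartAt V x x) := by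
    rw [ModelWithCorners.range_eq_univ, fderivWithin_univ]
    rfl
  unfold mfd mfderiv
  exact (if_pos hf).trans h3

/-- The tangent space at x is identified with the model space by the chart at x itself, so at this
one point the inverse chart has the identity as derivative. -/
theorem mfd_chart_symm_self (x : M) : mfd V V (chartAt V x).symm (chartAt V x x) =
    ContinuousLinearMap.id ℝ V := by
  rw [mfd_eq_fderiv (mdifferentiableAt_chart_symm x (mem_chart_target V x))
    ((chartAt V x).left_inv (mem_chart_source V x))]
  have h2 : (fun y => chartAt V x ((chartAt V x).symm ((chartAt V (chartAt V x x)).symm y)))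
      =ᶠ[𝓝 (chartAt V x x)] id := by
    filter_upwards [(chartAt V x).open_target.mem_nhds (mem_chart_target V x)] with z hz
    exact (chartAt V x).right_inv hz
  exact h2.fderiv_eq.trans fderiv_id

theorem mfd_comp {V'' : Type*} [NormedAddCommGroup V''] [NormedSpace ℝ V'']
    {M'' : Type*} [TopologicalSpace M''] [ChartedSpace V'' M''] {g : M' → M''} {f : M → M'} {x : M}
    {z : M'} (hz : f x = z) (hg : MDifferentiableAt 𝓘(ℝ, V') 𝓘(ℝ, V'') g z)
    (hf : MDifferentiableAt 𝓘(ℝ, V) 𝓘(ℝ, V') f x) :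
    mfd V V'' (fun y => g (f y)) x = (mfd V' V'' g z).comp (mfd V V' f x) := by
  subst hz
  exact mfderiv_comp (I' := 𝓘(ℝ, V')) x hg hf

end ChartDeriv

variable {EG : Type*} [NormedAddCommGroup EG] [NormedSpace ℝ EG] [CompleteSpace EG]
  {G : Type*} [TopologicalSpace G] [ChartedSpace EG G] [Group G] [LieGroup 𝓘(ℝ, EG) ∞ G]

variable (EG G) in
/-- The coordinates of the unit element. -/
def unitCoord : EG := chartAt EG (1 : G) 1

variable (EG G) in
/-- The inverse of the chart at the unit element. -/
def expChart (x : EG) : G := (chartAt EG (1 : G)).symm x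

variable (EG G) in
theorem expChart_unitCoord : expChart EG G (unitCoord EG G) = 1 :=
  (chartAt EG (1 : G)).left_inv (mem_chart_source EG 1)

theorem contMDiffAt_expChart : ContMDiffAt 𝓘(ℝ, EG) 𝓘(ℝ, EG) ∞ (expChart EG G) (unitCoord EG G) :=
  (contMDiffOn_chart_symm (I := 𝓘(ℝ, EG)) (x := (1 : G))).contMDiffAt
    ((chartAt EG (1 : G)).open_target.mem_nhds (mem_chart_target EG 1))

variable (EG G) in
/-- The group multiplication in the chart at the unit element. -/
def localMul (q : EG × EG) : EG := chartAt EG (1 : G) (expChart EG G q.1 * expChart EG G q.2)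

variable (EG G) in
/-- The conjugation `(h, k) ↦ h⁻¹ k h` in the chart at the unit element. -/
def localConj (q : EG × EG) : EG :=
  chartAt EG (1 : G) ((expChart EG G q.1)⁻¹ * expChart EG G q.2 * expChart EG G q.1)

theorem contDiffAt_chart_one_comp {U : Type*} [NormedAddCommGroup U] [NormedSpace ℝ U] {f : U → G}
    {y : U} (hf : ContMDiffAt 𝓘(ℝ, U) 𝓘(ℝ, EG) ∞ f y) (h1 : f y = 1) :
    ContDiffAt ℝ ∞ (fun z => chartAt EG (1 : G) (f z)) y := by
  rw [← contMDiffAt_iff_contDiffAt]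
  have h2 : ContMDiffAt 𝓘(ℝ, EG) 𝓘(ℝ, EG) ∞ (chartAt EG (1 : G)) (f y) :=
    (contMDiffOn_chart (I := 𝓘(ℝ, EG))).contMDiffAt
      ((chartAt EG (1 : G)).open_source.mem_nhds (by rw [h1]; exact mem_chart_source EG 1))
  exact h2.comp y hf

variable (EG G) in
theorem contMDiffAt_expChart_fst : ContMDiffAt 𝓘(ℝ, EG × EG) 𝓘(ℝ, EG) ∞
    (fun q : EG × EG => expChart EG G q.1) (unitCoord EG G, unitCoord EG G) :=
  ContMDiffAt.comp (g := expChart EG G) (f := (Prod.fst : EG × EG → EG))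
    (I' := 𝓘(ℝ, EG)) _ contMDiffAt_expChart contDiff_fst.contMDiff.contMDiffAt

variable (EG G) in
theorem contMDiffAt_expChart_snd : ContMDiffAt 𝓘(ℝ, EG × EG) 𝓘(ℝ, EG) ∞
    (fun q : EG × EG => expChart EG G q.2) (unitCoord EG G, unitCoord EG G) :=
  ContMDiffAt.comp (g := expChart EG G) (f := (Prod.snd : EG × EG → EG))
    (I' := 𝓘(ℝ, EG)) _ contMDiffAt_expChart contDiff_snd.contMDiff.contMDiffAt

variable (EG G) in
theorem contDiffAt_localMul : ContDiffAt ℝ ∞ (localMul EG G) (unitCoord EG G, unitCoord EG G) :=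
  contDiffAt_chart_one_comp ((contMDiffAt_expChart_fst EG G).mul (contMDiffAt_expChart_snd EG G))
    (by simp [expChart_unitCoord])

variable (EG G) in
theorem contDiffAt_localConj : ContDiffAt ℝ ∞ (localConj EG G) (unitCoord EG G, unitCoord EG G) :=
  contDiffAt_chart_one_comp (((contMDiffAt_expChart_fst EG G).inv.mul
    (contMDiffAt_expChart_snd EG G)).mul (contMDiffAt_expChart_fst EG G))
    (by simp [expChart_unitCoord])

theorem mdifferentiableAt_mul_left (g h : G) :
    MDifferentiableAt 𝓘(ℝ, EG) 𝓘(ℝ, EG) (fun k => g * k) h :=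
  (contMDiff_mul_left (I := 𝓘(ℝ, EG)) (n := ∞)).contMDiffAt.mdifferentiableAt (by simp)

variable (EG) in
theorem mdifferentiableAt_conj (g h : G) :
    MDifferentiableAt 𝓘(ℝ, EG) 𝓘(ℝ, EG) (fun k => g * k * g⁻¹) h :=
  ((contMDiff_mul_right (I := 𝓘(ℝ, EG)) (n := ∞) (a := g⁻¹)).comp
    (contMDiff_mul_left (I := 𝓘(ℝ, EG)) (n := ∞) (a := g))).contMDiffAt.mdifferentiableAt (by simp)

theorem Ad_eq (a : G) : (Ad a : EG → EG) = mfd EG EG (fun h : G => a * h * a⁻¹) 1 := rfl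

theorem Ad_eq_fderiv (a : G) (ξ : EG) : Ad a ξ = fderiv ℝ
    (fun x => chartAt EG (1 : G) (a * expChart EG G x * a⁻¹)) (unitCoord EG G) ξ := by
  rw [Ad_eq, mfd_eq_fderiv (mdifferentiableAt_conj EG a 1) (z := 1) (by simp)]
  rfl

theorem Ad_mul (a b : G) (ξ : EG) : Ad (a * b) ξ = Ad a (Ad b ξ) := by
  have h : (fun h : G => a * b * h * (a * b)⁻¹) = fun h => a * (b * h * b⁻¹) * a⁻¹ := by
    funext h; group
  rw [Ad_eq, Ad_eq, Ad_eq, h, mfd_comp (V' := EG) (g := fun h => a * h * a⁻¹) (z := 1) (by simp)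
    (mdifferentiableAt_conj EG a 1) (mdifferentiableAt_conj EG b 1)]
  rfl

theorem Ad_one (ξ : EG) : Ad (1 : G) ξ = ξ := by
  have h : (fun h : G => 1 * h * 1⁻¹) = id := by funext h; simp
  rw [Ad_eq, h]
  exact DFunLike.congr_fun (mfderiv_id (I := 𝓘(ℝ, EG)) (x := (1 : G))) ξ

variable (EG G) in
/-- The second derivative of the multiplication at the unit element. -/
def hessMul : EG × EG →L[ℝ] EG × EG →L[ℝ] EG :=
  fderiv ℝ (fderiv ℝ (localMul EG G)) (unitCoord EG G, unitCoord EG G)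

variable (EG G) in
theorem tendsto_diag : Filter.Tendsto (fun x : EG => (x, unitCoord EG G)) (𝓝 (unitCoord EG G))
    (𝓝 (unitCoord EG G, unitCoord EG G)) :=
  (continuous_id.prodMk continuous_const).tendsto _

theorem hasFDerivAt_partial_fst {U W : Type*} [NormedAddCommGroup U] [NormedSpace ℝ U]
    [NormedAddCommGroup W] [NormedSpace ℝ W] {F : U × U → W} {x y : U}
    (hF : DifferentiableAt ℝ F (x, y)) : HasFDerivAt (fun z => F (z, y))
      ((fderiv ℝ F (x, y)).comp (ContinuousLinearMap.inl ℝ U U)) x :=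
  HasFDerivAt.comp (f := fun z => (z, y)) x hF.hasFDerivAt (hasFDerivAt_prodMk_left x y)

theorem hasFDerivAt_partial_snd {U W : Type*} [NormedAddCommGroup U] [NormedSpace ℝ U]
    [NormedAddCommGroup W] [NormedSpace ℝ W] {F : U × U → W} {x y : U}
    (hF : DifferentiableAt ℝ F (x, y)) : HasFDerivAt (fun z => F (x, z))
      ((fderiv ℝ F (x, y)).comp (ContinuousLinearMap.inr ℝ U U)) y :=
  HasFDerivAt.comp (f := fun z => (x, z)) y hF.hasFDerivAt (hasFDerivAt_prodMk_right x y)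

theorem fderiv_partial_snd {U W : Type*} [NormedAddCommGroup U] [NormedSpace ℝ U]
    [NormedAddCommGroup W] [NormedSpace ℝ W] {F : U × U → W} {x y : U}
    (hF : DifferentiableAt ℝ F (x, y)) (v : U) :
    fderiv ℝ (fun z => F (x, z)) y v = fderiv ℝ F (x, y) (0, v) :=
  DFunLike.congr_fun (hasFDerivAt_partial_snd hF).fderiv v

theorem fderiv_partial_fst {U W : Type*} [NormedAddCommGroup U] [NormedSpace ℝ U]
    [NormedAddCommGroup W] [NormedSpace ℝ W] {F : U × U → W} {x y : U}
    (hF : DifferentiableAt ℝ F (x, y)) (v : U) :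
    fderiv ℝ (fun z => F (z, y)) x v = fderiv ℝ F (x, y) (v, 0) :=
  DFunLike.congr_fun (hasFDerivAt_partial_fst hF).fderiv v

variable (EG G) in
theorem eventually_localMul : ∀ᶠ q in 𝓝 (unitCoord EG G, unitCoord EG G),
    q.1 ∈ (chartAt EG (1 : G)).target ∧ q.2 ∈ (chartAt EG (1 : G)).target ∧
    expChart EG G q.1 * expChart EG G q.2 ∈ (chartAt EG (1 : G)).source ∧
    (expChart EG G q.1)⁻¹ * expChart EG G q.2 * expChart EG G q.1 ∈ (chartAt EG (1 : G)).source ∧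
    DifferentiableAt ℝ (localMul EG G) q ∧ DifferentiableAt ℝ (localConj EG G) q := by
  have h0 := (chartAt EG (1 : G)).open_target.mem_nhds (mem_chart_target EG (1 : G))
  have hs : (chartAt EG (1 : G)).source ∈ 𝓝 (1 : G) :=
    (chartAt EG (1 : G)).open_source.mem_nhds (mem_chart_source EG (1 : G))
  have h1 := (((contMDiffAt_expChart_fst EG G).mul (contMDiffAt_expChart_snd EG G)).continuousAt)
  have h2 := (((contMDiffAt_expChart_fst EG G).inv.mul
    (contMDiffAt_expChart_snd EG G)).mul (contMDiffAt_expChart_fst EG G)).continuousAt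
  have h3 := ((contDiffAt_localMul EG G).of_le (m := 1) (by simp)).eventually (by simp)
  have h4 := ((contDiffAt_localConj EG G).of_le (m := 1) (by simp)).eventually (by simp)
  have h5 := (continuousAt_fst (p := (unitCoord EG G, unitCoord EG G))).preimage_mem_nhds h0
  have h6 := (continuousAt_snd (p := (unitCoord EG G, unitCoord EG G))).preimage_mem_nhds h0
  have h7 := h1.preimage_mem_nhds (t := (chartAt EG (1 : G)).source)
    (by simpa [expChart_unitCoord] using hs)
  have h8 := h2.preimage_mem_nhds (t := (chartAt EG (1 : G)).source)
    (by simpa [expChart_unitCoord] using hs)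
  filter_upwards [h3, h4, h5, h6, h7, h8] with q h3 h4 h5 h6 h7 h8
  exact ⟨h5, h6, h7, h8, h3.differentiableAt (by simp), h4.differentiableAt (by simp)⟩

/-- Left invariant vector fields in the chart at the unit element. -/
def leftField (ξ : EG) (x : EG) : EG := fderiv ℝ (localMul EG G) (x, unitCoord EG G) (0, ξ)

/-- Matches left-invariant vector fields on the group with the partial derivative of the
multiplication in the chart at the unit. -/
theorem mfd_mul_left_chart {x : EG} (hx : x ∈ (chartAt EG (1 : G)).target)
    (hd : DifferentiableAt ℝ (localMul EG G) (x, unitCoord EG G)) (ξ : EG) :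
    mfd EG EG (chartAt EG (1 : G)) (expChart EG G x)
      (mfd EG EG (fun k : G => expChart EG G x * k) 1 ξ) = leftField (G := G) ξ x := by
  have h1 : expChart EG G x ∈ (chartAt EG (1 : G)).source := (chartAt EG (1 : G)).map_target hx
  rw [leftField, ← fderiv_partial_snd hd]
  have h2 : mfd EG EG (fun y => chartAt EG (1 : G) (expChart EG G x * expChart EG G y))
      (unitCoord EG G) = ((mfd EG EG (chartAt EG (1 : G)) (expChart EG G x)).comp
      (mfd EG EG (fun k : G => expChart EG G x * k) 1)).comp
      (mfd EG EG (expChart EG G) (unitCoord EG G)) := by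
    rw [mfd_comp (V' := EG) (f := expChart EG G) (z := 1)
      (g := fun k => chartAt EG (1 : G) (expChart EG G x * k)) (expChart_unitCoord EG G) ?_ ?_,
      mfd_comp (V' := EG) (f := fun k => expChart EG G x * k) (z := expChart EG G x)
        (g := chartAt EG (1 : G)) (mul_one _) ?_ (mdifferentiableAt_mul_left _ _)]
    · exact mdifferentiableAt_chart _ h1
    · refine MDifferentiableAt.comp (I' := 𝓘(ℝ, EG)) (g := chartAt EG (1 : G)) (1 : G) ?_
        (mdifferentiableAt_mul_left _ _)
      rw [mul_one]
      exact mdifferentiableAt_chart _ h1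
    · exact mdifferentiableAt_chart_symm _ (mem_chart_target EG (1 : G))
  have h3 : mfd EG EG (expChart EG G) (unitCoord EG G) = ContinuousLinearMap.id ℝ EG :=
    mfd_chart_symm_self (1 : G)
  rw [h3, ContinuousLinearMap.comp_id] at h2
  have h4 := DFunLike.congr_fun h2 ξ
  rw [mfd, mfderiv_eq_fderiv] at h4
  exact h4.symm

theorem leftField_unit (ξ : EG) : leftField (G := G) ξ (unitCoord EG G) = ξ := by
  have hd := (contDiffAt_localMul EG G).differentiableAt (by simp)
  rw [leftField, ← fderiv_partial_snd hd]
  have h : (fun y => localMul EG G (unitCoord EG G, y)) =ᶠ[𝓝 (unitCoord EG G)] id := by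
    filter_upwards [(chartAt EG (1 : G)).open_target.mem_nhds (mem_chart_target EG (1 : G))] with y hy
    simp only [localMul, expChart_unitCoord, one_mul]
    exact (chartAt EG (1 : G)).right_inv hy
  rw [h.fderiv_eq, fderiv_id]
  rfl

theorem hasFDerivAt_leftField (ξ : EG) :
    HasFDerivAt (leftField (G := G) ξ) (((hessMul EG G).flip (0, ξ)).comp
      (ContinuousLinearMap.inl ℝ EG EG)) (unitCoord EG G) := by
  have h1 : DifferentiableAt ℝ (fderiv ℝ (localMul EG G)) (unitCoord EG G, unitCoord EG G) :=
    ((contDiffAt_localMul EG G).fderiv_right (m := ∞) (by simp)).differentiableAt (by simp)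
  have h2 := hasFDerivAt_partial_fst h1
  have h3 := h2.clm_apply (hasFDerivAt_const ((0, ξ) : EG × EG) (unitCoord EG G))
  refine h3.congr_fderiv ?_
  ext v
  simp [hessMul]

/-- Left invariant vector fields, pulled back to the chart at the unit element. -/
def pullbackLeft (ξ : EG) : EG → EG :=
  VectorField.mpullbackWithin 𝓘(ℝ, EG) 𝓘(ℝ, EG) (extChartAt 𝓘(ℝ, EG) (1 : G)).symm
    (mulInvariantVectorField (I := 𝓘(ℝ, EG)) (G := G) ξ) (range 𝓘(ℝ, EG))

theorem pullbackLeft_eventuallyEq (ξ : EG) :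
    pullbackLeft (G := G) ξ =ᶠ[𝓝 (unitCoord EG G)] leftField (G := G) ξ := by
  filter_upwards [(tendsto_diag EG G).eventually (eventually_localMul EG G)] with x hx
  rw [← mfd_mul_left_chart hx.1 hx.2.2.2.2.1, pullbackLeft, ModelWithCorners.range_eq_univ,
    VectorField.mpullbackWithin_apply, mfderivWithin_univ]
  have h1 := mfderiv_chart_comp_mfderiv_chart_symm (1 : G) hx.1
  have h2 := mfderiv_chart_symm_comp_mfderiv_chart (1 : G)
    ((chartAt EG (1 : G)).map_target hx.1)
  rw [(chartAt EG (1 : G)).right_inv hx.1] at h2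
  have h3 := ContinuousLinearMap.inverse_eq h2 h1
  exact congrArg (fun L : EG →L[ℝ] EG => L (mfd EG EG (fun k : G => expChart EG G x * k) 1 ξ)) h3

/-- The bracket of the Lie algebra is the vector field bracket of left-invariant fields at 1. In the
chart these fields take the values ξ, ζ at the unit, and their derivatives there are mixed second
derivatives of the multiplication. -/
theorem bracketMap_eq (ξ ζ : EG) : bracketMap EG G ξ ζ =
    hessMul EG G (ξ, 0) (0, ζ) - hessMul EG G (ζ, 0) (0, ξ) := by
  have hin : mfd EG EG (extChartAt 𝓘(ℝ, EG) (1 : G)) 1 = ContinuousLinearMap.id ℝ EG := by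
    have h1 := mfderiv_chart_symm_comp_mfderiv_chart (1 : G) (mem_chart_source EG (1 : G))
    have h2 : (mfd EG EG (chartAt EG (1 : G)).symm (unitCoord EG G)).comp
      (mfd EG EG (chartAt EG (1 : G)) 1) = ContinuousLinearMap.id ℝ EG := h1
    have h3 : mfd EG EG (chartAt EG (1 : G)).symm (unitCoord EG G) = _ :=
      mfd_chart_symm_self (1 : G)
    rw [h3, ContinuousLinearMap.id_comp] at h2
    exact h2
  have h1 : bracketMap EG G ξ ζ = (mfd EG EG (extChartAt 𝓘(ℝ, EG) (1 : G)) 1).inverse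
      (VectorField.lieBracketWithin ℝ (pullbackLeft (G := G) ξ) (pullbackLeft (G := G) ζ)
        ((extChartAt 𝓘(ℝ, EG) (1 : G)).symm ⁻¹' univ ∩ range 𝓘(ℝ, EG)) (unitCoord EG G)) := rfl
  rw [h1, hin, ContinuousLinearMap.inverse_id, ContinuousLinearMap.id_apply,
    ModelWithCorners.range_eq_univ, preimage_univ, univ_inter, VectorField.lieBracketWithin_univ,
    VectorField.lieBracket, (pullbackLeft_eventuallyEq ξ).fderiv_eq,
    (pullbackLeft_eventuallyEq ζ).fderiv_eq, (pullbackLeft_eventuallyEq ξ).self_of_nhds,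
    (pullbackLeft_eventuallyEq ζ).self_of_nhds, leftField_unit, leftField_unit,
    (hasFDerivAt_leftField ξ).fderiv, (hasFDerivAt_leftField ζ).fderiv]
  rfl

/-- The function `h ↦ Ad h⁻¹ ζ` in the chart at the unit element. -/
def adInv (ζ : EG) (x : EG) : EG := Ad (expChart EG G x)⁻¹ ζ

theorem adInv_eq : ∀ᶠ x in 𝓝 (unitCoord EG G), ∀ ζ : EG,
    adInv (G := G) ζ x = fderiv ℝ (localConj EG G) (x, unitCoord EG G) (0, ζ) := by
  filter_upwards [(tendsto_diag EG G).eventually (eventually_localMul EG G)] with x hx ζ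
  rw [adInv, Ad_eq_fderiv, ← fderiv_partial_snd hx.2.2.2.2.2]
  simp only [inv_inv]
  rfl

theorem adInv_unit (ζ : EG) : adInv (G := G) ζ (unitCoord EG G) = ζ := by
  rw [adInv, expChart_unitCoord, inv_one, Ad_one]

theorem hasFDerivAt_adInv (ζ : EG) : HasFDerivAt (adInv (G := G) ζ)
    (fderiv ℝ (adInv (G := G) ζ) (unitCoord EG G)) (unitCoord EG G) := by
  refine DifferentiableAt.hasFDerivAt ?_
  have h1 : DifferentiableAt ℝ (fderiv ℝ (localConj EG G)) (unitCoord EG G, unitCoord EG G) :=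
    ((contDiffAt_localConj EG G).fderiv_right (m := ∞) (by simp)).differentiableAt (by simp)
  have h2 := hasFDerivAt_partial_fst h1
  have h3 := h2.clm_apply (hasFDerivAt_const ((0, ζ) : EG × EG) (unitCoord EG G))
  exact h3.differentiableAt.congr_of_eventuallyEq (adInv_eq.mono fun x hx => hx ζ)

/-- The derivative of the adjoint representation is the Lie bracket. -/
theorem fderiv_adInv (ζ ξ : EG) :
    fderiv ℝ (adInv (G := G) ζ) (unitCoord EG G) ξ = -bracketMap EG G ξ ζ := by
  set e₀ := unitCoord EG G with he
  have hm : DifferentiableAt ℝ (fderiv ℝ (localMul EG G)) (e₀, e₀) :=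
    ((contDiffAt_localMul EG G).fderiv_right (m := ∞) (by simp)).differentiableAt (by simp)
  -- The identity x · (x⁻¹yx) = y · x, differentiated in y at the unit in the direction ζ, for every
  -- x near the unit.
  have hev : (fun x => fderiv ℝ (localMul EG G) (x, e₀) (0, adInv (G := G) ζ x)) =ᶠ[𝓝 e₀]
      fun x => fderiv ℝ (localMul EG G) (e₀, x) (ζ, 0) := by
    have htd2 : Filter.Tendsto (fun x : EG => (e₀, x)) (𝓝 e₀) (𝓝 (e₀, e₀)) :=
      (continuous_const.prodMk continuous_id).tendsto _
    have hc2 : ∀ᶠ q in 𝓝 (e₀, e₀), ∀ᶠ r in 𝓝 q, _ :=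
      eventually_eventually_nhds.2 (eventually_localMul EG G)
    filter_upwards [(tendsto_diag EG G).eventually hc2, htd2.eventually (eventually_localMul EG G),
      adInv_eq (G := G)] with x hx hx2 hx3
    have hx1 := hx.self_of_nhds
    rw [hx3, ← fderiv_partial_fst hx2.2.2.2.2.1]
    have hcu : localConj EG G (x, e₀) = e₀ := by
      simp [localConj, he, expChart_unitCoord]; rfl
    have h1 : HasFDerivAt (fun y : EG => (x, localConj EG G (x, y)))
        ((0 : EG →L[ℝ] EG).prod ((fderiv ℝ (localConj EG G) (x, e₀)).comp
          (ContinuousLinearMap.inr ℝ EG EG))) e₀ :=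
      (hasFDerivAt_const x e₀).prodMk (hasFDerivAt_partial_snd hx1.2.2.2.2.2)
    have h2 : HasFDerivAt (localMul EG G) (fderiv ℝ (localMul EG G) (x, e₀))
        (x, localConj EG G (x, e₀)) := by
      rw [hcu]; exact hx1.2.2.2.2.1.hasFDerivAt
    have h3 := (HasFDerivAt.comp (f := fun y => (x, localConj EG G (x, y))) e₀ h2 h1).fderiv
    have h4 : (fun y => localMul EG G (x, localConj EG G (x, y))) =ᶠ[𝓝 e₀]
        fun y => localMul EG G (y, x) := by
      have htd3 : Filter.Tendsto (fun y : EG => (x, y)) (𝓝 e₀) (𝓝 (x, e₀)) :=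
        (continuous_const.prodMk continuous_id).tendsto _
      filter_upwards [htd3.eventually hx] with y hy
      have h5 : expChart EG G (localConj EG G (x, y)) =
          (expChart EG G x)⁻¹ * expChart EG G y * expChart EG G x :=
        (chartAt EG (1 : G)).left_inv hy.2.2.2.1
      simp only [localMul, h5]
      congr 1
      group
    have h5 := h4.fderiv_eq (𝕜 := ℝ)
    have h6 := DFunLike.congr_fun (h3.symm.trans h5) ζ
    exact h6
  have hl := (hasFDerivAt_partial_fst hm).clm_apply
    ((hasFDerivAt_const (0 : EG) e₀).prodMk (hasFDerivAt_adInv (G := G) ζ))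
  have hr := (hasFDerivAt_partial_snd hm).clm_apply (hasFDerivAt_const ((ζ, 0) : EG × EG) e₀)
  -- Differentiating that identity in x in the direction ξ expresses the derivative of Ad x⁻¹ ζ
  -- through two mixed second derivatives of the multiplication.
  have h1 := DFunLike.congr_fun (hl.fderiv.symm.trans (hev.fderiv_eq.trans hr.fderiv)) ξ
  have hsymm : hessMul EG G (0, ξ) (ζ, 0) = hessMul EG G (ζ, 0) (0, ξ) :=
    ((contDiffAt_localMul EG G).isSymmSndFDerivAt
      (by rw [minSmoothness_of_isRCLikeNormedField]; exact ENat.LEInfty.out)) _ _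
  have h2 := leftField_unit (G := G) (fderiv ℝ (adInv (G := G) ζ) e₀ ξ)
  rw [bracketMap_eq, ← hsymm, neg_sub, ← h2, eq_sub_iff_add_eq, leftField]
  have h3 := adInv_unit (G := G) ζ
  simp only [add_apply, ContinuousLinearMap.comp_apply, ContinuousLinearMap.flip_apply,
    zero_apply] at h1
  rw [map_zero, zero_add, show adInv (G := G) ζ e₀ = ζ from h3] at h1
  exact h1

/-- The adjoint representation is compatible with the bracket. -/
theorem Ad_bracketMap (a : G) (ξ ζ : EG) :
    Ad a (bracketMap EG G ξ ζ) = bracketMap EG G (Ad a ξ) (Ad a ζ) := by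
  set e₀ := unitCoord EG G with he
  let c : EG → EG := fun x => chartAt EG (1 : G) (a * expChart EG G x * a⁻¹)
  have hcm : ContMDiffAt 𝓘(ℝ, EG) 𝓘(ℝ, EG) ∞ (fun x => a * expChart EG G x * a⁻¹) e₀ :=
    (contMDiffAt_const.mul contMDiffAt_expChart).mul contMDiffAt_const
  have h1 : a * expChart EG G e₀ * a⁻¹ = 1 := by rw [he, expChart_unitCoord]; simp
  have hc : DifferentiableAt ℝ c e₀ := (contDiffAt_chart_one_comp hcm h1).differentiableAt (by simp)
  have hc0 : c e₀ = e₀ := by simp only [c, h1]; rfl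
  -- Ad((axa⁻¹)⁻¹) Ad(a) = Ad(a) Ad(x⁻¹). Differentiating at the unit turns both sides into
  -- brackets.
  have hev : (fun x => adInv (G := G) (Ad a ζ) (c x)) =ᶠ[𝓝 e₀]
      fun x => mfd EG EG (fun h : G => a * h * a⁻¹) 1 (adInv (G := G) ζ x) := by
    have hs : (chartAt EG (1 : G)).source ∈ 𝓝 (a * expChart EG G e₀ * a⁻¹) := by
      rw [h1]
      exact (chartAt EG (1 : G)).open_source.mem_nhds (mem_chart_source EG (1 : G))
    filter_upwards [hcm.continuousAt.preimage_mem_nhds hs] with x hx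
    have h2 : expChart EG G (c x) = a * expChart EG G x * a⁻¹ := (chartAt EG (1 : G)).left_inv hx
    rw [adInv, h2, ← Ad_eq, adInv, ← Ad_mul, ← Ad_mul]
    congr 1
    group
  have hl : HasFDerivAt (fun x => adInv (G := G) (Ad a ζ) (c x))
      ((fderiv ℝ (adInv (G := G) (Ad a ζ)) e₀).comp (fderiv ℝ c e₀)) e₀ := by
    refine HasFDerivAt.comp (g := adInv (G := G) (Ad a ζ)) e₀ ?_ hc.hasFDerivAt
    rw [hc0]
    exact hasFDerivAt_adInv _
  have hr := (mfd EG EG (fun h : G => a * h * a⁻¹) 1).hasFDerivAt.comp e₀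
    (hasFDerivAt_adInv (G := G) ζ)
  have h2 := DFunLike.congr_fun (hl.fderiv.symm.trans (hev.fderiv_eq.trans hr.fderiv)) ξ
  rw [ContinuousLinearMap.comp_apply, ContinuousLinearMap.comp_apply, fderiv_adInv,
    fderiv_adInv, map_neg, neg_inj, ← Ad_eq_fderiv] at h2
  exact h2.symm

/-- Infinitesimal invariance of an invariant inner product. -/
theorem InvariantInner.form_bracketMap [FiniteDimensional ℝ EG] (B : InvariantInner EG G)
    (ξ η ζ : EG) : B.form (bracketMap EG G ξ η) ζ + B.form η (bracketMap EG G ξ ζ) = 0 := by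
  let Bc : EG →L[ℝ] EG →L[ℝ] ℝ := LinearMap.toContinuousLinearMap
    ((LinearMap.toContinuousLinearMap (𝕜 := ℝ) (E := EG) (F' := ℝ)).toLinearMap ∘ₗ B.form)
  -- By invariance B(Ad h⁻¹ η, Ad h⁻¹ ζ) is constant in h, so its derivative at the unit vanishes.
  have h1 : (fun x => Bc (adInv (G := G) η x) (adInv (G := G) ζ x)) = fun _ => B.form η ζ := by
    funext x
    exact B.invariant _ _ _
  have h2 := (Bc.hasFDerivAt.comp (unitCoord EG G) (hasFDerivAt_adInv (G := G) η)).clm_apply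
    (hasFDerivAt_adInv (G := G) ζ)
  have h3 : fderiv ℝ (fun x => Bc (adInv (G := G) η x) (adInv (G := G) ζ x)) (unitCoord EG G) = 0 := by
    rw [h1, fderiv_fun_const]; rfl
  have h4 := DFunLike.congr_fun (h2.fderiv.symm.trans h3) ξ
  simp only [add_apply, ContinuousLinearMap.comp_apply, ContinuousLinearMap.flip_apply,
    zero_apply, Function.comp_apply, adInv_unit, fderiv_adInv, map_neg] at h4
  have h5 : ∀ u v, Bc u v = B.form u v := fun _ _ => rfl
  rw [h5, neg_apply, h5] at h4
  linarith

end LieGroupCalculus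

/-! ### Connections and gauges -/

section Gauges

set_option linter.unusedSectionVars false

variable {EG : Type*} [NormedAddCommGroup EG] [NormedSpace ℝ EG]
  {G : Type*} [TopologicalSpace G] [ChartedSpace EG G] [Group G]
  {n : ℕ} {X : Type*} [TopologicalSpace X] [ChartedSpace (R2 n) X]
  {EP : Type*} [NormedAddCommGroup EP] [NormedSpace ℝ EP]
  {P : Type*} [TopologicalSpace P] [ChartedSpace EP P]
  {E : PrincipalBundle EG G n X EP P}

theorem PrincipalBundle.proj_act (E : PrincipalBundle EG G n X EP P) (p : P) (a : G) :
    E.proj (E.act p a) = E.proj p := by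
  obtain ⟨e, hx, he, -⟩ := E.locallyTrivial (E.proj p)
  have hp : p ∈ e.source := e.mem_source.2 hx
  obtain ⟨h1, h2⟩ := he p hp a
  rw [← e.coe_fst h1, h2, e.coe_fst hp]

theorem PrincipalBundle.exists_act_eq (E : PrincipalBundle EG G n X EP P) {p p' : P}
    (h : E.proj p = E.proj p') : ∃ a : G, p' = E.act p a := by
  obtain ⟨e, hx, he, -⟩ := E.locallyTrivial (E.proj p)
  have hp : p ∈ e.source := e.mem_source.2 hx
  have hp' : p' ∈ e.source := e.mem_source.2 (h ▸ hx)
  obtain ⟨h1, h2⟩ := he p hp ((e p).2⁻¹ * (e p').2)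
  refine ⟨(e p).2⁻¹ * (e p').2, e.injOn hp' h1 ?_⟩
  refine Eq.trans ?_ h2.symm
  rw [mul_inv_cancel_left, e.coe_fst hp, h, ← e.coe_fst hp']
  rfl

theorem PrincipalBundle.contMDiff_act_left (E : PrincipalBundle EG G n X EP P) (a : G) :
    ContMDiff 𝓘(ℝ, EP) 𝓘(ℝ, EP) ∞ (fun q => E.act q a) :=
  E.smooth_act.comp (contMDiff_id.prodMk contMDiff_const)

theorem PrincipalBundle.contMDiff_act_right (E : PrincipalBundle EG G n X EP P) (p : P) :
    ContMDiff 𝓘(ℝ, EG) 𝓘(ℝ, EP) ∞ (fun a => E.act p a) :=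
  E.smooth_act.comp (contMDiff_const.prodMk contMDiff_id)

/-- The fundamental vector fields. -/
def PrincipalBundle.vert (E : PrincipalBundle EG G n X EP P) (p : P) : EG →L[ℝ] EP :=
  mfd EG EP (fun a : G => E.act p a) 1

/-- The value of a connection form. -/
def Connection.val (A : Connection E) (p : P) : EP →L[ℝ] EG :=
  (ContinuousAlternatingMap.ofSubsingleton ℝ EP EG (0 : Fin 1)).symm (A.form p)

theorem Connection.val_apply (A : Connection E) (p : P) (v : EP) : A.val p v = A.form p ![v] := by
  refine congrArg (A.form p) (funext fun i => ?_)
  fin_cases i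
  rfl

theorem Connection.val_vert (A : Connection E) (p : P) (ξ : EG) : A.val p (E.vert p ξ) = ξ := by
  rw [A.val_apply]
  exact A.vertical p ξ

theorem Connection.val_act (A : Connection E) (p : P) (a : G) (v : EP) :
    A.val (E.act p a) (mfd EP EP (fun q => E.act q a) p v) = Ad a⁻¹ (A.val p v) := by
  rw [A.val_apply, A.val_apply]
  exact A.equivariant p a v

variable [CompleteSpace EG] [LieGroup 𝓘(ℝ, EG) ∞ G]

theorem bracketMap_skew (u v : EG) : bracketMap EG G u v = -bracketMap EG G v u :=
  (lie_skew (L := GroupLieAlgebra 𝓘(ℝ, EG) G) u v).symm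

/-- The curvature on the total space. -/
def Connection.tot (A : Connection E) (p : P) : EP [⋀^Fin 2]→ₗ[ℝ] EG := A.curvatureTotal p

/-- [θ∧θ](u, v) is 2[θu, θv] by skewness of the bracket, which absorbs the factor ½. -/
theorem Connection.tot_apply (A : Connection E) (p : P) (u v : EP) :
    A.tot p ![u, v] = DForm.d A.form p ![u, v] + bracketMap EG G (A.val p u) (A.val p v) := by
  let a : EP [⋀^Fin 1]→ₗ[ℝ] EG := (A.form p).toAlternatingMap
  have h1 : A.tot p ![u, v] = DForm.d A.form p ![u, v] + (1 / 2 : ℝ) •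
    (wedge (bracketMap EG G) a a) ![u, v] := rfl
  have h2 : ∀ w, a ![w] = A.val p w := fun w => (A.val_apply p w).symm
  have h3 : ∀ w : EG, (1 / 2 : ℝ) • (w + w) = w := fun w => by
    rw [← two_smul ℝ, smul_smul]; norm_num
  rw [h1, wedge_one_one_apply, h2, h2, bracketMap_skew (A.val p v), sub_neg_eq_add, h3]

variable [IsManifold 𝓘(ℝ, EP) ∞ P]

/-- The curvature of the pullback of a connection form. -/
theorem Connection.tot_pullback (A : Connection E) {U : Type*} [NormedAddCommGroup U]
    [NormedSpace ℝ U] {f : U → P} {s : Set U} (hs : IsOpen s)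
    (hf : ContMDiffOn 𝓘(ℝ, U) 𝓘(ℝ, EP) ∞ f s) {y : U} (hy : y ∈ s) (u v : U) :
    A.tot (f y) ![mfd U EP f y u, mfd U EP f y v] =
      fderiv ℝ (fun z => A.val (f z) (mfd U EP f z v)) y u -
      fderiv ℝ (fun z => A.val (f z) (mfd U EP f z u)) y v +
      bracketMap EG G (A.val (f y) (mfd U EP f y u)) (A.val (f y) (mfd U EP f y v)) := by
  rw [A.tot_apply]
  congr 1
  have h1 := A.smooth.extDeriv_pullback hs hf hy
  have h2 := congrArg (fun F : U [⋀^Fin 2]→L[ℝ] EG => F ![u, v]) h1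
  have h3 : extDeriv (A.form.pullback f) y ![u, v] =
      DForm.d A.form (f y) ![mfd U EP f y u, mfd U EP f y v] := by
    refine h2.trans (congrArg (DForm.d A.form (f y)) (funext fun i => ?_))
    fin_cases i <;> rfl
  rw [← h3, extDeriv_apply (A.smooth.differentiableAt_pullback hs hf hy), Fin.sum_univ_two]
  have h4 : ∀ z w, A.form.pullback f z ![w] = A.val (f z) (mfd U EP f z w) := by
    intro z w
    rw [A.val_apply]
    refine congrArg (A.form (f z)) (funext fun i => ?_)
    fin_cases i
    rfl
  have e0 : (0 : Fin 2).removeNth ![u, v] = ![v] := by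
    ext i : 1; fin_cases i; rfl
  have e1 : (1 : Fin 2).removeNth ![u, v] = ![u] := by
    ext i : 1; fin_cases i; rfl
  rw [e0, e1]
  simp [h4, sub_eq_add_neg]

theorem Connection.contDiffAt_val (A : Connection E) {U : Type*} [NormedAddCommGroup U]
    [NormedSpace ℝ U] {f : U → P} {s : Set U} (hs : IsOpen s)
    (hf : ContMDiffOn 𝓘(ℝ, U) 𝓘(ℝ, EP) ∞ f s) {y : U} (hy : y ∈ s) (v : U) :
    ContDiffAt ℝ ∞ (fun z => A.val (f z) (mfd U EP f z v)) y := by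
  refine (A.smooth.contDiffAt_pullback_apply hs hf hy ![v]).congr_of_eventuallyEq
    (Filter.Eventually.of_forall fun z => ?_)
  simp only [A.val_apply]
  refine congrArg (A.form (f z)) (funext fun i => ?_)
  fin_cases i
  rfl

/-- Vertical vectors annihilate the curvature. -/
theorem Connection.tot_vert (A : Connection E) (p : P) (ξ : EG) (w : EP) :
    A.tot p ![E.vert p ξ, w] = 0 := by
  set q₀ := chartAt EP p p with hq₀
  set e₀ := unitCoord EG G with he₀
  -- The action map (q, x) ↦ q · x in charts. The structure equation is pulled back along it, with ξ
  -- in the group direction and w in the bundle direction.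
  let Ψ : EP × EG → P := fun q => E.act ((chartAt EP p).symm q.1) (expChart EG G q.2)
  have hs : IsOpen ((chartAt EP p).target ×ˢ (chartAt EG (1 : G)).target) :=
    (chartAt EP p).open_target.prod (chartAt EG (1 : G)).open_target
  have hΨ : ContMDiffOn 𝓘(ℝ, EP × EG) 𝓘(ℝ, EP) ∞ Ψ
      ((chartAt EP p).target ×ˢ (chartAt EG (1 : G)).target) := by
    refine E.smooth_act.comp_contMDiffOn (ContMDiffOn.prodMk ?_ ?_)
    · exact ContMDiffOn.comp (contMDiffOn_chart_symm (I := 𝓘(ℝ, EP)) (x := p))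
        contDiff_fst.contMDiff.contMDiffOn fun q hq => hq.1
    · exact ContMDiffOn.comp (contMDiffOn_chart_symm (I := 𝓘(ℝ, EG)) (x := (1 : G)))
        contDiff_snd.contMDiff.contMDiffOn fun q hq => hq.2
  have hm : (q₀, e₀) ∈ (chartAt EP p).target ×ˢ (chartAt EG (1 : G)).target :=
    ⟨mem_chart_target EP p, mem_chart_target EG (1 : G)⟩
  have hp : (chartAt EP p).symm q₀ = p := (chartAt EP p).left_inv (mem_chart_source EP p)
  have hΨ0 : Ψ (q₀, e₀) = p := by
    simp only [Ψ, hp, he₀, expChart_unitCoord, E.act_one]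
  have hd : ∀ q ∈ (chartAt EP p).target, ∀ x ∈ (chartAt EG (1 : G)).target,
      MDifferentiableAt 𝓘(ℝ, EP × EG) 𝓘(ℝ, EP) Ψ (q, x) := fun q hq x hx =>
    mdifferentiableAt_of_contMDiffOn hs hΨ ⟨hq, hx⟩
  have hfst : ∀ q ∈ (chartAt EP p).target, ∀ x ∈ (chartAt EG (1 : G)).target, ∀ v : EP,
      mfd (EP × EG) EP Ψ (q, x) (v, 0) = mfd EP EP (fun r => E.act r (expChart EG G x))
        ((chartAt EP p).symm q) (mfd EP EP (chartAt EP p).symm q v) := by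
    intro q hq x hx v
    have h1 : mfd EP EP (fun r => Ψ (r, x)) q = (mfd (EP × EG) EP Ψ (q, x)).comp
        (mfd EP (EP × EG) (fun r : EP => (r, x)) q) :=
      mfd_comp (f := fun r : EP => (r, x)) rfl (hd q hq x hx)
        (hasFDerivAt_prodMk_left q x).differentiableAt.mdifferentiableAt
    have h2 : mfd EP (EP × EG) (fun r : EP => (r, x)) q = ContinuousLinearMap.inl ℝ EP EG := by
      rw [mfd, mfderiv_eq_fderiv]
      exact (hasFDerivAt_prodMk_left q x).fderiv
    have h3 : mfd EP EP (fun r => Ψ (r, x)) q = (mfd EP EP (fun r => E.act r (expChart EG G x))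
        ((chartAt EP p).symm q)).comp (mfd EP EP (chartAt EP p).symm q) :=
      mfd_comp (g := fun r => E.act r (expChart EG G x)) (f := (chartAt EP p).symm) rfl
        ((E.contMDiff_act_left _).contMDiffAt.mdifferentiableAt (by simp))
        (mdifferentiableAt_chart_symm p hq)
    have h4 := DFunLike.congr_fun (h1.symm.trans h3) v
    rw [h2] at h4
    exact h4
  have hsnd : ∀ q ∈ (chartAt EP p).target, ∀ η : EG,
      mfd (EP × EG) EP Ψ (q, e₀) (0, η) = E.vert ((chartAt EP p).symm q) η := by
    intro q hq η
    have h1 : mfd EG EP (fun x => Ψ (q, x)) e₀ = (mfd (EP × EG) EP Ψ (q, e₀)).comp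
        (mfd EG (EP × EG) (fun x : EG => (q, x)) e₀) :=
      mfd_comp (f := fun x : EG => (q, x)) rfl (hd q hq e₀ hm.2)
        (hasFDerivAt_prodMk_right q e₀).differentiableAt.mdifferentiableAt
    have h2 : mfd EG (EP × EG) (fun x : EG => (q, x)) e₀ = ContinuousLinearMap.inr ℝ EP EG := by
      rw [mfd, mfderiv_eq_fderiv]
      exact (hasFDerivAt_prodMk_right q e₀).fderiv
    have h3 : mfd EG EP (fun x => Ψ (q, x)) e₀ = (E.vert ((chartAt EP p).symm q)).comp
        (mfd EG EG (expChart EG G) e₀) :=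
      mfd_comp (g := fun a => E.act ((chartAt EP p).symm q) a) (f := expChart EG G)
        (expChart_unitCoord EG G)
        ((E.contMDiff_act_right _).contMDiffAt.mdifferentiableAt (by simp))
        (mdifferentiableAt_chart_symm (1 : G) hm.2)
    have h5 : mfd EG EG (expChart EG G) e₀ = ContinuousLinearMap.id ℝ EG :=
      mfd_chart_symm_self (1 : G)
    have h4 := DFunLike.congr_fun (h1.symm.trans h3) η
    rw [h2, h5] at h4
    exact h4
  have key := A.tot_pullback hs hΨ hm (0, ξ) (w, 0)
  have hw : mfd EP EP (chartAt EP p).symm q₀ w = w :=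
    DFunLike.congr_fun (mfd_chart_symm_self p) w
  have hact1 : (fun r => E.act r (1 : G)) = id := funext fun r => E.act_one r
  have h5 : mfd (EP × EG) EP Ψ (q₀, e₀) (w, 0) = w := by
    rw [hfst q₀ hm.1 e₀ hm.2, hw, he₀, expChart_unitCoord, hact1]
    exact DFunLike.congr_fun (mfderiv_id (I := 𝓘(ℝ, EP)) (x := (chartAt EP p).symm q₀)) w
  have h6 : mfd (EP × EG) EP Ψ (q₀, e₀) (0, ξ) = E.vert p ξ := by
    rw [hsnd q₀ hm.1, hp]
  have hd1 := (A.contDiffAt_val hs hΨ hm (w, 0)).differentiableAt (by simp)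
  have hd2 := (A.contDiffAt_val hs hΨ hm (0, ξ)).differentiableAt (by simp)
  -- By equivariance, θ on the translate of w is Ad x⁻¹ θ(w), whose derivative in x is −[ξ, θ(w)].
  -- This cancels the bracket term of the curvature.
  have h7 : fderiv ℝ (fun z => A.val (Ψ z) (mfd (EP × EG) EP Ψ z (w, 0))) (q₀, e₀) (0, ξ) =
      -bracketMap EG G ξ (A.val p w) := by
    have h8 := DFunLike.congr_fun (HasFDerivAt.comp (f := fun x : EG => (q₀, x)) e₀ hd1.hasFDerivAt
      (hasFDerivAt_prodMk_right q₀ e₀)).fderiv ξ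
    refine Eq.trans h8.symm ?_
    rw [← fderiv_adInv (G := G), ← he₀]
    refine congrArg (fun L : EG →L[ℝ] EG => L ξ) (Filter.EventuallyEq.fderiv_eq ?_)
    filter_upwards [(chartAt EG (1 : G)).open_target.mem_nhds (mem_chart_target EG (1 : G))] with x hx
    change A.val (Ψ (q₀, x)) (mfd (EP × EG) EP Ψ (q₀, x) (w, 0)) = _
    rw [hfst q₀ hm.1 x hx, hw]
    refine (A.val_act ((chartAt EP p).symm q₀) (expChart EG G x) w).trans ?_
    rw [hp]
    rfl
  -- θ is constantly ξ on the fundamental vector field of ξ.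
  have h9 : fderiv ℝ (fun z => A.val (Ψ z) (mfd (EP × EG) EP Ψ z (0, ξ))) (q₀, e₀) (w, 0) = 0 := by
    have h8 := DFunLike.congr_fun (HasFDerivAt.comp (f := fun q : EP => (q, e₀)) q₀ hd2.hasFDerivAt
      (hasFDerivAt_prodMk_left q₀ e₀)).fderiv w
    refine Eq.trans h8.symm ?_
    have h10 : ((fun z => A.val (Ψ z) (mfd (EP × EG) EP Ψ z (0, ξ))) ∘ fun q : EP => (q, e₀))
        =ᶠ[𝓝 q₀] fun _ => ξ := by
      filter_upwards [(chartAt EP p).open_target.mem_nhds (mem_chart_target EP p)] with q hq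
      change A.val (Ψ (q, e₀)) (mfd (EP × EG) EP Ψ (q, e₀) (0, ξ)) = ξ
      have : Ψ (q, e₀) = (chartAt EP p).symm q := by
        simp only [Ψ, he₀, expChart_unitCoord, E.act_one]
      rw [hsnd q hq, this, A.val_vert]
    rw [h10.fderiv_eq, fderiv_fun_const]
    rfl
  rw [h7, h9, h5, h6, hΨ0, A.val_vert] at key
  rw [key]
  abel

end Gauges

/-! ### Local sections, horizontal lifts and local potentials. -/

section LocalSections

set_option linter.unusedSectionVars false

variable {EG : Type*} [NormedAddCommGroup EG] [NormedSpace ℝ EG] [CompleteSpace EG]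
  {G : Type*} [TopologicalSpace G] [ChartedSpace EG G] [Group G] [LieGroup 𝓘(ℝ, EG) ∞ G]
  {n : ℕ} {X : Type*} [TopologicalSpace X] [ChartedSpace (R2 n) X] [IsManifold 𝓘(ℝ, R2 n) ∞ X]
  {EP : Type*} [NormedAddCommGroup EP] [NormedSpace ℝ EP]
  {P : Type*} [TopologicalSpace P] [ChartedSpace EP P] [IsManifold 𝓘(ℝ, EP) ∞ P]
  {E : PrincipalBundle EG G n X EP P}

/-- A local section of a principal bundle, expressed in the chart at `i`. -/
structure IsGauge (E : PrincipalBundle EG G n X EP P) (i : X) (s : Set (R2 n)) (f : R2 n → P) :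
    Prop where
  isOpen : IsOpen s
  subset : s ⊆ (chartAt (R2 n) i).target
  smooth : ContMDiffOn 𝓘(ℝ, R2 n) 𝓘(ℝ, EP) ∞ f s
  proj : ∀ y ∈ s, E.proj (f y) = (chartAt (R2 n) i).symm y

theorem PrincipalBundle.mdifferentiableAt_proj (E : PrincipalBundle EG G n X EP P) (p : P) :
    MDifferentiableAt 𝓘(ℝ, EP) 𝓘(ℝ, R2 n) E.proj p := by
  obtain ⟨e, hx, -, he, -⟩ := E.locallyTrivial (E.proj p)
  have hp : p ∈ e.source := e.mem_source.2 hx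
  have h1 := (he.contMDiffAt (e.open_source.mem_nhds hp)).mdifferentiableAt (by simp)
  have h2 : MDifferentiableAt 𝓘(ℝ, EP) 𝓘(ℝ, R2 n) (fun q => (e q).1) p :=
    mdifferentiableAt_fst.comp p h1
  refine h2.congr_of_eventuallyEq ?_
  filter_upwards [e.open_source.mem_nhds hp] with q hq
  exact (e.coe_fst hq).symm

theorem PrincipalBundle.mdifferentiableAt_act_expChart (E : PrincipalBundle EG G n X EP P)
    {U : Type*} [NormedAddCommGroup U] [NormedSpace ℝ U] {f : U → P} {y : U}
    (hf : MDifferentiableAt 𝓘(ℝ, U) 𝓘(ℝ, EP) f y) :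
    MDifferentiableAt 𝓘(ℝ, U × EG) 𝓘(ℝ, EP) (fun q : U × EG => E.act (f q.1) (expChart EG G q.2))
      (y, unitCoord EG G) := by
  have h1 : MDifferentiableAt 𝓘(ℝ, U × EG) 𝓘(ℝ, EP) (fun q : U × EG => f q.1)
      (y, unitCoord EG G) :=
    MDifferentiableAt.comp (I' := 𝓘(ℝ, U)) (g := f) (f := (Prod.fst : U × EG → U))
      (y, unitCoord EG G) hf differentiableAt_fst.mdifferentiableAt
  have h2 : MDifferentiableAt 𝓘(ℝ, U × EG) 𝓘(ℝ, EG) (fun q : U × EG => expChart EG G q.2)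
      (y, unitCoord EG G) :=
    MDifferentiableAt.comp (I' := 𝓘(ℝ, EG)) (g := expChart EG G) (f := (Prod.snd : U × EG → EG))
      (y, unitCoord EG G) (mdifferentiableAt_chart_symm (1 : G) (mem_chart_target EG (1 : G)))
      differentiableAt_snd.mdifferentiableAt
  exact MDifferentiableAt.comp (g := fun q : P × G => E.act q.1 q.2) _
    (E.smooth_act.contMDiffAt.mdifferentiableAt (by simp)) (h1.prodMk h2)

/-- The two partial derivatives: the unit acts trivially in the first slot, and the orbit map in the
second has the fundamental vector field as its derivative. -/
theorem PrincipalBundle.mfd_act_expChart (E : PrincipalBundle EG G n X EP P)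
    {U : Type*} [NormedAddCommGroup U] [NormedSpace ℝ U] {f : U → P} {y : U}
    (hf : MDifferentiableAt 𝓘(ℝ, U) 𝓘(ℝ, EP) f y) (u : U) (ξ : EG) :
    mfd (U × EG) EP (fun q : U × EG => E.act (f q.1) (expChart EG G q.2)) (y, unitCoord EG G) (u, ξ)
      = mfd U EP f y u + E.vert (f y) ξ := by
  set e₀ := unitCoord EG G with he₀
  have hd := E.mdifferentiableAt_act_expChart hf
  have h1 : mfd U EP f y = (mfd (U × EG) EP
      (fun q : U × EG => E.act (f q.1) (expChart EG G q.2)) (y, e₀)).comp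
        (mfd U (U × EG) (fun r : U => (r, e₀)) y) := by
    rw [← mfd_comp (f := fun r : U => (r, e₀)) rfl hd
      (hasFDerivAt_prodMk_left y e₀).differentiableAt.mdifferentiableAt]
    congr 1
    funext r
    simp only [he₀, expChart_unitCoord, E.act_one]
  have h2 : mfd U (U × EG) (fun r : U => (r, e₀)) y = ContinuousLinearMap.inl ℝ U EG := by
    rw [mfd, mfderiv_eq_fderiv]
    exact (hasFDerivAt_prodMk_left y e₀).fderiv
  have h3 : mfd EG EP (fun x => E.act (f y) (expChart EG G x)) e₀ = (mfd (U × EG) EP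
      (fun q : U × EG => E.act (f q.1) (expChart EG G q.2)) (y, e₀)).comp
        (mfd EG (U × EG) (fun x : EG => (y, x)) e₀) :=
    mfd_comp (f := fun x : EG => (y, x)) rfl hd
      (hasFDerivAt_prodMk_right y e₀).differentiableAt.mdifferentiableAt
  have h4 : mfd EG (U × EG) (fun x : EG => (y, x)) e₀ = ContinuousLinearMap.inr ℝ U EG := by
    rw [mfd, mfderiv_eq_fderiv]
    exact (hasFDerivAt_prodMk_right y e₀).fderiv
  have h5 : mfd EG EP (fun x => E.act (f y) (expChart EG G x)) e₀ = (E.vert (f y)).comp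
      (mfd EG EG (expChart EG G) e₀) :=
    mfd_comp (g := fun a => E.act (f y) a) (f := expChart EG G)
      (expChart_unitCoord EG G)
      ((E.contMDiff_act_right _).contMDiffAt.mdifferentiableAt (by simp))
      (mdifferentiableAt_chart_symm (1 : G) (mem_chart_target EG (1 : G)))
  have h6 : mfd EG EG (expChart EG G) e₀ = ContinuousLinearMap.id ℝ EG :=
    mfd_chart_symm_self (1 : G)
  rw [h6, ContinuousLinearMap.comp_id, h3, h4] at h5
  rw [h2] at h1
  rw [h1, ← h5, ContinuousLinearMap.comp_apply, ContinuousLinearMap.comp_apply, ← map_add]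
  simp

theorem PrincipalBundle.mfd_proj_vert (E : PrincipalBundle EG G n X EP P) (p : P) (ξ : EG) :
    mfd EP (R2 n) E.proj p (E.vert p ξ) = 0 := by
  have h1 := mfd_comp (f := fun a : G => E.act p a) (g := E.proj) (x := 1) (E.act_one p)
    (E.mdifferentiableAt_proj p)
    ((E.contMDiff_act_right p).contMDiffAt.mdifferentiableAt (by simp))
  have h2 : (fun a : G => E.proj (E.act p a)) = fun _ => E.proj p := funext fun a => E.proj_act p a
  rw [h2] at h1
  have h3 : mfd EG (R2 n) (fun _ : G => E.proj p) 1 = 0 := mfderiv_const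
  rw [h3] at h1
  exact (DFunLike.congr_fun h1 ξ).symm

theorem IsGauge.mdifferentiableAt {i : X} {s : Set (R2 n)} {f : R2 n → P} (hf : IsGauge E i s f)
    {y : R2 n} (hy : y ∈ s) : MDifferentiableAt 𝓘(ℝ, R2 n) 𝓘(ℝ, EP) f y :=
  mdifferentiableAt_of_contMDiffOn hf.isOpen hf.smooth hy

theorem IsGauge.mfd_proj {i : X} {s : Set (R2 n)} {f : R2 n → P} (hf : IsGauge E i s f)
    {y : R2 n} (hy : y ∈ s) (u : R2 n) :
    mfd EP (R2 n) E.proj (f y) (mfd (R2 n) EP f y u) = chartD i y u := by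
  have h1 := mfd_comp (f := f) (g := E.proj) (x := y) rfl (E.mdifferentiableAt_proj (f y))
    (hf.mdifferentiableAt hy)
  have h2 : (fun z => E.proj (f z)) =ᶠ[𝓝 y] (chartAt (R2 n) i).symm := by
    filter_upwards [hf.isOpen.mem_nhds hy] with z hz
    exact hf.proj z hz
  have h3 : mfd (R2 n) (R2 n) (fun z => E.proj (f z)) y = chartD i y := h2.mfderiv_eq
  rw [h3] at h1
  exact (DFunLike.congr_fun h1 u).symm

/-- Existence of local sections through a given point. Together with the vertical vectors they span
the tangent space. -/
theorem exists_isGauge (E : PrincipalBundle EG G n X EP P) (i : X) (p : P)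
    (hp : E.proj p ∈ (chartAt (R2 n) i).source) :
    ∃ s f, IsGauge E i s f ∧ chartAt (R2 n) i (E.proj p) ∈ s ∧ f (chartAt (R2 n) i (E.proj p)) = p ∧
      ∀ w, ∃ u ξ, w = mfd (R2 n) EP f (chartAt (R2 n) i (E.proj p)) u + E.vert p ξ := by
  obtain ⟨e, hx, hact, he, he'⟩ := E.locallyTrivial (E.proj p)
  have hpe : p ∈ e.source := e.mem_source.2 hx
  set a₀ := (e p).2 with ha₀
  set y₀ := chartAt (R2 n) i (E.proj p) with hy₀
  let f : R2 n → P := fun y => e.toOpenPartialHomeomorph.symm ((chartAt (R2 n) i).symm y, a₀)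
  let s : Set (R2 n) := (chartAt (R2 n) i).target ∩ (chartAt (R2 n) i).symm ⁻¹' e.baseSet
  have hsymm : (chartAt (R2 n) i).symm y₀ = E.proj p := (chartAt (R2 n) i).left_inv hp
  have hy₀s : y₀ ∈ s := ⟨(chartAt (R2 n) i).map_source hp, by rw [mem_preimage, hsymm]; exact hx⟩
  have hg : IsGauge E i s f := by
    refine ⟨(chartAt (R2 n) i).symm.continuousOn.isOpen_inter_preimage
      (chartAt (R2 n) i).open_target e.open_baseSet, inter_subset_left, ?_, ?_⟩
    · refine he'.comp (f := fun y => ((chartAt (R2 n) i).symm y, a₀)) (ContMDiffOn.prodMk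
        ((contMDiffOn_chart_symm' i).mono inter_subset_left) contMDiffOn_const) fun y hy => ?_
      exact e.mem_target.2 hy.2
    · intro y hy
      exact e.proj_symm_apply' hy.2
  have hf0 : f y₀ = p := by
    have h1 : ((chartAt (R2 n) i).symm y₀, a₀) = e p := by
      rw [hsymm]; exact e.mk_proj_snd hpe
    simp only [f, h1]
    exact e.toOpenPartialHomeomorph.left_inv hpe
  refine ⟨s, f, hg, hy₀s, hf0, fun w => ?_⟩
  -- A local inverse of (y, x) ↦ f(y) · x near p. Differentiating the composite, which is the
  -- identity, splits each tangent vector into a part along the section and a vertical part.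
  let Δ : P → R2 n × EG := fun q => (chartAt (R2 n) i (E.proj q), chartAt EG (1 : G) (a₀⁻¹ * (e q).2))
  have hep := (he.contMDiffAt (e.open_source.mem_nhds hpe)).mdifferentiableAt (by simp)
  have hsnd : MDifferentiableAt 𝓘(ℝ, EP) 𝓘(ℝ, EG) (fun q => a₀⁻¹ * (e q).2) p := by
    have h1 : MDifferentiableAt 𝓘(ℝ, EP) 𝓘(ℝ, EG) (fun q => (e q).2) p :=
      mdifferentiableAt_snd.comp p hep
    exact MDifferentiableAt.comp (g := fun k : G => a₀⁻¹ * k) p (mdifferentiableAt_mul_left _ _) h1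
  have hone : a₀⁻¹ * (e p).2 = 1 := inv_mul_cancel _
  have hΔ : MDifferentiableAt 𝓘(ℝ, EP) 𝓘(ℝ, R2 n × EG) Δ p := by
    refine MDifferentiableAt.prodMk_space ?_ ?_
    · exact MDifferentiableAt.comp (g := chartAt (R2 n) i) p (mdifferentiableAt_chart i hp)
        (E.mdifferentiableAt_proj p)
    · refine MDifferentiableAt.comp (g := chartAt EG (1 : G)) p (mdifferentiableAt_chart _ ?_) hsnd
      rw [hone]
      exact mem_chart_source EG (1 : G)
  have hΔ0 : Δ p = (y₀, unitCoord EG G) := by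
    simp only [Δ, hone]
    rfl
  have hid : (fun q => E.act (f (Δ q).1) (expChart EG G (Δ q).2)) =ᶠ[𝓝 p] id := by
    have h1 : ∀ᶠ q in 𝓝 p, E.proj q ∈ (chartAt (R2 n) i).source ∩ e.baseSet :=
      (E.mdifferentiableAt_proj p).continuousAt.preimage_mem_nhds
        (((chartAt (R2 n) i).open_source.inter e.open_baseSet).mem_nhds ⟨hp, hx⟩)
    have h2 : ∀ᶠ q in 𝓝 p, a₀⁻¹ * (e q).2 ∈ (chartAt EG (1 : G)).source := by
      refine hsnd.continuousAt.preimage_mem_nhds ((chartAt EG (1 : G)).open_source.mem_nhds ?_)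
      rw [hone]
      exact mem_chart_source EG (1 : G)
    filter_upwards [h1, h2] with q h1 h2
    have hq : q ∈ e.source := e.mem_source.2 h1.2
    have h3 : expChart EG G (Δ q).2 = a₀⁻¹ * (e q).2 := (chartAt EG (1 : G)).left_inv h2
    have h4 : (chartAt (R2 n) i).symm (Δ q).1 = E.proj q := (chartAt (R2 n) i).left_inv h1.1
    have h5 : f (Δ q).1 = e.toOpenPartialHomeomorph.symm (E.proj q, a₀) := by simp only [f, h4]
    have ht : (E.proj q, a₀) ∈ e.target := e.mem_target.2 h1.2
    have h6 : e.toOpenPartialHomeomorph.symm (E.proj q, a₀) ∈ e.source :=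
      e.toOpenPartialHomeomorph.map_target ht
    have h7 : e (e.toOpenPartialHomeomorph.symm (E.proj q, a₀)) = (E.proj q, a₀) :=
      e.toOpenPartialHomeomorph.right_inv ht
    obtain ⟨h8, h9⟩ := hact _ h6 (a₀⁻¹ * (e q).2)
    rw [h3, h5]
    refine e.injOn h8 hq (h9.trans ?_)
    rw [h7, mul_inv_cancel_left]
    exact e.mk_proj_snd hq
  have hfd : MDifferentiableAt 𝓘(ℝ, R2 n) 𝓘(ℝ, EP) f y₀ := hg.mdifferentiableAt hy₀s
  have hcomp := mfd_comp (f := Δ) (g := fun q : R2 n × EG => E.act (f q.1) (expChart EG G q.2))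
    (x := p) hΔ0 (E.mdifferentiableAt_act_expChart hfd) hΔ
  have h1 : mfd EP EP (fun q => E.act (f (Δ q).1) (expChart EG G (Δ q).2)) p =
      ContinuousLinearMap.id ℝ EP := by
    refine Eq.trans (b := mfd EP EP id p) ?_ mfderiv_id
    exact hid.mfderiv_eq
  refine ⟨(mfd EP (R2 n × EG) Δ p w).1, (mfd EP (R2 n × EG) Δ p w).2, ?_⟩
  have h2 := DFunLike.congr_fun (h1.symm.trans hcomp) w
  rw [ContinuousLinearMap.comp_apply] at h2
  have h3 := E.mfd_act_expChart hfd (mfd EP (R2 n × EG) Δ p w).1 (mfd EP (R2 n × EG) Δ p w).2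
  rw [hf0] at h3
  exact h2.trans h3

/-! #### Horizontal lifts -/

/-- The horizontal lift. -/
def Connection.lift (A : Connection E) (p : P) : R2 n →L[ℝ] EP := A.horizontalLift p

/-- `horizontalLift` goes through `ContinuousLinearMap.inverse`, which is meaningful only if (dπ, θ)
is invertible. A local section through p provides an explicit two-sided inverse. -/
theorem Connection.lift_eq (A : Connection E) {p : P} {u : R2 n} {w : EP}
    (h1 : mfd EP (R2 n) E.proj p w = u) (h2 : A.val p w = 0) : A.lift p u = w := by
  obtain ⟨s, f, hf, hy, hfp, hsp⟩ := exists_isGauge E (E.proj p) p (mem_chart_source (R2 n) _)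
  set y := chartAt (R2 n) (E.proj p) (E.proj p) with hy0
  set T := mfd (R2 n) EP f y
  let L : EP →L[ℝ] R2 n × EG := (mfd EP (R2 n) E.proj p).prod (A.val p)
  -- Lifts u along the section and corrects the vertical part so that θ takes the value η.
  let R : R2 n × EG →L[ℝ] EP := T.coprod (E.vert p) - (E.vert p).comp
    ((A.val p).comp (T.comp (ContinuousLinearMap.fst ℝ (R2 n) EG)))
  have hid : chartD (E.proj p) y = ContinuousLinearMap.id ℝ (R2 n) := mfd_chart_symm_self (E.proj p)
  have hT : ∀ u, mfd EP (R2 n) E.proj p (T u) = u := by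
    intro u
    have := hf.mfd_proj hy u
    rw [hfp, hid] at this
    exact this
  have hR : ∀ u η, R (u, η) = T u + E.vert p η - E.vert p (A.val p (T u)) := fun u η => by
    simp [R]
  have hLR : L.comp R = ContinuousLinearMap.id ℝ _ := by
    refine ContinuousLinearMap.ext fun q => ?_
    obtain ⟨u, η⟩ := q
    rw [ContinuousLinearMap.comp_apply, hR]
    refine Prod.ext ?_ ?_
    · change mfd EP (R2 n) E.proj p _ = u
      rw [map_sub, map_add, E.mfd_proj_vert, E.mfd_proj_vert, hT]
      simp
    · change A.val p _ = η
      rw [map_sub, map_add, A.val_vert, A.val_vert]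
      abel
  have hRL : R.comp L = ContinuousLinearMap.id ℝ _ := by
    refine ContinuousLinearMap.ext fun w => ?_
    obtain ⟨u, η, rfl⟩ := hsp w
    have hL : L (T u + E.vert p η) = (u, A.val p (T u) + η) := by
      refine Prod.ext ?_ ?_
      · change mfd EP (R2 n) E.proj p _ = u
        rw [map_add, E.mfd_proj_vert, hT, add_zero]
      · change A.val p _ = _
        rw [map_add, A.val_vert]
    change R (L (T u + E.vert p η)) = T u + E.vert p η
    rw [hL, hR, map_add]
    abel
  have hinv : L.inverse = R := ContinuousLinearMap.inverse_eq hLR hRL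
  have h3 : A.lift p u = L.inverse (u, 0) := rfl
  have h4 : L w = (u, 0) := Prod.ext h1 h2
  rw [h3, hinv, ← h4]
  exact DFunLike.congr_fun hRL w

theorem IsGauge.lift {i : X} {s : Set (R2 n)} {f : R2 n → P} (hf : IsGauge E i s f)
    (A : Connection E) {y : R2 n} (hy : y ∈ s) (u : R2 n) :
    A.lift (f y) (chartD i y u) = mfd (R2 n) EP f y u -
      E.vert (f y) (A.val (f y) (mfd (R2 n) EP f y u)) := by
  refine A.lift_eq ?_ ?_
  · rw [map_sub, E.mfd_proj_vert, sub_zero, hf.mfd_proj hy]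
  · rw [map_sub, A.val_vert, sub_self]

/-- The curvature at a point of the total space. -/
def Connection.curv (A : Connection E) (p : P) : R2 n [⋀^Fin 2]→ₗ[ℝ] EG := A.curvature p

/-- The difference of two connections at a point of the total space. -/
def Connection.diff (A A' : Connection E) (p : P) (u : R2 n) : EG := A'.val p (A.lift p u)

/-- The components of the local potential of a connection in a gauge. -/
def potential (A : Connection E) (f : R2 n → P) (y : R2 n) (a : Fin (2 * n)) : EG :=
  A.val (f y) (mfd (R2 n) EP f y (stdVec a))

variable (G) in
/-- The field strength of a local potential. -/
def fieldStrength (θ : R2 n → Fin (2 * n) → EG) (y : R2 n) (a b : Fin (2 * n)) : EG :=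
  pd a (fun z => θ z b) y - pd b (fun z => θ z a) y + bracketMap EG G (θ y a) (θ y b)

theorem IsGauge.contDiffAt_potential {i : X} {s : Set (R2 n)} {f : R2 n → P}
    (hf : IsGauge E i s f) (A : Connection E) {y : R2 n} (hy : y ∈ s) (a : Fin (2 * n)) :
    ContDiffAt ℝ ∞ (fun z => potential A f z a) y :=
  A.contDiffAt_val hf.isOpen hf.smooth hy (stdVec a)

/-- The horizontal lift differs from the derivative of the section by a vertical vector, which the
curvature annihilates. So the curvature can be evaluated on the section. -/
theorem IsGauge.curv {i : X} {s : Set (R2 n)} {f : R2 n → P} (hf : IsGauge E i s f)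
    (A : Connection E) {y : R2 n} (hy : y ∈ s) (a b : Fin (2 * n)) :
    A.curv (f y) ![chartD i y (stdVec a), chartD i y (stdVec b)] =
      fieldStrength G (potential A f) y a b := by
  have h1 : A.curv (f y) ![chartD i y (stdVec a), chartD i y (stdVec b)] =
      A.tot (f y) ![A.lift (f y) (chartD i y (stdVec a)), A.lift (f y) (chartD i y (stdVec b))] := by
    refine congrArg (A.tot (f y)) (funext fun k => ?_)
    fin_cases k <;> rfl
  have h2 : ∀ u v : EP, ∀ ξ : EG, A.tot (f y) ![u - E.vert (f y) ξ, v] = A.tot (f y) ![u, v] := by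
    intro u v ξ
    rw [sub_eq_add_neg, ← neg_one_smul ℝ, twoForm_cons_add, twoForm_cons_smul, A.tot_vert,
      smul_zero, add_zero]
  rw [h1, hf.lift A hy, hf.lift A hy, h2, twoForm_swap, h2, ← twoForm_swap,
    A.tot_pullback hf.isOpen hf.smooth hy]
  rfl

theorem IsGauge.diff {i : X} {s : Set (R2 n)} {f : R2 n → P} (hf : IsGauge E i s f)
    (A A' : Connection E) {y : R2 n} (hy : y ∈ s) (a : Fin (2 * n)) :
    A.diff A' (f y) (chartD i y (stdVec a)) = potential A' f y a - potential A f y a := by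
  rw [Connection.diff, hf.lift A hy, map_sub, A'.val_vert]
  rfl

theorem IsGauge.act {i : X} {s : Set (R2 n)} {f : R2 n → P} (hf : IsGauge E i s f) (g : G) :
    IsGauge E i s (fun y => E.act (f y) g) :=
  ⟨hf.isOpen, hf.subset, (E.contMDiff_act_left g).comp_contMDiffOn hf.smooth, fun y hy => by
    rw [E.proj_act, hf.proj y hy]⟩

theorem IsGauge.potential_act {i : X} {s : Set (R2 n)} {f : R2 n → P} (hf : IsGauge E i s f)
    (A : Connection E) (g : G) {y : R2 n} (hy : y ∈ s) (a : Fin (2 * n)) :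
    potential A (fun y => E.act (f y) g) y a = Ad g⁻¹ (potential A f y a) := by
  rw [potential, mfd_comp (f := f) (g := fun q => E.act q g) rfl
    ((E.contMDiff_act_left g).contMDiffAt.mdifferentiableAt (by simp)) (hf.mdifferentiableAt hy)]
  exact A.val_act (f y) g _

/-- The group element is constant, so no inhomogeneous term appears; Ad g⁻¹ is linear and respects
the bracket. -/
theorem IsGauge.fieldStrength_act {i : X} {s : Set (R2 n)} {f : R2 n → P} (hf : IsGauge E i s f)
    (A : Connection E) (g : G) {y : R2 n} (hy : y ∈ s) (a b : Fin (2 * n)) :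
    fieldStrength G (potential A (fun y => E.act (f y) g)) y a b =
      Ad g⁻¹ (fieldStrength G (potential A f) y a b) := by
  have h1 : ∀ c d, pd c (fun z => potential A (fun y => E.act (f y) g) z d) y =
      Ad g⁻¹ (pd c (fun z => potential A f z d) y) := by
    intro c d
    have h2 : (fun z => potential A (fun y => E.act (f y) g) z d) =ᶠ[𝓝 y]
        fun z => mfd EG EG (fun h : G => g⁻¹ * h * g⁻¹⁻¹) 1 (potential A f z d) := by
      filter_upwards [hf.isOpen.mem_nhds hy] with z hz
      exact hf.potential_act A g hz d
    have h3 := HasFDerivAt.comp (f := fun z => potential A f z d) y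
      (mfd EG EG (fun h : G => g⁻¹ * h * g⁻¹⁻¹) 1).hasFDerivAt
      ((hf.contDiffAt_potential A hy d).differentiableAt (by simp)).hasFDerivAt
    rw [pd_congr h2, pd]
    exact DFunLike.congr_fun h3.fderiv (stdVec c)
  rw [fieldStrength, h1, h1, hf.potential_act A g hy, hf.potential_act A g hy, ← Ad_bracketMap,
    Ad_eq, ← map_sub, ← map_add]
  rfl

/-! #### Local components over the base -/

/-- A point in the fibre over the point with coordinates `y`. -/
def basePoint (E : PrincipalBundle EG G n X EP P) (i : X) (y : R2 n) : P :=
  Function.surjInv E.proj_surjective ((chartAt (R2 n) i).symm y)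

/-- The components of the curvature in the chart at `i`. -/
def Connection.curvComp (A : Connection E) (i : X) (y : R2 n) (a b : Fin (2 * n)) : EG :=
  A.curv (basePoint E i y) ![chartD i y (stdVec a), chartD i y (stdVec b)]

/-- The components of the difference of two connections in the chart at `i`. -/
def Connection.diffComp (A A' : Connection E) (i : X) (y : R2 n) (a : Fin (2 * n)) : EG :=
  A.diff A' (basePoint E i y) (chartD i y (stdVec a))

/-- In a local gauge, the curvature is the field strength of the potential. -/
theorem exists_potential (A A' : Connection E) (i : X) {y₀ : R2 n}
    (hy₀ : y₀ ∈ (chartAt (R2 n) i).target) :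
    ∃ θ θ' : R2 n → Fin (2 * n) → EG,
      (∀ a, ContDiffAt ℝ ∞ (fun z => θ z a) y₀) ∧ (∀ a, ContDiffAt ℝ ∞ (fun z => θ' z a) y₀) ∧
      ∀ᶠ y in 𝓝 y₀, ∃ g : G, (∀ a b, A.curvComp i y a b = Ad g (fieldStrength G θ y a b)) ∧
        (∀ a b, A'.curvComp i y a b = Ad g (fieldStrength G θ' y a b)) ∧
        ∀ a, A.diffComp A' i y a = Ad g (θ' y a - θ y a) := by
  have hp : E.proj (basePoint E i y₀) = (chartAt (R2 n) i).symm y₀ :=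
    Function.surjInv_eq E.proj_surjective _
  obtain ⟨s, f, hf, hy, -, -⟩ := exists_isGauge E i (basePoint E i y₀)
    (by rw [hp]; exact (chartAt (R2 n) i).map_target hy₀)
  rw [hp, (chartAt (R2 n) i).right_inv hy₀] at hy
  refine ⟨potential A f, potential A' f, hf.contDiffAt_potential A hy, hf.contDiffAt_potential A' hy,
    ?_⟩
  filter_upwards [hf.isOpen.mem_nhds hy] with y hy
  have hpy : E.proj (f y) = E.proj (basePoint E i y) := by
    rw [hf.proj y hy]
    exact (Function.surjInv_eq E.proj_surjective _).symm
  -- The base points are chosen without any continuity in y, so g may vary irregularly. This is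
  -- harmless because only Ad-invariant expressions are differentiated.
  obtain ⟨g, hg⟩ := E.exists_act_eq hpy
  refine ⟨g⁻¹, fun a b => ?_, fun a b => ?_, fun a => ?_⟩
  · rw [Connection.curvComp, hg, (hf.act g).curv A hy, hf.fieldStrength_act A g hy]
  · rw [Connection.curvComp, hg, (hf.act g).curv A' hy, hf.fieldStrength_act A' g hy]
  · rw [Connection.diffComp, hg, (hf.act g).diff A A' hy, hf.potential_act A g hy,
      hf.potential_act A' g hy, Ad_eq, ← map_sub]

end LocalSections

/-! ### Chern-Simons forms -/

section BilinearCalculus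

set_option linter.unusedSectionVars false

variable {n : ℕ} {EG W : Type*} [NormedAddCommGroup EG] [NormedSpace ℝ EG] [FiniteDimensional ℝ EG]
  [NormedAddCommGroup W] [NormedSpace ℝ W]

/-- A bilinear map on a finite dimensional space as a continuous bilinear map. -/
def bilinCLM (β : EG →ₗ[ℝ] EG →ₗ[ℝ] W) : EG →L[ℝ] EG →L[ℝ] W :=
  LinearMap.toContinuousLinearMap
    ((LinearMap.toContinuousLinearMap : (EG →ₗ[ℝ] W) ≃ₗ[ℝ] (EG →L[ℝ] W)).toLinearMap ∘ₗ β)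

variable {f g : R2 n → EG} {y : R2 n}

theorem contDiffAt_bilin (β : EG →ₗ[ℝ] EG →ₗ[ℝ] W) (hf : ContDiffAt ℝ ∞ f y)
    (hg : ContDiffAt ℝ ∞ g y) : ContDiffAt ℝ ∞ (fun z => β (f z) (g z)) y :=
  ((bilinCLM β).contDiff.contDiffAt.comp y hf).clm_apply hg

theorem pd_bilin (β : EG →ₗ[ℝ] EG →ₗ[ℝ] W) (hf : DifferentiableAt ℝ f y)
    (hg : DifferentiableAt ℝ g y) (a : Fin (2 * n)) :
    pd a (fun z => β (f z) (g z)) y = β (pd a f y) (g y) + β (f y) (pd a g y) := by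
  have h := ((bilinCLM β).hasFDerivAt_of_bilinear hf.hasFDerivAt hg.hasFDerivAt).fderiv
  have h' := DFunLike.congr_fun h (stdVec a)
  rw [add_comm]
  exact h'

end BilinearCalculus

section ChernSimonsAlgebra

variable {M : Type*} [AddCommGroup M] [Module ℝ M]

/-- The components of a 3-form built from a 1-form and a 2-form with values in a Lie algebra. -/
def csComp {ι : Type*} (B : M →ₗ[ℝ] M →ₗ[ℝ] ℝ) (br : M →ₗ[ℝ] M →ₗ[ℝ] M) (t : ι → M)
    (F : ι → ι → M) (b c d : ι) : ℝ :=
  B (t b) (F c d) + B (t c) (F d b) + B (t d) (F b c) - B (t b) (br (t c) (t d))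

end ChernSimonsAlgebra

section ChernSimons

set_option linter.unusedSectionVars false

variable {EG : Type*} [NormedAddCommGroup EG] [NormedSpace ℝ EG] [CompleteSpace EG]
  [FiniteDimensional ℝ EG]
  {G : Type*} [TopologicalSpace G] [ChartedSpace EG G] [Group G] [LieGroup 𝓘(ℝ, EG) ∞ G]
  {n : ℕ}

theorem bracketMap_jacobi (ξ η ζ : EG) : bracketMap EG G ξ (bracketMap EG G η ζ) +
    bracketMap EG G η (bracketMap EG G ζ ξ) + bracketMap EG G ζ (bracketMap EG G ξ η) = 0 :=
  lie_jacobi (L := GroupLieAlgebra 𝓘(ℝ, EG) G) ξ η ζ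

/-- Infinitesimal invariance, with symmetry of B and skewness of the bracket, makes B(ξ, [η, ζ])
invariant under cyclic permutations. -/
theorem InvariantInner.form_bracketMap_rotate (B : InvariantInner EG G) (ξ η ζ : EG) :
    B.form ξ (bracketMap EG G η ζ) = B.form ζ (bracketMap EG G ξ η) := by
  have h := B.form_bracketMap η ξ ζ
  rw [bracketMap_skew η ξ, map_neg, LinearMap.neg_apply] at h
  rw [B.symm ζ]
  linarith

/-- By invariance the left-hand side is B(s, ·) of a Jacobi sum. It disposes of the terms of degree
four in the potential in B(F∧F). -/
theorem InvariantInner.form_bracketMap_bracketMap (B : InvariantInner EG G) (s t u v : EG) :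
    B.form (bracketMap EG G s t) (bracketMap EG G u v)
      - B.form (bracketMap EG G s u) (bracketMap EG G t v)
      + B.form (bracketMap EG G s v) (bracketMap EG G t u) = 0 := by
  have h : ∀ u w, B.form (bracketMap EG G s u) w = B.form s (bracketMap EG G u w) := fun u w => by
    rw [B.symm, ← B.form_bracketMap_rotate]
  rw [h, h, h, bracketMap_skew t v, map_neg, map_neg, sub_neg_eq_add, ← map_add, ← map_add,
    bracketMap_jacobi, map_zero]

variable {θ θ' : R2 n → Fin (2 * n) → EG} {y : R2 n}

/-- The exterior derivative of the Chern-Simons form. -/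
theorem InvariantInner.pd_csComp (B : InvariantInner EG G)
    (hθ : ∀ a, ContDiffAt ℝ ∞ (fun z => θ z a) y) (a b c d : Fin (2 * n)) :
    pd a (fun z => csComp B.form (bracketMap EG G) (θ z) (fieldStrength G θ z) b c d) y
      - pd b (fun z => csComp B.form (bracketMap EG G) (θ z) (fieldStrength G θ z) a c d) y
      + pd c (fun z => csComp B.form (bracketMap EG G) (θ z) (fieldStrength G θ z) a b d) y
      - pd d (fun z => csComp B.form (bracketMap EG G) (θ z) (fieldStrength G θ z) a b c) y =
    2 * (B.form (fieldStrength G θ y a b) (fieldStrength G θ y c d)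
      - B.form (fieldStrength G θ y a c) (fieldStrength G θ y b d)
      + B.form (fieldStrength G θ y a d) (fieldStrength G θ y b c)) := by
  -- When F is the field strength of θ itself, the three cubic terms coming from F and the
  -- subtracted one leave the coefficient 2.
  have hc : ∀ z b c d, csComp B.form (bracketMap EG G) (θ z) (fieldStrength G θ z) b c d =
      B.form (θ z b) (pd c (fun z => θ z d) z - pd d (fun z => θ z c) z)
      + B.form (θ z c) (pd d (fun z => θ z b) z - pd b (fun z => θ z d) z)
      + B.form (θ z d) (pd b (fun z => θ z c) z - pd c (fun z => θ z b) z)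
      + 2 * B.form (θ z b) (bracketMap EG G (θ z c) (θ z d)) := by
    intro z b c d
    have h1 := B.form_bracketMap_rotate (θ z b) (θ z c) (θ z d)
    have h2 := B.form_bracketMap_rotate (θ z d) (θ z b) (θ z c)
    simp only [csComp, fieldStrength, map_add]
    linarith
  have hdiff : ∀ a, DifferentiableAt ℝ (fun z => θ z a) y := fun a =>
    (hθ a).differentiableAt (by simp)
  have hd : ∀ a b, ContDiffAt ℝ ∞ (pd a (fun z => θ z b)) y := fun a b => ContDiffAt.pd (hθ b) a
  have hdd : ∀ c d, ContDiffAt ℝ ∞ (fun z => pd c (fun z => θ z d) z - pd d (fun z => θ z c) z) y :=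
    fun c d => (hd c d).sub (hd d c)
  have hp : ∀ a b c d, pd a (fun z => B.form (θ z b)
      (pd c (fun z => θ z d) z - pd d (fun z => θ z c) z)) y =
      B.form (pd a (fun z => θ z b) y) (pd c (fun z => θ z d) y - pd d (fun z => θ z c) y)
      + B.form (θ y b) (pd a (pd c (fun z => θ z d)) y - pd a (pd d (fun z => θ z c)) y) := by
    intro a b c d
    rw [pd_bilin B.form (hdiff b) ((hdd c d).differentiableAt (by simp)),
      pd_sub ((hd c d).differentiableAt (by simp)) ((hd d c).differentiableAt (by simp))]
  have hq : ∀ a b c d, pd a (fun z => B.form (θ z b) (bracketMap EG G (θ z c) (θ z d))) y =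
      B.form (pd a (fun z => θ z b) y) (bracketMap EG G (θ y c) (θ y d))
      + B.form (pd a (fun z => θ z c) y) (bracketMap EG G (θ y d) (θ y b))
      + B.form (pd a (fun z => θ z d) y) (bracketMap EG G (θ y b) (θ y c)) := by
    intro a b c d
    have h1 := B.form_bracketMap_rotate (θ y b) (pd a (fun z => θ z c) y) (θ y d)
    have h2 := B.form_bracketMap_rotate (pd a (fun z => θ z c) y) (θ y d) (θ y b)
    have h3 := B.form_bracketMap_rotate (θ y b) (θ y c) (pd a (fun z => θ z d) y)
    rw [pd_bilin B.form (hdiff b) ((contDiffAt_bilin _ (hθ c) (hθ d)).differentiableAt (by simp)),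
      pd_bilin _ (hdiff c) (hdiff d), map_add]
    linarith
  have hr : ∀ a b c d, pd a (fun z => csComp B.form (bracketMap EG G) (θ z) (fieldStrength G θ z)
      b c d) y =
      pd a (fun z => B.form (θ z b) (pd c (fun z => θ z d) z - pd d (fun z => θ z c) z)) y
      + pd a (fun z => B.form (θ z c) (pd d (fun z => θ z b) z - pd b (fun z => θ z d) z)) y
      + pd a (fun z => B.form (θ z d) (pd b (fun z => θ z c) z - pd c (fun z => θ z b) z)) y
      + 2 * pd a (fun z => B.form (θ z b) (bracketMap EG G (θ z c) (θ z d))) y := by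
    intro a b c d
    have s1 : ∀ b c d, DifferentiableAt ℝ (fun z => B.form (θ z b)
        (pd c (fun z => θ z d) z - pd d (fun z => θ z c) z)) y := fun b c d =>
      (contDiffAt_bilin B.form (hθ b) (hdd c d)).differentiableAt (by simp)
    have s2 : DifferentiableAt ℝ (fun z => B.form (θ z b) (bracketMap EG G (θ z c) (θ z d))) y :=
      (contDiffAt_bilin B.form (hθ b) (contDiffAt_bilin _ (hθ c) (hθ d))).differentiableAt (by simp)
    simp_rw [hc]
    rw [pd_add (((s1 b c d).fun_add (s1 c d b)).fun_add (s1 d b c)) (s2.const_mul 2),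
      pd_add ((s1 b c d).fun_add (s1 c d b)) (s1 d b c), pd_add (s1 b c d) (s1 c d b),
      pd_const_mul 2 s2]
  -- The second derivatives of θ drop out of the exterior derivative by symmetry.
  have hsym : ∀ a b c, pd a (pd b (fun z => θ z c)) y = pd b (pd a (fun z => θ z c)) y :=
    fun a b c => pd_comm (hθ c) a b
  simp only [hr, hp, hq, fieldStrength]
  have hbb := B.form_bracketMap_bracketMap (θ y a) (θ y b) (θ y c) (θ y d)
  simp only [hsym b a, hsym c a, hsym c b, hsym d a, hsym d b, hsym d c]
  rw [bracketMap_skew (θ y c) (θ y a), bracketMap_skew (θ y d) (θ y a),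
    bracketMap_skew (θ y d) (θ y b)]
  have hB : ∀ i j k l, B.form (pd i (fun z => θ z j) y) (pd k (fun z => θ z l) y) =
    B.form (pd k (fun z => θ z l) y) (pd i (fun z => θ z j) y) := fun _ _ _ _ => B.symm _ _
  simp only [map_add, map_sub, map_neg, LinearMap.add_apply, LinearMap.sub_apply,
    B.symm (bracketMap EG G _ _) (pd _ _ _)]
  rw [hB c d a b, hB c d b a, hB d c a b, hB d c b a, hB b d a c, hB b d c a, hB d b a c, hB d b c a,
    hB b c a d, hB b c d a, hB c b a d, hB c b d a]
  linear_combination -2 * hbb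

/-- The components of a primitive of the difference of Chern-Simons forms. -/
def csPrimitive (B : InvariantInner EG G) (θ θ' : R2 n → Fin (2 * n) → EG) (c d : Fin (2 * n))
    (z : R2 n) : ℝ := B.form (θ z c) (θ' z d) - B.form (θ z d) (θ' z c)

/-- The transgression formula: up to the exact form d B(θ∧θ'), the difference of the Chern-Simons
forms of θ' and θ is an expression in θ' − θ and F + F'. These transform by Ad under a change of
section, so that the expression is global, unlike the Chern-Simons forms themselves. -/
theorem InvariantInner.csComp_sub (B : InvariantInner EG G)
    (hθ : ∀ a, DifferentiableAt ℝ (fun z => θ z a) y)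
    (hθ' : ∀ a, DifferentiableAt ℝ (fun z => θ' z a) y) (b c d : Fin (2 * n)) :
    csComp B.form (bracketMap EG G) (fun a => θ' y a - θ y a)
      (fun a b => fieldStrength G θ y a b + fieldStrength G θ' y a b) b c d =
    csComp B.form (bracketMap EG G) (θ' y) (fieldStrength G θ' y) b c d
      - csComp B.form (bracketMap EG G) (θ y) (fieldStrength G θ y) b c d
      + (pd b (csPrimitive B θ θ' c d) y + pd c (csPrimitive B θ θ' d b) y
        + pd d (csPrimitive B θ θ' b c) y) := by
  have hp : ∀ b c d, pd b (csPrimitive B θ θ' c d) y =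
      B.form (pd b (fun z => θ z c) y) (θ' y d) + B.form (θ y c) (pd b (fun z => θ' z d) y)
      - (B.form (pd b (fun z => θ z d) y) (θ' y c) + B.form (θ y d) (pd b (fun z => θ' z c) y)) := by
    intro b c d
    have s1 : ∀ c d, DifferentiableAt ℝ (fun z => B.form (θ z c) (θ' z d)) y := fun c d =>
      ((bilinCLM B.form).hasFDerivAt_of_bilinear (hθ c).hasFDerivAt
        (hθ' d).hasFDerivAt).differentiableAt
    unfold csPrimitive
    rw [pd_sub (s1 c d) (s1 d c), pd_bilin _ (hθ c) (hθ' d), pd_bilin _ (hθ d) (hθ' c)]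
  rw [hp, hp, hp]
  simp only [csComp, fieldStrength, map_add, map_sub, LinearMap.sub_apply,
    B.symm (pd _ _ _) (θ' y _)]
  have r := B.form_bracketMap_rotate
  have e1 := r (θ' y b) (θ y c) (θ y d)
  have e2 := r (θ' y d) (θ y b) (θ y c)
  have e3 := r (θ' y c) (θ y d) (θ y b)
  have e4 := r (θ y b) (θ' y c) (θ' y d)
  have e5 := r (θ y d) (θ' y b) (θ' y c)
  have e6 := r (θ y c) (θ' y d) (θ' y b)
  have e7 := r (θ y b) (θ y c) (θ' y d)
  have e8 := r (θ y b) (θ' y c) (θ y d)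
  have e9 := r (θ' y b) (θ' y c) (θ y d)
  have e10 := r (θ' y b) (θ y c) (θ' y d)
  linarith

/-- The four terms of an exterior derivative dσ contribute equally to its contraction with q twice,
by relabelling and the skewness of q. -/
theorem sum_mul_alternating {ι : Type*} [Fintype ι] [DecidableEq ι] {q : Matrix ι ι ℝ}
    (hq : ∀ a b, q a b = -q b a) {s : ι → ι → ι → ι → ℝ} (h1 : ∀ a b c d, s a b c d = s a c d b) :
    ∑ a, ∑ b, ∑ c, ∑ d, q a b * q c d * (s a b c d - s b a c d + s c a b d - s d a b c) =
      4 * ∑ a, ∑ b, ∑ c, ∑ d, q a b * q c d * s a b c d := by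
  have e1 : ∑ a, ∑ b, ∑ c, ∑ d, q a b * q c d * s b a c d =
      -∑ a, ∑ b, ∑ c, ∑ d, q a b * q c d * s a b c d := by
    rw [Finset.sum_comm]
    simp only [← Finset.sum_neg_distrib]
    refine Finset.sum_congr rfl fun a _ => Finset.sum_congr rfl fun b _ =>
      Finset.sum_congr rfl fun c _ => Finset.sum_congr rfl fun d _ => ?_
    rw [hq b a]; ring
  have e2 : ∑ a, ∑ b, ∑ c, ∑ d, q a b * q c d * s c a b d =
      ∑ a, ∑ b, ∑ c, ∑ d, q a b * q c d * s a b c d := by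
    rw [sum₄_comm]
    refine Finset.sum_congr rfl fun a _ => Finset.sum_congr rfl fun b _ =>
      Finset.sum_congr rfl fun c _ => Finset.sum_congr rfl fun d _ => ?_
    rw [h1 a b c d]; ring
  have e3 : ∑ a, ∑ b, ∑ c, ∑ d, q a b * q c d * s d a b c =
      -∑ a, ∑ b, ∑ c, ∑ d, q a b * q c d * s c a b d := by
    simp only [← Finset.sum_neg_distrib]
    refine Finset.sum_congr rfl fun a _ => Finset.sum_congr rfl fun b _ => ?_
    rw [Finset.sum_comm]
    refine Finset.sum_congr rfl fun c _ => Finset.sum_congr rfl fun d _ => ?_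
    rw [hq d c]; ring
  simp only [mul_sub, mul_add, Finset.sum_add_distrib, Finset.sum_sub_distrib]
  linarith

/-- With p the second derivatives of a 2-form, this is the contraction with q twice of a derivative
of an exact 3-form. It vanishes because second derivatives commute while q and the 2-form are skew.
-/
theorem sum_mul_exact {ι : Type*} [Fintype ι] [DecidableEq ι] {q : Matrix ι ι ℝ}
    (hq : ∀ a b, q a b = -q b a) {p : ι → ι → ι → ι → ℝ} (h1 : ∀ a b c d, p a b c d = p b a c d)
    (h2 : ∀ a b c d, p a b c d = -p a b d c) :
    ∑ a, ∑ b, ∑ c, ∑ d, q a b * q c d * (p a b c d + p a c d b + p a d b c) = 0 := by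
  have e1 : ∑ a, ∑ b, ∑ c, ∑ d, q a b * q c d * p a b c d =
      -∑ a, ∑ b, ∑ c, ∑ d, q a b * q c d * p a b c d := by
    refine Finset.sum_comm.trans ?_
    simp only [← Finset.sum_neg_distrib]
    refine Finset.sum_congr rfl fun a _ => Finset.sum_congr rfl fun b _ =>
      Finset.sum_congr rfl fun c _ => Finset.sum_congr rfl fun d _ => ?_
    rw [hq b a, h1 b a]; ring
  have e2 : ∑ a, ∑ b, ∑ c, ∑ d, q a b * q c d * p a c d b =
      -∑ a, ∑ b, ∑ c, ∑ d, q a b * q c d * p a c d b := by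
    refine (sum₄_comm _).trans ?_
    simp only [← Finset.sum_neg_distrib]
    refine Finset.sum_congr rfl fun a _ => Finset.sum_congr rfl fun b _ =>
      Finset.sum_congr rfl fun c _ => Finset.sum_congr rfl fun d _ => ?_
    rw [h1 c a, h2 a c b d]; ring
  have e3 : ∑ a, ∑ b, ∑ c, ∑ d, q a b * q c d * p a d b c =
      ∑ a, ∑ b, ∑ c, ∑ d, q a b * q c d * p a c d b := by
    refine Finset.sum_congr rfl fun a _ => Finset.sum_congr rfl fun b _ => ?_
    rw [Finset.sum_comm]
    refine Finset.sum_congr rfl fun c _ => Finset.sum_congr rfl fun d _ => ?_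
    rw [hq d c, h2 a c b d]; ring
  simp only [mul_add, Finset.sum_add_distrib]
  linarith

theorem contDiffAt_fieldStrength (hθ : ∀ a, ContDiffAt ℝ ∞ (fun z => θ z a) y) (a b : Fin (2 * n)) :
    ContDiffAt ℝ ∞ (fun z => fieldStrength G θ z a b) y :=
  ((ContDiffAt.pd (hθ b) a).sub (ContDiffAt.pd (hθ a) b)).add (contDiffAt_bilin _ (hθ a) (hθ b))

theorem contDiffAt_csComp (B : InvariantInner EG G) {t : R2 n → Fin (2 * n) → EG}
    {F : R2 n → Fin (2 * n) → Fin (2 * n) → EG} (ht : ∀ a, ContDiffAt ℝ ∞ (fun z => t z a) y)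
    (hF : ∀ a b, ContDiffAt ℝ ∞ (fun z => F z a b) y) (b c d : Fin (2 * n)) :
    ContDiffAt ℝ ∞ (fun z => csComp B.form (bracketMap EG G) (t z) (F z) b c d) y :=
  (((contDiffAt_bilin _ (ht b) (hF c d)).add (contDiffAt_bilin _ (ht c) (hF d b))).add
    (contDiffAt_bilin _ (ht d) (hF b c))).sub
      (contDiffAt_bilin _ (ht b) (contDiffAt_bilin _ (ht c) (ht d)))

theorem InvariantInner.csComp_rotate (B : InvariantInner EG G) {ι : Type*} (t : ι → EG)
    (F : ι → ι → EG) (b c d : ι) : csComp B.form (bracketMap EG G) t F b c d =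
      csComp B.form (bracketMap EG G) t F c d b := by
  have := B.form_bracketMap_rotate (t c) (t d) (t b)
  simp only [csComp]
  linarith

/-- The contracted transgression formula. -/
theorem InvariantInner.sum_mul_pd_csComp (B : InvariantInner EG G)
    {q : Matrix (Fin (2 * n)) (Fin (2 * n)) ℝ} (hq : ∀ a b, q a b = -q b a)
    (hθ : ∀ a, ContDiffAt ℝ ∞ (fun z => θ z a) y) (hθ' : ∀ a, ContDiffAt ℝ ∞ (fun z => θ' z a) y) :
    ∑ a, ∑ b, ∑ c, ∑ d, q a b * q c d * pd a (fun z => csComp B.form (bracketMap EG G)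
      (fun a => θ' z a - θ z a) (fun a b => fieldStrength G θ z a b + fieldStrength G θ' z a b)
        b c d) y =
      topo B.form q (fieldStrength G θ' y) - topo B.form q (fieldStrength G θ y) := by
  -- Four times the left-hand side is the contraction of the exterior derivative of the Chern-Simons
  -- form, which is twice the three-splittings expression and hence 4 · `topo`.
  have key : ∀ θ : R2 n → Fin (2 * n) → EG, (∀ a, ContDiffAt ℝ ∞ (fun z => θ z a) y) →
      ∑ a, ∑ b, ∑ c, ∑ d, q a b * q c d * pd a (fun z => csComp B.form (bracketMap EG G)
        (θ z) (fieldStrength G θ z) b c d) y = topo B.form q (fieldStrength G θ y) := by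
    intro θ hθ
    have h1 := sum_mul_alternating hq (s := fun a b c d => pd a (fun z => csComp B.form
      (bracketMap EG G) (θ z) (fieldStrength G θ z) b c d) y)
      (fun a b c d => by simp_rw [B.csComp_rotate _ _ b c d])
    simp only [B.pd_csComp hθ] at h1
    have h2 := sum_mul_wedge_eq_topo B.form hq (fieldStrength G θ y)
    have h3 : ∑ a, ∑ b, ∑ c, ∑ d, q a b * q c d * (2 * (B.form (fieldStrength G θ y a b)
        (fieldStrength G θ y c d) - B.form (fieldStrength G θ y a c) (fieldStrength G θ y b d) +
          B.form (fieldStrength G θ y a d) (fieldStrength G θ y b c))) =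
        4 * topo B.form q (fieldStrength G θ y) := by
      rw [show (4 : ℝ) = 2 * 2 by norm_num, mul_assoc, ← h2, sum₄_comm]
      simp only [Finset.mul_sum]
      refine Finset.sum_congr rfl fun a _ => Finset.sum_congr rfl fun b _ =>
        Finset.sum_congr rfl fun c _ => Finset.sum_congr rfl fun d _ => ?_
      ring
    linarith
  have hev : ∀ θ : R2 n → Fin (2 * n) → EG, (∀ a, ContDiffAt ℝ ∞ (fun z => θ z a) y) →
      ∀ᶠ z in 𝓝 y, ∀ a, DifferentiableAt ℝ (fun z => θ z a) z := by
    intro θ hθ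
    refine Filter.eventually_all.2 fun a => ?_
    filter_upwards [((hθ a).of_le (m := 1) (by simp)).eventually (by simp)] with z hz
    exact hz.differentiableAt (by simp)
  have hp : ∀ c d, ContDiffAt ℝ ∞ (csPrimitive B θ θ' c d) y := fun c d =>
    (contDiffAt_bilin _ (hθ c) (hθ' d)).sub (contDiffAt_bilin _ (hθ d) (hθ' c))
  -- The transgression formula holds on a neighbourhood of y, so it can be differentiated once more.
  have hsplit : ∀ a b c d, pd a (fun z => csComp B.form (bracketMap EG G)
      (fun a => θ' z a - θ z a) (fun a b => fieldStrength G θ z a b + fieldStrength G θ' z a b)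
        b c d) y =
      pd a (fun z => csComp B.form (bracketMap EG G) (θ' z) (fieldStrength G θ' z) b c d) y
      - pd a (fun z => csComp B.form (bracketMap EG G) (θ z) (fieldStrength G θ z) b c d) y
      + (pd a (pd b (csPrimitive B θ θ' c d)) y + pd a (pd c (csPrimitive B θ θ' d b)) y
        + pd a (pd d (csPrimitive B θ θ' b c)) y) := by
    intro a b c d
    have s1 : ∀ θ : R2 n → Fin (2 * n) → EG, (∀ a, ContDiffAt ℝ ∞ (fun z => θ z a) y) →
      DifferentiableAt ℝ (fun z => csComp B.form (bracketMap EG G) (θ z) (fieldStrength G θ z) b c d)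
        y := fun θ hθ =>
      (contDiffAt_csComp B hθ (contDiffAt_fieldStrength hθ) b c d).differentiableAt (by simp)
    have s2 : ∀ b c d, DifferentiableAt ℝ (pd b (csPrimitive B θ θ' c d)) y := fun b c d =>
      (ContDiffAt.pd (hp c d) b).differentiableAt (by simp)
    rw [← pd_sub (s1 θ' hθ') (s1 θ hθ), ← pd_add (s2 b c d) (s2 c d b),
      ← pd_add ((s2 b c d).fun_add (s2 c d b)) (s2 d b c),
      ← pd_add ((s1 θ' hθ').fun_sub (s1 θ hθ)) (((s2 b c d).fun_add (s2 c d b)).fun_add (s2 d b c))]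
    refine pd_congr ?_ a
    filter_upwards [hev θ hθ, hev θ' hθ'] with z h1 h2
    exact B.csComp_sub h1 h2 b c d
  have hex := sum_mul_exact hq (p := fun a b c d => pd a (pd b (csPrimitive B θ θ' c d)) y)
    (fun a b c d => pd_comm (hp c d) a b) (fun a b c d => by
      have h1 : csPrimitive B θ θ' c d = fun z => -csPrimitive B θ θ' d c z := by
        funext z; simp only [csPrimitive]; ring
      have h2 : pd b (csPrimitive B θ θ' c d) = fun z => -pd b (csPrimitive B θ θ' d c) z := by
        funext z; rw [h1]; exact pd_neg b
      rw [h2]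
      exact pd_neg a)
  simp only [hsplit]
  simp only [mul_add, mul_sub, Finset.sum_add_distrib, Finset.sum_sub_distrib] at hex ⊢
  linarith [key θ hθ, key θ' hθ']

end ChernSimons

/-! ### The topological density of a connection -/

section TrilinearForms

variable {V M : Type*} [AddCommGroup V] [Module ℝ V] [AddCommGroup M] [Module ℝ M]

/-- The trilinear form with components `csComp`. -/
def csForm (B : M →ₗ[ℝ] M →ₗ[ℝ] ℝ) (br : M →ₗ[ℝ] M →ₗ[ℝ] M) (t : V →ₗ[ℝ] M)
    (S : V →ₗ[ℝ] V →ₗ[ℝ] M) : V →ₗ[ℝ] V →ₗ[ℝ] V →ₗ[ℝ] ℝ :=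
  LinearMap.mk₂ ℝ (fun u v => (B (t u)).comp (S v) + (B (t v)).comp (S.flip u)
      + (B.flip (S u v)).comp t - (B (t u)).comp ((br (t v)).comp t))
    (fun u u' v => by ext w; simp; ring) (fun c u v => by ext w; simp; ring)
    (fun u v v' => by ext w; simp; ring) (fun c u v => by ext w; simp; ring)

theorem topo_transform {ι : Type*} [Fintype ι] [DecidableEq ι] (B : M →ₗ[ℝ] M →ₗ[ℝ] ℝ)
    {P q q' : Matrix ι ι ℝ} (h : P * q' * Pᵀ = q) (F : ι → ι → M) :
    topo B q' (fun a c => ∑ s, ∑ t, (P s a * P t c) • F s t) = topo B q F := by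
  rw [topo, pairing_transform B h h, topo, contract, contract, sum_smul_transform h]

end TrilinearForms

section TopologicalDensity

set_option linter.unusedSectionVars false

variable {EG : Type*} [NormedAddCommGroup EG] [NormedSpace ℝ EG] [CompleteSpace EG]
  [FiniteDimensional ℝ EG]
  {G : Type*} [TopologicalSpace G] [ChartedSpace EG G] [Group G] [LieGroup 𝓘(ℝ, EG) ∞ G]
  {n : ℕ} {X : Type*} [TopologicalSpace X] [ChartedSpace (R2 n) X] [IsManifold 𝓘(ℝ, R2 n) ∞ X]
  {EP : Type*} [NormedAddCommGroup EP] [NormedSpace ℝ EP]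
  {P : Type*} [TopologicalSpace P] [ChartedSpace EP P] [IsManifold 𝓘(ℝ, EP) ∞ P]
  {E : PrincipalBundle EG G n X EP P} {Ω : SymplecticForm n X} [T2Space X] [CompactSpace X]

theorem Ad_add (g : G) (ξ η : EG) : Ad g (ξ + η) = Ad g ξ + Ad g η := by
  rw [Ad_eq, ← map_add]

theorem InvariantInner.csComp_Ad (B : InvariantInner EG G) {ι : Type*} (g : G) (t : ι → EG)
    (F : ι → ι → EG) (b c d : ι) :
    csComp B.form (bracketMap EG G) (fun a => Ad g (t a)) (fun a b => Ad g (F a b)) b c d =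
      csComp B.form (bracketMap EG G) t F b c d := by
  simp only [csComp, ← Ad_bracketMap, B.invariant]

theorem InvariantInner.pairing_Ad (B : InvariantInner EG G) {ι : Type*} [Fintype ι] (g : G)
    (p q : Matrix ι ι ℝ) (F : ι → ι → EG) :
    pairing B.form p q (fun a b => Ad g (F a b)) (fun a b => Ad g (F a b)) =
      pairing B.form p q F F := by
  simp only [pairing, B.invariant]

theorem InvariantInner.topo_Ad (B : InvariantInner EG G) {ι : Type*} [Fintype ι] (g : G)
    (q : Matrix ι ι ℝ) (F : ι → ι → EG) :
    topo B.form q (fun a b => Ad g (F a b)) = topo B.form q F := by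
  have h : contract q (fun a b => Ad g (F a b)) = Ad g (contract q F) := by
    simp only [contract, Ad_eq, map_smul, map_sum]
  rw [topo, topo, B.pairing_Ad, h, B.invariant]

theorem basePoint_transition (E : PrincipalBundle EG G n X EP P) (i k : X) {y : R2 n}
    (hy : y ∈ (transition i k).source) : basePoint E k (transition i k y) = basePoint E i y := by
  rw [basePoint, basePoint, symm_transition i k hy]

/-- The Chern-Simons form of two connections, at a point of the total space. -/
def Connection.chernSimons (B : InvariantInner EG G) (A A' : Connection E) (p : P) :
    R2 n →ₗ[ℝ] R2 n →ₗ[ℝ] R2 n →ₗ[ℝ] ℝ :=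
  csForm B.form (bracketMap EG G) ((A'.val p).comp (A.lift p)).toLinearMap
    (twoFormBilin (A.curv p) + twoFormBilin (A'.curv p))

/-- The chart components are values of one trilinear form at a chosen point of the fibre, so a
change of charts is multilinearity. -/
theorem Connection.chernSimons_apply (B : InvariantInner EG G) (A A' : Connection E) (i : X)
    (y : R2 n) (b c d : Fin (2 * n)) :
    A.chernSimons B A' (basePoint E i y) (chartD i y (stdVec b)) (chartD i y (stdVec c))
      (chartD i y (stdVec d)) = csComp B.form (bracketMap EG G) (A.diffComp A' i y)
        (fun a b => A.curvComp i y a b + A'.curvComp i y a b) b c d := rfl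

/-- Smoothness holds although the base points are chosen arbitrarily: Ad-invariance removes the
unknown group element, and a smooth expression in local potentials remains. -/
theorem Connection.contDiffAt_chernSimons (B : InvariantInner EG G) (A A' : Connection E) (i : X)
    {y : R2 n} (hy : y ∈ (chartAt (R2 n) i).target) (b c d : Fin (2 * n)) :
    ContDiffAt ℝ ∞ (fun z => csComp B.form (bracketMap EG G) (A.diffComp A' i z)
        (fun a b => A.curvComp i z a b + A'.curvComp i z a b) b c d) y := by
  obtain ⟨θ, θ', hθ, hθ', h⟩ := exists_potential A A' i hy
  refine (contDiffAt_csComp B (t := fun z a => θ' z a - θ z a)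
    (F := fun z a b => fieldStrength G θ z a b + fieldStrength G θ' z a b)
    (fun a => (hθ' a).sub (hθ a)) (fun a b => (contDiffAt_fieldStrength hθ a b).add
      (contDiffAt_fieldStrength hθ' a b)) b c d).congr_of_eventuallyEq ?_
  filter_upwards [h] with z ⟨g, h1, h2, h3⟩
  have e1 : A.diffComp A' i z = fun a => Ad g (θ' z a - θ z a) := funext h3
  simp only [e1, h1, h2, ← Ad_add]
  exact B.csComp_Ad g _ (fun a b => fieldStrength G θ z a b + fieldStrength G θ' z a b) b c d

theorem Connection.sum_pd_chernSimons (B : InvariantInner EG G) (A A' : Connection E) (i : X)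
    {y : R2 n} (hy : y ∈ (chartAt (R2 n) i).target) {q : Matrix (Fin (2 * n)) (Fin (2 * n)) ℝ}
    (hq : ∀ a b, q a b = -q b a) :
    ∑ a, ∑ b, ∑ c, ∑ d, q a b * q c d * pd a (fun z => csComp B.form (bracketMap EG G)
      (A.diffComp A' i z) (fun a b => A.curvComp i z a b + A'.curvComp i z a b) b c d) y =
      topo B.form q (A'.curvComp i y) - topo B.form q (A.curvComp i y) := by
  obtain ⟨θ, θ', hθ, hθ', h⟩ := exists_potential A A' i hy
  have h0 : ∀ b c d, (fun z => csComp B.form (bracketMap EG G)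
      (A.diffComp A' i z) (fun a b => A.curvComp i z a b + A'.curvComp i z a b) b c d) =ᶠ[𝓝 y]
      fun z => csComp B.form (bracketMap EG G)
      (fun a => θ' z a - θ z a) (fun a b => fieldStrength G θ z a b + fieldStrength G θ' z a b)
        b c d := by
    intro b c d
    filter_upwards [h] with z ⟨g, h1, h2, h3⟩
    have e1 : A.diffComp A' i z = fun a => Ad g (θ' z a - θ z a) := funext h3
    simp only [e1, h1, h2, ← Ad_add]
    exact B.csComp_Ad g _ (fun a b => fieldStrength G θ z a b + fieldStrength G θ' z a b) b c d
  obtain ⟨g, h1, h2, -⟩ := h.self_of_nhds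
  have e1 : A.curvComp i y = fun a b => Ad g (fieldStrength G θ y a b) :=
    funext fun a => funext fun b => h1 a b
  have e2 : A'.curvComp i y = fun a b => Ad g (fieldStrength G θ' y a b) :=
    funext fun a => funext fun b => h2 a b
  rw [e1, e2, B.topo_Ad g q (fieldStrength G θ' y), B.topo_Ad g q (fieldStrength G θ y),
    ← B.sum_mul_pd_csComp hq hθ hθ']
  simp only [pd_congr (h0 _ _ _)]

theorem SymplecticForm.mat_inv_skew (Ω : SymplecticForm n X) (i : X) {y : R2 n}
    (hy : y ∈ (chartAt (R2 n) i).target) (a b : Fin (2 * n)) :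
    (Ω.mat i y)⁻¹ a b = -(Ω.mat i y)⁻¹ b a := by
  have hsq : ((Ω.mat i y)⁻¹)ᵀ = -(Ω.mat i y)⁻¹ := by
    rw [Matrix.transpose_nonsing_inv, Ω.mat_skew]
    exact Matrix.inv_eq_left_inv (by
      rw [neg_mul_neg, Matrix.nonsing_inv_mul _ (Ω.isUnit_det_mat i hy)])
  simpa using congrFun (congrFun hsq b) a

variable (Ω) in
/-- The contraction of the Chern-Simons form with the symplectic form. -/
def Connection.csField (B : InvariantInner EG G) (A A' : Connection E) : CovectorField n X where
  comp i y b := ∑ c, ∑ d, (Ω.mat i y)⁻¹ c d * csComp B.form (bracketMap EG G) (A.diffComp A' i y)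
    (fun a b => A.curvComp i y a b + A'.curvComp i y a b) b c d
  transform i k y hy a := by
    simp only [← Connection.chernSimons_apply, basePoint_transition E i k hy]
    set T := A.chernSimons B A' (basePoint E i y)
    set L := chartD k (transition i k y)
    let τ : R2 n →L[ℝ] R2 n := fderiv ℝ (transition i k) y
    have hL : chartD i y = L.comp τ := chartD_transition i k hy
    have h1 : ∀ u, ∑ c, ∑ d, (Ω.mat i y)⁻¹ c d * T u (chartD i y (stdVec c)) (chartD i y (stdVec d)) =
        ∑ c, ∑ d, (Ω.mat k (transition i k y))⁻¹ c d * T u (L (stdVec c)) (L (stdVec d)) := by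
      intro u
      have h2 := sum_smul_transform (mat_inv_transition Ω i k hy)
        fun c d => T u (L (stdVec c)) (L (stdVec d))
      simp only [smul_eq_mul] at h2
      rw [← h2]
      refine Finset.sum_congr rfl fun c _ => Finset.sum_congr rfl fun d _ => ?_
      have h3 := bilin_apply_apply ((T u).compl₁₂ L.toLinearMap L.toLinearMap) τ τ c d
      congr 1
      rw [hL]
      exact h3
    simp only [h1]
    have h4 : chartD i y (stdVec a) = ∑ b, transJac i k y b a • L (stdVec b) := by
      rw [hL, ContinuousLinearMap.comp_apply, apply_stdVec τ, map_sum]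
      exact Finset.sum_congr rfl fun b _ => map_smul _ _ _
    rw [h4]
    simp only [map_sum, map_smul, LinearMap.sum_apply, LinearMap.smul_apply, smul_eq_mul,
      Finset.mul_sum, Finset.sum_mul]
    symm
    refine Finset.sum_comm.trans (Finset.sum_congr rfl fun c _ => ?_)
    refine Finset.sum_comm.trans (Finset.sum_congr rfl fun d _ => ?_)
    refine Finset.sum_congr rfl fun b _ => ?_
    ring
  smooth i y hy b := ContDiffAt.sum fun c _ => ContDiffAt.sum fun d _ =>
    (((Ω.smoothMat_mat i hy).inv (Ω.isUnit_det_mat i hy)) c d).mul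
      (A.contDiffAt_chernSimons B A' i hy b c d)

theorem contDiffAt_contract {q : R2 n → Matrix (Fin (2 * n)) (Fin (2 * n)) ℝ} {y : R2 n}
    {F : R2 n → Fin (2 * n) → Fin (2 * n) → EG} (hq : SmoothMat q y)
    (hF : ∀ a b, ContDiffAt ℝ ∞ (fun z => F z a b) y) :
    ContDiffAt ℝ ∞ (fun z => contract (q z) (F z)) y :=
  contDiffAt_const.smul (ContDiffAt.sum fun a _ => ContDiffAt.sum fun b _ => (hq a b).smul (hF a b))

theorem contDiffAt_pairing (B : InvariantInner EG G)
    {p q : R2 n → Matrix (Fin (2 * n)) (Fin (2 * n)) ℝ} {y : R2 n}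
    {F : R2 n → Fin (2 * n) → Fin (2 * n) → EG} (hp : SmoothMat p y) (hq : SmoothMat q y)
    (hF : ∀ a b, ContDiffAt ℝ ∞ (fun z => F z a b) y) :
    ContDiffAt ℝ ∞ (fun z => pairing B.form (p z) (q z) (F z) (F z)) y :=
  ContDiffAt.sum fun a _ => ContDiffAt.sum fun b _ => (hp a b).mul
    (ContDiffAt.sum fun c _ => ContDiffAt.sum fun d _ =>
      (hq c d).mul (contDiffAt_bilin _ (hF a c) (hF b d)))

theorem CompatibleACS.isUnit_det_metricMatrix (j : CompatibleACS Ω) (i : X) {y : R2 n}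
    (hy : y ∈ (chartAt (R2 n) i).target) : IsUnit (metricMatrix j.metric i y).det := by
  rw [metricMatrix_eq_mul j i hy]
  exact isUnit_iff_ne_zero.2 (j.isCompatiblePair_mat i hy).pos.det_pos.ne'

theorem CompatibleACS.smoothMat_metricMatrix (j : CompatibleACS Ω) (i : X) {y : R2 n}
    (hy : y ∈ (chartAt (R2 n) i).target) : SmoothMat (metricMatrix j.metric i) y := by
  refine ((Ω.smoothMat_mat i hy).mul (fun a b => j.contDiffAt_endMatrix i hy a b)).congr ?_
  filter_upwards [(chartAt (R2 n) i).open_target.mem_nhds hy] with z hz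
  exact metricMatrix_eq_mul j i hz

/-- The function `Λ²(F ∧ F)`, which only depends on the symplectic form. -/
def Connection.topDensity (B : InvariantInner EG G) (Ω : SymplecticForm n X) (A : Connection E)
    (x : X) : ℝ :=
  topo B.form (Ω.inv x) (comps (A.curv (Function.surjInv E.proj_surjective x)))

theorem Connection.curvComp_eq (A : Connection E) (i : X) (y : R2 n) : A.curvComp i y =
    fun a b => ∑ c, ∑ d, (jac i y c a * jac i y d b) • comps (A.curv (basePoint E i y)) c d :=
  funext fun a => funext fun b => twoForm_apply_apply _ _ _ a b

theorem Connection.topDensity_symm (B : InvariantInner EG G) (A : Connection E) (i : X)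
    {y : R2 n} (hy : y ∈ (chartAt (R2 n) i).target) :
    A.topDensity B Ω ((chartAt (R2 n) i).symm y) = topo B.form (Ω.mat i y)⁻¹ (A.curvComp i y) := by
  rw [A.curvComp_eq, topo_transform B.form (jac_mul_mat_inv Ω i hy)]
  rfl

/-- Differentiating the contraction ω^{cd}σ_{bcd} yields the derivative of σ, which is the
transgression, and a term with the derivative of ω⁻¹, which dω = 0 kills. -/
theorem Connection.isDiv_csField (B : InvariantInner EG G) (A A' : Connection E) :
    (A.csField Ω B A').IsDiv Ω fun x => A'.topDensity B Ω x - A.topDensity B Ω x := by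
  intro i y hy
  simp only [A.topDensity_symm B i hy, A'.topDensity_symm B i hy]
  rw [← A.sum_pd_chernSimons B A' i hy (Ω.mat_inv_skew i hy)]
  set σ := fun z => csComp B.form (bracketMap EG G) (A.diffComp A' i z)
    (fun a b => A.curvComp i z a b + A'.curvComp i z a b) with hσ
  -- The term in which ω⁻¹ is differentiated.
  have h0 := sum_inv_mul_pd_inv_mul_alternating (Ω.smoothMat_mat i hy) (Ω.isUnit_det_mat i hy)
    (Ω.mat_skew i) (Ω.pd_mat_cyclic i hy) (σ := σ y) (fun a b c => B.csComp_rotate _ _ a b c)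
  have s1 : ∀ c d, DifferentiableAt ℝ (fun z => (Ω.mat i z)⁻¹ c d) y := fun c d =>
    (((Ω.smoothMat_mat i hy).inv (Ω.isUnit_det_mat i hy)) c d).differentiableAt (by simp)
  have s2 : ∀ b c d, DifferentiableAt ℝ (fun z => σ z b c d) y := fun b c d =>
    (A.contDiffAt_chernSimons B A' i hy b c d).differentiableAt (by simp)
  have h1 : ∀ a b, pd a (fun z => (A.csField Ω B A').comp i z b) y =
      ∑ c, ∑ d, (pd a (fun z => (Ω.mat i z)⁻¹ c d) y * σ y b c d +
        (Ω.mat i y)⁻¹ c d * pd a (fun z => σ z b c d) y) := by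
    intro a b
    have h2 := pd_sum (s := Finset.univ) (f := fun c z => ∑ d, (Ω.mat i z)⁻¹ c d * σ z b c d)
      (fun c _ => DifferentiableAt.fun_sum fun d _ => (s1 c d).mul (s2 b c d)) a
    refine h2.trans (Finset.sum_congr rfl fun c _ => ?_)
    rw [pd_sum (f := fun d z => (Ω.mat i z)⁻¹ c d * σ z b c d) fun d _ => (s1 c d).mul (s2 b c d)]
    exact Finset.sum_congr rfl fun d _ => pd_mul (s1 c d) (s2 b c d) a
  simp only [h1, Finset.mul_sum, mul_add, Finset.sum_add_distrib, ← mul_assoc]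
  rw [h0, zero_add]

theorem Connection.smoothFun_topDensity (B : InvariantInner EG G) (A : Connection E) :
    SmoothFun n (A.topDensity B Ω) := by
  intro i y hy
  obtain ⟨θ, _, hθ, -, h⟩ := exists_potential A A i hy
  have hq := (Ω.smoothMat_mat i hy).inv (Ω.isUnit_det_mat i hy)
  have hF := contDiffAt_fieldStrength (G := G) hθ
  refine ((contDiffAt_const (c := (2 : ℝ))).mul (contDiffAt_bilin B.form (contDiffAt_contract hq hF)
    (contDiffAt_contract hq hF)) |>.sub (contDiffAt_pairing B hq hq hF)).congr_of_eventuallyEq ?_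
  filter_upwards [h, (chartAt (R2 n) i).open_target.mem_nhds hy] with z ⟨g, h1, _, _⟩ hz
  have e1 : A.curvComp i z = fun a b => Ad g (fieldStrength G θ z a b) :=
    funext fun a => funext fun b => h1 a b
  rw [A.topDensity_symm B i hz, e1]
  exact B.topo_Ad g _ (fieldStrength G θ z)

theorem curvNormSq_symm (B : InvariantInner EG G) (j : CompatibleACS Ω) (A : Connection E) (i : X)
    {y : R2 n} (hy : y ∈ (chartAt (R2 n) i).target) :
    curvNormSq B j.metric A ((chartAt (R2 n) i).symm y) = (1 / 2) * pairing B.form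
      (metricMatrix j.metric i y)⁻¹ (metricMatrix j.metric i y)⁻¹ (A.curvComp i y)
        (A.curvComp i y) := by
  have h1 : curvNormSq B j.metric A ((chartAt (R2 n) i).symm y) = (1 / 2) * pairing B.form
      (invGram j.metric (E.proj (basePoint E i y))) (invGram j.metric (E.proj (basePoint E i y)))
      (comps (A.curv (basePoint E i y))) (comps (A.curv (basePoint E i y))) :=
    normSqTwoForm_eq j _ B.form (A.curv (basePoint E i y))
  rw [h1, show E.proj (basePoint E i y) = (chartAt (R2 n) i).symm y from
    Function.surjInv_eq E.proj_surjective _, A.curvComp_eq,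
    pairing_transform B.form (jac_mul_metric_inv j i hy) (jac_mul_metric_inv j i hy)]

theorem smoothFun_curvNormSq (B : InvariantInner EG G) (j : CompatibleACS Ω) (A : Connection E) :
    SmoothFun n (curvNormSq B j.metric A) := by
  intro i y hy
  obtain ⟨θ, _, hθ, -, h⟩ := exists_potential A A i hy
  have hq := (j.smoothMat_metricMatrix i hy).inv (j.isUnit_det_metricMatrix i hy)
  have hF := contDiffAt_fieldStrength (G := G) hθ
  refine ((contDiffAt_const (c := (1 / 2 : ℝ))).mul
    (contDiffAt_pairing B hq hq hF)).congr_of_eventuallyEq ?_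
  filter_upwards [h, (chartAt (R2 n) i).open_target.mem_nhds hy] with z ⟨g, h1, _, _⟩ hz
  have e1 : A.curvComp i z = fun a b => Ad g (fieldStrength G θ z a b) :=
    funext fun a => funext fun b => h1 a b
  rw [curvNormSq_symm B j A i hz, e1]
  congr 1
  exact B.pairing_Ad g _ _ (fieldStrength G θ z)

theorem lambdaSqFF_eq_topDensity (B : InvariantInner EG G) (j : CompatibleACS Ω) (A : Connection E)
    (x : X) : lambdaSqFF B j A (Function.surjInv E.proj_surjective x) = A.topDensity B Ω x := by
  have h1 : lambdaSqFF B j A (Function.surjInv E.proj_surjective x) =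
      topo B.form (Ω.inv (E.proj (Function.surjInv E.proj_surjective x)))
        (comps (A.curv (Function.surjInv E.proj_surjective x))) :=
    lefschetzAdjoint_wedge j _ B.form B.symm (A.curv (Function.surjInv E.proj_surjective x))
  rw [h1, Function.surjInv_eq E.proj_surjective x]
  rfl

/-- The integral of the topological density does not depend on the connection. -/
theorem Connection.integral_topDensity (B : InvariantInner EG G) (A A' : Connection E) :
    Ω.integral (A'.topDensity B Ω) = Ω.integral (A.topDensity B Ω) := by
  have h1 := (A.isDiv_csField (Ω := Ω) B A').integral_eq_zero
  have h2 := Ω.integral_add (A.isDiv_csField (Ω := Ω) B A').smoothFun (A.smoothFun_topDensity (Ω := Ω) B)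
  rw [h1, zero_add] at h2
  rw [← h2]
  congr 1
  funext x
  ring

end TopologicalDensity

/-! ### The Ricci form in coordinates -/

section RicciFormCalculus

set_option linter.unusedSectionVars false

variable {n : ℕ} {y : R2 n} {J J₁ J₂ h : R2 n → Matrix (Fin (2 * n)) (Fin (2 * n)) ℝ}

theorem SmoothMat.sub {f g : R2 n → Matrix (Fin (2 * n)) (Fin (2 * n)) ℝ} (hf : SmoothMat f y)
    (hg : SmoothMat g y) : SmoothMat (fun z => f z - g z) y := fun a b => (hf a b).sub (hg a b)

theorem SmoothMat.smul {f : R2 n → Matrix (Fin (2 * n)) (Fin (2 * n)) ℝ} (c : ℝ)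
    (hf : SmoothMat f y) : SmoothMat (fun z => c • f z) y := fun a b => contDiffAt_const.mul (hf a b)

theorem pd_trace_mul {f g : R2 n → Matrix (Fin (2 * n)) (Fin (2 * n)) ℝ} (hf : SmoothMat f y)
    (hg : SmoothMat g y) (a : Fin (2 * n)) : pd a (fun z => (f z * g z).trace) y =
      (pderivMatrix a f y * g y).trace + (f y * pderivMatrix a g y).trace := by
  rw [pd_trace (hf.mul hg), pderivMatrix_mul hf hg, Matrix.trace_add]

/-- The trace of `J R` for a connection that preserves the almost complex structure `J`. -/
theorem trace_mul_linearCurvature {D : R2 n → Fin (2 * n) → Matrix (Fin (2 * n)) (Fin (2 * n)) ℝ}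
    (hJ : SmoothMat J y) (hD : ∀ a, SmoothMat (fun z => D z a) y) (hsq : J y * J y = -1)
    (hpar : ∀ a, pderivMatrix a J y = J y * D y a - D y a * J y) (a b : Fin (2 * n)) :
    (J y * linearCurvature D y a b).trace = pd a (fun z => (J z * D z b).trace) y
      - pd b (fun z => (J z * D z a).trace) y
      - (1 / 2) * (J y * pderivMatrix a J y * pderivMatrix b J y).trace := by
  rw [pd_trace_mul hJ (hD b), pd_trace_mul hJ (hD a), hpar, hpar, linearCurvature]
  set K := J y
  set A := D y a
  set B := D y b
  have e : ∀ M : Matrix (Fin (2 * n)) (Fin (2 * n)) ℝ, M * K * K = -M := fun M => by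
    rw [mul_assoc, hsq, mul_neg, mul_one]
  -- With K² = −1 and cyclicity of the trace, every word in A, B and K without derivatives of A or B
  -- reduces to tr(KAB) or tr(KBA).
  have t1 : (A * K * B).trace = (K * B * A).trace := by
    rw [Matrix.trace_mul_cycle, Matrix.trace_mul_cycle]
  have t2 : (B * K * A).trace = (K * A * B).trace := by
    rw [Matrix.trace_mul_cycle, Matrix.trace_mul_cycle]
  have t3 : (A * B * K).trace = (K * A * B).trace := Matrix.trace_mul_cycle _ _ _
  have t4 : (K * A * K * B * K).trace = -(K * B * A).trace := by
    rw [← t1, Matrix.trace_mul_comm, ← Matrix.trace_neg]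
    simp only [← mul_assoc, hsq, neg_mul, one_mul]
  simp only [mul_sub, sub_mul, mul_add, ← mul_assoc, hsq, e, neg_mul, one_mul, Matrix.trace_sub,
    Matrix.trace_add, Matrix.trace_neg, t1, t2, t3, t4]
  ring

theorem pderivMatrix_comm (hh : SmoothMat h y) (a b : Fin (2 * n)) :
    pderivMatrix a (pderivMatrix b h) y = pderivMatrix b (pderivMatrix a h) y := by
  ext c d
  exact pd_comm (hh c d) a b

theorem mul_pderivMatrix_anticomm (hJ : SmoothMat J y) (hsq : ∀ᶠ z in 𝓝 y, J z * J z = -1)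
    (a : Fin (2 * n)) : J y * pderivMatrix a J y = -(pderivMatrix a J y * J y) := by
  have h1 := pderivMatrix_congr (f := fun z => J z * J z) (g := fun _ => -1) hsq a
  rw [pderivMatrix_const, pderivMatrix_mul hJ hJ] at h1
  exact eq_neg_of_add_eq_zero_right h1

/-- The form `tr(J h⁻¹ dh)`. -/
def gaugeTrace (J h : R2 n → Matrix (Fin (2 * n)) (Fin (2 * n)) ℝ) (y : R2 n) (a : Fin (2 * n)) : ℝ :=
  (J y * ((h y)⁻¹ * pderivMatrix a h y)).trace

/-- Conjugation by h carries J₂ to J₁ and turns ∂J₂ into ∂J₁ + [h⁻¹∂h, J₁]. Expanding the quadratic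
term of J₂ in these leaves exactly the curl of tr(J₁h⁻¹∂h). It is used with the Jacobian of a
transition function as h, where it makes the Ricci form a tensor, and with h = J + J', where it
compares two structures. -/
theorem pd_gaugeTrace_sub (hJ₁ : SmoothMat J₁ y) (hJ₂ : SmoothMat J₂ y) (hh : SmoothMat h y)
    (hu : IsUnit (h y).det) (hsq : ∀ᶠ z in 𝓝 y, J₁ z * J₁ z = -1)
    (hc : ∀ᶠ z in 𝓝 y, h z * J₁ z = J₂ z * h z) (a b : Fin (2 * n)) :
    pd a (fun z => gaugeTrace J₁ h z b) y - pd b (fun z => gaugeTrace J₁ h z a) y =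
      (1 / 2) * (J₁ y * pderivMatrix a J₁ y * pderivMatrix b J₁ y).trace
      - (1 / 2) * (J₂ y * pderivMatrix a J₂ y * pderivMatrix b J₂ y).trace := by
  have hi := hh.inv hu
  have hpd : ∀ a b, pd a (fun z => gaugeTrace J₁ h z b) y =
      (pderivMatrix a J₁ y * ((h y)⁻¹ * pderivMatrix b h y)).trace
      - (J₁ y * ((h y)⁻¹ * pderivMatrix a h y) * ((h y)⁻¹ * pderivMatrix b h y)).trace
      + (J₁ y * ((h y)⁻¹ * pderivMatrix a (pderivMatrix b h) y)).trace := by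
    intro a b
    unfold gaugeTrace
    rw [pd_trace_mul hJ₁ (hi.mul (hh.pderivMatrix b)), pderivMatrix_mul hi (hh.pderivMatrix b),
      pderivMatrix_inv hh hu, mul_add, Matrix.trace_add, neg_mul, mul_neg, Matrix.trace_neg]
    simp only [mul_assoc]
    ring
  rw [hpd, hpd, pderivMatrix_comm hh b a]
  have hinv : (h y)⁻¹ * h y = 1 := Matrix.nonsing_inv_mul _ hu
  have hinv' : h y * (h y)⁻¹ = 1 := Matrix.mul_nonsing_inv _ hu
  -- The derivative of hJ₁ = J₂h, conjugated back by h.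
  have hder : ∀ a, (h y)⁻¹ * pderivMatrix a J₂ y * h y = pderivMatrix a J₁ y
      + (h y)⁻¹ * pderivMatrix a h y * J₁ y - J₁ y * ((h y)⁻¹ * pderivMatrix a h y) := by
    intro a
    have h1 := pderivMatrix_congr (f := fun z => h z * J₁ z) (g := fun z => J₂ z * h z) hc a
    rw [pderivMatrix_mul hh hJ₁, pderivMatrix_mul hJ₂ hh] at h1
    have h2 : pderivMatrix a J₂ y * h y = pderivMatrix a h y * J₁ y + h y * pderivMatrix a J₁ y
        - J₂ y * pderivMatrix a h y := by rw [h1]; abel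
    have h3 : (h y)⁻¹ * J₂ y = J₁ y * (h y)⁻¹ := by
      calc (h y)⁻¹ * J₂ y = (h y)⁻¹ * (J₂ y * h y) * (h y)⁻¹ := by
            simp only [mul_assoc, hinv', mul_one]
        _ = _ := by rw [← hc.self_of_nhds]; simp only [← mul_assoc, hinv, one_mul]
    rw [mul_assoc, h2, mul_sub, mul_add, ← mul_assoc, ← mul_assoc, hinv, one_mul, ← mul_assoc, h3]
    simp only [mul_assoc]
    abel
  have hK : (h y)⁻¹ * J₂ y * h y = J₁ y := by
    rw [mul_assoc, ← hc.self_of_nhds, ← mul_assoc, hinv, one_mul]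
  have htr : (J₂ y * pderivMatrix a J₂ y * pderivMatrix b J₂ y).trace =
      (((h y)⁻¹ * J₂ y * h y) * ((h y)⁻¹ * pderivMatrix a J₂ y * h y)
        * ((h y)⁻¹ * pderivMatrix b J₂ y * h y)).trace := by
    have e : ∀ M N : Matrix (Fin (2 * n)) (Fin (2 * n)) ℝ, M * h y * ((h y)⁻¹ * N) = M * N :=
      fun M N => by rw [mul_assoc, ← mul_assoc (h y), hinv', one_mul]
    rw [mul_assoc (h y)⁻¹ (pderivMatrix a J₂ y), e, mul_assoc (h y)⁻¹ (pderivMatrix b J₂ y),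
      ← mul_assoc (_ * _) (pderivMatrix a J₂ y), e, ← mul_assoc, Matrix.trace_mul_comm _ (h y)]
    simp only [← mul_assoc, hinv', one_mul]
  rw [htr, hK, hder, hder]
  have hA := mul_pderivMatrix_anticomm hJ₁ hsq a
  have hB := mul_pderivMatrix_anticomm hJ₁ hsq b
  have hs := hsq.self_of_nhds
  set K := J₁ y
  set A := pderivMatrix a J₁ y
  set B := pderivMatrix b J₁ y
  set u := (h y)⁻¹ * pderivMatrix a h y
  set v := (h y)⁻¹ * pderivMatrix b h y
  have e : ∀ M : Matrix (Fin (2 * n)) (Fin (2 * n)) ℝ, M * K * K = -M := fun M => by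
    rw [mul_assoc, hs, mul_neg, mul_one]
  have t1 : (K * A * v * K).trace = -(A * v).trace := by
    rw [Matrix.trace_mul_comm, ← Matrix.trace_neg]
    simp only [← mul_assoc, hs, neg_mul, one_mul]
  have t2 : (K * A * K * v).trace = (A * v).trace := by
    rw [hA, neg_mul, e, neg_neg]
  have t3 : (K * u * K * B).trace = (u * B).trace := by
    rw [mul_assoc, hB, mul_neg, Matrix.trace_neg, ← mul_assoc, Matrix.trace_mul_comm, ← Matrix.trace_neg]
    simp only [← mul_assoc, hs, neg_mul, one_mul, neg_neg]
  have t6 : (u * K * v).trace = (K * v * u).trace := by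
    rw [Matrix.trace_mul_cycle, Matrix.trace_mul_cycle]
  have t4 : (K * u * K * v * K).trace = -(K * v * u).trace := by
    rw [← t6, Matrix.trace_mul_comm, ← Matrix.trace_neg]
    simp only [← mul_assoc, hs, neg_mul, one_mul]
  have t5 : (u * v * K).trace = (K * u * v).trace := Matrix.trace_mul_cycle _ _ _
  have t7 : (B * u).trace = (u * B).trace := Matrix.trace_mul_comm _ _
  simp only [mul_sub, sub_mul, mul_add, add_mul, ← mul_assoc, hs, e, neg_mul, one_mul,
    Matrix.trace_sub, Matrix.trace_add, Matrix.trace_neg, t1, t2, t3, t4, t5, t6, t7]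
  ring

end RicciFormCalculus

/-! ### The Hermitian scalar curvature -/

section HermitianScalar

set_option linter.unusedSectionVars false

variable {n : ℕ} {X : Type*} [TopologicalSpace X] [ChartedSpace (R2 n) X]
  [IsManifold 𝓘(ℝ, R2 n) ∞ X] [T2Space X] [CompactSpace X] {Ω : SymplecticForm n X}

theorem sum_skew_mul_symm {ι : Type*} [Fintype ι] {q : Matrix ι ι ℝ} (hq : ∀ a b, q a b = -q b a)
    {s : ι → ι → ℝ} (hs : ∀ a b, s a b = s b a) : ∑ a, ∑ b, q a b * s a b = 0 := by
  have h : ∑ a, ∑ b, q a b * s a b = -∑ a, ∑ b, q a b * s a b := by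
    refine Finset.sum_comm.trans ?_
    simp only [← Finset.sum_neg_distrib]
    refine Finset.sum_congr rfl fun a _ => Finset.sum_congr rfl fun b _ => ?_
    rw [hq b a, hs b a]; ring
  linarith

namespace CompatibleACS

variable (j : CompatibleACS Ω) (i : X) {y : R2 n} (hy : y ∈ (chartAt (R2 n) i).target)

include hy

theorem smoothMat_endMatrix : SmoothMat (endMatrix j.J i) y :=
  fun a b => j.contDiffAt_endMatrix i hy a b

theorem eventually_endMatrix_sq : ∀ᶠ z in 𝓝 y, endMatrix j.J i z * endMatrix j.J i z = -1 := by
  filter_upwards [(chartAt (R2 n) i).open_target.mem_nhds hy] with z hz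
  exact (j.isCompatiblePair_mat i hz).sq

theorem metricMatrix_symm (a b : Fin (2 * n)) :
    metricMatrix j.metric i y a b = metricMatrix j.metric i y b a := by
  have := (j.isCompatiblePair_mat i hy).pos.isHermitian
  rw [Matrix.IsHermitian, Matrix.conjTranspose_eq_transpose_of_trivial,
    ← metricMatrix_eq_mul j i hy] at this
  exact congrFun (congrFun this b) a

theorem pd_metricMatrix_symm (c a b : Fin (2 * n)) :
    pd c (fun z => metricMatrix j.metric i z a b) y =
      pd c (fun z => metricMatrix j.metric i z b a) y := by
  refine pd_congr ?_ c
  filter_upwards [(chartAt (R2 n) i).open_target.mem_nhds hy] with z hz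
  exact j.metricMatrix_symm i hz a b

theorem smoothMat_leviCivita (a : Fin (2 * n)) :
    SmoothMat (fun z => leviCivita j.metric i z a) y := by
  intro k l
  have hg := j.smoothMat_metricMatrix i hy
  exact contDiffAt_const.mul (ContDiffAt.sum fun m _ =>
    ((hg.inv (j.isUnit_det_metricMatrix i hy)) k m).mul
    (((hg.pderivMatrix a l m).add (hg.pderivMatrix l a m)).sub (hg.pderivMatrix m a l)))

theorem smoothMat_hermitianConnection (a : Fin (2 * n)) :
    SmoothMat (fun z => hermitianConnection j i z a) y := by
  have hJ := j.smoothMat_endMatrix i hy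
  have hC := j.smoothMat_leviCivita i hy a
  exact hC.sub ((hJ.mul (((hJ.pderivMatrix a).add (hC.mul hJ)).sub (hJ.mul hC))).smul _)

/-- The Hermitian connection preserves J: since ∇J anticommutes with J, the commutator of J with the
correction −½J∇J cancels ∇J. -/
theorem pderivMatrix_endMatrix_eq (a : Fin (2 * n)) : pderivMatrix a (endMatrix j.J i) y =
    endMatrix j.J i y * hermitianConnection j i y a
      - hermitianConnection j i y a * endMatrix j.J i y := by
  have h1 := mul_pderivMatrix_anticomm (j.smoothMat_endMatrix i hy)
    (j.eventually_endMatrix_sq i hy) a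
  have hs := (j.isCompatiblePair_mat i hy).sq
  rw [hermitianConnection]
  set K := endMatrix j.J i y
  set C := leviCivita j.metric i y a
  set A := pderivMatrix a (endMatrix j.J i) y
  have e : ∀ M : Matrix (Fin (2 * n)) (Fin (2 * n)) ℝ, M * K * K = -M := fun M => by
    rw [mul_assoc, hs, mul_neg, mul_one]
  have h2 : K * A * K = A := by rw [h1, neg_mul, e, neg_neg]
  simp only [mul_sub, sub_mul, mul_add, add_mul, mul_smul_comm, smul_mul_assoc, ← mul_assoc, hs, e,
    neg_mul, mul_neg, one_mul, h2]
  module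

/-- The correction term contributes a multiple of tr(∇J), which is zero because ∂J anticommutes with
J and the trace of a commutator vanishes. -/
theorem trace_mul_hermitianConnection (a : Fin (2 * n)) :
    (endMatrix j.J i y * hermitianConnection j i y a).trace =
      (endMatrix j.J i y * leviCivita j.metric i y a).trace := by
  have h1 := mul_pderivMatrix_anticomm (j.smoothMat_endMatrix i hy)
    (j.eventually_endMatrix_sq i hy) a
  have hs := (j.isCompatiblePair_mat i hy).sq
  rw [hermitianConnection]
  set K := endMatrix j.J i y
  set C := leviCivita j.metric i y a
  set A := pderivMatrix a (endMatrix j.J i) y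
  have h2 : A.trace = 0 := by
    have h3 : (K * A * K).trace = A.trace := by
      rw [h1, neg_mul, mul_assoc, hs, mul_neg, mul_one, neg_neg]
    rw [Matrix.trace_mul_comm, ← mul_assoc, hs, neg_mul, one_mul, Matrix.trace_neg] at h3
    linarith
  have h4 : (C * K).trace = (K * C).trace := Matrix.trace_mul_comm _ _
  simp only [mul_sub, mul_add, mul_smul_comm, ← mul_assoc, hs, neg_mul, mul_neg, one_mul, Matrix.trace_sub,
    Matrix.trace_add, Matrix.trace_neg, Matrix.trace_smul, h2, h4, smul_eq_mul]
  ring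

omit hy in
/-- A potential of the Ricci form, up to a term of first order in the almost complex structure. -/
def ricciPotential (y : R2 n) (a : Fin (2 * n)) : ℝ :=
  ∑ l, ∑ m, (Ω.mat i y)⁻¹ l m * pd l (fun z => metricMatrix j.metric i z a m) y

/-- In tr(JΓ_a) the Christoffel symbols are contracted with Jg⁻¹ = ω⁻¹. Skewness kills their
symmetric part and leaves one derivative of the metric. -/
theorem trace_mul_leviCivita (a : Fin (2 * n)) :
    (endMatrix j.J i y * leviCivita j.metric i y a).trace = j.ricciPotential i y a := by
  have h := j.isCompatiblePair_mat i hy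
  have hq := h.inv_skew_apply
  have hπ : ∀ s l, ∑ k, endMatrix j.J i y s k * (metricMatrix j.metric i y)⁻¹ k l =
      (Ω.mat i y)⁻¹ s l := by
    intro s l
    rw [← Matrix.mul_apply, metricMatrix_eq_mul j i hy, h.mul_metric_inv]
  set g := fun (c a b : Fin (2 * n)) => pd c (fun z => metricMatrix j.metric i z a b) y with hg
  have h1 : (endMatrix j.J i y * leviCivita j.metric i y a).trace =
      ∑ s, ∑ l, (Ω.mat i y)⁻¹ s l * ((1 / 2) * (g a s l + g s a l - g l a s)) := by
    rw [Matrix.trace]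
    refine Finset.sum_congr rfl fun s _ => ?_
    rw [Matrix.diag_apply, Matrix.mul_apply]
    simp only [← hπ, Finset.sum_mul]
    rw [Finset.sum_comm]
    refine Finset.sum_congr rfl fun k _ => ?_
    rw [leviCivita, Matrix.of_apply, Finset.mul_sum, Finset.mul_sum]
    refine Finset.sum_congr rfl fun l _ => ?_
    simp only [pderivMatrix_apply, hg]
    ring
  have h2 := sum_skew_mul_symm hq (s := fun s l => (1 / 2) * g a s l) fun s l => by
    simp only [hg, j.pd_metricMatrix_symm i hy a s l]
  have h3 := sum_skew_mul_symm hq (s := fun s l => (1 / 2) * (g s a l + g l a s)) fun s l => by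
    ring
  rw [h1, ricciPotential]
  have h4 : ∀ s l, (Ω.mat i y)⁻¹ s l * ((1 / 2) * (g a s l + g s a l - g l a s)) =
      (Ω.mat i y)⁻¹ s l * ((1 / 2) * g a s l) + (Ω.mat i y)⁻¹ s l * g s a l
      - (Ω.mat i y)⁻¹ s l * ((1 / 2) * (g s a l + g l a s)) := fun s l => by ring
  simp only [h4, Finset.sum_add_distrib, Finset.sum_sub_distrib]
  rw [h2, h3]
  ring

theorem contDiffAt_ricciPotential (a : Fin (2 * n)) :
    ContDiffAt ℝ ∞ (fun z => j.ricciPotential i z a) y :=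
  ContDiffAt.sum fun l _ => ContDiffAt.sum fun m _ =>
    (((Ω.smoothMat_mat i hy).inv (Ω.isUnit_det_mat i hy)) l m).mul
      (ContDiffAt.pd (j.smoothMat_metricMatrix i hy a m) l)

omit hy in
/-- Twice the components of the Ricci form in the chart at `i`. -/
def ricciComp (y : R2 n) (a b : Fin (2 * n)) : ℝ :=
  pd a (fun z => j.ricciPotential i z b) y - pd b (fun z => j.ricciPotential i z a) y
    - (1 / 2) * (endMatrix j.J i y * pderivMatrix a (endMatrix j.J i) y *
        pderivMatrix b (endMatrix j.J i) y).trace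

theorem trace_mul_linearCurvature_hermitianConnection (a b : Fin (2 * n)) :
    (endMatrix j.J i y * linearCurvature (hermitianConnection j i) y a b).trace =
      j.ricciComp i y a b := by
  have h1 : ∀ a, (fun z => (endMatrix j.J i z * hermitianConnection j i z a).trace) =ᶠ[𝓝 y]
      fun z => j.ricciPotential i z a := by
    intro a
    filter_upwards [(chartAt (R2 n) i).open_target.mem_nhds hy] with z hz
    rw [j.trace_mul_hermitianConnection i hz, j.trace_mul_leviCivita i hz]
  rw [trace_mul_linearCurvature (j.smoothMat_endMatrix i hy) (j.smoothMat_hermitianConnection i hy)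
    (j.isCompatiblePair_mat i hy).sq (j.pderivMatrix_endMatrix_eq i hy), pd_congr (h1 b),
    pd_congr (h1 a), ricciComp]

omit hy in
-- The factor −1/4 collects ½ from Λ, ½ from the definition of ρ_J and the sign in g⁻¹Jᵀ = −ω⁻¹.
theorem hermScalar_eq (x : X) : hermScalar j x = -(1 / 4) * ∑ a, ∑ b,
    (Ω.mat x (chartAt (R2 n) x x))⁻¹ a b * j.ricciComp x (chartAt (R2 n) x x) a b := by
  have hx := mem_chart_target (R2 n) x
  have h := (j.isCompatiblePair_mat x hx).metric_inv_mul_transpose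
  rw [← metricMatrix_eq_mul j x hx] at h
  have h1 : ∀ a c, ∑ b, (metricMatrix j.metric x (chartAt (R2 n) x x))⁻¹ a b *
      endMatrix j.J x (chartAt (R2 n) x x) c b = -(Ω.mat x (chartAt (R2 n) x x))⁻¹ a c := by
    intro a c
    have h2 := congrFun (congrFun h a) c
    rw [Matrix.mul_apply] at h2
    exact h2
  rw [hermScalar, Finset.mul_sum, Finset.mul_sum]
  refine Finset.sum_congr rfl fun a _ => ?_
  rw [Finset.sum_comm, Finset.mul_sum, Finset.mul_sum]
  refine Finset.sum_congr rfl fun c _ => ?_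
  rw [← Finset.sum_mul, h1, ricciForm, j.trace_mul_linearCurvature_hermitianConnection x hx]
  ring

end CompatibleACS

end HermitianScalar

/-! ### The total Hermitian scalar curvature -/

section TotalHermitianScalar

set_option linter.unusedSectionVars false

variable {n : ℕ} {X : Type*} [TopologicalSpace X] [ChartedSpace (R2 n) X]
  [IsManifold 𝓘(ℝ, R2 n) ∞ X] [T2Space X] [CompactSpace X] {Ω : SymplecticForm n X}

theorem contDiffAt_gaugeTrace {J h : R2 n → Matrix (Fin (2 * n)) (Fin (2 * n)) ℝ} {y : R2 n}
    (hJ : SmoothMat J y) (hh : SmoothMat h y) (hu : IsUnit (h y).det) (a : Fin (2 * n)) :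
    ContDiffAt ℝ ∞ (fun z => gaugeTrace J h z a) y :=
  (hJ.mul ((hh.inv hu).mul (hh.pderivMatrix a))).trace

/-! ### Behaviour of the Ricci potential and the Ricci form under changes of charts. -/

section Transition

variable (i k : X) {y : R2 n} (hy : y ∈ (transition i k).source)

include hy

theorem smoothMat_transJac : SmoothMat (transJac i k) y := fun a b => contDiffAt_transJac i k hy a b

theorem pd_transJac_symm (a b c : Fin (2 * n)) :
    pd a (fun z => transJac i k z c b) y = pd b (fun z => transJac i k z c a) y := by
  have h1 : ContDiffAt ℝ ∞ (fun z => transition i k z c) y :=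
    (EuclideanSpace.proj (𝕜 := ℝ) c).contDiff.contDiffAt.comp y (contDiffAt_transition i k hy)
  have h2 : ∀ b, (fun z => transJac i k z c b) =ᶠ[𝓝 y] pd b (fun z => transition i k z c) := by
    intro b
    filter_upwards [(transition i k).open_source.mem_nhds hy] with z hz
    have h3 := HasFDerivAt.comp (f := transition i k) z
      (EuclideanSpace.proj (𝕜 := ℝ) c : R2 n →L[ℝ] ℝ).hasFDerivAt
      ((contDiffAt_transition i k hz).differentiableAt (by simp)).hasFDerivAt
    exact (DFunLike.congr_fun h3.fderiv (stdVec b)).symm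
  rw [pd_congr (h2 b), pd_congr (h2 a), pd_comm h1]

theorem SmoothMat.comp_transition {f : R2 n → Matrix (Fin (2 * n)) (Fin (2 * n)) ℝ}
    (hf : SmoothMat f (transition i k y)) : SmoothMat (fun z => f (transition i k z)) y :=
  fun a b => (hf a b).comp y (contDiffAt_transition i k hy)

theorem pderivMatrix_comp_transition {f : R2 n → Matrix (Fin (2 * n)) (Fin (2 * n)) ℝ}
    (hf : SmoothMat f (transition i k y)) (a : Fin (2 * n)) :
    pderivMatrix a (fun z => f (transition i k z)) y =
      ∑ e, transJac i k y e a • pderivMatrix e f (transition i k y) := by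
  ext c d
  rw [pderivMatrix_apply, pd_comp_transition hy (F := fun z => f z c d) (hf.diff c d),
    Matrix.sum_apply]
  exact Finset.sum_congr rfl fun e _ => mul_comm _ _

/-- Differentiating g_i = tᵀ g_k t, with t the Jacobian, gives three terms. The derivative of g_k
gives the tensorial part, that of the right factor t vanishes, and that of the left factor gives the
inhomogeneous term tr(J t⁻¹dt). -/
theorem CompatibleACS.ricciPotential_transition (j : CompatibleACS Ω) (a : Fin (2 * n)) :
    j.ricciPotential i y a =
      ∑ c, j.ricciPotential k (transition i k y) c * transJac i k y c a
        + gaugeTrace (endMatrix j.J i) (transJac i k) y a := by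
  have hy0 := ((mem_transition_source i k).1 hy).1
  have hyk := transition_mem_target i k hy
  set t := transJac i k y with ht
  set q := (Ω.mat i y)⁻¹ with hq
  set g := metricMatrix j.metric k (transition i k y) with hg
  have hst := smoothMat_transJac i k hy
  have hstT : SmoothMat (fun z => (transJac i k z)ᵀ) y := fun a b => hst b a
  have hsg := j.smoothMat_metricMatrix k hyk
  have hsg' := SmoothMat.comp_transition i k hy hsg
  have hT : ∀ l, pderivMatrix l (fun z => (transJac i k z)ᵀ) y = (pderivMatrix l (transJac i k) y)ᵀ :=
    fun l => rfl
  have h1 : ∀ l, pderivMatrix l (metricMatrix j.metric i) y =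
      ((pderivMatrix l (transJac i k) y)ᵀ * g + tᵀ *
        ∑ e, t e l • pderivMatrix e (metricMatrix j.metric k) (transition i k y)) * t
      + tᵀ * g * pderivMatrix l (transJac i k) y := by
    intro l
    have h2 : metricMatrix j.metric i =ᶠ[𝓝 y] fun z => (transJac i k z)ᵀ *
        metricMatrix j.metric k (transition i k z) * transJac i k z := by
      filter_upwards [(transition i k).open_source.mem_nhds hy] with z hz
      exact metricMatrix_transition j i k hz
    rw [pderivMatrix_congr h2, pderivMatrix_mul (hstT.mul hsg') hst, pderivMatrix_mul hstT hsg',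
      pderivMatrix_comp_transition i k hy hsg, hT]
  have h0 : j.ricciPotential i y a =
      ∑ l, ∑ m, q l m * (pderivMatrix l (metricMatrix j.metric i) y) a m := rfl
  -- Second derivatives of the transition function are symmetric in l and m, while q is skew.
  have e3 : ∑ l, ∑ m, q l m * (tᵀ * g * pderivMatrix l (transJac i k) y) a m = 0 := by
    refine sum_skew_mul_symm (j.isCompatiblePair_mat i hy0).inv_skew_apply fun l m => ?_
    rw [Matrix.mul_apply, Matrix.mul_apply]
    refine Finset.sum_congr rfl fun c _ => ?_
    rw [pderivMatrix_apply, pd_transJac_symm i k hy]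
    rfl
  have e2 : ∑ l, ∑ m, q l m * (tᵀ * (∑ e, t e l •
      pderivMatrix e (metricMatrix j.metric k) (transition i k y)) * t) a m =
      ∑ c, j.ricciPotential k (transition i k y) c * t c a := by
    have h2 : ∀ c, ∑ l, ∑ m, q l m * ∑ e, ∑ d, t e l * t d m *
        pd e (fun z => metricMatrix j.metric k z c d) (transition i k y) =
        j.ricciPotential k (transition i k y) c := fun c =>
      sum_smul_transform (mat_inv_transition Ω i k hy)
        fun e d => pd e (fun z => metricMatrix j.metric k z c d) (transition i k y)
    simp only [← h2, Finset.sum_mul]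
    symm
    refine Finset.sum_comm.trans (Finset.sum_congr rfl fun l _ => ?_)
    refine Finset.sum_comm.trans (Finset.sum_congr rfl fun m _ => ?_)
    rw [mul_assoc, Matrix.mul_apply, Finset.mul_sum]
    refine Finset.sum_congr rfl fun c _ => ?_
    rw [mul_assoc]
    congr 1
    rw [Matrix.transpose_apply, mul_comm (t c a)]
    congr 1
    simp only [Matrix.mul_apply, Matrix.sum_apply, Matrix.smul_apply, smul_eq_mul, Finset.sum_mul]
    refine Finset.sum_comm.trans (Finset.sum_congr rfl fun d _ => Finset.sum_congr rfl fun e _ => ?_)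
    rw [pderivMatrix_apply]
    ring
  have e1 : ∑ l, ∑ m, q l m * ((pderivMatrix l (transJac i k) y)ᵀ * g * t) a m =
      gaugeTrace (endMatrix j.J i) (transJac i k) y a := by
    have hK : endMatrix j.J i y * t⁻¹ = q * (g * t)ᵀ := by
      have hgT : gᵀ = g := by
        ext a b
        exact j.metricMatrix_symm k hyk b a
      have h2 := metricMatrix_transition j i k hy
      have h3 : q * metricMatrix j.metric i y = endMatrix j.J i y := by
        rw [metricMatrix_eq_mul j i hy0, ← mul_assoc, (j.isCompatiblePair_mat i hy0).inv_mul, one_mul]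
      rw [← h3, h2, Matrix.transpose_mul, hgT]
      simp only [mul_assoc]
      rw [Matrix.mul_nonsing_inv _ (isUnit_det_transJac i k hy), mul_one]
    have h2 : gaugeTrace (endMatrix j.J i) (transJac i k) y a =
        (pderivMatrix a (transJac i k) y * (endMatrix j.J i y * t⁻¹)).trace := by
      rw [gaugeTrace, ← mul_assoc, Matrix.trace_mul_comm]
    rw [h2, hK, Matrix.trace]
    simp only [Matrix.diag_apply, Matrix.mul_apply (M := pderivMatrix a (transJac i k) y),
      Matrix.mul_apply (M := q), Matrix.transpose_apply, Finset.mul_sum]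
    symm
    refine Finset.sum_comm.trans (Finset.sum_congr rfl fun l _ => ?_)
    refine Finset.sum_comm.trans (Finset.sum_congr rfl fun m _ => ?_)
    rw [mul_assoc, Matrix.mul_apply, Finset.mul_sum]
    refine Finset.sum_congr rfl fun c _ => ?_
    rw [Matrix.transpose_apply, pderivMatrix_apply, pderivMatrix_apply, pd_transJac_symm i k hy]
    ring
  rw [h0]
  simp only [h1, add_mul, Matrix.add_apply, mul_add, Finset.sum_add_distrib]
  rw [e3, e2, e1]
  ring

theorem CompatibleACS.trace_comp_transition (j : CompatibleACS Ω) (a b : Fin (2 * n)) :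
    (endMatrix j.J k (transition i k y) *
      pderivMatrix a (fun z => endMatrix j.J k (transition i k z)) y *
      pderivMatrix b (fun z => endMatrix j.J k (transition i k z)) y).trace =
    ∑ c, ∑ d, transJac i k y c a * transJac i k y d b * (endMatrix j.J k (transition i k y) *
      pderivMatrix c (endMatrix j.J k) (transition i k y) *
      pderivMatrix d (endMatrix j.J k) (transition i k y)).trace := by
  have hJ := j.smoothMat_endMatrix k (transition_mem_target i k hy)
  rw [pderivMatrix_comp_transition i k hy hJ, pderivMatrix_comp_transition i k hy hJ]
  simp only [Finset.mul_sum, Finset.sum_mul, Matrix.trace_sum, mul_smul_comm, smul_mul_assoc,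
    Matrix.trace_smul, smul_eq_mul]
  rw [Finset.sum_comm]
  exact Finset.sum_congr rfl fun _ _ => Finset.sum_congr rfl fun _ _ => by ring

/-- Neither part of `ricciComp` is a tensor. The curl of the inhomogeneous term tr(J t⁻¹dt) of the
potential is exactly the defect of the quadratic term. -/
theorem CompatibleACS.ricciComp_transition (j : CompatibleACS Ω) (a b : Fin (2 * n)) :
    j.ricciComp i y a b = ∑ c, ∑ d, (transJac i k y c a * transJac i k y d b) *
      j.ricciComp k (transition i k y) c d := by
  have hy0 := ((mem_transition_source i k).1 hy).1
  have hyk := transition_mem_target i k hy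
  have hu := isUnit_det_transJac i k hy
  have hst := smoothMat_transJac i k hy
  have hJ := j.smoothMat_endMatrix i hy0
  have hJk := j.smoothMat_endMatrix k hyk
  have hJ' := SmoothMat.comp_transition i k hy hJk
  have hsrc := (transition i k).open_source.mem_nhds hy
  have hτ := fun c => (j.contDiffAt_ricciPotential k hyk c).differentiableAt (n := ∞) (by simp)
  have hτ' : ∀ c, DifferentiableAt ℝ (fun z => j.ricciPotential k (transition i k z) c) y := fun c =>
    DifferentiableAt.comp (g := fun z => j.ricciPotential k z c) y (hτ c)
      ((contDiffAt_transition i k hy).differentiableAt (by simp))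
  have h1 : ∀ a b, pd a (fun z => j.ricciPotential i z b) y =
      ∑ c, (∑ d, pd d (fun z => j.ricciPotential k z c) (transition i k y) * transJac i k y d a) *
        transJac i k y c b
      + ∑ c, j.ricciPotential k (transition i k y) c * pd a (fun z => transJac i k z c b) y
      + pd a (fun z => gaugeTrace (endMatrix j.J i) (transJac i k) z b) y := by
    intro a b
    have h2 : (fun z => j.ricciPotential i z b) =ᶠ[𝓝 y] fun z =>
        ∑ c, j.ricciPotential k (transition i k z) c * transJac i k z c b
        + gaugeTrace (endMatrix j.J i) (transJac i k) z b := by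
      filter_upwards [hsrc] with z hz
      exact j.ricciPotential_transition i k hz b
    have s1 : ∀ c, DifferentiableAt ℝ (fun z =>
        j.ricciPotential k (transition i k z) c * transJac i k z c b) y := fun c =>
      (hτ' c).fun_mul (hst.diff c b)
    rw [pd_congr h2, pd_add (DifferentiableAt.fun_sum fun c _ => s1 c)
      ((contDiffAt_gaugeTrace hJ hst hu b).differentiableAt (by simp)),
      pd_sum (f := fun c z => j.ricciPotential k (transition i k z) c * transJac i k z c b)
        fun c _ => s1 c, ← Finset.sum_add_distrib]
    congr 1
    refine Finset.sum_congr rfl fun c _ => ?_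
    rw [pd_mul (hτ' c) (hst.diff c b),
      pd_comp_transition hy (F := fun z => j.ricciPotential k z c) (hτ c)]
  have h2 := pd_gaugeTrace_sub hJ hJ' hst hu (j.eventually_endMatrix_sq i hy0)
    (by filter_upwards [hsrc] with z hz; exact transJac_mul_endMatrix j i k hz) a b
  rw [j.trace_comp_transition i k hy] at h2
  have h3 : ∀ a b, ∑ c, (∑ d, pd d (fun z => j.ricciPotential k z c) (transition i k y) *
      transJac i k y d a) * transJac i k y c b = ∑ c, ∑ d, transJac i k y c a * transJac i k y d b *
        pd c (fun z => j.ricciPotential k z d) (transition i k y) := by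
    intro a b
    simp only [Finset.sum_mul]
    rw [Finset.sum_comm]
    exact Finset.sum_congr rfl fun _ _ => Finset.sum_congr rfl fun _ _ => by ring
  have h4 : ∑ c, ∑ d, transJac i k y c b * transJac i k y d a *
      pd c (fun z => j.ricciPotential k z d) (transition i k y) =
      ∑ c, ∑ d, transJac i k y c a * transJac i k y d b *
        pd d (fun z => j.ricciPotential k z c) (transition i k y) := by
    rw [Finset.sum_comm]
    exact Finset.sum_congr rfl fun _ _ => Finset.sum_congr rfl fun _ _ => by ring
  have h5 : ∑ c, j.ricciPotential k (transition i k y) c * pd b (fun z => transJac i k z c a) y =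
      ∑ c, j.ricciPotential k (transition i k y) c * pd a (fun z => transJac i k z c b) y :=
    Finset.sum_congr rfl fun c _ => by rw [pd_transJac_symm i k hy]
  have h6 : ∀ c d, transJac i k y c a * transJac i k y d b *
      j.ricciComp k (transition i k y) c d =
      transJac i k y c a * transJac i k y d b *
        pd c (fun z => j.ricciPotential k z d) (transition i k y)
      - transJac i k y c a * transJac i k y d b *
        pd d (fun z => j.ricciPotential k z c) (transition i k y)
      - (1 / 2) * (transJac i k y c a * transJac i k y d b * (endMatrix j.J k (transition i k y) *
      pderivMatrix c (endMatrix j.J k) (transition i k y) *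
      pderivMatrix d (endMatrix j.J k) (transition i k y)).trace) := fun c d => by
    rw [CompatibleACS.ricciComp]; ring
  simp only [h6, Finset.sum_sub_distrib, ← Finset.mul_sum]
  rw [CompatibleACS.ricciComp, h1, h1, h3, h3, h4, h5]
  linarith

/-- The inhomogeneous terms are those of the difference of the two Ricci potentials, so they cancel
in `ricciField`. The reason is that the Jacobian intertwines J + J' in the two charts. -/
theorem CompatibleACS.gaugeTrace_transition (j j' : CompatibleACS Ω) (a : Fin (2 * n)) :
    gaugeTrace (endMatrix j.J i) (fun z => endMatrix j.J i z + endMatrix j'.J i z) y a =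
      ∑ c, gaugeTrace (endMatrix j.J k) (fun z => endMatrix j.J k z + endMatrix j'.J k z)
        (transition i k y) c * transJac i k y c a
      + gaugeTrace (endMatrix j.J i) (transJac i k) y a
      - gaugeTrace (endMatrix j'.J i) (transJac i k) y a := by
  have hy0 := ((mem_transition_source i k).1 hy).1
  have hyk := transition_mem_target i k hy
  have hu := isUnit_det_transJac i k hy
  have hst := smoothMat_transJac i k hy
  have hsh := (j.smoothMat_endMatrix i hy0).add (j'.smoothMat_endMatrix i hy0)
  have hsk := (j.smoothMat_endMatrix k hyk).add (j'.smoothMat_endMatrix k hyk)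
  have hci := j.isCompatiblePair_mat i hy0
  have hci' := j'.isCompatiblePair_mat i hy0
  have hui := hci.isUnit_det_add hci'
  have huk := (j.isCompatiblePair_mat k hyk).isUnit_det_add (j'.isCompatiblePair_mat k hyk)
  have hth : ∀ z ∈ (transition i k).source, transJac i k z * (endMatrix j.J i z + endMatrix j'.J i z) =
      (endMatrix j.J k (transition i k z) + endMatrix j'.J k (transition i k z)) * transJac i k z :=
    fun z hz => by
      rw [mul_add, transJac_mul_endMatrix j i k hz, transJac_mul_endMatrix j' i k hz, add_mul]
  have hd := pderivMatrix_congr (f := fun z => transJac i k z *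
    (endMatrix j.J i z + endMatrix j'.J i z)) (by
      filter_upwards [(transition i k).open_source.mem_nhds hy] with z hz
      exact hth z hz) a
  rw [pderivMatrix_mul hst hsh, pderivMatrix_mul (SmoothMat.comp_transition i k hy hsk) hst] at hd
  have hk : ∑ c, gaugeTrace (endMatrix j.J k) (fun z => endMatrix j.J k z + endMatrix j'.J k z)
      (transition i k y) c * transJac i k y c a = (endMatrix j.J k (transition i k y) *
        ((endMatrix j.J k (transition i k y) + endMatrix j'.J k (transition i k y))⁻¹ *
          pderivMatrix a (fun z => endMatrix j.J k (transition i k z) +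
            endMatrix j'.J k (transition i k z)) y)).trace := by
    rw [pderivMatrix_comp_transition i k hy hsk]
    simp only [Finset.mul_sum, Matrix.trace_sum, mul_smul_comm, Matrix.trace_smul, smul_eq_mul]
    exact Finset.sum_congr rfl fun c _ => mul_comm _ _
  rw [hk]
  unfold gaugeTrace
  have hthy := hth y hy
  have htJ := transJac_mul_endMatrix j i k hy
  set t := transJac i k y
  set dt := pderivMatrix a (transJac i k) y
  set K := endMatrix j.J i y
  set K' := endMatrix j'.J i y
  set L := endMatrix j.J k (transition i k y)
  set L' := endMatrix j'.J k (transition i k y)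
  set dh := pderivMatrix a (fun z => endMatrix j.J i z + endMatrix j'.J i z) y
  set dk := pderivMatrix a (fun z => endMatrix j.J k (transition i k z) +
    endMatrix j'.J k (transition i k z)) y
  have t1 : t⁻¹ * t = 1 := Matrix.nonsing_inv_mul _ hu
  have t2 : t * t⁻¹ = 1 := Matrix.mul_nonsing_inv _ hu
  have k1 : (K + K')⁻¹ * (K + K') = 1 := Matrix.nonsing_inv_mul _ hui
  have k2 : (K + K') * (K + K')⁻¹ = 1 := Matrix.mul_nonsing_inv _ hui
  have l1 : (L + L')⁻¹ * (L + L') = 1 := Matrix.nonsing_inv_mul _ huk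
  have hinv : (K + K')⁻¹ * t⁻¹ = t⁻¹ * (L + L')⁻¹ := by
    rw [← Matrix.mul_inv_rev, ← Matrix.mul_inv_rev, hthy]
  have hdh : (K + K')⁻¹ * dh = t⁻¹ * (L + L')⁻¹ * dk * t + t⁻¹ * dt
      - (K + K')⁻¹ * (t⁻¹ * dt) * (K + K') := by
    have e1 : t * dh = dk * t + (L + L') * dt - dt * (K + K') := by rw [← hd]; abel
    have e2 : dh = t⁻¹ * (dk * t + (L + L') * dt - dt * (K + K')) := by
      rw [← e1, ← mul_assoc, t1, one_mul]
    have e3 : (K + K')⁻¹ * t⁻¹ * (L + L') = t⁻¹ := by rw [hinv, mul_assoc, l1, mul_one]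
    rw [e2, ← mul_assoc, mul_sub, mul_add, ← mul_assoc, ← mul_assoc, ← mul_assoc, e3, hinv]
    simp only [← mul_assoc, hinv]
  have f1 : (K * (t⁻¹ * (L + L')⁻¹ * dk * t)).trace = (L * ((L + L')⁻¹ * dk)).trace := by
    rw [← mul_assoc, Matrix.trace_mul_comm]
    simp only [← mul_assoc]
    rw [htJ, mul_assoc L, t2, mul_one]
  have f2 : (K * ((K + K')⁻¹ * (t⁻¹ * dt) * (K + K'))).trace = (K' * (t⁻¹ * dt)).trace := by
    -- Both sides equal K'K − 1.
    have e3 : (K + K') * K = K' * (K + K') := by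
      rw [add_mul, mul_add, hci.sq, hci'.sq, add_comm]
    rw [← mul_assoc, Matrix.trace_mul_comm]
    simp only [← mul_assoc]
    rw [e3, mul_assoc K', k2, mul_one]
  rw [hdh, mul_sub, mul_add, Matrix.trace_sub, Matrix.trace_add, f1, f2]

end Transition

theorem CompatibleACS.hermScalar_symm (j : CompatibleACS Ω) (i : X) {y : R2 n}
    (hy : y ∈ (chartAt (R2 n) i).target) : hermScalar j ((chartAt (R2 n) i).symm y) =
      -(1 / 4) * ∑ a, ∑ b, (Ω.mat i y)⁻¹ a b * j.ricciComp i y a b := by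
  have hy' := mem_transition_symm i hy
  rw [j.hermScalar_eq, ← transition_apply]
  congr 1
  have h := sum_smul_transform (mat_inv_transition Ω i _ hy')
    (j.ricciComp ((chartAt (R2 n) i).symm y) (transition i ((chartAt (R2 n) i).symm y) y))
  simp only [smul_eq_mul] at h
  rw [← h]
  exact Finset.sum_congr rfl fun a _ => Finset.sum_congr rfl fun b _ => by
    rw [j.ricciComp_transition i _ hy']

theorem CompatibleACS.contDiffAt_ricciComp (j : CompatibleACS Ω) (i : X) {y : R2 n}
    (hy : y ∈ (chartAt (R2 n) i).target) (a b : Fin (2 * n)) :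
    ContDiffAt ℝ ∞ (fun z => j.ricciComp i z a b) y := by
  have hJ := j.smoothMat_endMatrix i hy
  exact ((ContDiffAt.pd (j.contDiffAt_ricciPotential i hy b) a).sub
    (ContDiffAt.pd (j.contDiffAt_ricciPotential i hy a) b)).sub
      (contDiffAt_const.mul ((hJ.mul (hJ.pderivMatrix a)).mul (hJ.pderivMatrix b)).trace)

theorem CompatibleACS.smoothFun_hermScalar (j : CompatibleACS Ω) : SmoothFun n (hermScalar j) := by
  intro i y hy
  have h : ContDiffAt ℝ ∞ (fun z => -(1 / 4) * ∑ a, ∑ b, (Ω.mat i z)⁻¹ a b * j.ricciComp i z a b)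
      y := contDiffAt_const.mul (ContDiffAt.sum fun a _ => ContDiffAt.sum fun b _ =>
      (((Ω.smoothMat_mat i hy).inv (Ω.isUnit_det_mat i hy)) a b).mul
        (j.contDiffAt_ricciComp i hy a b))
  refine h.congr_of_eventuallyEq ?_
  filter_upwards [(chartAt (R2 n) i).open_target.mem_nhds hy] with z hz
  exact j.hermScalar_symm i hz

/-- A 1-form whose differential is the difference of the Ricci forms of two almost complex
structures, up to a factor. -/
def CompatibleACS.ricciField (j j' : CompatibleACS Ω) : CovectorField n X where
  comp i y a := j.ricciPotential i y a - j'.ricciPotential i y a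
    - gaugeTrace (endMatrix j.J i) (fun z => endMatrix j.J i z + endMatrix j'.J i z) y a
  transform i k y hy a := by
    rw [j.ricciPotential_transition i k hy, j'.ricciPotential_transition i k hy,
      j.gaugeTrace_transition i k hy j']
    simp only [sub_mul, Finset.sum_sub_distrib]
    ring
  smooth i y hy a := ((j.contDiffAt_ricciPotential i hy a).sub
    (j'.contDiffAt_ricciPotential i hy a)).sub (contDiffAt_gaugeTrace (j.smoothMat_endMatrix i hy)
      ((j.smoothMat_endMatrix i hy).add (j'.smoothMat_endMatrix i hy))
      ((j.isCompatiblePair_mat i hy).isUnit_det_add (j'.isCompatiblePair_mat i hy)) a)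

/-- J + J' intertwines J and J', so the curl of the field is the difference of the `ricciComp`.
Contracting a curl with ω⁻¹ gives twice the divergence, and with the factor −1/4 in the scalar
curvature this explains the 2. -/
theorem CompatibleACS.isDiv_ricciField (j j' : CompatibleACS Ω) :
    (j.ricciField j').IsDiv Ω fun x => 2 * (hermScalar j' x - hermScalar j x) := by
  intro i y hy
  have hJ := j.smoothMat_endMatrix i hy
  have hJ' := j'.smoothMat_endMatrix i hy
  have hu := (j.isCompatiblePair_mat i hy).isUnit_det_add (j'.isCompatiblePair_mat i hy)
  have hτ := fun a => (j.contDiffAt_ricciPotential i hy a).differentiableAt (n := ∞) (by simp)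
  have hτ' := fun a => (j'.contDiffAt_ricciPotential i hy a).differentiableAt (n := ∞) (by simp)
  have hg := fun a => (contDiffAt_gaugeTrace hJ (hJ.add hJ') hu a).differentiableAt (n := ∞) (by simp)
  have h1 : ∀ a b, pd a (fun z => (j.ricciField j').comp i z b) y =
      pd a (fun z => j.ricciPotential i z b) y - pd a (fun z => j'.ricciPotential i z b) y
      - pd a (fun z => gaugeTrace (endMatrix j.J i)
        (fun z => endMatrix j.J i z + endMatrix j'.J i z) z b) y := by
    intro a b
    refine (pd_sub ((hτ b).fun_sub (hτ' b)) (hg b) a).trans ?_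
    rw [pd_sub (hτ b) (hτ' b)]
  have h2 : ∀ a b, j.ricciComp i y a b - j'.ricciComp i y a b =
      pd a (fun z => (j.ricciField j').comp i z b) y
      - pd b (fun z => (j.ricciField j').comp i z a) y := by
    intro a b
    have h3 := pd_gaugeTrace_sub hJ hJ' (hJ.add hJ') hu (j.eventually_endMatrix_sq i hy) (by
      filter_upwards [j.eventually_endMatrix_sq i hy, j'.eventually_endMatrix_sq i hy] with z hz hz'
      rw [add_mul, mul_add, hz, hz', add_comm]) a b
    rw [h1, h1, CompatibleACS.ricciComp, CompatibleACS.ricciComp]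
    linarith
  have h3 : ∑ a, ∑ b, (Ω.mat i y)⁻¹ a b * pd b (fun z => (j.ricciField j').comp i z a) y =
      -∑ a, ∑ b, (Ω.mat i y)⁻¹ a b * pd a (fun z => (j.ricciField j').comp i z b) y := by
    rw [Finset.sum_comm]
    simp only [← Finset.sum_neg_distrib]
    refine Finset.sum_congr rfl fun a _ => Finset.sum_congr rfl fun b _ => ?_
    rw [Ω.mat_inv_skew i hy b a]; ring
  have h4 : ∑ a, ∑ b, (Ω.mat i y)⁻¹ a b * j.ricciComp i y a b
      - ∑ a, ∑ b, (Ω.mat i y)⁻¹ a b * j'.ricciComp i y a b =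
      ∑ a, ∑ b, (Ω.mat i y)⁻¹ a b * pd a (fun z => (j.ricciField j').comp i z b) y
      - ∑ a, ∑ b, (Ω.mat i y)⁻¹ a b * pd b (fun z => (j.ricciField j').comp i z a) y := by
    simp only [← Finset.sum_sub_distrib, ← mul_sub, h2]
  simp only [j.hermScalar_symm i hy, j'.hermScalar_symm i hy]
  linarith

/-- The total Hermitian scalar curvature does not depend on the almost complex structure. -/
theorem CompatibleACS.integral_hermScalar (j j' : CompatibleACS Ω) :
    Ω.integral (hermScalar j') = Ω.integral (hermScalar j) := by
  have h1 := (j.isDiv_ricciField j').integral_eq_zero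
  have h2 := Ω.integral_add (j.isDiv_ricciField j').smoothFun
    ((smoothFun_const (n := n) (X := X) 2).mul j.smoothFun_hermScalar)
  rw [h1, zero_add, Ω.integral_const_mul] at h2
  have h3 : (fun x => 2 * (hermScalar j' x - hermScalar j x) + 2 * hermScalar j x) =
      fun x => 2 * hermScalar j' x := by
    funext x; ring
  rw [h3, Ω.integral_const_mul] at h2
  linarith

end TotalHermitianScalar

/-! ### Kähler metrics -/

section Nijenhuis

variable {ι : Type*} [Fintype ι]

/-- The components of the Nijenhuis tensor, in terms of `J` and its partial derivatives. -/
def nijenhuis (J : Matrix ι ι ℝ) (dJ : ι → Matrix ι ι ℝ) (a b c : ι) : ℝ :=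
  ∑ l, (J l a * dJ l c b - J l b * dJ l c a - J c l * (dJ a l b - dJ b l a))

theorem nijenhuis_eq (J : Matrix ι ι ℝ) (dJ : ι → Matrix ι ι ℝ) (a b c : ι) :
    nijenhuis J dJ a b c = (∑ l, J l a * dJ l c b - (J * dJ a) c b)
      - (∑ l, J l b * dJ l c a - (J * dJ b) c a) := by
  simp only [nijenhuis, Matrix.mul_apply, ← Finset.sum_sub_distrib]
  exact Finset.sum_congr rfl fun l _ => by ring

/-- The Nijenhuis tensor is a tensor. -/
theorem nijenhuis_transform {J K h : Matrix ι ι ℝ} {dJ dK dh : ι → Matrix ι ι ℝ} (hJ : h * J = K * h)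
    (hd : ∀ l, h * dJ l + dh l * J = (∑ e, h e l • dK e) * h + K * dh l)
    (hs : ∀ l c a, dh l c a = dh a c l) (a b c : ι) :
    ∑ s, h c s * nijenhuis J dJ a b s = ∑ e, ∑ f, h e a * h f b * nijenhuis K dK e f c := by
  have h1 : ∀ l, h * dJ l = (∑ e, h e l • dK e) * h + K * dh l - dh l * J := fun l => by
    rw [← hd, add_sub_cancel_right]
  -- Before skew-symmetrization in a and b, the expression picks up terms in dh. These are symmetric
  -- in a and b because dh is, and cancel in the difference.
  have key : ∀ a b, ∑ s, h c s * (∑ l, J l a * dJ l s b - (J * dJ a) s b) =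
      ∑ e, ∑ f, h e a * h f b * (∑ l, K l e * dK l c f - (K * dK e) c f)
      + (K * dh b * J) c a + (K * dh a * J) c b - (∑ l, J l a * (dh l * J) c b)
      - (K * K * dh a) c b := by
    intro a b
    have e0 : ∑ s, h c s * (∑ l, J l a * dJ l s b - (J * dJ a) s b) =
        ∑ l, J l a * (h * dJ l) c b - (K * (h * dJ a)) c b := by
      rw [← mul_assoc, ← hJ, mul_assoc]
      simp only [mul_sub, Finset.sum_sub_distrib]
      congr 1
      simp only [Matrix.mul_apply, Finset.mul_sum]
      rw [Finset.sum_comm]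
      exact Finset.sum_congr rfl fun _ _ => Finset.sum_congr rfl fun _ _ => by ring
    have e1 : ∑ l, J l a * ((∑ e, h e l • dK e) * h) c b =
        ∑ e, ∑ f, h e a * h f b * ∑ l, K l e * dK l c f := by
      have e2 : ∀ e, ∑ l, J l a * h e l = ∑ s, K e s * h s a := fun e => by
        have := congrFun (congrFun hJ e) a
        rw [Matrix.mul_apply, Matrix.mul_apply] at this
        rw [← this]
        exact Finset.sum_congr rfl fun _ _ => mul_comm _ _
      calc ∑ l, J l a * ((∑ e, h e l • dK e) * h) c b
          = ∑ l, ∑ f, ∑ e, J l a * h e l * (dK e c f * h f b) := by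
            refine Finset.sum_congr rfl fun l _ => ?_
            rw [Matrix.mul_apply, Finset.mul_sum]
            refine Finset.sum_congr rfl fun f _ => ?_
            rw [Matrix.sum_apply, Finset.sum_mul, Finset.mul_sum]
            exact Finset.sum_congr rfl fun e _ => by rw [Matrix.smul_apply, smul_eq_mul]; ring
        _ = ∑ f, ∑ e, (∑ l, J l a * h e l) * (dK e c f * h f b) := by
            rw [Finset.sum_comm]
            refine Finset.sum_congr rfl fun f _ => ?_
            rw [Finset.sum_comm]
            exact Finset.sum_congr rfl fun e _ => by rw [Finset.sum_mul]
        _ = ∑ f, ∑ s, ∑ e, K e s * h s a * (dK e c f * h f b) := by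
            refine Finset.sum_congr rfl fun f _ => ?_
            simp only [e2, Finset.sum_mul]
            rw [Finset.sum_comm]
        _ = _ := by
            rw [Finset.sum_comm]
            refine Finset.sum_congr rfl fun s _ => Finset.sum_congr rfl fun f _ => ?_
            rw [Finset.mul_sum]
            exact Finset.sum_congr rfl fun e _ => by ring
    have e3 : (K * ((∑ e, h e a • dK e) * h)) c b =
        ∑ e, ∑ f, h e a * h f b * (K * dK e) c f := by
      rw [← mul_assoc, Finset.mul_sum, Finset.sum_mul, Matrix.sum_apply]
      refine Finset.sum_congr rfl fun e _ => ?_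
      rw [mul_smul_comm, smul_mul_assoc, Matrix.smul_apply, Matrix.mul_apply, smul_eq_mul,
        Finset.mul_sum]
      exact Finset.sum_congr rfl fun f _ => by ring
    have e4 : ∑ l, J l a * (K * dh l) c b = (K * dh b * J) c a := by
      rw [Matrix.mul_apply]
      refine Finset.sum_congr rfl fun l _ => ?_
      rw [mul_comm, Matrix.mul_apply, Matrix.mul_apply]
      congr 1
      exact Finset.sum_congr rfl fun m _ => by rw [hs]
    rw [e0]
    simp only [h1, mul_sub, mul_add, Matrix.sub_apply, Matrix.add_apply, Finset.sum_add_distrib,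
      Finset.sum_sub_distrib]
    rw [e1, e3, e4, mul_assoc K K, mul_assoc K (dh a)]
    ring
  have s1 : ∑ l, J l a * (dh l * J) c b = ∑ l, J l b * (dh l * J) c a := by
    simp only [Matrix.mul_apply, Finset.mul_sum]
    rw [Finset.sum_comm]
    exact Finset.sum_congr rfl fun l _ => Finset.sum_congr rfl fun m _ => by rw [hs m c l]; ring
  have s2 : (K * K * dh a) c b = (K * K * dh b) c a := by
    rw [Matrix.mul_apply, Matrix.mul_apply]
    exact Finset.sum_congr rfl fun l _ => by rw [hs]
  have k1 := key a b
  have k2 := key b a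
  have k3 : ∑ e, ∑ f, h e b * h f a * (∑ l, K l e * dK l c f - (K * dK e) c f) =
      ∑ e, ∑ f, h e a * h f b * (∑ l, K l f * dK l c e - (K * dK f) c e) := by
    rw [Finset.sum_comm]
    exact Finset.sum_congr rfl fun _ _ => Finset.sum_congr rfl fun _ _ => by ring
  rw [k3] at k2
  have e5 : ∑ s, h c s * nijenhuis J dJ a b s =
      ∑ s, h c s * (∑ l, J l a * dJ l s b - (J * dJ a) s b)
      - ∑ s, h c s * (∑ l, J l b * dJ l s a - (J * dJ b) s a) := by
    rw [← Finset.sum_sub_distrib]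
    exact Finset.sum_congr rfl fun s _ => by rw [nijenhuis_eq]; ring
  have e6 : ∑ e, ∑ f, h e a * h f b * nijenhuis K dK e f c =
      ∑ e, ∑ f, h e a * h f b * (∑ l, K l e * dK l c f - (K * dK e) c f)
      - ∑ e, ∑ f, h e a * h f b * (∑ l, K l f * dK l c e - (K * dK f) c e) := by
    simp only [← Finset.sum_sub_distrib]
    exact Finset.sum_congr rfl fun e _ => Finset.sum_congr rfl fun f _ => by
      rw [nijenhuis_eq]; ring
  rw [e5, e6, k1, k2, s1, s2]
  ring

variable [DecidableEq ι]

/-- A 3-tensor with the symmetries of the covariant derivative of an integrable almost complex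
structure vanishes. -/
theorem eq_zero_of_nijenhuis {J : Matrix ι ι ℝ} (hJ : J * J = -1) {T : ι → ι → ι → ℝ}
    (hskew : ∀ a b c, T a b c = -T a c b)
    (hJT : ∀ a b c, ∑ l, J l b * T a l c = ∑ l, J l c * T a b l)
    (hcyc : ∀ a b c, T a b c + T b c a + T c a b = 0)
    (hN : ∀ a b c, ∑ l, J l a * T l b c - ∑ l, J l b * T l a c + ∑ l, J l c * T a b l
      - ∑ l, J l c * T b a l = 0) (a b c : ι) : T a b c = 0 := by
  -- R and Q insert J into the first and the third argument of T; in the application T is the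
  -- covariant derivative of J with an index lowered.
  set R := fun a b c => ∑ l, J l a * T l b c with hR
  set Q := fun a b c => ∑ l, J l c * T a b l with hQ
  have hRskew : ∀ a b c, R a b c = -R a c b := fun a b c => by
    simp only [hR, ← Finset.sum_neg_distrib]
    exact Finset.sum_congr rfl fun l _ => by rw [hskew l b c]; ring
  have hQskew : ∀ a b c, Q a b c = -Q a c b := fun a b c => by
    simp only [hQ]
    rw [← hJT a b c, ← Finset.sum_neg_distrib]
    exact Finset.sum_congr rfl fun l _ => by rw [hskew a l c]; ring
  have hsym : ∀ a b c, R a b c + Q a b c = R b a c + Q b a c := fun a b c => by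
    have := hN a b c
    simp only [hR, hQ]
    linarith
  have hRQ : ∀ a b c, R a b c = -Q a b c := fun a b c => by
    have := hsym a b c
    have := hsym b c a
    have := hsym c a b
    have := hRskew a b c
    have := hRskew b c a
    have := hRskew c a b
    have := hQskew a b c
    have := hQskew b c a
    have := hQskew c a b
    linarith
  -- The cyclic identity with J inserted into one argument; `hJT` moves J between the second and
  -- third arguments.
  have hsum1 : ∀ a b c, R a b c + Q b c a + Q c a b = 0 := fun a b c => by
    have : ∑ l, J l a * (T l b c + T b c l + T c l b) = 0 :=
      Finset.sum_eq_zero fun l _ => by rw [hcyc, mul_zero]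
    simp only [mul_add, Finset.sum_add_distrib, hJT c a b] at this
    exact this
  have hQ0 : ∀ a b c, Q a b c = 0 := fun a b c => by
    have h1 := hsum1 a b c
    have h2 := hsum1 b c a
    have h3 := hsum1 c a b
    rw [hRQ] at h1 h2 h3
    linarith
  -- A second insertion of J recovers −T from Q.
  have h4 : ∑ d, Q a b d * J d c = -T a b c := by
    have h5 : ∀ l, ∑ d, J l d * J d c = -(1 : Matrix ι ι ℝ) l c := fun l => by
      rw [← Matrix.mul_apply, hJ, Matrix.neg_apply]
    simp only [hQ, Finset.sum_mul]
    rw [Finset.sum_comm]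
    have h6 : ∀ l, ∑ d, J l d * T a b l * J d c = T a b l * -(1 : Matrix ι ι ℝ) l c := fun l => by
      rw [← h5, Finset.mul_sum]
      exact Finset.sum_congr rfl fun _ _ => by ring
    simp [h6, Matrix.one_apply]
  simp only [hQ0, zero_mul, Finset.sum_const_zero] at h4
  linarith

/-- On a Kähler manifold the complex structure is parallel. -/
theorem IsCompatiblePair.covariantDeriv_eq_zero {w J : Matrix ι ι ℝ} (h : IsCompatiblePair w J)
    {C dw dJ : ι → Matrix ι ι ℝ} (hC : ∀ a b c, C a b c = C c b a)
    (hw : ∀ a b c, dw a b c = -dw a c b) (hcyc : ∀ a b c, dw a b c + dw b c a + dw c a b = 0)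
    (hg : ∀ a, dw a * J + w * dJ a = (C a)ᵀ * (w * J) + w * J * C a)
    (hdJ : ∀ a, J * dJ a = -(dJ a * J)) (hN : ∀ a b c, nijenhuis J dJ a b c = 0) (a : ι) :
    dJ a + C a * J - J * C a = 0 := by
  set N := fun a => dJ a + C a * J - J * C a with hNdef
  have e : ∀ M : Matrix ι ι ℝ, M * J * J = -M := fun M => by
    rw [mul_assoc, h.sq, mul_neg, mul_one]
  have hJN : ∀ a, J * N a = -(N a * J) := fun a => by
    simp only [hNdef, mul_sub, mul_add, sub_mul, add_mul, ← mul_assoc, h.sq, e, hdJ, neg_mul, one_mul]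
    abel
  -- Metric compatibility turns ∇J, lowered with g = wJ, into −∇w.
  have hgN : ∀ a, w * J * N a = (C a)ᵀ * w + w * C a - dw a := fun a => by
    have h1 : w * (J * dJ a) = -(((C a)ᵀ * (w * J) + w * J * C a) * J) - dw a := by
      rw [hdJ, ← hg, add_mul, e, mul_neg, ← mul_assoc]
      abel
    simp only [hNdef, mul_sub, mul_add]
    rw [mul_assoc w J (dJ a), h1]
    simp only [add_mul, ← mul_assoc, e, neg_mul]
    abel
  have hws : ∀ a b, w a b = -w b a := fun a b => congrFun (congrFun h.skew b) a
  have hnij : ∀ a b c, nijenhuis J N a b c = 0 := by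
    intro a b c
    -- With h = 1 and the Christoffel symbols in place of dh, the transformation rule says that
    -- partial derivatives may be replaced by covariant ones, the connection being torsion-free.
    have h1 := nijenhuis_transform (J := J) (K := J) (h := 1) (dJ := dJ) (dK := N) (dh := C)
      (by simp) (fun l => by simp [hNdef, Matrix.one_apply]) (fun l c a => hC l c a) a b c
    simpa [hN, Matrix.one_apply] using h1.symm
  have hgN' : ∀ a b c, (w * J * N a) c b =
      ∑ x, C a x c * w x b + ∑ x, w c x * C a x b - dw a c b := fun a b c => by
    rw [hgN, Matrix.sub_apply, Matrix.add_apply, Matrix.mul_apply, Matrix.mul_apply]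
    rfl
  have hT : ∀ a b c, (w * J * N a) c b = 0 := by
    -- The four conditions are skewness of ∇w, anticommutation of ∇J with J, dw = 0 rewritten with a
    -- torsion-free connection, and integrability.
    refine eq_zero_of_nijenhuis (T := fun a b c => (w * J * N a) c b) h.sq ?_ ?_ ?_ ?_
    · intro a b c
      rw [hgN', hgN', hw a b c]
      have h1 : ∀ b c, ∑ x, C a x c * w x b = -∑ x, w b x * C a x c := fun b c => by
        rw [← Finset.sum_neg_distrib]
        exact Finset.sum_congr rfl fun x _ => by rw [hws x b]; ring
      rw [h1 c b, h1 b c]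
      ring
    · intro a b c
      have h1 : (w * J * N a * J) c b = (Jᵀ * (w * J * N a)) c b := by
        rw [← mul_assoc, ← mul_assoc Jᵀ, h.compat, mul_assoc (w * J), ← neg_neg (N a * J), ← hJN,
          mul_neg, ← mul_assoc, e, neg_mul, neg_neg]
      rw [Matrix.mul_apply, Matrix.mul_apply] at h1
      simpa [mul_comm] using h1
    · intro a b c
      rw [hgN', hgN', hgN']
      have h1 : ∀ a b c, ∑ x, C a x c * w x b = -∑ x, w b x * C c x a := fun a b c => by
        rw [← Finset.sum_neg_distrib]
        exact Finset.sum_congr rfl fun x _ => by rw [hws x b, hC]; ring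
      rw [h1 a b c, h1 b c a, h1 c a b]
      linarith [hcyc a c b, hw a c b, hw b a c, hw c b a, hw a b c, hw b c a, hw c a b, hcyc a b c]
    · intro a b c
      have h1 : ∑ s, (w * J) c s * nijenhuis J N a b s = 0 := by simp [hnij]
      have h2 : ∀ a b, ∑ s, (w * J) c s * ∑ l, J l a * N l s b = ∑ l, J l a * (w * J * N l) c b := by
        intro a b
        simp only [Matrix.mul_apply (M := w * J) (N := N _), Finset.mul_sum]
        rw [Finset.sum_comm]
        exact Finset.sum_congr rfl fun _ _ => Finset.sum_congr rfl fun _ _ => by ring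
      have h3 : ∀ a b, ∑ s, (w * J) c s * (J * N a) s b = -∑ l, J l c * (w * J * N a) l b := by
        intro a b
        have h4 : w * J * (J * N a) = -(Jᵀ * (w * J * N a)) := by
          rw [← mul_assoc, ← mul_assoc, ← mul_assoc, h.compat, e, neg_mul]
        have h5 := congrFun (congrFun h4 c) b
        rw [Matrix.mul_apply, Matrix.neg_apply, Matrix.mul_apply] at h5
        exact h5
      simp only [nijenhuis_eq, mul_sub, Finset.sum_sub_distrib, h2, h3] at h1
      linarith
  have h0 : w * J * N a = 0 := by
    ext c b
    exact hT a b c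
  have h1 : J * N a = 0 := by
    rw [← one_mul (J * N a), ← h.inv_mul, mul_assoc, ← mul_assoc w, h0, mul_zero]
  have h2 : J * (J * N a) = -N a := by rw [← mul_assoc, h.sq, neg_mul, one_mul]
  rw [h1, mul_zero] at h2
  exact neg_eq_zero.1 h2.symm

/-- The trace of the Ricci tensor of a Kähler metric. -/
theorem IsCompatiblePair.sum_mul_ricci {w J : Matrix ι ι ℝ} (h : IsCompatiblePair w J)
    {R : ι → ι → Matrix ι ι ℝ} (hskew : ∀ a b, R a b = -R b a)
    (hbianchi : ∀ a b c l, R a b l c + R b c l a + R c a l b = 0)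
    (hJ : ∀ a b, R a b * J = J * R a b) :
    ∑ a, ∑ b, (w * J)⁻¹ a b * ∑ i, R i a i b =
      -(1 / 2) * ∑ a, ∑ b, w⁻¹ a b * (J * R a b).trace := by
  -- As R commutes with J, applying J to an argument of the Ricci tensor gives a contraction of JR.
  have h1 : ∀ a m, ∑ c, J c m * ∑ i, R i a i c = ∑ i, (J * R i a) i m := by
    intro a m
    have h2 : ∀ i, (J * R i a) i m = ∑ c, R i a i c * J c m := fun i => by
      rw [← hJ, Matrix.mul_apply]
    simp only [h2, Finset.mul_sum]
    refine Finset.sum_comm.trans ?_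
    exact Finset.sum_congr rfl fun _ _ => Finset.sum_congr rfl fun _ _ => mul_comm _ _
  -- The Bianchi identity turns the skew part of that contraction into tr(JR_{am}); contraction with
  -- w⁻¹ sees only this part, whence the factor ½.
  have h2 : ∀ a m, ∑ i, (J * R i a) i m - ∑ i, (J * R i m) i a = -(J * R a m).trace := by
    intro a m
    rw [Matrix.trace, ← Finset.sum_sub_distrib, ← Finset.sum_neg_distrib]
    refine Finset.sum_congr rfl fun i _ => ?_
    rw [Matrix.diag_apply]
    simp only [Matrix.mul_apply]
    rw [← Finset.sum_sub_distrib, ← Finset.sum_neg_distrib]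
    refine Finset.sum_congr rfl fun l _ => ?_
    have h3 := hbianchi i a m l
    have h4 : R m i l a = -R i m l a := congrFun (congrFun (hskew m i) l) a
    rw [h4] at h3
    linear_combination J i l * h3
  have h3 : ∀ a b, ∑ m, w⁻¹ a m * J b m = (w * J)⁻¹ a b := by
    intro a b
    have h4 : w⁻¹ * Jᵀ = (w * J)⁻¹ := by
      have h5 := h.metric_inv_mul_transpose
      rw [← neg_eq_iff_eq_neg] at h5
      rw [← h5, neg_mul, mul_assoc, ← Matrix.transpose_mul, h.sq, Matrix.transpose_neg,
        Matrix.transpose_one, mul_neg, mul_one, neg_neg]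
    rw [← h4, Matrix.mul_apply]
    rfl
  have h4 : ∑ a, ∑ b, (w * J)⁻¹ a b * ∑ i, R i a i b = ∑ a, ∑ m, w⁻¹ a m * ∑ i, (J * R i a) i m := by
    refine Finset.sum_congr rfl fun a _ => ?_
    simp only [← h1, ← h3, Finset.sum_mul]
    refine Finset.sum_comm.trans (Finset.sum_congr rfl fun _ _ => ?_)
    rw [Finset.mul_sum]
    exact Finset.sum_congr rfl fun _ _ => by ring
  have h5 : ∑ a, ∑ m, w⁻¹ a m * ∑ i, (J * R i m) i a =
      -∑ a, ∑ m, w⁻¹ a m * ∑ i, (J * R i a) i m := by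
    refine Finset.sum_comm.trans ?_
    simp only [← Finset.sum_neg_distrib]
    refine Finset.sum_congr rfl fun a _ => Finset.sum_congr rfl fun m _ => ?_
    rw [h.inv_skew_apply m a, neg_mul]
  have h6 : ∑ a, ∑ m, w⁻¹ a m * (J * R a m).trace =
      -(∑ a, ∑ m, w⁻¹ a m * ∑ i, (J * R i a) i m - ∑ a, ∑ m, w⁻¹ a m * ∑ i, (J * R i m) i a) := by
    simp only [← Finset.sum_sub_distrib, ← mul_sub, h2, mul_neg, Finset.sum_neg_distrib, neg_neg]
  rw [h4, h6, h5]
  ring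

end Nijenhuis

/-! ### Symmetries of the curvature of a linear connection. -/

section Curvature

variable {n : ℕ} {y : R2 n} {C : R2 n → Fin (2 * n) → Matrix (Fin (2 * n)) (Fin (2 * n)) ℝ}

theorem linearCurvature_skew (a b : Fin (2 * n)) :
    linearCurvature C y a b = -linearCurvature C y b a := by
  rw [linearCurvature, linearCurvature]
  abel

/-- The first Bianchi identity for a torsion-free connection. -/
theorem linearCurvature_bianchi (hC : ∀ᶠ z in 𝓝 y, ∀ a b c, C z a b c = C z c b a)
    (a b c l : Fin (2 * n)) : linearCurvature C y a b l c + linearCurvature C y b c l a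
      + linearCurvature C y c a l b = 0 := by
  have h1 : ∀ a b c, pderivMatrix a (fun z => C z b) y l c = pderivMatrix a (fun z => C z c) y l b :=
    fun a b c => pd_congr (hC.mono fun z hz => hz b l c) a
  have h2 : ∀ a b c, (C y a * C y b) l c = (C y a * C y c) l b := fun a b c => by
    rw [Matrix.mul_apply, Matrix.mul_apply]
    exact Finset.sum_congr rfl fun m _ => by rw [hC.self_of_nhds b m c]
  simp only [linearCurvature, Matrix.add_apply, Matrix.sub_apply]
  rw [h1 a b c, h1 b c a, h1 c a b, h2 a b c, h2 b c a, h2 c a b]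
  ring

/-- The curvature of a connection that preserves `J` commutes with `J`. -/
theorem linearCurvature_mul_comm {J : R2 n → Matrix (Fin (2 * n)) (Fin (2 * n)) ℝ}
    (hJ : SmoothMat J y) (hC : ∀ a, SmoothMat (fun z => C z a) y)
    (h : ∀ᶠ z in 𝓝 y, ∀ a, pderivMatrix a J z = J z * C z a - C z a * J z) (a b : Fin (2 * n)) :
    linearCurvature C y a b * J y = J y * linearCurvature C y a b := by
  have h1 : ∀ a b, pderivMatrix a (pderivMatrix b J) y =
      pderivMatrix a J y * C y b + J y * pderivMatrix a (fun z => C z b) y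
      - (pderivMatrix a (fun z => C z b) y * J y + C y b * pderivMatrix a J y) := fun a b => by
    rw [pderivMatrix_congr (g := fun z => J z * C z b - C z b * J z) (h.mono fun z hz => hz b) a,
      ← pderivMatrix_mul hJ (hC b), ← pderivMatrix_mul (hC b) hJ]
    ext c d
    exact pd_sub ((hJ.mul (hC b)).diff c d) (((hC b).mul hJ).diff c d) a
  have h2 := pderivMatrix_comm hJ a b
  rw [h1, h1, h.self_of_nhds a, h.self_of_nhds b] at h2
  rw [linearCurvature, ← sub_eq_zero]
  rw [← sub_eq_zero] at h2
  rw [← neg_eq_zero, ← h2]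
  noncomm_ring

end Curvature

/-! ### Integrable structures: parallel J and comparison of the scalar curvatures. -/

section Kahler

set_option linter.unusedSectionVars false

variable {n : ℕ} {X : Type*} [TopologicalSpace X] [ChartedSpace (R2 n) X]
  [IsManifold 𝓘(ℝ, R2 n) ∞ X] [T2Space X] [CompactSpace X] {Ω : SymplecticForm n X}

namespace CompatibleACS

variable {j : CompatibleACS Ω} (i : X) {y : R2 n} (hy : y ∈ (chartAt (R2 n) i).target)

include hy

/-- Integrability is assumed at each x in the chart at x only; tensoriality of the Nijenhuis
expression gives it at all points of every chart. -/
theorem Integrable.nijenhuis_eq_zero (hj : j.Integrable) (a b c : Fin (2 * n)) :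
    nijenhuis (endMatrix j.J i y) (fun l => pderivMatrix l (endMatrix j.J i) y) a b c = 0 := by
  have hs := mem_transition_symm i hy
  set k := (chartAt (R2 n) i).symm y with hk
  have hyk := transition_mem_target i k hs
  have hJi := j.smoothMat_endMatrix i hy
  have hJk := j.smoothMat_endMatrix k hyk
  have hh := smoothMat_transJac i k hs
  have hd : ∀ l, transJac i k y * pderivMatrix l (endMatrix j.J i) y
      + pderivMatrix l (transJac i k) y * endMatrix j.J i y =
      (∑ e, transJac i k y e l • pderivMatrix e (endMatrix j.J k) (transition i k y)) * transJac i k y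
      + endMatrix j.J k (transition i k y) * pderivMatrix l (transJac i k) y := by
    intro l
    have h1 := pderivMatrix_congr (f := fun z => transJac i k z * endMatrix j.J i z) (by
      filter_upwards [(transition i k).open_source.mem_nhds hs] with z hz
      exact transJac_mul_endMatrix j i k hz) l
    rw [pderivMatrix_mul hh hJi, pderivMatrix_mul (SmoothMat.comp_transition i k hs hJk) hh,
      pderivMatrix_comp_transition i k hs hJk] at h1
    rw [← h1, add_comm]
  have h0 : ∀ c, ∑ s, transJac i k y c s * nijenhuis (endMatrix j.J i y)
      (fun l => pderivMatrix l (endMatrix j.J i) y) a b s = 0 := by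
    intro c
    rw [nijenhuis_transform (transJac_mul_endMatrix j i k hs) hd
      (fun l c a => pd_transJac_symm i k hs l a c)]
    refine Finset.sum_eq_zero fun e _ => Finset.sum_eq_zero fun f _ => ?_
    have h1 : nijenhuis (endMatrix j.J k (transition i k y))
        (fun e => pderivMatrix e (endMatrix j.J k) (transition i k y)) e f c = 0 := hj k e f c
    rw [h1, mul_zero]
  have h1 : transJac i k y *ᵥ (fun s => nijenhuis (endMatrix j.J i y)
      (fun l => pderivMatrix l (endMatrix j.J i) y) a b s) = 0 := funext h0
  have h2 := congrArg ((transJac i k y)⁻¹ *ᵥ ·) h1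
  simp only [Matrix.mulVec_mulVec, Matrix.nonsing_inv_mul _ (isUnit_det_transJac i k hs),
    Matrix.one_mulVec, Matrix.mulVec_zero] at h2
  exact congrFun h2 c

theorem leviCivita_symm (a b c : Fin (2 * n)) :
    leviCivita j.metric i y a b c = leviCivita j.metric i y c b a := by
  simp only [leviCivita, Matrix.of_apply]
  congr 1
  refine Finset.sum_congr rfl fun l _ => ?_
  congr 1
  have : pderivMatrix l (metricMatrix j.metric i) y a c = pderivMatrix l (metricMatrix j.metric i) y c a :=
    j.pd_metricMatrix_symm i hy l a c
  rw [this]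
  ring

theorem metricMatrix_mul_leviCivita (a b c : Fin (2 * n)) :
    (metricMatrix j.metric i y * leviCivita j.metric i y a) b c =
      (1 / 2) * (pderivMatrix a (metricMatrix j.metric i) y c b
        + pderivMatrix c (metricMatrix j.metric i) y a b
        - pderivMatrix b (metricMatrix j.metric i) y a c) := by
  set D := fun b => (1 / 2) * (pderivMatrix a (metricMatrix j.metric i) y c b
        + pderivMatrix c (metricMatrix j.metric i) y a b
        - pderivMatrix b (metricMatrix j.metric i) y a c) with hD
  have h1 : ∀ k, leviCivita j.metric i y a k c = ((metricMatrix j.metric i y)⁻¹ *ᵥ D) k := by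
    intro k
    rw [leviCivita, Matrix.of_apply, Finset.mul_sum, Matrix.mulVec, dotProduct]
    exact Finset.sum_congr rfl fun l _ => by rw [hD]; ring
  rw [Matrix.mul_apply]
  simp only [h1]
  change (metricMatrix j.metric i y *ᵥ ((metricMatrix j.metric i y)⁻¹ *ᵥ D)) b = D b
  rw [Matrix.mulVec_mulVec, Matrix.mul_nonsing_inv _ (j.isUnit_det_metricMatrix i hy),
    Matrix.one_mulVec]

theorem pderivMatrix_metricMatrix (a : Fin (2 * n)) : pderivMatrix a (metricMatrix j.metric i) y =
    (leviCivita j.metric i y a)ᵀ * metricMatrix j.metric i y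
      + metricMatrix j.metric i y * leviCivita j.metric i y a := by
  have hg : (metricMatrix j.metric i y)ᵀ = metricMatrix j.metric i y := by
    ext b c
    exact j.metricMatrix_symm i hy c b
  have hs : ∀ c a b, pderivMatrix c (metricMatrix j.metric i) y a b =
      pderivMatrix c (metricMatrix j.metric i) y b a := j.pd_metricMatrix_symm i hy
  ext b c
  have h1 : ((leviCivita j.metric i y a)ᵀ * metricMatrix j.metric i y) b c =
      (metricMatrix j.metric i y * leviCivita j.metric i y a) c b := by
    conv_lhs => rw [← hg, ← Matrix.transpose_mul, Matrix.transpose_apply]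
  rw [Matrix.add_apply, h1, metricMatrix_mul_leviCivita i hy, metricMatrix_mul_leviCivita i hy,
    hs a c b, hs c a b, hs b a c]
  ring

/-- ∇J = 0. Since this holds throughout the chart, the Hermitian and Levi-Civita connections agree
there, and so do their curvatures. -/
theorem Integrable.pderivMatrix_endMatrix (hj : j.Integrable) (a : Fin (2 * n)) :
    pderivMatrix a (endMatrix j.J i) y + leviCivita j.metric i y a * endMatrix j.J i y
      - endMatrix j.J i y * leviCivita j.metric i y a = 0 := by
  have hJ := j.smoothMat_endMatrix i hy
  refine (j.isCompatiblePair_mat i hy).covariantDeriv_eq_zero (C := leviCivita j.metric i y)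
    (dw := fun l => pderivMatrix l (Ω.mat i) y)
    (dJ := fun l => pderivMatrix l (endMatrix j.J i) y) (leviCivita_symm i hy) ?_
    (Ω.pd_mat_cyclic i hy) ?_ (mul_pderivMatrix_anticomm hJ (j.eventually_endMatrix_sq i hy))
    (hj.nijenhuis_eq_zero i hy) a
  · intro a b c
    have h1 : (fun z => Ω.mat i z b c) = fun z => -Ω.mat i z c b := funext fun z =>
      congrFun (congrFun (Ω.mat_skew i z) c) b
    rw [pderivMatrix_apply, h1]
    exact pd_neg _
  · intro a
    have h1 : metricMatrix j.metric i =ᶠ[𝓝 y] fun z => Ω.mat i z * endMatrix j.J i z := by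
      filter_upwards [(chartAt (R2 n) i).open_target.mem_nhds hy] with z hz
      exact metricMatrix_eq_mul j i hz
    have h2 := pderivMatrix_metricMatrix (j := j) i hy a
    rw [pderivMatrix_congr h1, pderivMatrix_mul (Ω.smoothMat_mat i hy) hJ,
      metricMatrix_eq_mul j i hy] at h2
    exact h2

theorem Integrable.linearCurvature_hermitianConnection (hj : j.Integrable) (a b : Fin (2 * n)) :
    linearCurvature (hermitianConnection j i) y a b =
      linearCurvature (leviCivita j.metric i) y a b := by
  have h1 : ∀ᶠ z in 𝓝 y, ∀ a, hermitianConnection j i z a = leviCivita j.metric i z a := by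
    filter_upwards [(chartAt (R2 n) i).open_target.mem_nhds hy] with z hz a
    rw [hermitianConnection, hj.pderivMatrix_endMatrix i hz, mul_zero, smul_zero, sub_zero]
  rw [linearCurvature, linearCurvature, h1.self_of_nhds, h1.self_of_nhds,
    pderivMatrix_congr (h1.mono fun z hz => hz b), pderivMatrix_congr (h1.mono fun z hz => hz a)]

omit hy in
/-- On a Kähler manifold, the Riemannian scalar curvature is twice the Hermitian one. -/
theorem Integrable.riemScalar_eq (hj : j.Integrable) (x : X) :
    riemScalar j.metric x = 2 * hermScalar j x := by
  have hx := mem_chart_target (R2 n) x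
  have hn := (chartAt (R2 n) x).open_target.mem_nhds hx
  -- The Riemannian scalar curvature becomes −½ ω^{ab}tr(JR_{ab}), and the Hermitian one is −¼ of
  -- the same contraction.
  rw [riemScalar, metricMatrix_eq_mul j x hx,
    (j.isCompatiblePair_mat x hx).sum_mul_ricci linearCurvature_skew
      (linearCurvature_bianchi (by
        filter_upwards [hn] with z hz
        exact leviCivita_symm x hz))
      (linearCurvature_mul_comm (j.smoothMat_endMatrix x hx) (j.smoothMat_leviCivita x hx) (by
        filter_upwards [hn] with z hz a
        rw [← sub_eq_zero, ← hj.pderivMatrix_endMatrix x hz a]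
        abel)), j.hermScalar_eq]
  simp only [← j.trace_mul_linearCurvature_hermitianConnection x hx,
    hj.linearCurvature_hermitianConnection x hx]
  ring

end CompatibleACS

end Kahler

/-! ### The lower bound for the functional -/

section LowerBound

set_option linter.unusedSectionVars false

variable {n : ℕ} {X : Type*} [TopologicalSpace X] [ChartedSpace (R2 n) X]
  [IsManifold 𝓘(ℝ, R2 n) ∞ X] [T2Space X] [CompactSpace X] {Ω : SymplecticForm n X}
  {EG : Type*} [NormedAddCommGroup EG] [NormedSpace ℝ EG] [FiniteDimensional ℝ EG]
  [CompleteSpace EG]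
  {G : Type*} [TopologicalSpace G] [ChartedSpace EG G] [Group G] [LieGroup 𝓘(ℝ, EG) ∞ G]
  {EP : Type*} [NormedAddCommGroup EP] [NormedSpace ℝ EP] [FiniteDimensional ℝ EP]
  {P : Type*} [TopologicalSpace P] [ChartedSpace EP P] [IsManifold 𝓘(ℝ, EP) ∞ P]
  {E : PrincipalBundle EG G n X EP P}

theorem InvariantInner.self_nonneg (B : InvariantInner EG G) (ξ : EG) : 0 ≤ B.form ξ ξ := by
  rcases eq_or_ne ξ 0 with rfl | h
  · simp
  · exact (B.pos ξ h).le

theorem curvNormSq_eq (B : InvariantInner EG G) (j : CompatibleACS Ω) (A : Connection E) (x : X) :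
    curvNormSq B j.metric A x = (1 / 2) * pairing B.form (formMat (Ω.at x) * clmMat (j.at x))⁻¹
      (formMat (Ω.at x) * clmMat (j.at x))⁻¹
      (comps (A.curv (Function.surjInv E.proj_surjective x)))
      (comps (A.curv (Function.surjInv E.proj_surjective x))) := by
  have h1 : curvNormSq B j.metric A x = (1 / 2) * pairing B.form
      (invGram j.metric (E.proj (Function.surjInv E.proj_surjective x)))
      (invGram j.metric (E.proj (Function.surjInv E.proj_surjective x)))
      (comps (A.curv (Function.surjInv E.proj_surjective x)))
      (comps (A.curv (Function.surjInv E.proj_surjective x))) :=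
    normSqTwoForm_eq j _ B.form (A.curv (Function.surjInv E.proj_surjective x))
  rw [h1, Function.surjInv_eq E.proj_surjective x, j.invGram_eq]

/-- 2|F|² is the g-contraction of F with itself, and Λ²(F∧F) is 2|ΛF|² minus the ω-contraction,
which is at most the g-contraction. -/
theorem neg_topDensity_le (B : InvariantInner EG G) (j : CompatibleACS Ω) (A : Connection E)
    (x : X) : 0 ≤ 2 * curvNormSq B j.metric A x + A.topDensity B Ω x := by
  have h1 := (j.isCompatiblePair x).pairing_le B.form B.symm B.self_nonneg
    (comps (A.curv (Function.surjInv E.proj_surjective x)))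
  have h2 := B.self_nonneg (contract (Ω.inv x)
    (comps (A.curv (Function.surjInv E.proj_surjective x))))
  rw [curvNormSq_eq, Connection.topDensity, topo]
  rw [← SymplecticForm.inv] at h1
  linarith

/-- Equality holds for connections with curvature of type `(1,1)` and `Λ F = 0`. -/
theorem two_mul_curvNormSq_add_topDensity (B : InvariantInner EG G) {j : CompatibleACS Ω}
    {A : Connection E} (hA : CurvatureType11 j A) (hΛ : ∀ p, lambdaF j A p = 0) (x : X) :
    2 * curvNormSq B j.metric A x + A.topDensity B Ω x = 0 := by
  have hx := Function.surjInv_eq E.proj_surjective x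
  have h1 : ∀ a b, twist (clmMat (j.at (E.proj (Function.surjInv E.proj_surjective x))))
      (comps (A.curv (Function.surjInv E.proj_surjective x))) a b =
      comps (A.curv (Function.surjInv E.proj_surjective x)) a b :=
    twist_comps j _ (A.curv (Function.surjInv E.proj_surjective x)) (hA _)
  have h2 : contract (Ω.inv (E.proj (Function.surjInv E.proj_surjective x)))
      (comps (A.curv (Function.surjInv E.proj_surjective x))) = 0 :=
    (lefschetzAdjoint_two j _ (A.curv (Function.surjInv E.proj_surjective x))).symm.trans (hΛ _)
  rw [hx] at h1 h2
  have h3 := (j.isCompatiblePair x).pairing_eq B.form _ h1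
  rw [curvNormSq_eq, Connection.topDensity, topo, h2, map_zero, SymplecticForm.inv, h3]
  ring

/-- Completes the square with c. The leftover multiple of |F|² is α₁(1 − 2c) · 2|F|²; the density
Λ²(F∧F) is added to it inside the integral and subtracted outside, where it is topological. -/
theorem CYM_eq (B : InvariantInner EG G) (α₀ α₁ c : ℝ) (j : CompatibleACS Ω) {S : X → ℝ}
    (hS : SmoothFun n S) (A : Connection E) :
    CYM B α₀ α₁ j.metric S A =
      Ω.integral (fun x => (α₀ * S x - 2 * α₁ * curvNormSq B j.metric A x - c) ^ 2
        + α₁ * (1 - 2 * c) * (2 * curvNormSq B j.metric A x + A.topDensity B Ω x))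
      + (2 * c * α₀ * Ω.integral S - c ^ 2 * Ω.integral (fun _ => 1)
        - α₁ * (1 - 2 * c) * Ω.integral (A.topDensity B Ω)) := by
  have hf := smoothFun_curvNormSq B j A
  have ht := A.smoothFun_topDensity (Ω := Ω) B
  have hc : ∀ r : ℝ, SmoothFun n (fun _ : X => r) := smoothFun_const
  have h1 := (hc α₀).mul hS
  have h2 := (hc (-2 * α₁)).mul hf
  have hsq := (h1.add h2).mul (h1.add h2)
  -- Expanded into summands that are known to be smooth, because additivity of the integral requires
  -- it.
  have e : (fun x => (α₀ * S x - 2 * α₁ * curvNormSq B j.metric A x - c) ^ 2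
        + α₁ * (1 - 2 * c) * (2 * curvNormSq B j.metric A x + A.topDensity B Ω x)) =
      fun x => (α₀ * S x + -2 * α₁ * curvNormSq B j.metric A x) *
        (α₀ * S x + -2 * α₁ * curvNormSq B j.metric A x)
        + (2 * α₁ * curvNormSq B j.metric A x + (-(2 * c * α₀) * S x + (c ^ 2 * 1
        + α₁ * (1 - 2 * c) * A.topDensity B Ω x))) := by
    funext x; ring
  have e' : (fun x => (α₀ * S x - 2 * α₁ * curvNormSq B j.metric A x) ^ 2) =
      fun x => (α₀ * S x + -2 * α₁ * curvNormSq B j.metric A x) *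
        (α₀ * S x + -2 * α₁ * curvNormSq B j.metric A x) := by
    funext x; ring
  rw [CYM, j.volIntegral_eq, j.volIntegral_eq, e, e',
    Ω.integral_add hsq (((hc _).mul hf).add (((hc _).mul hS).add (((hc _).mul (hc 1)).add
      ((hc _).mul ht)))),
    Ω.integral_add ((hc _).mul hf) (((hc _).mul hS).add (((hc _).mul (hc 1)).add ((hc _).mul ht))),
    Ω.integral_add ((hc _).mul hS) (((hc _).mul (hc 1)).add ((hc _).mul ht)),
    Ω.integral_add ((hc _).mul (hc 1)) ((hc _).mul ht)]
  simp only [Ω.integral_const_mul]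
  ring

/-- Solutions of the coupled equations minimize the functional among all pairs with the same total
scalar curvature. -/
theorem CYM_le (B : InvariantInner EG G) {α₀ α₁ c : ℝ} (hα₁ : 0 < α₁) (hc : 2 * c < 1)
    {j j' : CompatibleACS Ω} {S S' : X → ℝ} (hS : SmoothFun n S) (hS' : SmoothFun n S')
    (hint : Ω.integral S' = Ω.integral S) {A : Connection E}
    (h : CoupledEquations B α₀ α₁ 0 c j S A) (hA : CurvatureType11 j A) (A' : Connection E) :
    CYM B α₀ α₁ j.metric S A ≤ CYM B α₀ α₁ j'.metric S' A' := by
  -- For a solution −2|F|² = Λ²(F∧F), so the second coupled equation is the vanishing of the square.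
  have h0 : (fun x => (α₀ * S x - 2 * α₁ * curvNormSq B j.metric A x - c) ^ 2
      + α₁ * (1 - 2 * c) * (2 * curvNormSq B j.metric A x + A.topDensity B Ω x)) =
      fun _ => (0 : ℝ) * 1 := by
    funext x
    have h1 := two_mul_curvNormSq_add_topDensity B hA h.1 x
    have h2 := h.2 (Function.surjInv E.proj_surjective x)
    rw [lambdaSqFF_eq_topDensity, Function.surjInv_eq E.proj_surjective x] at h2
    have h3 : α₀ * S x - 2 * α₁ * curvNormSq B j.metric A x - c = 0 := by
      linear_combination h2 - α₁ * h1
    rw [h1, h3]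
    ring
  rw [CYM_eq B α₀ α₁ c j hS, CYM_eq B α₀ α₁ c j' hS', h0, Ω.integral_const_mul, hint,
    A.integral_topDensity B A', zero_mul]
  -- The terms outside the integral are now identical, and only nonnegativity of the competitor's
  -- integrand is left.
  gcongr
  refine Ω.integral_nonneg fun x => add_nonneg (sq_nonneg _) (mul_nonneg ?_ ?_)
  · exact mul_nonneg hα₁.le (by linarith)
  · exact neg_topDensity_le B j' A' x

end LowerBound

end CoupledYM

end

/-! ### The minimization theorem. -/

theorem mainTheorem8
    -- a compact symplectic manifold of dimension `2n`
    {n : ℕ} {X : Type*} [TopologicalSpace X] [ChartedSpace (CoupledYM.R2 n) X]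
    [IsManifold 𝓘(ℝ, CoupledYM.R2 n) ∞ X] [T2Space X] [CompactSpace X]
    (Ω : CoupledYM.SymplecticForm n X)
    -- a compact Lie group with semisimple Lie algebra and an invariant inner product on it
    {EG : Type*} [NormedAddCommGroup EG] [NormedSpace ℝ EG] [FiniteDimensional ℝ EG]
    [CompleteSpace EG]
    {G : Type*} [TopologicalSpace G] [ChartedSpace EG G] [Group G] [LieGroup 𝓘(ℝ, EG) ∞ G]
    [CompactSpace G] [T2Space G]
    [LieAlgebra.IsSemisimple ℝ (GroupLieAlgebra 𝓘(ℝ, EG) G)]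
    (B : CoupledYM.InvariantInner EG G)
    -- a smooth principal `G`-bundle over `X`
    {EP : Type*} [NormedAddCommGroup EP] [NormedSpace ℝ EP] [FiniteDimensional ℝ EP]
    {P : Type*} [TopologicalSpace P] [ChartedSpace EP P] [IsManifold 𝓘(ℝ, EP) ∞ P]
    (E : CoupledYM.PrincipalBundle EG G n X EP P)
    (α₀ α₁ c : ℝ) (hα₀ : 0 < α₀) (hα₁ : 0 < α₁) (hc : 2 * c < 1)
    (z : EG) (hz : z ∈ LieAlgebra.center ℝ (GroupLieAlgebra 𝓘(ℝ, EG) G)) :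
    -- Hermitian scalar curvature, all compatible almost complex structures
    (∀ (j : CoupledYM.CompatibleACS Ω) (A : CoupledYM.Connection E),
      CoupledYM.CoupledEquations B α₀ α₁ z c j (CoupledYM.hermScalar j) A →
      CoupledYM.CurvatureType11 j A →
      ∀ (j' : CoupledYM.CompatibleACS Ω) (A' : CoupledYM.Connection E),
        CoupledYM.CYM B α₀ α₁ j.metric (CoupledYM.hermScalar j) A
          ≤ CoupledYM.CYM B α₀ α₁ j'.metric (CoupledYM.hermScalar j') A') ∧
    -- Riemannian scalar curvature, Kähler metrics with Kähler form `Ω`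
    (∀ (j : CoupledYM.CompatibleACS Ω) (A : CoupledYM.Connection E), j.Integrable →
      CoupledYM.CoupledEquations B α₀ α₁ z c j (CoupledYM.riemScalar j.metric) A →
      CoupledYM.CurvatureType11 j A →
      ∀ (j' : CoupledYM.CompatibleACS Ω) (A' : CoupledYM.Connection E), j'.Integrable →
        CoupledYM.CYM B α₀ α₁ j.metric (CoupledYM.riemScalar j.metric) A
          ≤ CoupledYM.CYM B α₀ α₁ j'.metric (CoupledYM.riemScalar j'.metric) A') := by
  -- The centre of a semisimple Lie algebra is trivial; the equality case of the pointwise estimate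
  -- requires ΛF = 0.
  obtain rfl : z = 0 := by
    rw [LieAlgebra.center_eq_bot] at hz
    exact (LieSubmodule.mem_bot (R := ℝ) (L := GroupLieAlgebra 𝓘(ℝ, EG) G)
      (M := GroupLieAlgebra 𝓘(ℝ, EG) G) z).1 hz
  refine ⟨fun j A h hA j' A' => ?_, fun j A hj h hA j' A' hj' => ?_⟩
  · exact CoupledYM.CYM_le B hα₁ hc j.smoothFun_hermScalar j'.smoothFun_hermScalar
      (j.integral_hermScalar j') h hA A'
  -- For integrable structures, smoothness and invariance of the total Riemannian scalar curvature
  -- are inherited from the Hermitian one.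
  · have hR : ∀ j : CoupledYM.CompatibleACS Ω, j.Integrable →
        CoupledYM.riemScalar j.metric = fun x => 2 * CoupledYM.hermScalar j x :=
      fun j hj => funext hj.riemScalar_eq
    have hS : ∀ j : CoupledYM.CompatibleACS Ω, j.Integrable →
        CoupledYM.SmoothFun n (CoupledYM.riemScalar j.metric) := fun j hj => by
      rw [hR j hj]
      exact (CoupledYM.smoothFun_const 2).mul j.smoothFun_hermScalar
    refine CoupledYM.CYM_le B hα₁ hc (hS j hj) (hS j' hj') ?_ h hA A'
    rw [hR j hj, hR j' hj', Ω.integral_const_mul, Ω.integral_const_mul, j.integral_hermScalar j']
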